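/- Let $p$ be a prime and let $k$ be an algebraically closed field of characteristic $p$. Let $W(k)$ be the ring of Witt vectors, $\sigma$ its Frobenius, and let $\mathbb D = W(k)\{F,V\}/(FV-p)$ be the Dieudonné ring, i.e. the ring generated by $W(k)$, $F$ and $V$ with the relations $FV=VF=p$, $Fa=\sigma(a)F$ and $aV=V\sigma(a)$ for $a\in W(k)$. For one of the equations $h\in k[[x,y,z]]$ below put $R=k[[x,y,z]]/(h)$, $X=\operatorname{Spec}R$, and let $\mathfrak m$ be the maximal ideal of $R$. Since $h\equiv z^2$ modulo $(x,y)$, the punctured spectrum is covered by $D(x)$ and $D(y)$, and the Čech complex gives $$H^2_{\mathfrak m}(X,W_l\mathcal O_X)=W_l(R_{xy})/\bigl(W_l(R_x)+W_l(R_y)\bigr).$$ The operators $F$ and $V$ of $W_l(R_{xy})$ act on this group, and $a\in W(k)$ acts as multiplication by $\sigma^{-l}(a)$. This makes $H^2_{\mathfrak m}(X,W_l\mathcal O_X)[F^m]$, the kernel of $F^m$, a left $\mathbb D$-module. These modules form a directed system of left $\mathbb D$-modules with respect to the inclusions (in $m$) and the maps $V\colon W_l\to W_{l+1}$ (in $l$).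 Let $$M=\varinjlim_{m,l}H^2_{\mathfrak m}(X,W_l\mathcal O_X)[F^m].$$ For $j\in\mathbb Z$ put $f_j=\frac{z}{xy^j}\in H^2_{\mathfrak m}(X,\mathcal O_X)$, and let $f_j^{(l)}=(f_j,0,\dots,0)\in H^2_{\mathfrak m}(X,W_l\mathcal O_X)$ be the class of the Teichmüller lift of $\frac{z}{xy^j}$. (So $f_j=f_j^{(1)}$.) For every $h$ and all $l$ one has $f_j^{(l)}=0$ for $j\le 0$. Then in each of the following cases (the rational double points that are not $F$-injective) the generators listed are killed by a power of $F$, hence define elements of $M$; the left $\mathbb D$-module $M$ is presented by these generators and the relations listed; and $M$ has the length listed, both over $\mathbb D$ and over $W(k)$. When there is one generator $f$, a relation $P\equiv 0$ with $P\in\mathbb D$ stands for $P f=0$. * $p=5$: * $E_8^0$, $h=z^2+x^3+y^5$: generator $f_1$; $F\equiv V\equiv0$; length $1$. * $p=3$: * $E_6^0$, $h=z^2+x^3+y^4$: generator $f_1$; $F\equiv V\equiv0$; length $1$. * $E_7^0$, $h=z^2+x^3+xy^3$: generator $f_1$; $F\equiv V\equiv0$; length $1$. * $E_8^1$, $h=z^2+x^3+y^5+x^2y^3$: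 generator $f_1^{(2)}$; $F-V\equiv V^2\equiv0$; length $2$. * $E_8^0$, $h=z^2+x^3+y^5$: generator $f_1^{(2)}$; $F\equiv V^2\equiv0$; length $2$. * $p=2$: * $D_n^r$, where either $n=2m$, $r$ is an integer with $0\le r\le m-2$, and $h=z^2+x^2y+xy^m+zxy^{m-r}$; or $n=2m+1$, $r=s+\frac12$ with an integer $0\le s\le m-2$, and $h=z^2+x^2y+zy^m+zxy^{m-s}$. Put $C(l,j)=2^{l-1}(2j-1)$ and $L_n^r=\lfloor\min\{\frac n2-1,\,n-2r-2\}\rfloor$. Generators: all $f_j^{(l)}$ with $l,j\ge1$ and $C(l,j)\le L_n^r$; relations: $V(f_j^{(l)})=f_j^{(l-1)}$ (with $f_j^{(0)}=0$) and $F(f_j^{(l)})=f^{(1)}_{C(l,j)-(n/2-r-1)}$ (which is $0$ if the index is $\le0$); length $L_n^r$. * $E_6^0$, $h=z^2+x^3+y^2z$: generator $f_1$; $F\equiv V\equiv0$; length $1$. * $E_7^2$, $h=z^2+x^3+xy^3+y^3z$: generator $f_1^{(2)}$; $F+V\equiv V^2\equiv0$; length $2$. * $E_7^1$, $h=z^2+x^3+xy^3+x^2yz$: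 generator $f_1^{(3)}$; $F+V^2\equiv V^3\equiv0$; length $3$. * $E_7^0$, $h=z^2+x^3+xy^3$: generator $f_1^{(3)}$; $F\equiv V^3\equiv0$; length $3$. * $E_8^3$, $h=z^2+x^3+y^5+y^3z$: generator $f_1^{(3)}$; $F+V\equiv V^3\equiv0$; length $3$. * $E_8^2$, $h=z^2+x^3+y^5+xy^2z$: generator $f_1^{(3)}$; $F+V^2\equiv V^3\equiv0$; length $3$. * $E_8^1$, $h=z^2+x^3+y^5+xy^3z$: generators $f_1^{(3)},f_2$; relations $F(f_1^{(3)})=V^3(f_1^{(3)})=0$ and $F(f_2)-V^2(f_1^{(3)})=V(f_2)=0$; length $4$. * $E_8^0$, $h=z^2+x^3+y^5$: generators $f_1^{(3)},f_2$; relations $F(f_1^{(3)})=V^3(f_1^{(3)})=0$ and $F(f_2)=V(f_2)=0$; length $4$. -/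

import Mathlib

universe u

noncomputable section

namespace LocalWitt

/-! ### Truncated Witt vectors: functoriality, Frobenius and Verschiebung -/

section Truncated

variable {p : ℕ} [Fact p.Prime] {A B C : Type u} [CommRing A] [CommRing B] [CommRing C]

/-- The ring homomorphism `W_l(A) → W_l(B)` induced by a ring homomorphism `A → B`. -/
def tmap (l : ℕ) (f : A →+* B) : TruncatedWittVector p l A →+* TruncatedWittVector p l B :=
  RingHom.liftOfRightInverse (WittVector.truncate l) TruncatedWittVector.out
    TruncatedWittVector.truncateFun_out
    ⟨(WittVector.truncate l).comp (WittVector.map f), by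
      intro x hx
      rw [WittVector.mem_ker_truncate] at hx
      rw [RingHom.mem_ker, RingHom.comp_apply, ← RingHom.mem_ker, WittVector.mem_ker_truncate]
      intro i hi
      rw [WittVector.map_coeff, hx i hi, map_zero]⟩

theorem tmap_truncate (l : ℕ) (f : A →+* B) (x : WittVector p A) :
    tmap l f (WittVector.truncate l x) = WittVector.truncate l (WittVector.map f x) :=
  RingHom.liftOfRightInverse_comp_apply _ _ _ _ _

theorem coeff_tmap (l : ℕ) (f : A →+* B) (x : TruncatedWittVector p l A) (i : Fin l) :
    (tmap l f x).coeff i = f (x.coeff i) := by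
  obtain ⟨x, rfl⟩ := WittVector.truncate_surjective p l A x
  rw [tmap_truncate, WittVector.coeff_truncate, WittVector.coeff_truncate, WittVector.map_coeff]

theorem tmap_tmap (l : ℕ) (f : A →+* B) (g : B →+* C) (x : TruncatedWittVector p l A) :
    tmap l g (tmap l f x) = tmap l (g.comp f) x := by
  ext i
  simp [coeff_tmap]

theorem truncate_iterate_verschiebung {d l l' : ℕ} (h : l' ≤ l + d) {x y : WittVector p A}
    (hxy : WittVector.truncate l x = WittVector.truncate l y) :
    WittVector.truncate l' (WittVector.verschiebung^[d] x) =
      WittVector.truncate l' (WittVector.verschiebung^[d] y) := by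
  ext i
  rw [WittVector.coeff_truncate, WittVector.coeff_truncate]
  rcases lt_or_ge (i : ℕ) d with hi | hi
  · rw [WittVector.iterate_verschiebung_coeff_eq_zero _ hi,
      WittVector.iterate_verschiebung_coeff_eq_zero _ hi]
  · obtain ⟨e, he⟩ := Nat.exists_eq_add_of_le' hi
    rw [he, WittVector.iterate_verschiebung_coeff, WittVector.iterate_verschiebung_coeff]
    have hel : e < l := by have := i.2; omega
    have := congrArg (TruncatedWittVector.coeff ⟨e, hel⟩) hxy
    simpa only [WittVector.coeff_truncate] using this

/-- The `d`-fold Verschiebung `V^d : W_l(A) → W_{l'}(A)` for `l' ≤ l + d`, that is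
`(a_0, a_1, …) ↦ (0, …, 0, a_0, a_1, …)` with `d` zeros. For `d = l' - l` it is the inclusion
`V^{l' - l} : W_l(A) → W_{l'}(A)`, for `d = 1` and `l' = l` it is the endomorphism `V`. -/
def tV (d l l' : ℕ) (h : l' ≤ l + d) :
    TruncatedWittVector p l A →+ TruncatedWittVector p l' A where
  toFun x := WittVector.truncate l' (WittVector.verschiebung^[d] x.out)
  map_zero' := by
    have h0 : WittVector.truncate l (0 : TruncatedWittVector p l A).out =
        WittVector.truncate l (0 : WittVector p A) := by
      rw [map_zero]; exact TruncatedWittVector.truncateFun_out _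
    rw [truncate_iterate_verschiebung h h0, iterate_map_zero, map_zero]
  map_add' x y := by
    have h0 : WittVector.truncate l (x + y).out = WittVector.truncate l (x.out + y.out) := by
      rw [map_add]
      have e : ∀ z : TruncatedWittVector p l A, WittVector.truncate l z.out = z :=
        fun z => TruncatedWittVector.truncateFun_out z
      rw [e, e, e]
    rw [truncate_iterate_verschiebung h h0, iterate_map_add, map_add]

theorem tV_truncate (d l l' : ℕ) (h : l' ≤ l + d) (x : WittVector p A) :
    tV d l l' h (WittVector.truncate l x) =
      WittVector.truncate l' (WittVector.verschiebung^[d] x) :=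
  truncate_iterate_verschiebung h (TruncatedWittVector.truncateFun_out _)

theorem map_iterate_verschiebung (f : A →+* B) (d : ℕ)
    (w : WittVector p A) :
    WittVector.map f (WittVector.verschiebung^[d] w) =
      WittVector.verschiebung^[d] (WittVector.map f w) := by
  induction d with
  | zero => rfl
  | succ d ih =>
    rw [Function.iterate_succ_apply', Function.iterate_succ_apply', WittVector.map_verschiebung,
      ih]

theorem tmap_tV (d l l' : ℕ) (h : l' ≤ l + d) (f : A →+* B) (x : TruncatedWittVector p l A) :
    tmap l' f (tV d l l' h x) = tV d l l' h (tmap l f x) := by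
  obtain ⟨x, rfl⟩ := WittVector.truncate_surjective p l A x
  rw [tV_truncate, tmap_truncate, tmap_truncate, tV_truncate]
  rw [map_iterate_verschiebung]

end Truncated

section Frobenius

variable (p : ℕ) [Fact p.Prime] (k : Type u) [Field k] [CharP k p]

/-- The Frobenius endomorphism `a ↦ a ^ p` of a `k`-algebra. -/
def frobHom (A : Type u) [CommRing A] [Algebra k A] : A →+* A where
  toFun a := a ^ p
  map_one' := one_pow _
  map_mul' a b := mul_pow a b p
  map_zero' := zero_pow (Fact.out : p.Prime).ne_zero
  map_add' a b := by
    rcases subsingleton_or_nontrivial A with hA | hA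
    · exact Subsingleton.elim _ _
    · have : CharP A p := charP_of_injective_algebraMap (algebraMap k A).injective p
      exact add_pow_char a b p

theorem frobHom_comp {A B : Type u} [CommRing A] [Algebra k A] [CommRing B] [Algebra k B]
    (f : A →+* B) : f.comp (frobHom p k A) = (frobHom p k B).comp f :=
  RingHom.ext fun a => map_pow f a p

theorem verschiebung_map_frobHom {A : Type u} [CommRing A] [Algebra k A] (x : WittVector p A) :
    WittVector.verschiebung (WittVector.map (frobHom p k A) x) = p * x := by
  rcases subsingleton_or_nontrivial A with hA | hA
  · ext i; exact Subsingleton.elim _ _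
  · have : CharP A p := charP_of_injective_algebraMap (algebraMap k A).injective p
    have : frobHom p k A = frobenius A p := RingHom.ext fun a => rfl
    rw [this, ← WittVector.frobenius_eq_map_frobenius, WittVector.verschiebung_frobenius, mul_comm]

theorem map_frobHom_map_algebraMap {A : Type u} [CommRing A] [Algebra k A] (a : WittVector p k) :
    WittVector.map (frobHom p k A) (WittVector.map (algebraMap k A) a) =
      WittVector.map (algebraMap k A) (WittVector.frobenius a) := by
  ext i
  rw [WittVector.map_coeff, WittVector.map_coeff, WittVector.map_coeff,
    WittVector.coeff_frobenius_charP, map_pow]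
  rfl

theorem mul_verschiebung {A : Type u} [CommRing A] [Algebra k A] (a : WittVector p k)
    (x : WittVector p A) :
    WittVector.map (algebraMap k A) a * WittVector.verschiebung x =
      WittVector.verschiebung (WittVector.map (algebraMap k A) (WittVector.frobenius a) * x) := by
  rcases subsingleton_or_nontrivial A with hA | hA
  · ext i; exact Subsingleton.elim _ _
  · have : CharP A p := charP_of_injective_algebraMap (algebraMap k A).injective p
    have : frobHom p k A = frobenius A p := RingHom.ext fun a => rfl
    rw [← map_frobHom_map_algebraMap, this, ← WittVector.frobenius_eq_map_frobenius, mul_comm,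
      ← WittVector.verschiebung_mul_frobenius, mul_comm]

end Frobenius

/-! ### The Dieudonné ring -/

section Dieudonne

variable (p : ℕ) [Fact p.Prime] (k : Type u) [Field k] [CharP k p]

/-- Generators of the Dieudonné ring: the scalars from `W(k)`, and `F` and `V`. -/
inductive DGen
  | scal (a : WittVector p k)
  | F
  | V

variable {k}

/-- The generator attached to a scalar `a ∈ W(k)`, in the free ring. -/
abbrev gS (a : WittVector p k) : FreeAlgebra ℤ (DGen p k) := FreeAlgebra.ι ℤ (DGen.scal a)

variable (k)

/-- The generator `F`, in the free ring. -/
abbrev gF : FreeAlgebra ℤ (DGen p k) := FreeAlgebra.ι ℤ DGen.F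

/-- The generator `V`, in the free ring. -/
abbrev gV : FreeAlgebra ℤ (DGen p k) := FreeAlgebra.ι ℤ DGen.V

/-- Relations of the Dieudonné ring: the scalars form a copy of `W(k)`, `F V = V F = p`,
`F a = σ(a) F` and `a V = V σ(a)`, where `σ` is the Frobenius of `W(k)`. -/
inductive DRel : FreeAlgebra ℤ (DGen p k) → FreeAlgebra ℤ (DGen p k) → Prop
  | one : DRel (gS p 1) 1
  | add (a b : WittVector p k) : DRel (gS p (a + b)) (gS p a + gS p b)
  | mul (a b : WittVector p k) : DRel (gS p (a * b)) (gS p a * gS p b)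
  | FV : DRel (gF p k * gV p k) (p : FreeAlgebra ℤ (DGen p k))
  | VF : DRel (gV p k * gF p k) (p : FreeAlgebra ℤ (DGen p k))
  | F_scal (a : WittVector p k) : DRel (gF p k * gS p a) (gS p (WittVector.frobenius a) * gF p k)
  | scal_V (a : WittVector p k) : DRel (gS p a * gV p k) (gV p k * gS p (WittVector.frobenius a))

/-- The Dieudonné ring `𝔻 = W(k){F, V} / (F V - p)`. -/
def DieudonneRing : Type u := RingQuot (DRel p k)

instance : Ring (DieudonneRing p k) := inferInstanceAs (Ring (RingQuot (DRel p k)))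

namespace DieudonneRing

/-- The quotient map from the free ring. -/
def mk : FreeAlgebra ℤ (DGen p k) →+* DieudonneRing p k := RingQuot.mkRingHom (DRel p k)

theorem mk_surjective : Function.Surjective (mk p k) := RingQuot.mkRingHom_surjective _

theorem mk_rel {x y : FreeAlgebra ℤ (DGen p k)} (h : DRel p k x y) : mk p k x = mk p k y :=
  RingQuot.mkRingHom_rel h

/-- The element `F` of the Dieudonné ring. -/
def F : DieudonneRing p k := mk p k (gF p k)

/-- The element `V` of the Dieudonné ring. -/
def V : DieudonneRing p k := mk p k (gV p k)

/-- The ring homomorphism `W(k) → 𝔻`. -/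
def scal : WittVector p k →+* DieudonneRing p k where
  toFun a := mk p k (gS p a)
  map_one' := (mk_rel p k DRel.one).trans (map_one _)
  map_mul' a b := (mk_rel p k (DRel.mul a b)).trans (map_mul _ _ _)
  map_add' a b := (mk_rel p k (DRel.add a b)).trans (map_add _ _ _)
  map_zero' := by
    have h := (mk_rel p k (DRel.add 0 0)).trans (map_add _ _ _)
    rw [add_zero] at h
    exact left_eq_add.mp h

variable {p k}

/-- Induction on the elements of the Dieudonné ring. -/
theorem induction {P : DieudonneRing p k → Prop} (hint : ∀ n : ℤ, P n)
    (hscal : ∀ a, P (scal p k a)) (hF : P (F p k)) (hV : P (V p k))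
    (hmul : ∀ a b, P a → P b → P (a * b)) (hadd : ∀ a b, P a → P b → P (a + b))
    (d : DieudonneRing p k) : P d := by
  obtain ⟨d, rfl⟩ := mk_surjective p k d
  induction d using FreeAlgebra.induction with
  | grade0 n =>
    have : mk p k (algebraMap ℤ _ n) = (n : DieudonneRing p k) := by simp
    rw [this]; exact hint n
  | grade1 x =>
    cases x with
    | scal a => exact hscal a
    | F => exact hF
    | V => exact hV
  | mul a b ha hb => rw [map_mul]; exact hmul _ _ ha hb
  | add a b ha hb => rw [map_add]; exact hadd _ _ ha hb

/-- A ring homomorphism out of the Dieudonné ring is given by the images of the generators. -/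
def lift {T : Type u} [Ring T] (s : WittVector p k →+* T) (f v : T)
    (hfv : f * v = p) (hvf : v * f = p) (hf : ∀ a, f * s a = s (WittVector.frobenius a) * f)
    (hv : ∀ a, s a * v = v * s (WittVector.frobenius a)) : DieudonneRing p k →+* T :=
  RingQuot.lift ⟨(FreeAlgebra.lift ℤ (fun x : DGen p k => match x with
    | DGen.scal a => s a
    | DGen.F => f
    | DGen.V => v) : FreeAlgebra ℤ (DGen p k) →ₐ[ℤ] T).toRingHom, by
      intro x y h
      cases h <;> simp [hfv, hvf, hf, hv]⟩

section lift
variable {T : Type u} [Ring T] (s : WittVector p k →+* T) (f v : T)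
    (hfv : f * v = p) (hvf : v * f = p) (hf : ∀ a, f * s a = s (WittVector.frobenius a) * f)
    (hv : ∀ a, s a * v = v * s (WittVector.frobenius a))

theorem lift_scal (a : WittVector p k) : lift s f v hfv hvf hf hv (scal p k a) = s a := by
  change RingQuot.lift _ (RingQuot.mkRingHom _ (FreeAlgebra.ι ℤ (DGen.scal a))) = _
  rw [RingQuot.lift_mkRingHom_apply]
  exact FreeAlgebra.lift_ι_apply _ _

theorem lift_F : lift s f v hfv hvf hf hv (F p k) = f := by
  change RingQuot.lift _ (RingQuot.mkRingHom _ (FreeAlgebra.ι ℤ DGen.F)) = _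
  rw [RingQuot.lift_mkRingHom_apply]
  exact FreeAlgebra.lift_ι_apply _ _

theorem lift_V : lift s f v hfv hvf hf hv (V p k) = v := by
  change RingQuot.lift _ (RingQuot.mkRingHom _ (FreeAlgebra.ι ℤ DGen.V)) = _
  rw [RingQuot.lift_mkRingHom_apply]
  exact FreeAlgebra.lift_ι_apply _ _

end lift

end DieudonneRing

end Dieudonne

/-! ### The local Witt vector cohomology `H^2_𝔪(X, W_l 𝒪_X)`

Here `X = Spec R` for a `k`-algebra `R`, and `x`, `y` are elements of `R` such that the open sets
`D(x)` and `D(y)` cover the complement of the closed point. The groups are computed by the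
augmented Čech complex `W_l(R) → W_l(R_x) × W_l(R_y) → W_l(R_{xy})`, in degrees `0, 1, 2`. -/

section Cech

variable (p : ℕ) [Fact p.Prime] (k : Type u) [Field k] [CharP k p]
  {R : Type u} [CommRing R] [Algebra k R] (x y : R)

/-- The restriction `R_x → R_{xy}`. -/
def resX : Localization.Away x →+* Localization.Away (x * y) :=
  IsLocalization.Away.awayToAwayRight x y

/-- The restriction `R_y → R_{xy}`. -/
def resY : Localization.Away y →+* Localization.Away (x * y) :=
  IsLocalization.Away.awayToAwayLeft y x

theorem resX_algebraMap : (resX x y).comp (algebraMap k (Localization.Away x)) =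
    algebraMap k (Localization.Away (x * y)) := by
  ext a
  rw [RingHom.comp_apply, IsScalarTower.algebraMap_apply k R, resX,
    IsLocalization.Away.awayToAwayRight_eq, ← IsScalarTower.algebraMap_apply k R]

theorem resY_algebraMap : (resY x y).comp (algebraMap k (Localization.Away y)) =
    algebraMap k (Localization.Away (x * y)) := by
  ext a
  rw [RingHom.comp_apply, IsScalarTower.algebraMap_apply k R, resY,
    IsLocalization.Away.awayToAwayLeft_eq, ← IsScalarTower.algebraMap_apply k R]

/-- The coboundaries in the last degree of the Čech complex: the image of
`W_l(R_x) × W_l(R_y) → W_l(R_{xy})`, `(a, b) ↦ a - b`. -/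
def coboundaries (l : ℕ) : AddSubgroup (TruncatedWittVector p l (Localization.Away (x * y))) :=
  (tmap l (resX x y)).toAddMonoidHom.range ⊔ (tmap l (resY x y)).toAddMonoidHom.range

/-- The local cohomology group `H^2_𝔪(X, W_l 𝒪_X)`, as the second cohomology group of the Čech
complex `W_l(R) → W_l(R_x) × W_l(R_y) → W_l(R_{xy})`. -/
def H2 (l : ℕ) : Type u :=
  TruncatedWittVector p l (Localization.Away (x * y)) ⧸ coboundaries p x y l

instance (l : ℕ) : AddCommGroup (H2 p x y l) :=
  inferInstanceAs (AddCommGroup (_ ⧸ coboundaries p x y l))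

/-- The class of a Čech cocycle. -/
def cls (l : ℕ) : TruncatedWittVector p l (Localization.Away (x * y)) →+ H2 p x y l :=
  QuotientAddGroup.mk' _

theorem cls_surjective (l : ℕ) : Function.Surjective (cls p x y l) :=
  QuotientAddGroup.mk'_surjective _

variable {p x y}

theorem cls_eq_zero_iff {l : ℕ} (w : TruncatedWittVector p l (Localization.Away (x * y))) :
    cls p x y l w = 0 ↔ w ∈ coboundaries p x y l :=
  QuotientAddGroup.eq_zero_iff w

/-- An additive map on cochains that preserves coboundaries induces a map on cohomology. -/
def H2.map {l l' : ℕ} (φ : TruncatedWittVector p l (Localization.Away (x * y)) →+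
      TruncatedWittVector p l' (Localization.Away (x * y)))
    (hX : ∀ w, φ (tmap l (resX x y) w) ∈ (tmap (p := p) l' (resX x y)).toAddMonoidHom.range)
    (hY : ∀ w, φ (tmap l (resY x y) w) ∈ (tmap (p := p) l' (resY x y)).toAddMonoidHom.range) :
    H2 p x y l →+ H2 p x y l' :=
  QuotientAddGroup.map _ _ φ <| by
    refine sup_le ?_ ?_
    · rintro _ ⟨w, rfl⟩
      exact (le_sup_left : _ ≤ coboundaries p x y l') (hX w)
    · rintro _ ⟨w, rfl⟩
      exact (le_sup_right : _ ≤ coboundaries p x y l') (hY w)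

variable (p x y)

/-- The Frobenius `F` on `H^2_𝔪(X, W_l 𝒪_X)`, induced by
`(a_0, a_1, …) ↦ (a_0 ^ p, a_1 ^ p, …)`. -/
def H2.frob (l : ℕ) : AddMonoid.End (H2 p x y l) :=
  H2.map (tmap l (frobHom p k (Localization.Away (x * y)))).toAddMonoidHom
    (fun w => ⟨tmap l (frobHom p k (Localization.Away x)) w, by
      change tmap l (resX x y) (tmap l _ w) = tmap l (frobHom p k _) (tmap l (resX x y) w)
      rw [tmap_tmap, tmap_tmap, frobHom_comp]⟩)
    (fun w => ⟨tmap l (frobHom p k (Localization.Away y)) w, by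
      change tmap l (resY x y) (tmap l _ w) = tmap l (frobHom p k _) (tmap l (resY x y) w)
      rw [tmap_tmap, tmap_tmap, frobHom_comp]⟩)

/-- The maps `V^d : H^2_𝔪(X, W_l 𝒪_X) → H^2_𝔪(X, W_{l'} 𝒪_X)`, for `l' ≤ l + d`. -/
def H2.ver (d l l' : ℕ) (h : l' ≤ l + d) : H2 p x y l →+ H2 p x y l' :=
  H2.map (tV d l l' h)
    (fun w => ⟨tV d l l' h w, tmap_tV d l l' h (resX x y) w⟩)
    (fun w => ⟨tV d l l' h w, tmap_tV d l l' h (resY x y) w⟩)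

/-- The image of a Witt vector over `k` in `W_l(A)`, for a `k`-algebra `A`. -/
def const (l : ℕ) (A : Type u) [CommRing A] [Algebra k A] :
    WittVector p k →+* TruncatedWittVector p l A :=
  (WittVector.truncate l).comp (WittVector.map (algebraMap k A))

theorem tmap_const (l : ℕ) {A B : Type u} [CommRing A] [Algebra k A] [CommRing B] [Algebra k B]
    (f : A →+* B) (hf : f.comp (algebraMap k A) = algebraMap k B) (a : WittVector p k) :
    tmap l f (const p k l A a) = const p k l B a := by
  rw [const, const, RingHom.comp_apply, RingHom.comp_apply, tmap_truncate]
  congr 1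
  ext i
  simp only [WittVector.map_coeff]
  exact RingHom.congr_fun hf _

/-- Multiplication by (the image of) `a ∈ W(k)` on `H^2_𝔪(X, W_l 𝒪_X)`. -/
def H2.mulConst (l : ℕ) (a : WittVector p k) : AddMonoid.End (H2 p x y l) :=
  H2.map (AddMonoidHom.mulLeft (const p k l (Localization.Away (x * y)) a))
    (fun w => ⟨const p k l (Localization.Away x) a * w, by
      change tmap l (resX x y) (_ * w) = _ * tmap l (resX x y) w
      rw [map_mul, tmap_const p k l _ (resX_algebraMap k x y)]⟩)
    (fun w => ⟨const p k l (Localization.Away y) a * w, by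
      change tmap l (resY x y) (_ * w) = _ * tmap l (resY x y) w
      rw [map_mul, tmap_const p k l _ (resY_algebraMap k x y)]⟩)

variable {k}

theorem H2.frob_cls (l : ℕ) (w : WittVector p (Localization.Away (x * y))) :
    H2.frob p k x y l (cls p x y l (WittVector.truncate l w)) =
      cls p x y l (WittVector.truncate l (WittVector.map (frobHom p k _) w)) :=
  congrArg (cls p x y l) (tmap_truncate l (frobHom p k (Localization.Away (x * y))) w)

theorem H2.ver_cls (d l l' : ℕ) (h : l' ≤ l + d) (w : WittVector p (Localization.Away (x * y))) :
    H2.ver p x y d l l' h (cls p x y l (WittVector.truncate l w)) =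
      cls p x y l' (WittVector.truncate l' (WittVector.verschiebung^[d] w)) :=
  congrArg (cls p x y l') (tV_truncate d l l' h w)

theorem H2.mulConst_cls (l : ℕ) (a : WittVector p k)
    (w : WittVector p (Localization.Away (x * y))) :
    H2.mulConst p k x y l a (cls p x y l (WittVector.truncate l w)) =
      cls p x y l (WittVector.truncate l (WittVector.map (algebraMap k _) a * w)) := by
  rw [map_mul]; rfl

variable {p x y}

theorem H2.exists_rep {l : ℕ} (ξ : H2 p x y l) :
    ∃ w : WittVector p (Localization.Away (x * y)),
      cls p x y l (WittVector.truncate l w) = ξ := by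
  obtain ⟨v, rfl⟩ := cls_surjective p x y l ξ
  obtain ⟨w, rfl⟩ := WittVector.truncate_surjective p l _ v
  exact ⟨w, rfl⟩

end Cech

/-! ### The structure of a left module over the Dieudonné ring -/

section ModuleStructure

variable (p : ℕ) [Fact p.Prime] (k : Type u) [Field k] [CharP k p] [PerfectRing k p]

/-- The automorphism `σ^{-l}` of `W(k)`. -/
def sigmaInv : ℕ → WittVector p k →+* WittVector p k
  | 0 => RingHom.id _
  | l + 1 => ((WittVector.frobeniusEquiv p k).symm : WittVector p k →+* WittVector p k).comp
      (sigmaInv l)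

theorem frobenius_sigmaInv_succ (l : ℕ) (a : WittVector p k) :
    WittVector.frobenius (sigmaInv p k (l + 1) a) = sigmaInv p k l a :=
  (WittVector.frobeniusEquiv p k).apply_symm_apply _

theorem frobenius_sigmaInv (l : ℕ) (a : WittVector p k) :
    WittVector.frobenius (sigmaInv p k l a) = sigmaInv p k l (WittVector.frobenius a) := by
  induction l with
  | zero => rfl
  | succ l ih =>
    rw [frobenius_sigmaInv_succ]
    change _ = (WittVector.frobeniusEquiv p k).symm (sigmaInv p k l (WittVector.frobenius a))
    rw [← ih]
    exact ((WittVector.frobeniusEquiv p k).symm_apply_apply _).symm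

theorem iterate_frobenius_sigmaInv (l d : ℕ) (a : WittVector p k) :
    WittVector.frobenius^[d] (sigmaInv p k (l + d) a) = sigmaInv p k l a := by
  induction d with
  | zero => rfl
  | succ d ih =>
    rw [Function.iterate_succ_apply, ← add_assoc, frobenius_sigmaInv_succ, ih]

variable {R : Type u} [CommRing R] [Algebra k R] (x y : R)

/-- The scalar `a ∈ W(k)` acts on `H^2_𝔪(X, W_l 𝒪_X)` as multiplication by `σ^{-l}(a)`. With this
convention the maps `V : H^2_𝔪(X, W_l 𝒪_X) → H^2_𝔪(X, W_{l+1} 𝒪_X)` are linear. -/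
def H2.scal (l : ℕ) : WittVector p k →+* AddMonoid.End (H2 p x y l) where
  toFun a := H2.mulConst p k x y l (sigmaInv p k l a)
  map_one' := by
    ext ξ
    obtain ⟨w, rfl⟩ := H2.exists_rep ξ
    rw [map_one, H2.mulConst_cls, map_one, one_mul]
    rfl
  map_mul' a b := by
    ext ξ
    obtain ⟨w, rfl⟩ := H2.exists_rep ξ
    rw [AddMonoid.End.coe_mul, Function.comp_apply, H2.mulConst_cls, H2.mulConst_cls, H2.mulConst_cls,
      map_mul (sigmaInv p k l), map_mul (WittVector.map _), mul_assoc]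
  map_zero' := by
    ext ξ
    obtain ⟨w, rfl⟩ := H2.exists_rep ξ
    rw [map_zero, H2.mulConst_cls, map_zero, zero_mul, map_zero, map_zero]
    rfl
  map_add' a b := by
    ext ξ
    obtain ⟨w, rfl⟩ := H2.exists_rep ξ
    change _ = H2.mulConst p k x y l _ _ + H2.mulConst p k x y l _ _
    rw [H2.mulConst_cls, H2.mulConst_cls, H2.mulConst_cls, map_add, map_add, add_mul, map_add,
      map_add]

/-- The Verschiebung `V` as an endomorphism of `H^2_𝔪(X, W_l 𝒪_X)`, induced by
`(a_0, …, a_{l-1}) ↦ (0, a_0, …, a_{l-2})`. -/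
def H2.verEnd (l : ℕ) : AddMonoid.End (H2 p x y l) := H2.ver p x y 1 l l (Nat.le_succ l)

theorem H2.verEnd_cls (l : ℕ) (w : WittVector p (Localization.Away (x * y))) :
    H2.verEnd p x y l (cls p x y l (WittVector.truncate l w)) =
      cls p x y l (WittVector.truncate l (WittVector.verschiebung w)) :=
  H2.ver_cls p x y 1 l l (Nat.le_succ l) w

theorem H2.scal_cls (l : ℕ) (a : WittVector p k) (w : WittVector p (Localization.Away (x * y))) :
    H2.scal p k x y l a (cls p x y l (WittVector.truncate l w)) =
      cls p x y l (WittVector.truncate l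
        (WittVector.map (algebraMap k _) (sigmaInv p k l a) * w)) :=
  H2.mulConst_cls p x y l _ w

theorem natCast_cls {l : ℕ} (w : WittVector p (Localization.Away (x * y))) :
    cls p x y l (WittVector.truncate l ((p : WittVector p _) * w)) =
      ((p : ℕ) : AddMonoid.End (H2 p x y l)) (cls p x y l (WittVector.truncate l w)) := by
  rw [← nsmul_eq_mul, map_nsmul, map_nsmul, AddMonoid.End.natCast_apply]

/-- The action of the Dieudonné ring on `H^2_𝔪(X, W_l 𝒪_X)`. -/
def H2.action (l : ℕ) : DieudonneRing p k →+* AddMonoid.End (H2 p x y l) :=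
  DieudonneRing.lift (H2.scal p k x y l) (H2.frob p k x y l) (H2.verEnd p x y l)
    (by
      ext ξ
      obtain ⟨w, rfl⟩ := H2.exists_rep ξ
      rw [AddMonoid.End.coe_mul, Function.comp_apply, H2.verEnd_cls, H2.frob_cls, WittVector.map_verschiebung,
        verschiebung_map_frobHom, natCast_cls])
    (by
      ext ξ
      obtain ⟨w, rfl⟩ := H2.exists_rep ξ
      rw [AddMonoid.End.coe_mul, Function.comp_apply, H2.frob_cls, H2.verEnd_cls, verschiebung_map_frobHom,
        natCast_cls])
    (by
      intro a
      ext ξ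
      obtain ⟨w, rfl⟩ := H2.exists_rep ξ
      rw [AddMonoid.End.coe_mul, Function.comp_apply, AddMonoid.End.coe_mul, Function.comp_apply, H2.scal_cls, H2.frob_cls, H2.frob_cls,
        H2.scal_cls, map_mul, map_frobHom_map_algebraMap, frobenius_sigmaInv])
    (by
      intro a
      ext ξ
      obtain ⟨w, rfl⟩ := H2.exists_rep ξ
      rw [AddMonoid.End.coe_mul, Function.comp_apply, AddMonoid.End.coe_mul, Function.comp_apply, H2.scal_cls, H2.verEnd_cls,
        H2.verEnd_cls, H2.scal_cls, mul_verschiebung, frobenius_sigmaInv])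

variable {p} {x y} in
/-- `H^2_𝔪(X, W_l 𝒪_X)` as a left module over the Dieudonné ring. -/
instance (l : ℕ) : Module (DieudonneRing p k) (H2 p x y l) :=
  Module.compHom _ (H2.action p k x y l)

variable {p k x y}

theorem H2.smul_def {l : ℕ} (d : DieudonneRing p k) (ξ : H2 p x y l) :
    d • ξ = H2.action p k x y l d ξ := rfl

theorem H2.F_smul {l : ℕ} (ξ : H2 p x y l) :
    DieudonneRing.F p k • ξ = H2.frob p k x y l ξ := by
  rw [H2.smul_def, H2.action, DieudonneRing.lift_F]

theorem H2.V_smul {l : ℕ} (ξ : H2 p x y l) :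
    DieudonneRing.V p k • ξ = H2.verEnd p x y l ξ := by
  rw [H2.smul_def, H2.action, DieudonneRing.lift_V]

theorem H2.scal_smul {l : ℕ} (a : WittVector p k) (ξ : H2 p x y l) :
    DieudonneRing.scal p k a • ξ = H2.mulConst p k x y l (sigmaInv p k l a) ξ := by
  rw [H2.smul_def, H2.action, DieudonneRing.lift_scal]; rfl

theorem H2.intCast_smul {l : ℕ} (n : ℤ) (ξ : H2 p x y l) :
    (n : DieudonneRing p k) • ξ = n • ξ := by
  rw [H2.smul_def, map_intCast, AddMonoid.End.intCast_apply]

theorem H2.frob_verEnd {l : ℕ} (ξ : H2 p x y l) :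
    H2.frob p k x y l (H2.verEnd p x y l ξ) = H2.verEnd p x y l (H2.frob p k x y l ξ) := by
  obtain ⟨w, rfl⟩ := H2.exists_rep ξ
  rw [H2.verEnd_cls, H2.frob_cls, H2.frob_cls, H2.verEnd_cls, WittVector.map_verschiebung]

theorem H2.iterate_frob_mulConst {l : ℕ} (m : ℕ) (a : WittVector p k) (ξ : H2 p x y l) :
    (H2.frob p k x y l)^[m] (H2.mulConst p k x y l a ξ) =
      H2.mulConst p k x y l (WittVector.frobenius^[m] a) ((H2.frob p k x y l)^[m] ξ) := by
  induction m generalizing a ξ with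
  | zero => rfl
  | succ m ih =>
    rw [Function.iterate_succ_apply, Function.iterate_succ_apply, Function.iterate_succ_apply,
      ← ih]
    obtain ⟨w, rfl⟩ := H2.exists_rep ξ
    rw [H2.mulConst_cls, H2.frob_cls, H2.frob_cls, H2.mulConst_cls, map_mul,
      map_frobHom_map_algebraMap]

theorem H2.iterate_frob_verEnd {l : ℕ} (m : ℕ) (ξ : H2 p x y l) :
    (H2.frob p k x y l)^[m] (H2.verEnd p x y l ξ) =
      H2.verEnd p x y l ((H2.frob p k x y l)^[m] ξ) := by
  induction m generalizing ξ with
  | zero => rfl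
  | succ m ih => rw [Function.iterate_succ_apply, Function.iterate_succ_apply, H2.frob_verEnd, ih]

variable (p k x y)

/-- The left `𝔻`-module `H^2_𝔪(X, W_l 𝒪_X)[F^m]`, the kernel of `F^m`. -/
def kerF (m l : ℕ) : Submodule (DieudonneRing p k) (H2 p x y l) where
  carrier := {ξ | (H2.frob p k x y l)^[m] ξ = 0}
  zero_mem' := iterate_map_zero _ _
  add_mem' {ξ η} hξ hη := by
    rw [Set.mem_ofPred_eq] at *
    rw [iterate_map_add, hξ, hη, add_zero]
  smul_mem' d := by
    induction d using DieudonneRing.induction with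
    | hint n =>
      intro ξ hξ
      rw [Set.mem_ofPred_eq] at *
      rw [H2.intCast_smul, iterate_map_zsmul, hξ, smul_zero]
    | hscal a =>
      intro ξ hξ
      rw [Set.mem_ofPred_eq] at *
      rw [H2.scal_smul, H2.iterate_frob_mulConst, hξ, map_zero]
    | hF =>
      intro ξ hξ
      rw [Set.mem_ofPred_eq] at *
      rw [H2.F_smul, ← Function.iterate_succ_apply, Function.iterate_succ_apply', hξ, map_zero]
    | hV =>
      intro ξ hξ
      rw [Set.mem_ofPred_eq] at *
      rw [H2.V_smul, H2.iterate_frob_verEnd, hξ, map_zero]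
    | hmul a b ha hb =>
      intro ξ hξ
      rw [mul_smul]
      exact ha (hb hξ)
    | hadd a b ha hb =>
      intro ξ hξ
      have h1 := ha hξ
      have h2 := hb hξ
      rw [Set.mem_ofPred_eq] at *
      rw [add_smul, iterate_map_add, h1, h2, add_zero]

variable {p k x y}

theorem mem_kerF {m l : ℕ} {ξ : H2 p x y l} :
    ξ ∈ kerF p k x y m l ↔ (H2.frob p k x y l)^[m] ξ = 0 := Iff.rfl

theorem iterate_mul_verschiebung {A : Type u} [CommRing A] [Algebra k A] (d : ℕ)
    (a : WittVector p k) (w : WittVector p A) :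
    WittVector.map (algebraMap k A) a * WittVector.verschiebung^[d] w =
      WittVector.verschiebung^[d]
        (WittVector.map (algebraMap k A) (WittVector.frobenius^[d] a) * w) := by
  induction d generalizing a with
  | zero => rfl
  | succ d ih =>
    rw [Function.iterate_succ_apply', Function.iterate_succ_apply', mul_verschiebung, ih,
      Function.iterate_succ_apply]

theorem H2.iterate_frob_ver {d l l' : ℕ} (h : l' ≤ l + d) (m : ℕ) (ξ : H2 p x y l) :
    (H2.frob p k x y l')^[m] (H2.ver p x y d l l' h ξ) =
      H2.ver p x y d l l' h ((H2.frob p k x y l)^[m] ξ) := by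
  induction m generalizing ξ with
  | zero => rfl
  | succ m ih =>
    rw [Function.iterate_succ_apply, Function.iterate_succ_apply, ← ih]
    obtain ⟨w, rfl⟩ := H2.exists_rep ξ
    rw [H2.ver_cls, H2.frob_cls, H2.frob_cls, H2.ver_cls, map_iterate_verschiebung]

variable (p k x y)

/-- The `𝔻`-linear map `V^{l' - l} : H^2_𝔪(X, W_l 𝒪_X) → H^2_𝔪(X, W_{l'} 𝒪_X)` for `l ≤ l'`. -/
def H2.incl {l l' : ℕ} (h : l ≤ l') : H2 p x y l →ₗ[DieudonneRing p k] H2 p x y l' where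
  toFun := H2.ver p x y (l' - l) l l' (by omega)
  map_add' := map_add _
  map_smul' d := by
    rw [RingHom.id_apply]
    induction d using DieudonneRing.induction with
    | hint n => intro ξ; rw [H2.intCast_smul, H2.intCast_smul, map_zsmul]
    | hscal a =>
      intro ξ
      obtain ⟨e, rfl⟩ := Nat.exists_eq_add_of_le h
      obtain ⟨w, rfl⟩ := H2.exists_rep ξ
      rw [H2.scal_smul, H2.scal_smul, H2.mulConst_cls, H2.ver_cls, H2.ver_cls, H2.mulConst_cls,
        iterate_mul_verschiebung, Nat.add_sub_cancel_left, iterate_frobenius_sigmaInv]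
    | hF =>
      intro ξ
      rw [H2.F_smul, H2.F_smul]
      exact (H2.iterate_frob_ver _ 1 ξ).symm
    | hV =>
      intro ξ
      obtain ⟨w, rfl⟩ := H2.exists_rep ξ
      rw [H2.V_smul, H2.V_smul, H2.verEnd_cls, H2.ver_cls, H2.ver_cls, H2.verEnd_cls,
        ← Function.iterate_succ_apply, Function.iterate_succ_apply']
    | hmul a b ha hb => intro ξ; rw [mul_smul, ha, hb, mul_smul]
    | hadd a b ha hb => intro ξ; rw [add_smul, map_add, ha, hb, add_smul]

/-- The transition maps of the directed system `H^2_𝔪(X, W_l 𝒪_X)[F^m]`, indexed by the pairs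
`(m, l)`: inclusions in the direction of `m`, and powers of `V` in the direction of `l`. -/
def trans (i j : ℕ × ℕ) (h : i ≤ j) :
    kerF p k x y i.1 i.2 →ₗ[DieudonneRing p k] kerF p k x y j.1 j.2 :=
  (H2.incl p k x y h.2).restrict (by
    intro ξ hξ
    rw [mem_kerF] at hξ ⊢
    change (H2.frob p k x y j.2)^[j.1] (H2.ver p x y _ _ _ _ ξ) = 0
    have hm : (H2.frob p k x y i.2)^[j.1] ξ = 0 := by
      obtain ⟨e, he⟩ := Nat.exists_eq_add_of_le' h.1
      rw [he, Function.iterate_add_apply, hξ, iterate_map_zero]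
    rw [H2.iterate_frob_ver, hm, map_zero])

instance : DirectedSystem (fun i : ℕ × ℕ => kerF p k x y i.1 i.2)
    (fun i j h => trans p k x y i j h) where
  map_self i ξ := by
    apply Subtype.ext
    change H2.ver p x y _ _ _ _ ξ.1 = ξ.1
    obtain ⟨w, hw⟩ := H2.exists_rep ξ.1
    rw [← hw, H2.ver_cls, Nat.sub_self]
    rfl
  map_map m j i hij hjm ξ := by
    apply Subtype.ext
    change H2.ver p x y _ _ _ _ (H2.ver p x y _ _ _ _ ξ.1) = H2.ver p x y _ _ _ _ ξ.1
    obtain ⟨w, hw⟩ := H2.exists_rep ξ.1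
    have h1 := hij.2
    have h2 := hjm.2
    rw [← hw, H2.ver_cls, H2.ver_cls, H2.ver_cls, ← Function.iterate_add_apply,
      show m.2 - j.2 + (j.2 - i.2) = m.2 - i.2 by omega]

/-- The left `𝔻`-module `colim_{m, l} H^2_𝔪(X, W_l 𝒪_X)[F^m]`. -/
def LocalWittCohomology : Type u :=
  Module.DirectLimit (fun i : ℕ × ℕ => kerF p k x y i.1 i.2) (trans p k x y)

instance : AddCommGroup (LocalWittCohomology p k x y) :=
  inferInstanceAs (AddCommGroup (Module.DirectLimit
    (fun i : ℕ × ℕ => kerF p k x y i.1 i.2) (trans p k x y)))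

instance : Module (DieudonneRing p k) (LocalWittCohomology p k x y) :=
  inferInstanceAs (Module (DieudonneRing p k) (Module.DirectLimit
    (fun i : ℕ × ℕ => kerF p k x y i.1 i.2) (trans p k x y)))

/-- The underlying `W(k)`-module. -/
instance : Module (WittVector p k) (LocalWittCohomology p k x y) :=
  Module.compHom _ (DieudonneRing.scal p k)

/-- The canonical map `H^2_𝔪(X, W_l 𝒪_X)[F^m] → colim_{m, l} H^2_𝔪(X, W_l 𝒪_X)[F^m]`. -/
def LocalWittCohomology.of (m l : ℕ) :
    kerF p k x y m l →ₗ[DieudonneRing p k] LocalWittCohomology p k x y :=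
  Module.DirectLimit.of (DieudonneRing p k) (ℕ × ℕ)
    (fun i : ℕ × ℕ => kerF p k x y i.1 i.2) (trans p k x y) (m, l)

variable {p k x y}

/-- `g` is the element of the colimit represented by `ξ ∈ H^2_𝔪(X, W_l 𝒪_X)`; in particular `ξ`
is killed by some power of `F`. -/
def IsRepresentedBy (g : LocalWittCohomology p k x y) {l : ℕ} (ξ : H2 p x y l) : Prop :=
  ∃ (m : ℕ) (h : ξ ∈ kerF p k x y m l), g = LocalWittCohomology.of p k x y m l ⟨ξ, h⟩

end ModuleStructure

/-! ### Hypersurface singularities `k[[x, y, z]] / (h)` -/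

section Hypersurface

variable (p : ℕ) [Fact p.Prime] {k : Type u} [Field k] [CharP k p]

/-- The ring `k[[x, y, z]] / (h)`. -/
abbrev HypRing (h : MvPowerSeries (Fin 3) k) : Type u :=
  MvPowerSeries (Fin 3) k ⧸ Ideal.span {h}

/-- The images of the variables `x = X 0`, `y = X 1`, `z = X 2` in `k[[x, y, z]] / (h)`. -/
def var (h : MvPowerSeries (Fin 3) k) (i : Fin 3) : HypRing h :=
  Ideal.Quotient.mk _ (MvPowerSeries.X i)

/-- For an equation `h` with `h ≡ z^2` modulo `(x, y)`, the complement of the closed point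
of `Spec k[[x, y, z]] / (h)` is covered by `D(x)` and `D(y)`: a prime ideal that
contains `x` and `y` contains `z`. -/
theorem var_mem_of_isPrime (h : MvPowerSeries (Fin 3) k)
    (hh : h - MvPowerSeries.X 2 ^ 2 ∈ Ideal.span {MvPowerSeries.X 0, MvPowerSeries.X 1})
    (P : Ideal (HypRing h)) [P.IsPrime] (hx : var h 0 ∈ P) (hy : var h 1 ∈ P) (i : Fin 3) :
    var h i ∈ P := by
  have hz : var h 2 ∈ P := by
    apply Ideal.IsPrime.mem_of_pow_mem (n := 2) inferInstance
    obtain ⟨a, b, hab⟩ := Ideal.mem_span_pair.mp hh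
    have h0 : Ideal.Quotient.mk (Ideal.span {h}) h = 0 :=
      Ideal.Quotient.eq_zero_iff_mem.mpr (Ideal.mem_span_singleton_self h)
    have e : var h 2 ^ 2 = -(Ideal.Quotient.mk _ a * var h 0 + Ideal.Quotient.mk _ b * var h 1) := by
      have := congrArg (Ideal.Quotient.mk (Ideal.span {h})) hab
      rw [map_sub, h0, map_add, map_mul, map_mul, map_pow, zero_sub] at this
      exact (neg_eq_iff_eq_neg.mp this.symm)
    rw [e]
    exact P.neg_mem (P.add_mem (P.mul_mem_left _ hx) (P.mul_mem_left _ hy))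
  fin_cases i
  exacts [hx, hy, hz]

/-- The section `z / (x y^j) = z x^{-1} y^{-j}` of the structure sheaf over `D(x y)`, `j ∈ ℤ`. -/
def frac (h : MvPowerSeries (Fin 3) k) (j : ℤ) : Localization.Away (var h 0 * var h 1) :=
  algebraMap _ _ (var h 2) * Ring.inverse (algebraMap _ _ (var h 0)) *
    (Ring.inverse (algebraMap _ _ (var h 1)) ^ j.toNat * algebraMap _ _ (var h 1) ^ (-j).toNat)

/-- `x` and `y` are invertible over `D(x y)`, so that the inverses in `frac` are genuine. -/
theorem isUnit_var (h : MvPowerSeries (Fin 3) k) :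
    IsUnit (algebraMap (HypRing h) (Localization.Away (var h 0 * var h 1)) (var h 0)) ∧
      IsUnit (algebraMap (HypRing h) (Localization.Away (var h 0 * var h 1)) (var h 1)) := by
  have := IsLocalization.Away.algebraMap_isUnit (S := Localization.Away (var h 0 * var h 1))
    (var h 0 * var h 1)
  rw [map_mul] at this
  exact ⟨isUnit_of_mul_isUnit_left this, isUnit_of_mul_isUnit_right this⟩

/-- The class `f_j^{(l)} = (f_j, 0, …, 0) ∈ H^2_𝔪(X, W_l 𝒪_X)`, the Teichmüller lift of
`f_j = z / (x y^j)`. -/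
def fClass (h : MvPowerSeries (Fin 3) k) (l : ℕ) (j : ℤ) : H2 p (var h 0) (var h 1) l :=
  cls p _ _ l (WittVector.truncate l (WittVector.teichmuller p (frac h j)))

variable [PerfectRing k p]

/-- For `X = Spec k[[x, y, z]] / (h)`, the left `𝔻`-module `colim_{m, l} H^2_𝔪(X, W_l 𝒪_X)[F^m]`
is presented by the generators `f_j^{(l)}`, for `(l, j)` in the family `gen`, and the relations
`rels`, and it has length `len` (over `𝔻`, and also over `W(k)`). A relation is an element of the
free left `𝔻`-module on the generators. -/
def HasPresentation (h : MvPowerSeries (Fin 3) k) {ι : Type} (gen : ι → ℕ × ℕ)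
    (rels : Set (ι →₀ DieudonneRing p k)) (len : ℕ) : Prop :=
  ∃ g : ι → LocalWittCohomology p k (var h 0) (var h 1),
    (∀ i, IsRepresentedBy (g i) (fClass p h (gen i).1 (gen i).2)) ∧
    Function.Surjective (Finsupp.linearCombination (DieudonneRing p k) g) ∧
    LinearMap.ker (Finsupp.linearCombination (DieudonneRing p k) g) =
      Submodule.span (DieudonneRing p k) rels ∧
    Module.length (DieudonneRing p k) (LocalWittCohomology p k (var h 0) (var h 1)) = len ∧
    Module.length (WittVector p k) (LocalWittCohomology p k (var h 0) (var h 1)) = len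

end Hypersurface

/-! ### The presentation in type `D_n^r`, characteristic `2` -/

section TypeD

/-- `C(l, j) = 2^{l-1} (2 j - 1)`, for `l, j ≥ 1`. -/
def cIndex (l j : ℕ) : ℕ := 2 ^ (l - 1) * (2 * j - 1)

/-- `L_n^r = ⌊min (n/2 - 1, n - 2 r - 2)⌋`. -/
def lBound (n : ℕ) (r : ℚ) : ℤ := ⌊min ((n : ℚ) / 2 - 1) (n - 2 * r - 2)⌋

/-- The pairs `(l, j)` with `l, j ≥ 1` and `C(l, j) ≤ L_n^r`. -/
abbrev DIndex (n : ℕ) (r : ℚ) : Type :=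
  {i : ℕ × ℕ // 1 ≤ i.1 ∧ 1 ≤ i.2 ∧ (cIndex i.1 i.2 : ℤ) ≤ lBound n r}

variable (p : ℕ) [Fact p.Prime] (k : Type u) [Field k] [CharP k p]

/-- The relations `V (f_j^{(l)}) = f_j^{(l-1)}` and `F (f_j^{(l)}) = f_t^{(1)}`, where
`t = C(l, j) - (n/2 - r - 1)`, with the convention that `f_j^{(0)} = 0`, and
`f_t^{(1)} = 0` for `t ≤ 0`. -/
inductive DRelation (n : ℕ) (r : ℚ) : (DIndex n r →₀ DieudonneRing p k) → Prop
  | V_eq (i i' : DIndex n r) (hl : i'.1.1 + 1 = i.1.1) (hj : i'.1.2 = i.1.2) :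
      DRelation n r (Finsupp.single i (DieudonneRing.V p k) - Finsupp.single i' 1)
  | V_zero (i : DIndex n r) (hl : i.1.1 = 1) :
      DRelation n r (Finsupp.single i (DieudonneRing.V p k))
  | F_eq (i i' : DIndex n r) (hl : i'.1.1 = 1)
      (hj : (i'.1.2 : ℚ) = cIndex i.1.1 i.1.2 - ((n : ℚ) / 2 - r - 1)) :
      DRelation n r (Finsupp.single i (DieudonneRing.F p k) - Finsupp.single i' 1)
  | F_zero (i : DIndex n r) (hj : (cIndex i.1.1 i.1.2 : ℚ) - ((n : ℚ) / 2 - r - 1) ≤ 0) :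
      DRelation n r (Finsupp.single i (DieudonneRing.F p k))

end TypeD

end LocalWitt

end

set_option linter.unusedSectionVars false
set_option linter.unnecessarySeqFocus false
set_option linter.unusedSimpArgs false

noncomputable section

namespace LocalWitt

/-! ### The ring as a free module of rank two over `k[[x, y]]` -/

section DoubleCover

/-! The equations are quadratic in z, so Weierstrass division makes R free over k[[x, y]] with basis
1, z. An element of R_xy then has coefficients at the monomials x^i y^j z^ε with ε in {0, 1}, and
its class in H²_𝔪(X, 𝒪_X) vanishes exactly when all coefficients with i, j < 0 vanish
(`mem_Bd_one_iff`). The same coefficients show R_x ∩ R_y = R, which makes V : H²_𝔪(W_l) →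
H²_𝔪(W_{l+1}) injective (`mem_Bd_of_verschiebung`). Hence the transition maps of the directed system
are injective, and the colimit can be handled through Witt vectors over R_xy modulo coboundaries
(`el_eq_zero_iff`).

The expected W(k)-generators are the f_j^{(l)} with j in a finite set J and 1 ≤ l ≤ lam j.
Verschiebung lowers l by one. For Frobenius, F f_j is the Teichmüller lift of x^{-p} y^{-pj} z^p.
One replaces z^p by means of the equation and expands the Teichmüller lift of a sum
(`teichmuller_sum`): the part of level i is V^i of integral multiples of lifts of products of p^i
terms. Most of these products have a nonnegative exponent of x or of y and are coboundaries. What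
survives is F f_j ≡ c V^e f_{j'} + V^{lam j} η_j in length lam j + 1 (`FrobRelations`). In lengths
at most lam j this gives the action of F, and shows that a power of F kills f_j.

That nothing else is killed by a power of F is `FrobRelations.Nil_le_Sp`. Let w be such a class in
length l + 1. By induction on l and on the power of F, Fw lies in the span of the expected elements,
and w does so up to terms V^{l - lam j}(a_j f_j) with lam j ≤ l and a term V^l u. Applying F and
cancelling V^l, one finds that u^p + Σ d_j η_j lies, in length one, in the k-span of the f_j, where
d_j is a p-power of the constant term of a_j. If this forces all d_j = 0 and u into that span, then
each a_j is divisible by p = VF, and w is in the span as well. This condition is checked on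
coefficients. The p-th powers only have coefficients in certain residue classes of exponents modulo
p, one for each term of z^p besides the class of zero, and they determine u up to the support of the
f_j. A weight estimate then isolates a point outside these classes at which η_j has a nonzero
coefficient.

For the presentation, order the pairs (l, j) lexicographically; F and V send each basis element into
the W(k)-span of the smaller ones. Then so does p = FV, so each step of the filtration by these
spans is zero or a copy of k. This applies both to the module given by generators and relations and
to the colimit. In the colimit the steps are nonzero, so the natural map is bijective and the
filtration is a composition series over 𝔻 and over W(k) at once, of length Σ lam j
(`bijective_and_length_of_triangular`, `hasPresentation_of_relations`). In type D, (l, j) ↦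
2^{l-1}(2j-1) is a bijection from the index pairs onto 1, …, L, which gives the length L. -/

/-- A presentation of `R` as a free module with basis `1, z` over `k[[x, y]]`. -/
structure DoubleCover (k : Type u) [Field k] {R : Type u} [CommRing R] [Algebra k R]
    (x y z : R) where
  /-- The structure map. -/
  ι : MvPowerSeries (Fin 2) k →+* R
  ι_C : ∀ a, ι (MvPowerSeries.C a) = algebraMap k R a
  ι_X : ι (MvPowerSeries.X 0) = x
  ι_Y : ι (MvPowerSeries.X 1) = y
  bij : Function.Bijective fun s : MvPowerSeries (Fin 2) k × MvPowerSeries (Fin 2) k =>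
    ι s.1 + ι s.2 * z

variable {k : Type u} [Field k]

/-- Power series in three variables as power series in the last one. -/
def lastEquiv (k : Type u) [Field k] :
    MvPowerSeries (Fin 3) k ≃ₐ[k] PowerSeries (MvPowerSeries (Fin 2) k) :=
  (MvPowerSeries.renameEquiv k finSuccEquivLast).trans (MvPowerSeries.optionEquivLeft (Fin 2) k)

theorem lastEquiv_X0 : lastEquiv k (MvPowerSeries.X 0) = PowerSeries.C (MvPowerSeries.X 0) := by
  have h : finSuccEquivLast (0 : Fin 3) = some (0 : Fin 2) := rfl
  simp [lastEquiv, h]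

theorem lastEquiv_X1 : lastEquiv k (MvPowerSeries.X 1) = PowerSeries.C (MvPowerSeries.X 1) := by
  have h : finSuccEquivLast (1 : Fin 3) = some (1 : Fin 2) := rfl
  simp [lastEquiv, h]

theorem lastEquiv_X2 : lastEquiv k (MvPowerSeries.X 2) = PowerSeries.X := by
  have h : finSuccEquivLast (2 : Fin 3) = none := rfl
  simp [lastEquiv, h]

/-- The ideal of `k[[x, y]]` generated by the variables. -/
abbrev varIdeal (k : Type u) [Field k] : Ideal (MvPowerSeries (Fin 2) k) :=
  Ideal.span (Set.range MvPowerSeries.X)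

theorem varIdeal_ne_top : varIdeal k ≠ ⊤ := by
  rw [Ideal.ne_top_iff_one]
  intro h
  have hle : varIdeal k ≤ RingHom.ker (MvPowerSeries.constantCoeff (σ := Fin 2) (R := k)) := by
    rw [Ideal.span_le]
    rintro _ ⟨i, rfl⟩
    simp [RingHom.mem_ker]
  have := hle h
  simp [RingHom.mem_ker] at this

theorem X0_mem_varIdeal : (MvPowerSeries.X 0 : MvPowerSeries (Fin 2) k) ∈ varIdeal k :=
  Ideal.subset_span ⟨0, rfl⟩

theorem X1_mem_varIdeal : (MvPowerSeries.X 1 : MvPowerSeries (Fin 2) k) ∈ varIdeal k :=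
  Ideal.subset_span ⟨1, rfl⟩

open Polynomial in
/-- The hypersurface `z² + b₁ z + b₀ = 0`, with `b₀, b₁ ∈ (x, y)`, as a double cover. -/
def DoubleCover.ofQuadratic (h : MvPowerSeries (Fin 3) k) (b₀ b₁ : MvPowerSeries (Fin 2) k)
    (h₀ : b₀ ∈ varIdeal k) (h₁ : b₁ ∈ varIdeal k)
    (hh : lastEquiv k h = PowerSeries.X ^ 2 + PowerSeries.C b₁ * PowerSeries.X +
      PowerSeries.C b₀) :
    DoubleCover k (var h 0) (var h 1) (var h 2) where
  ι := (Ideal.Quotient.mk _).comp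
    (((lastEquiv k).symm : PowerSeries (MvPowerSeries (Fin 2) k) →+* _).comp PowerSeries.C)
  ι_C a := by
    have : PowerSeries.C (MvPowerSeries.C a) = lastEquiv k (MvPowerSeries.C a) := by
      simp [lastEquiv]
    simp only [RingHom.comp_apply, this]
    simp
    rfl
  ι_X := by
    simp only [RingHom.comp_apply, ← lastEquiv_X0]
    simp [var]
  ι_Y := by
    simp only [RingHom.comp_apply, ← lastEquiv_X1]
    simp [var]
  bij := by
    set g : (MvPowerSeries (Fin 2) k)[X] := X ^ 2 + Polynomial.C b₁ * X + Polynomial.C b₀ with hg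
    have hg' : (g : PowerSeries (MvPowerSeries (Fin 2) k)) = lastEquiv k h := by
      rw [hh, hg]; simp
    have hdeg : (Polynomial.C b₁ * X + Polynomial.C b₀).degree < ((2 : ℕ) : WithBot ℕ) := by
      exact lt_of_le_of_lt degree_linear_le (by norm_num)
    have hmonic : g.Monic := by
      rw [hg, add_assoc]
      exact monic_X_pow_add hdeg
    have hnat : g.natDegree = 2 := by
      rw [hg, add_assoc, natDegree_add_eq_left_of_degree_lt, natDegree_X_pow]
      rw [degree_X_pow]; exact hdeg
    have H : g.IsDistinguishedAt (varIdeal k) := by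
      refine ⟨⟨fun {n} hn => ?_⟩, hmonic⟩
      rw [hnat] at hn
      interval_cases n
      · simpa [hg] using h₀
      · simpa [hg, coeff_X, coeff_C] using h₁
    -- Modulo (x, y) the divisor is X², so Weierstrass remainders have degree less than two: they
    -- are the a + bX.
    have hord : ((g : PowerSeries (MvPowerSeries (Fin 2) k)).map (Ideal.Quotient.mk (varIdeal k))).order.toNat = 2 := by
      have := congrArg ENat.toNat (H.coe_natDegree_eq_order_map g 1
        (by rw [PowerSeries.constantCoeff_one, ← Ideal.ne_top_iff_one]; exact varIdeal_ne_top)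
        (by simp))
      rw [← this, hnat]; rfl
    have HW := H.isWeierstrassDivisorAt'
    have key : ∀ s : MvPowerSeries (Fin 2) k × MvPowerSeries (Fin 2) k, (Ideal.Quotient.mk (Ideal.span {h})
        ((lastEquiv k).symm ((Polynomial.C s.1 + Polynomial.C s.2 * X : (MvPowerSeries (Fin 2) k)[X]) : PowerSeries (MvPowerSeries (Fin 2) k)))) =
        (Ideal.Quotient.mk (Ideal.span {h}) ((lastEquiv k).symm (PowerSeries.C s.1))) +
        (Ideal.Quotient.mk (Ideal.span {h}) ((lastEquiv k).symm (PowerSeries.C s.2))) *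
          var h 2 := by
      intro s
      have : MvPowerSeries.X 2 = (lastEquiv k).symm PowerSeries.X := by
        rw [← lastEquiv_X2]; simp
      rw [var, this, ← map_mul, ← map_mul, ← map_add, ← map_add]
      simp
    constructor
    · intro s t hst
      have hst' : Ideal.Quotient.mk (Ideal.span {h})
        ((lastEquiv k).symm ((Polynomial.C s.1 + Polynomial.C s.2 * X : (MvPowerSeries (Fin 2) k)[X]) : PowerSeries (MvPowerSeries (Fin 2) k))) =
        Ideal.Quotient.mk (Ideal.span {h})
        ((lastEquiv k).symm ((Polynomial.C t.1 + Polynomial.C t.2 * X : (MvPowerSeries (Fin 2) k)[X]) : PowerSeries (MvPowerSeries (Fin 2) k))) := by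
        rw [key, key]; exact hst
      rw [Ideal.Quotient.mk_eq_mk_iff_sub_mem, Ideal.mem_span_singleton'] at hst'
      obtain ⟨q, hq⟩ := hst'
      have hq2 := congrArg (lastEquiv k) hq
      rw [map_mul, map_sub, AlgEquiv.apply_symm_apply, AlgEquiv.apply_symm_apply, ← hg',
        mul_comm] at hq2
      have hq3 : (g : PowerSeries (MvPowerSeries (Fin 2) k)) * lastEquiv k q =
          ((Polynomial.C (s.1 - t.1) + Polynomial.C (s.2 - t.2) * X : (MvPowerSeries (Fin 2) k)[X]) : PowerSeries (MvPowerSeries (Fin 2) k)) := by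
        rw [hq2]; push_cast; simp; ring
      -- Uniqueness in Weierstrass division: a multiple of g that is a polynomial of degree less
      -- than two is zero.
      have := (HW.eq_zero_of_mul_eq (by
        rw [hord, add_comm]; exact lt_of_le_of_lt degree_linear_le (by norm_num)) hq3).2
      have e0 := congrArg (fun f => Polynomial.coeff f 0) this
      have e1 := congrArg (fun f => Polynomial.coeff f 1) this
      simp [coeff_X, coeff_C] at e0 e1
      exact Prod.ext (sub_eq_zero.mp e0) (sub_eq_zero.mp e1)
    · intro r
      obtain ⟨f, rfl⟩ := Ideal.Quotient.mk_surjective r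
      obtain ⟨q, r, hd, e⟩ : ∃ q : PowerSeries (MvPowerSeries (Fin 2) k),
          ∃ r : (MvPowerSeries (Fin 2) k)[X], r.degree < ((2 : ℕ) : WithBot ℕ) ∧
          lastEquiv k f = g * q + r :=
        ⟨_, _, (HW.isWeierstrassDivisionAt_div_mod (lastEquiv k f)).degree_lt.trans_eq
            (congrArg _ hord),
          (HW.isWeierstrassDivisionAt_div_mod (lastEquiv k f)).eq_mul_add⟩
      have hd' : r.natDegree ≤ 1 := by
        by_cases h0 : r = 0
        · rw [h0]; simp
        · have := (natDegree_lt_iff_degree_lt h0).mpr hd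
          omega
      obtain ⟨b, a, hab⟩ := exists_eq_X_add_C_of_natDegree_le_one hd'
      refine ⟨(a, b), ?_⟩
      change Ideal.Quotient.mk (Ideal.span {h}) ((lastEquiv k).symm (PowerSeries.C a)) +
        Ideal.Quotient.mk (Ideal.span {h}) ((lastEquiv k).symm (PowerSeries.C b)) * var h 2 = _
      rw [← key (a, b), Ideal.Quotient.mk_eq_mk_iff_sub_mem, Ideal.mem_span_singleton']
      refine ⟨-(lastEquiv k).symm q, ?_⟩
      apply (lastEquiv k).injective
      rw [map_mul, map_sub, map_neg, AlgEquiv.apply_symm_apply, AlgEquiv.apply_symm_apply, ← hg',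
        e, hab, add_comm (Polynomial.C a)]
      ring

end DoubleCover

/-! ### Coefficients of power series with integer exponents -/

section SeriesCoeff

variable {k : Type u} [Field k]

/-- The coefficient of `x^i y^j` of a power series, for integers `i`, `j`. -/
def sc (s : MvPowerSeries (Fin 2) k) (i j : ℤ) : k :=
  if 0 ≤ i ∧ 0 ≤ j then
    MvPowerSeries.coeff (Finsupp.single 0 i.toNat + Finsupp.single 1 j.toNat) s else 0

theorem sc_add (s t : MvPowerSeries (Fin 2) k) (i j : ℤ) : sc (s + t) i j = sc s i j + sc t i j := by
  unfold sc; split_ifs <;> simp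

theorem sc_neg_of_neg {s : MvPowerSeries (Fin 2) k} {i j : ℤ} (h : i < 0 ∨ j < 0) :
    sc s i j = 0 := by
  unfold sc; rw [if_neg]; omega

theorem fin2_finsupp (m : Fin 2 →₀ ℕ) :
    Finsupp.single 0 (m 0) + Finsupp.single 1 (m 1) = m := by
  ext i; fin_cases i <;> simp

theorem sc_nat (s : MvPowerSeries (Fin 2) k) (m : Fin 2 →₀ ℕ) :
    sc s (m 0) (m 1) = MvPowerSeries.coeff m s := by
  unfold sc
  rw [if_pos (by omega), Int.toNat_natCast, Int.toNat_natCast, fin2_finsupp]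

theorem sc_ext {s t : MvPowerSeries (Fin 2) k} (h : ∀ i j, sc s i j = sc t i j) : s = t := by
  ext m
  rw [← sc_nat, ← sc_nat, h]

theorem sc_X0_mul (s : MvPowerSeries (Fin 2) k) (i j : ℤ) :
    sc (MvPowerSeries.X 0 * s) i j = sc s (i - 1) j := by
  unfold sc
  by_cases h : 0 ≤ i ∧ 0 ≤ j
  · rw [if_pos h, MvPowerSeries.X, mul_comm, MvPowerSeries.coeff_mul_monomial]
    by_cases h1 : 1 ≤ i
    · have hle : Finsupp.single (M := ℕ) (0 : Fin 2) 1 ≤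
          Finsupp.single 0 i.toNat + Finsupp.single 1 j.toNat := by
        intro t
        fin_cases t <;> simp <;> omega
      rw [if_pos hle, if_pos (by omega), mul_one]
      congr 2
      ext t
      fin_cases t <;> simp
    · rw [if_neg, if_neg (by omega)]
      intro hle
      have := hle 0
      simp at this
      omega
  · rw [if_neg h, if_neg (by omega)]

theorem sc_X1_mul (s : MvPowerSeries (Fin 2) k) (i j : ℤ) :
    sc (MvPowerSeries.X 1 * s) i j = sc s i (j - 1) := by
  unfold sc
  by_cases h : 0 ≤ i ∧ 0 ≤ j
  · rw [if_pos h, MvPowerSeries.X, mul_comm, MvPowerSeries.coeff_mul_monomial]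
    by_cases h1 : 1 ≤ j
    · have hle : Finsupp.single (M := ℕ) (1 : Fin 2) 1 ≤
          Finsupp.single 0 i.toNat + Finsupp.single 1 j.toNat := by
        intro t
        fin_cases t <;> simp <;> omega
      rw [if_pos hle, if_pos (by omega), mul_one]
      congr 2
      ext t
      fin_cases t <;> simp
    · rw [if_neg, if_neg (by omega)]
      intro hle
      have := hle 1
      simp at this
      omega
  · rw [if_neg h, if_neg (by omega)]

theorem sc_C_mul (a : k) (s : MvPowerSeries (Fin 2) k) (i j : ℤ) :
    sc (MvPowerSeries.C a * s) i j = a * sc s i j := by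
  unfold sc; split_ifs <;> simp

theorem sc_one (i j : ℤ) : sc (1 : MvPowerSeries (Fin 2) k) i j = if i = 0 ∧ j = 0 then 1 else 0 := by
  unfold sc
  by_cases h : 0 ≤ i ∧ 0 ≤ j
  · rw [if_pos h, MvPowerSeries.coeff_one]
    refine if_congr ?_ rfl rfl
    rw [DFunLike.ext_iff]
    constructor
    · intro h'
      have h0 := h' 0
      have h1 := h' 1
      simp at h0 h1
      omega
    · rintro ⟨rfl, rfl⟩ t
      simp
  · rw [if_neg h, if_neg (by omega)]

theorem sc_X0_pow_mul (n : ℕ) (s : MvPowerSeries (Fin 2) k) (i j : ℤ) :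
    sc (MvPowerSeries.X 0 ^ n * s) i j = sc s (i - n) j := by
  induction n generalizing i with
  | zero => simp
  | succ n ih => rw [pow_succ', mul_assoc, sc_X0_mul, ih]; congr 1; push_cast; ring

theorem sc_X1_pow_mul (n : ℕ) (s : MvPowerSeries (Fin 2) k) (i j : ℤ) :
    sc (MvPowerSeries.X 1 ^ n * s) i j = sc s i (j - n) := by
  induction n generalizing j with
  | zero => simp
  | succ n ih => rw [pow_succ', mul_assoc, sc_X1_mul, ih]; congr 1; push_cast; ring

theorem exists_of_sc_eq_zero_left {s : MvPowerSeries (Fin 2) k} {n : ℕ}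
    (h : ∀ i j : ℤ, i < n → sc s i j = 0) : ∃ t, s = MvPowerSeries.X 0 ^ n * t := by
  rw [← dvd_def, MvPowerSeries.X_pow_dvd_iff]
  intro m hm
  rw [← sc_nat]
  exact h _ _ (by exact_mod_cast hm)

theorem exists_of_sc_eq_zero_right {s : MvPowerSeries (Fin 2) k} {n : ℕ}
    (h : ∀ i j : ℤ, j < n → sc s i j = 0) : ∃ t, s = MvPowerSeries.X 1 ^ n * t := by
  rw [← dvd_def, MvPowerSeries.X_pow_dvd_iff]
  intro m hm
  rw [← sc_nat]
  exact h _ _ (by exact_mod_cast hm)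

/-- Collect the terms whose x-exponent is at least n; every remaining term has y-exponent at least
n. -/
theorem exists_of_sc_eq_zero {s : MvPowerSeries (Fin 2) k} {n : ℕ}
    (h : ∀ i j : ℤ, i < n → j < n → sc s i j = 0) :
    ∃ t t', s = MvPowerSeries.X 0 ^ n * t + MvPowerSeries.X 1 ^ n * t' := by
  let a : MvPowerSeries (Fin 2) k := fun m => if m 0 < n then 0 else MvPowerSeries.coeff m s
  have ha : ∀ m, MvPowerSeries.coeff m a = if m 0 < n then 0 else MvPowerSeries.coeff m s :=
    fun m => rfl
  have h1 : MvPowerSeries.X 0 ^ n ∣ a := by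
    rw [MvPowerSeries.X_pow_dvd_iff]
    intro m hm
    rw [ha, if_pos hm]
  have h2 : MvPowerSeries.X 1 ^ n ∣ s - a := by
    rw [MvPowerSeries.X_pow_dvd_iff]
    intro m hm
    rw [map_sub, ha]
    split_ifs with h0
    · rw [sub_zero, ← sc_nat]
      exact h _ _ (by exact_mod_cast h0) (by exact_mod_cast hm)
    · exact sub_self _
  obtain ⟨t, ht⟩ := h1
  obtain ⟨t', ht'⟩ := h2
  exact ⟨t, t', by rw [← ht, ← ht']; ring⟩

/-- The effect of Frobenius on coefficients. -/
def frobCoeff (p : ℕ) (f : ℤ → ℤ → k) (i j : ℤ) : k :=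
  if (p : ℤ) ∣ i ∧ (p : ℤ) ∣ j then f (i / p) (j / p) ^ p else 0

theorem frobCoeff_mul (p : ℕ) [hp : Fact p.Prime] (f : ℤ → ℤ → k) (i j : ℤ) :
    frobCoeff p f (p * i) (p * j) = f i j ^ p := by
  have : (p : ℤ) ≠ 0 := by exact_mod_cast hp.out.ne_zero
  rw [frobCoeff, if_pos ⟨dvd_mul_right _ _, dvd_mul_right _ _⟩, Int.mul_ediv_cancel_left _ this,
    Int.mul_ediv_cancel_left _ this]

theorem frobCoeff_of_not (p : ℕ) (f : ℤ → ℤ → k) {i j : ℤ}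
    (h : ¬ ((p : ℤ) ∣ i ∧ (p : ℤ) ∣ j)) : frobCoeff p f i j = 0 := if_neg h

/-- In characteristic p the p-th power raises coefficients to the p-th power and multiplies
exponents by p. -/
theorem sc_pow (p : ℕ) [hp : Fact p.Prime] [CharP k p] (s : MvPowerSeries (Fin 2) k) (i j : ℤ) :
    sc (s ^ p) i j = frobCoeff p (sc s) i j := by
  have hp0 := hp.out.ne_zero
  have hpz : (0 : ℤ) < p := by exact_mod_cast hp.out.pos
  have : ExpChar k p := ExpChar.prime hp.out
  rw [← MvPowerSeries.map_frobenius_expand p hp0]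
  by_cases h : 0 ≤ i ∧ 0 ≤ j
  · obtain ⟨h1, h2⟩ := h
    lift i to ℕ using h1
    lift j to ℕ using h2
    unfold frobCoeff
    split_ifs with hd
    · obtain ⟨⟨i', hi⟩, ⟨j', hj⟩⟩ := hd
      have hi0 : 0 ≤ i' := by nlinarith
      have hj0 : 0 ≤ j' := by nlinarith
      lift i' to ℕ using hi0
      lift j' to ℕ using hj0
      rw [hi, hj, Int.mul_ediv_cancel_left _ hpz.ne', Int.mul_ediv_cancel_left _ hpz.ne']
      norm_cast at hi hj
      subst hi hj
      unfold sc
      rw [if_pos ⟨by positivity, by positivity⟩, if_pos ⟨by positivity, by positivity⟩]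
      have : Finsupp.single (0 : Fin 2) ((p : ℤ) * i').toNat +
          Finsupp.single 1 ((p : ℤ) * j').toNat =
          p • (Finsupp.single (0 : Fin 2) (i' : ℤ).toNat + Finsupp.single 1 (j' : ℤ).toNat) := by
        ext t
        fin_cases t <;> simp <;> norm_cast
      rw [this, MvPowerSeries.coeff_map, MvPowerSeries.coeff_expand_smul]
      rfl
    · unfold sc
      rw [if_pos (by omega), MvPowerSeries.coeff_map]
      rw [not_and_or] at hd
      rcases hd with hd | hd
      · rw [MvPowerSeries.coeff_expand_of_not_dvd p hp0 _ (i := 0), map_zero]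
        simpa using fun h => hd (Int.natCast_dvd_natCast.mpr h)
      · rw [MvPowerSeries.coeff_expand_of_not_dvd p hp0 _ (i := 1), map_zero]
        simpa using fun h => hd (Int.natCast_dvd_natCast.mpr h)
  · rw [sc_neg_of_neg (by omega)]
    unfold frobCoeff
    split_ifs with hd
    · obtain ⟨⟨i', hi⟩, ⟨j', hj⟩⟩ := hd
      rw [hi, hj, Int.mul_ediv_cancel_left _ hpz.ne', Int.mul_ediv_cancel_left _ hpz.ne',
        sc_neg_of_neg, zero_pow hp0]
      rw [hi, hj] at h
      by_contra hc
      exact h ⟨mul_nonneg hpz.le (by omega), mul_nonneg hpz.le (by omega)⟩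
    · rfl

end SeriesCoeff

/-! ### Laurent monomials in `R_{xy}` -/

section Monomials

variable {R : Type u} [CommRing R] (x y z : R)

theorem isUnit_algebraMap_left :
    IsUnit (algebraMap R (Localization.Away (x * y)) x) := by
  have := IsLocalization.Away.algebraMap_isUnit (S := Localization.Away (x * y)) (x * y)
  rw [map_mul] at this
  exact isUnit_of_mul_isUnit_left this

theorem isUnit_algebraMap_right :
    IsUnit (algebraMap R (Localization.Away (x * y)) y) := by
  have := IsLocalization.Away.algebraMap_isUnit (S := Localization.Away (x * y)) (x * y)
  rw [map_mul] at this
  exact isUnit_of_mul_isUnit_right this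

/-- The unit `x` of `R_{xy}`. -/
def xU : (Localization.Away (x * y))ˣ := (isUnit_algebraMap_left x y).unit

/-- The unit `y` of `R_{xy}`. -/
def yU : (Localization.Away (x * y))ˣ := (isUnit_algebraMap_right x y).unit

theorem coe_xU : (xU x y : Localization.Away (x * y)) = algebraMap R _ x := rfl

theorem coe_yU : (yU x y : Localization.Away (x * y)) = algebraMap R _ y := rfl

/-- The monomial `x^α y^β z^γ` in `R_{xy}`. -/
def mon (α β : ℤ) (γ : ℕ) : Localization.Away (x * y) :=
  ((xU x y ^ α : (Localization.Away (x * y))ˣ) : Localization.Away (x * y)) *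
    ((yU x y ^ β : (Localization.Away (x * y))ˣ) : Localization.Away (x * y)) *
      algebraMap R _ z ^ γ

theorem mon_mul_mon (α β α' β' : ℤ) (γ γ' : ℕ) :
    mon x y z α β γ * mon x y z α' β' γ' = mon x y z (α + α') (β + β') (γ + γ') := by
  unfold mon
  rw [zpow_add, zpow_add, pow_add, Units.val_mul, Units.val_mul]
  ring

theorem mon_zero : mon x y z 0 0 0 = 1 := by simp [mon]

theorem mon_pow (α β : ℤ) (γ n : ℕ) :
    mon x y z α β γ ^ n = mon x y z (n * α) (n * β) (n * γ) := by
  induction n with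
  | zero => simp [mon_zero]
  | succ n ih => rw [pow_succ, ih, mon_mul_mon]; congr 1 <;> push_cast <;> ring

theorem mon_prod {ι : Type*} (s : Finset ι) (α β : ι → ℤ) (γ : ι → ℕ) :
    ∏ i ∈ s, mon x y z (α i) (β i) (γ i) =
      mon x y z (∑ i ∈ s, α i) (∑ i ∈ s, β i) (∑ i ∈ s, γ i) := by
  classical
  induction s using Finset.induction_on with
  | empty => simp [mon_zero]
  | insert a s ha ih => rw [Finset.prod_insert ha, ih, mon_mul_mon, Finset.sum_insert ha,
      Finset.sum_insert ha, Finset.sum_insert ha]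

theorem mon_nat (a b c : ℕ) :
    mon x y z a b c = algebraMap R _ (x ^ a * y ^ b * z ^ c) := by
  simp [mon, coe_xU, coe_yU]

end Monomials

/-! ### Coefficients of elements of `R_{xy}` -/

namespace DoubleCover

variable {k : Type u} [Field k] {R : Type u} [CommRing R] [Algebra k R] {x y z : R}
  (D : DoubleCover k x y z)

/-- The components of an element of `R` in the basis `1, z`. -/
def cf (ε : Fin 2) (r : R) : MvPowerSeries (Fin 2) k :=
  if ε = 0 then ((Equiv.ofBijective _ D.bij).symm r).1 else ((Equiv.ofBijective _ D.bij).symm r).2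

theorem cf_spec (r : R) : D.ι (D.cf 0 r) + D.ι (D.cf 1 r) * z = r := by
  exact (Equiv.ofBijective _ D.bij).apply_symm_apply r

theorem cf_zero_apply (s t : MvPowerSeries (Fin 2) k) : D.cf 0 (D.ι s + D.ι t * z) = s := by
  have := (Equiv.ofBijective _ D.bij).symm_apply_apply (s, t)
  exact congrArg Prod.fst this

theorem cf_one_apply (s t : MvPowerSeries (Fin 2) k) : D.cf 1 (D.ι s + D.ι t * z) = t := by
  have := (Equiv.ofBijective _ D.bij).symm_apply_apply (s, t)
  exact congrArg Prod.snd this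

theorem cf_eq {r : R} {s t : MvPowerSeries (Fin 2) k} (h : r = D.ι s + D.ι t * z) (ε : Fin 2) :
    D.cf ε r = if ε = 0 then s else t := by
  subst h
  fin_cases ε
  · exact D.cf_zero_apply s t
  · exact D.cf_one_apply s t

theorem cf_add (ε : Fin 2) (r r' : R) : D.cf ε (r + r') = D.cf ε r + D.cf ε r' := by
  have : r + r' = D.ι (D.cf 0 r + D.cf 0 r') + D.ι (D.cf 1 r + D.cf 1 r') * z := by
    conv_lhs => rw [← D.cf_spec r, ← D.cf_spec r']
    rw [map_add, map_add]; ring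
  rw [D.cf_eq this]
  fin_cases ε <;> rfl

theorem cf_ι_mul (ε : Fin 2) (s : MvPowerSeries (Fin 2) k) (r : R) :
    D.cf ε (D.ι s * r) = s * D.cf ε r := by
  have : D.ι s * r = D.ι (s * D.cf 0 r) + D.ι (s * D.cf 1 r) * z := by
    conv_lhs => rw [← D.cf_spec r]
    rw [map_mul, map_mul]; ring
  rw [D.cf_eq this]
  fin_cases ε <;> rfl

theorem cf_ι (ε : Fin 2) (s : MvPowerSeries (Fin 2) k) :
    D.cf ε (D.ι s) = if ε = 0 then s else 0 :=
  D.cf_eq (by simp) ε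

theorem cf_ι_mul_z (ε : Fin 2) (s : MvPowerSeries (Fin 2) k) :
    D.cf ε (D.ι s * z) = if ε = 0 then 0 else s :=
  D.cf_eq (by simp) ε

theorem cf_ext {r r' : R} (h : ∀ ε, D.cf ε r = D.cf ε r') : r = r' := by
  rw [← D.cf_spec r, ← D.cf_spec r', h, h]

/-- The coefficient of `x^i y^j z^ε` of an element of `R`. -/
def rc (r : R) (ε : Fin 2) (i j : ℤ) : k := sc (D.cf ε r) i j

theorem rc_ext {r r' : R} (h : ∀ ε i j, D.rc r ε i j = D.rc r' ε i j) : r = r' :=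
  D.cf_ext fun ε => sc_ext fun i j => h ε i j

theorem rc_add (r r' : R) (ε : Fin 2) (i j : ℤ) :
    D.rc (r + r') ε i j = D.rc r ε i j + D.rc r' ε i j := by
  rw [rc, cf_add, sc_add]; rfl

theorem rc_of_neg {r : R} {ε : Fin 2} {i j : ℤ} (h : i < 0 ∨ j < 0) : D.rc r ε i j = 0 :=
  sc_neg_of_neg h

theorem rc_x_pow_mul (n : ℕ) (r : R) (ε : Fin 2) (i j : ℤ) :
    D.rc (x ^ n * r) ε i j = D.rc r ε (i - n) j := by
  rw [rc, show x ^ n = D.ι (MvPowerSeries.X 0 ^ n) by rw [map_pow, D.ι_X], cf_ι_mul,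
    sc_X0_pow_mul]
  rfl

theorem rc_y_pow_mul (n : ℕ) (r : R) (ε : Fin 2) (i j : ℤ) :
    D.rc (y ^ n * r) ε i j = D.rc r ε i (j - n) := by
  rw [rc, show y ^ n = D.ι (MvPowerSeries.X 1 ^ n) by rw [map_pow, D.ι_Y], cf_ι_mul,
    sc_X1_pow_mul]
  rfl

theorem rc_xy_pow_mul (n : ℕ) (r : R) (ε : Fin 2) (i j : ℤ) :
    D.rc ((x * y) ^ n * r) ε i j = D.rc r ε (i - n) (j - n) := by
  rw [mul_pow, mul_assoc, rc_x_pow_mul, rc_y_pow_mul]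

include D in
theorem xy_mem_nonZeroDivisors : x * y ∈ nonZeroDivisors R := by
  rw [mem_nonZeroDivisors_iff_right]
  intro r hr
  apply D.rc_ext
  intro ε i j
  have h0 := D.rc_xy_pow_mul 1 r ε (i + 1) (j + 1)
  rw [pow_one, mul_comm (x * y), hr] at h0
  have h1 := D.rc_xy_pow_mul 1 0 ε (i + 1) (j + 1)
  rw [pow_one, mul_zero] at h1
  rw [h1] at h0
  simpa using h0.symm

include D in
theorem algebraMap_injective :
    Function.Injective (algebraMap R (Localization.Away (x * y))) :=
  IsLocalization.injective _
    (Submonoid.powers_le.mpr D.xy_mem_nonZeroDivisors : Submonoid.powers (x * y) ≤ nonZeroDivisors R)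

theorem exists_num (a : Localization.Away (x * y)) :
    ∃ (n : ℕ) (r : R), a * algebraMap R _ (x * y) ^ n = algebraMap R _ r :=
  IsLocalization.Away.surj (x * y) a

/-- The coefficient of `x^i y^j z^ε` of an element of `R_{xy}`. -/
def lc (a : Localization.Away (x * y)) (ε : Fin 2) (i j : ℤ) : k :=
  D.rc (exists_num a).choose_spec.choose ε (i + (exists_num a).choose) (j + (exists_num a).choose)

/-- Independence of the denominator: the numerators of two fractions for the same element agree
after cross multiplication by powers of xy, because R embeds into R_xy. -/
theorem lc_eq {a : Localization.Away (x * y)} {n : ℕ} {r : R}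
    (h : a * algebraMap R _ (x * y) ^ n = algebraMap R _ r) (ε : Fin 2) (i j : ℤ) :
    D.lc a ε i j = D.rc r ε (i + n) (j + n) := by
  have h' := (exists_num a).choose_spec.choose_spec
  set n' := (exists_num a).choose
  set r' := (exists_num a).choose_spec.choose
  have e : (x * y) ^ n * r' = (x * y) ^ n' * r := by
    apply D.algebraMap_injective
    rw [map_mul, map_mul, ← h, ← h', map_pow, map_pow]
    ring
  have e1 := D.rc_xy_pow_mul n r' ε (i + n' + n) (j + n' + n)
  have e2 := D.rc_xy_pow_mul n' r ε (i + n' + n) (j + n' + n)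
  rw [e, e2] at e1
  change D.rc r' ε (i + n') (j + n') = _
  rw [show i + n' + n - n = i + n' by ring, show j + n' + n - n = j + n' by ring] at e1
  rw [← e1]
  congr 1 <;> ring

theorem lc_algebraMap (r : R) (ε : Fin 2) (i j : ℤ) :
    D.lc (algebraMap R _ r) ε i j = D.rc r ε i j := by
  rw [D.lc_eq (n := 0) (r := r) (by simp)]
  simp

theorem lc_add (a b : Localization.Away (x * y)) (ε : Fin 2) (i j : ℤ) :
    D.lc (a + b) ε i j = D.lc a ε i j + D.lc b ε i j := by
  obtain ⟨n, r, h⟩ := exists_num a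
  obtain ⟨n', r', h'⟩ := exists_num b
  rw [D.lc_eq h, D.lc_eq h', D.lc_eq (n := n + n') (r := (x * y) ^ n' * r + (x * y) ^ n * r') (by
    simp only [map_add, map_mul, map_pow] at h h' ⊢
    linear_combination (algebraMap R (Localization.Away (x * y)) x * algebraMap R _ y) ^ n' * h +
      (algebraMap R (Localization.Away (x * y)) x * algebraMap R _ y) ^ n * h'), rc_add,
    rc_xy_pow_mul, rc_xy_pow_mul]
  congr 2 <;> push_cast <;> ring

/-- `lc` as an additive homomorphism. -/
def lcHom (ε : Fin 2) (i j : ℤ) : Localization.Away (x * y) →+ k :=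
  AddMonoidHom.mk' (fun a => D.lc a ε i j) fun a b => D.lc_add a b ε i j

theorem lc_zero (ε : Fin 2) (i j : ℤ) : D.lc 0 ε i j = 0 := map_zero (D.lcHom ε i j)

theorem lc_neg (a : Localization.Away (x * y)) (ε : Fin 2) (i j : ℤ) :
    D.lc (-a) ε i j = -D.lc a ε i j := map_neg (D.lcHom ε i j) a

theorem lc_sub (a b : Localization.Away (x * y)) (ε : Fin 2) (i j : ℤ) :
    D.lc (a - b) ε i j = D.lc a ε i j - D.lc b ε i j := map_sub (D.lcHom ε i j) a b

theorem lc_sum {ι : Type*} (s : Finset ι) (f : ι → Localization.Away (x * y)) (ε : Fin 2)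
    (i j : ℤ) : D.lc (∑ t ∈ s, f t) ε i j = ∑ t ∈ s, D.lc (f t) ε i j :=
  map_sum (D.lcHom ε i j) f s

theorem lc_nsmul (n : ℕ) (a : Localization.Away (x * y)) (ε : Fin 2) (i j : ℤ) :
    D.lc (n • a) ε i j = n • D.lc a ε i j := map_nsmul (D.lcHom ε i j) n a

theorem lc_algebraMap_mul (c : k) (a : Localization.Away (x * y)) (ε : Fin 2) (i j : ℤ) :
    D.lc (algebraMap k _ c * a) ε i j = c * D.lc a ε i j := by
  obtain ⟨n, r, h⟩ := exists_num a
  rw [D.lc_eq h, D.lc_eq (n := n) (r := algebraMap k R c * r) (by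
    rw [map_mul _ _ r, ← h, IsScalarTower.algebraMap_apply k R (Localization.Away (x * y))]
    ring), rc,
    ← D.ι_C, cf_ι_mul, sc_C_mul]
  rfl

theorem lc_x_mul (a : Localization.Away (x * y)) (ε : Fin 2) (i j : ℤ) :
    D.lc (xU x y * a) ε i j = D.lc a ε (i - 1) j := by
  obtain ⟨n, r, h⟩ := exists_num a
  rw [D.lc_eq h, D.lc_eq (n := n) (r := x ^ 1 * r) (by
    rw [map_mul _ _ r, ← h, coe_xU, pow_one]; ring), rc_x_pow_mul]
  congr 1; push_cast; ring

theorem lc_y_mul (a : Localization.Away (x * y)) (ε : Fin 2) (i j : ℤ) :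
    D.lc (yU x y * a) ε i j = D.lc a ε i (j - 1) := by
  obtain ⟨n, r, h⟩ := exists_num a
  rw [D.lc_eq h, D.lc_eq (n := n) (r := y ^ 1 * r) (by
    rw [map_mul _ _ r, ← h, coe_yU, pow_one]; ring), rc_y_pow_mul]
  congr 1; push_cast; ring

theorem lc_x_zpow_mul (n : ℤ) (a : Localization.Away (x * y)) (ε : Fin 2) (i j : ℤ) :
    D.lc ((xU x y ^ n : (Localization.Away (x * y))ˣ) * a) ε i j = D.lc a ε (i - n) j := by
  induction n using Int.induction_on generalizing i with
  | zero => simp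
  | succ n ih =>
    rw [zpow_add_one, mul_comm (xU x y ^ _), Units.val_mul, mul_assoc, lc_x_mul, ih]
    congr 1; ring
  | pred n ih =>
    have := D.lc_x_mul (((xU x y ^ (-(n : ℤ) - 1) : (Localization.Away (x * y))ˣ)) * a) ε (i + 1) j
    rw [← mul_assoc, ← Units.val_mul, mul_comm (xU x y), ← zpow_add_one, sub_add_cancel, ih] at this
    rw [add_sub_cancel_right] at this
    rw [← this]
    congr 1; ring

theorem lc_y_zpow_mul (n : ℤ) (a : Localization.Away (x * y)) (ε : Fin 2) (i j : ℤ) :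
    D.lc ((yU x y ^ n : (Localization.Away (x * y))ˣ) * a) ε i j = D.lc a ε i (j - n) := by
  induction n using Int.induction_on generalizing j with
  | zero => simp
  | succ n ih =>
    rw [zpow_add_one, mul_comm (yU x y ^ _), Units.val_mul, mul_assoc, lc_y_mul, ih]
    congr 1; ring
  | pred n ih =>
    have := D.lc_y_mul (((yU x y ^ (-(n : ℤ) - 1) : (Localization.Away (x * y))ˣ)) * a) ε i (j + 1)
    rw [← mul_assoc, ← Units.val_mul, mul_comm (yU x y), ← zpow_add_one, sub_add_cancel, ih] at this
    rw [add_sub_cancel_right] at this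
    rw [← this]
    congr 1; ring

theorem lc_mon_mul (α β : ℤ) (a : Localization.Away (x * y)) (ε : Fin 2) (i j : ℤ) :
    D.lc (mon x y z α β 0 * a) ε i j = D.lc a ε (i - α) (j - β) := by
  rw [mon, pow_zero, mul_one, mul_assoc, lc_x_zpow_mul, lc_y_zpow_mul]

theorem lc_mon (α β : ℤ) (γ ε : Fin 2) (i j : ℤ) :
    D.lc (mon x y z α β γ) ε i j = if i = α ∧ j = β ∧ ε = γ then 1 else 0 := by
  have h : mon x y z α β γ = mon x y z α β 0 * mon x y z 0 0 γ := by
    rw [mon_mul_mon]; simp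
  have h' : mon x y z 0 0 γ = algebraMap R _ (z ^ (γ : ℕ)) := by simp [mon]
  have h1 : D.rc (z ^ (γ : ℕ)) ε (i - α) (j - β) =
      if ε = γ then sc (1 : MvPowerSeries (Fin 2) k) (i - α) (j - β) else 0 := by
    rw [rc]
    have h0 : (1 : R) = D.ι 1 := by simp
    have hz : ∀ ε, D.cf ε z = if ε = 0 then 0 else 1 := fun ε => by
      simpa using D.cf_ι_mul_z ε 1
    have hs : sc (0 : MvPowerSeries (Fin 2) k) (i - α) (j - β) = 0 := by simp [sc]
    fin_cases γ <;> fin_cases ε <;> simp only [Fin.zero_eta, Fin.mk_one, pow_zero, pow_one]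
    · rw [h0, cf_ι]; simp
    · rw [h0, cf_ι]; simp [hs]
    · rw [hz]; simp [hs]
    · rw [hz]; simp
  rw [h, lc_mon_mul, h', lc_algebraMap, h1, sc_one]
  by_cases hε : ε = γ
  · simp [hε, sub_eq_zero]
  · simp [hε]

/-! ### Vanishing of classes -/

/-- Denominators that are powers of x do not create negative exponents of y. -/
theorem lc_resX (b : Localization.Away x) (ε : Fin 2) (i j : ℤ) (hj : j < 0) :
    D.lc (resX x y b) ε i j = 0 := by
  obtain ⟨n, r, h⟩ := IsLocalization.Away.surj x b
  have h' := congrArg (resX x y) h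
  rw [map_mul, map_pow, resX, IsLocalization.Away.awayToAwayRight_eq,
    IsLocalization.Away.awayToAwayRight_eq] at h'
  rw [D.lc_eq (n := n) (r := y ^ n * r) (by
    rw [resX, map_mul, map_mul, mul_pow, ← mul_assoc, h', map_pow]; ring), rc_y_pow_mul,
    rc_of_neg]
  omega

theorem lc_resY (b : Localization.Away y) (ε : Fin 2) (i j : ℤ) (hi : i < 0) :
    D.lc (resY x y b) ε i j = 0 := by
  obtain ⟨n, r, h⟩ := IsLocalization.Away.surj y b
  have h' := congrArg (resY x y) h
  rw [map_mul, map_pow, resY, IsLocalization.Away.awayToAwayLeft_eq,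
    IsLocalization.Away.awayToAwayLeft_eq] at h'
  rw [D.lc_eq (n := n) (r := x ^ n * r) (by
    rw [resY, map_mul, map_mul, mul_pow, mul_comm (algebraMap R _ x ^ n), ← mul_assoc, h',
      map_pow]; ring), rc_x_pow_mul, rc_of_neg]
  omega

theorem mk_resX (n : ℕ) (r : R) : ∃ b : Localization.Away x,
    resX x y b * algebraMap R _ x ^ n = algebraMap R _ r := by
  refine ⟨IsLocalization.mk' _ r (⟨x ^ n, n, rfl⟩ : Submonoid.powers x), ?_⟩
  have h := IsLocalization.mk'_spec (Localization.Away x) r (⟨x ^ n, n, rfl⟩ : Submonoid.powers x)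
  have h' := congrArg (resX x y) h
  rwa [map_mul, resX, IsLocalization.Away.awayToAwayRight_eq,
    IsLocalization.Away.awayToAwayRight_eq, map_pow] at h'

theorem mk_resY (n : ℕ) (r : R) : ∃ b : Localization.Away y,
    resY x y b * algebraMap R _ y ^ n = algebraMap R _ r := by
  refine ⟨IsLocalization.mk' _ r (⟨y ^ n, n, rfl⟩ : Submonoid.powers y), ?_⟩
  have h := IsLocalization.mk'_spec (Localization.Away y) r (⟨y ^ n, n, rfl⟩ : Submonoid.powers y)
  have h' := congrArg (resY x y) h
  rwa [map_mul, resY, IsLocalization.Away.awayToAwayLeft_eq,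
    IsLocalization.Away.awayToAwayLeft_eq, map_pow] at h'

/-- The converse of `lc_resX` and `lc_resY`: over the denominator (xy)^n the numerator lies in the
ideal (x^n, y^n), and each of the two summands cancels one factor of the denominator. -/
theorem exists_eq_add {a : Localization.Away (x * y)}
    (h : ∀ ε i j, i < 0 → j < 0 → D.lc a ε i j = 0) :
    ∃ (b : Localization.Away x) (b' : Localization.Away y), a = resX x y b + resY x y b' := by
  obtain ⟨n, r, hr⟩ := exists_num a
  have hs : ∀ ε, ∃ t t', D.cf ε r = MvPowerSeries.X 0 ^ n * t + MvPowerSeries.X 1 ^ n * t' := by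
    intro ε
    apply exists_of_sc_eq_zero
    intro i j hi hj
    have := h ε (i - n) (j - n) (by omega) (by omega)
    rw [D.lc_eq hr, sub_add_cancel, sub_add_cancel] at this
    exact this
  obtain ⟨t0, t0', h0⟩ := hs 0
  obtain ⟨t1, t1', h1⟩ := hs 1
  obtain ⟨b, hb⟩ := mk_resX (x := x) (y := y) n (D.ι t0' + D.ι t1' * z)
  obtain ⟨b', hb'⟩ := mk_resY (x := x) (y := y) n (D.ι t0 + D.ι t1 * z)
  refine ⟨b, b', ?_⟩
  have e : r = x ^ n * (D.ι t0 + D.ι t1 * z) + y ^ n * (D.ι t0' + D.ι t1' * z) := by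
    conv_lhs => rw [← D.cf_spec r, h0, h1]
    simp only [map_add, map_mul, map_pow, D.ι_X, D.ι_Y]
    ring
  have hu : IsUnit (algebraMap R (Localization.Away (x * y)) (x * y) ^ n) :=
    (IsLocalization.Away.algebraMap_isUnit (x * y)).pow n
  apply hu.mul_right_cancel
  rw [hr, e, map_add, map_mul, map_mul, ← hb, ← hb', map_mul, map_pow, map_pow]
  ring

-- The vanishing of H¹_𝔪(X, 𝒪_X): an element regular on D(x) and on D(y) has no negative exponent at
-- all. This is what makes V injective on the cohomology.
include D in
theorem exists_of_resX_eq_resY {b : Localization.Away x} {b' : Localization.Away y}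
    (h : resX x y b = resY x y b') : ∃ r : R, resX x y b = algebraMap R _ r := by
  obtain ⟨n, r, hr⟩ := exists_num (resX x y b)
  have hz : ∀ ε i j, i < (n : ℤ) ∨ j < (n : ℤ) → sc (D.cf ε r) i j = 0 := by
    intro ε i j hij
    have h1 := D.lc_eq hr ε (i - n) (j - n)
    rw [sub_add_cancel, sub_add_cancel] at h1
    change D.rc r ε i j = 0
    rw [← h1]
    rcases hij with hi | hj
    · rw [h]; exact D.lc_resY _ _ _ _ (by omega)
    · exact D.lc_resX _ _ _ _ (by omega)
  have hs : ∀ ε, ∃ t, D.cf ε r = MvPowerSeries.X 0 ^ n * (MvPowerSeries.X 1 ^ n * t) := by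
    intro ε
    obtain ⟨t, ht⟩ := exists_of_sc_eq_zero_left (fun i j hi => hz ε i j (Or.inl hi))
    obtain ⟨t', ht'⟩ := exists_of_sc_eq_zero_right (s := t) (n := n) (by
      intro i j hj
      have := hz ε (i + n) j (Or.inr hj)
      rw [ht, sc_X0_pow_mul, add_sub_cancel_right] at this
      exact this)
    exact ⟨t', by rw [ht, ht']⟩
  obtain ⟨t0, h0⟩ := hs 0
  obtain ⟨t1, h1⟩ := hs 1
  refine ⟨D.ι t0 + D.ι t1 * z, ?_⟩
  have hu : IsUnit (algebraMap R (Localization.Away (x * y)) (x * y) ^ n) :=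
    (IsLocalization.Away.algebraMap_isUnit (x * y)).pow n
  apply hu.mul_right_cancel
  rw [hr, ← map_pow, ← map_mul]
  congr 1
  conv_lhs => rw [← D.cf_spec r, h0, h1]
  simp only [map_mul, map_pow, D.ι_X, D.ι_Y]
  ring

/-! ### Products with `z` and Frobenius -/

/-- The elements of `R_{xy}` that come from `k[[x, y]]_{xy}`. -/
def IsBase (b : Localization.Away (x * y)) : Prop :=
  ∃ (n : ℕ) (s : MvPowerSeries (Fin 2) k), b * algebraMap R _ (x * y) ^ n = algebraMap R _ (D.ι s)

variable {D}

theorem IsBase.lc_one {b : Localization.Away (x * y)} (hb : D.IsBase b) (i j : ℤ) :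
    D.lc b 1 i j = 0 := by
  obtain ⟨n, s, h⟩ := hb
  rw [D.lc_eq h, rc, cf_ι]
  simp [sc]

theorem IsBase.lc_mul_z_zero {b : Localization.Away (x * y)} (hb : D.IsBase b) (i j : ℤ) :
    D.lc (b * algebraMap R _ z) 0 i j = 0 := by
  obtain ⟨n, s, h⟩ := hb
  rw [D.lc_eq (n := n) (r := D.ι s * z) (by rw [map_mul _ _ z, ← h]; ring), rc, cf_ι_mul_z]
  simp [sc]

theorem IsBase.lc_mul_z_one {b : Localization.Away (x * y)} (hb : D.IsBase b) (i j : ℤ) :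
    D.lc (b * algebraMap R _ z) 1 i j = D.lc b 0 i j := by
  obtain ⟨n, s, h⟩ := hb
  rw [D.lc_eq (n := n) (r := D.ι s * z) (by rw [map_mul _ _ z, ← h]; ring), rc, cf_ι_mul_z,
    D.lc_eq h, rc, cf_ι]
  simp

theorem IsBase.pow {b : Localization.Away (x * y)} (hb : D.IsBase b) (m : ℕ) :
    D.IsBase (b ^ m) := by
  obtain ⟨n, s, h⟩ := hb
  refine ⟨n * m, s ^ m, ?_⟩
  rw [pow_mul, ← mul_pow, h, map_pow, map_pow]

theorem IsBase.lc_pow (p : ℕ) [Fact p.Prime] [CharP k p] {b : Localization.Away (x * y)}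
    (hb : D.IsBase b) (i j : ℤ) : D.lc (b ^ p) 0 i j = frobCoeff p (D.lc b 0) i j := by
  obtain ⟨n, s, h⟩ := hb
  have h' : b ^ p * algebraMap R _ (x * y) ^ (n * p) = algebraMap R _ (D.ι (s ^ p)) := by
    rw [pow_mul, ← mul_pow, h, map_pow, map_pow]
  have h1 : ∀ i j, D.lc b 0 i j = sc s (i + n) (j + n) := by
    intro i j
    rw [D.lc_eq h, rc, cf_ι]; simp
  rw [D.lc_eq h', rc, cf_ι, if_pos rfl, sc_pow p]
  unfold frobCoeff
  have hp : (p : ℤ) ≠ 0 := by exact_mod_cast (Fact.out : p.Prime).ne_zero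
  have e : ∀ i : ℤ, (p : ℤ) ∣ i + (n * p : ℕ) ↔ (p : ℤ) ∣ i := fun i => by
    push_cast
    exact Int.dvd_add_left (dvd_mul_left _ _)
  simp only [e]
  push_cast
  split_ifs with hd
  · rw [h1, Int.add_mul_ediv_right _ _ hp, Int.add_mul_ediv_right _ _ hp]
  · rfl

variable (D)

/-- On the components over k[[x, y]]_xy the Frobenius acts by scaling exponents, so p-th powers are
computed on each component, with z^p treated separately. -/
theorem exists_base_add (a : Localization.Away (x * y)) :
    ∃ a₀ a₁, D.IsBase a₀ ∧ D.IsBase a₁ ∧ a = a₀ + a₁ * algebraMap R _ z ∧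
      (∀ i j, D.lc a₀ 0 i j = D.lc a 0 i j) ∧ ∀ i j, D.lc a₁ 0 i j = D.lc a 1 i j := by
  obtain ⟨n, r, hr⟩ := exists_num a
  have hu : IsUnit (algebraMap R (Localization.Away (x * y)) (x * y) ^ n) :=
    (IsLocalization.Away.algebraMap_isUnit (x * y)).pow n
  obtain ⟨v, hv⟩ := hu.exists_left_inv
  have e : ∀ t, algebraMap R _ t * v * algebraMap R (Localization.Away (x * y)) (x * y) ^ n =
      algebraMap R _ t := fun t => by rw [mul_assoc, hv, mul_one]
  have b0 : D.IsBase (algebraMap R _ (D.ι (D.cf 0 r)) * v) := ⟨n, _, e _⟩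
  have b1 : D.IsBase (algebraMap R _ (D.ι (D.cf 1 r)) * v) := ⟨n, _, e _⟩
  have ha : a = algebraMap R _ (D.ι (D.cf 0 r)) * v +
      algebraMap R _ (D.ι (D.cf 1 r)) * v * algebraMap R _ z := by
    apply hu.mul_right_cancel
    rw [hr, add_mul, e, mul_right_comm, e, ← map_mul, ← map_add, D.cf_spec]
  refine ⟨_, _, b0, b1, ha, fun i j => ?_, fun i j => ?_⟩
  · conv_rhs => rw [ha, lc_add, b1.lc_mul_z_zero, add_zero]
  · conv_rhs => rw [ha, lc_add, b1.lc_mul_z_one, b0.lc_one, zero_add]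

theorem mon_one_eq (α β : ℤ) :
    mon x y z α β 1 = mon x y z α β 0 * algebraMap R _ z := by
  simp [mon]

theorem IsBase.lc_mul_mon {b : Localization.Away (x * y)} (hb : D.IsBase b) (α β : ℤ)
    (γ ε : Fin 2) (i j : ℤ) :
    D.lc (b * mon x y z α β γ) ε i j = if ε = γ then D.lc b 0 (i - α) (j - β) else 0 := by
  fin_cases γ
  · simp only [Fin.zero_eta]
    rw [mul_comm, lc_mon_mul]
    fin_cases ε
    · rfl
    · exact hb.lc_one _ _
  · simp only [Fin.mk_one]
    rw [mon_one_eq, mul_left_comm, lc_mon_mul]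
    fin_cases ε
    · exact hb.lc_mul_z_zero _ _
    · exact hb.lc_mul_z_one _ _

/-- The coefficients of a `p`-th power, in terms of an expression of `z ^ p`. -/
theorem lc_pow (p : ℕ) [Fact p.Prime] [CharP k p] {ι : Type*} (T : Finset ι) (κ : ι → ℤ)
    (α β : ι → ℤ) (γ : ι → Fin 2)
    (hz : mon x y z 0 0 p = ∑ t ∈ T, κ t • mon x y z (α t) (β t) (γ t))
    (a : Localization.Away (x * y)) (ε : Fin 2) (i j : ℤ) :
    D.lc (a ^ p) ε i j = (if ε = 0 then frobCoeff p (D.lc a 0) i j else 0) +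
      ∑ t ∈ T, if ε = γ t then κ t • frobCoeff p (D.lc a 1) (i - α t) (j - β t) else 0 := by
  obtain ⟨a₀, a₁, b0, b1, ha, h0, h1⟩ := D.exists_base_add a
  have e : a ^ p = a₀ ^ p + ∑ t ∈ T, κ t • (a₁ ^ p * mon x y z (α t) (β t) (γ t)) := by
    have h1 : mon x y z 0 0 p = algebraMap R _ z ^ p := by simp [mon]
    have h2 : a ^ p = a₀ ^ p + (a₁ * algebraMap R _ z) ^ p := by
      rw [ha]
      exact map_add (frobHom p k (Localization.Away (x * y))) a₀ (a₁ * algebraMap R _ z)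
    rw [h2, mul_pow, ← h1, hz, Finset.mul_sum]
    simp only [mul_smul_comm]
  have f0 : D.lc a 0 = D.lc a₀ 0 := by ext i j; exact (h0 i j).symm
  have f1 : D.lc a 1 = D.lc a₁ 0 := by ext i j; exact (h1 i j).symm
  rw [e, lc_add, lc_sum, f0, f1]
  congr 1
  · fin_cases ε
    · exact b0.lc_pow p i j
    · exact (b0.pow p).lc_one i j
  · refine Finset.sum_congr rfl fun t _ => ?_
    change D.lcHom ε i j (_ • _) = _
    rw [map_zsmul]
    change κ t • D.lc _ ε i j = _
    rw [(b1.pow p).lc_mul_mon, b1.lc_pow p]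
    split_ifs <;> simp

theorem lc_mul_z {ι : Type*} (T : Finset ι) (κ : ι → ℤ)
    (α β : ι → ℤ) (γ : ι → Fin 2)
    (hz : mon x y z 0 0 2 = ∑ t ∈ T, κ t • mon x y z (α t) (β t) (γ t))
    (a : Localization.Away (x * y)) (ε : Fin 2) (i j : ℤ) :
    D.lc (a * algebraMap R _ z) ε i j = (if ε = 1 then D.lc a 0 i j else 0) +
      ∑ t ∈ T, if ε = γ t then κ t • D.lc a 1 (i - α t) (j - β t) else 0 := by
  obtain ⟨a₀, a₁, b0, b1, ha, h0, h1⟩ := D.exists_base_add a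
  have e : a * algebraMap R _ z = a₀ * algebraMap R _ z +
      ∑ t ∈ T, κ t • (a₁ * mon x y z (α t) (β t) (γ t)) := by
    have h1 : mon x y z 0 0 2 = algebraMap R _ z ^ 2 := by simp [mon]
    conv_lhs => rw [ha, add_mul, mul_assoc a₁, ← sq, ← h1, hz, Finset.mul_sum]
    simp only [mul_smul_comm]
  rw [e, lc_add, lc_sum]
  congr 1
  · fin_cases ε
    · exact b0.lc_mul_z_zero i j
    · exact (b0.lc_mul_z_one i j).trans (h0 i j)
  · refine Finset.sum_congr rfl fun t _ => ?_
    change D.lcHom ε i j (_ • _) = _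
    rw [map_zsmul]
    change κ t • D.lc _ ε i j = _
    rw [b1.lc_mul_mon, h1]
    split_ifs <;> simp

/-- If every term of the equation has weight at least that of `z²`, the terms of a monomial
have at least its weight. -/
theorem weight_le_of_lc_ne_zero {ι : Type*} (T : Finset ι) (κ : ι → ℤ)
    (α β : ι → ℤ) (γ : ι → Fin 2)
    (hz : mon x y z 0 0 2 = ∑ t ∈ T, κ t • mon x y z (α t) (β t) (γ t)) (wx wy wz : ℤ)
    (hα : ∀ t ∈ T, 0 ≤ α t) (hβ : ∀ t ∈ T, 0 ≤ β t)
    (hw : ∀ t ∈ T, 2 * wz ≤ wx * α t + wy * β t + wz * (γ t : ℕ))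
    {a b : ℤ} {c : ℕ} {ε : Fin 2} {i j : ℤ} (h : D.lc (mon x y z a b c) ε i j ≠ 0) :
    a ≤ i ∧ b ≤ j ∧ wx * a + wy * b + wz * c ≤ wx * i + wy * j + wz * (ε : ℕ) := by
  induction c generalizing ε i j with
  | zero =>
    have := D.lc_mon a b 0 ε i j
    simp only [Fin.coe_ofNat_eq_mod, Nat.zero_mod] at this
    rw [this] at h
    have h2 : i = a ∧ j = b ∧ ε = 0 := by by_contra hc; exact h (if_neg hc)
    obtain ⟨rfl, rfl, rfl⟩ := h2
    simp
  | succ c ih =>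
    have e : mon x y z a b (c + 1) = mon x y z a b c * algebraMap R _ z := by
      simp only [mon]; ring
    -- Multiplication by z either moves a coefficient from 1 to z or creates z², which is rewritten
    -- by the equation; neither lowers the weight below the expected one.
    rw [e, D.lc_mul_z T κ α β γ hz] at h
    by_cases h0 : (if ε = 1 then D.lc (mon x y z a b c) 0 i j else 0) = 0
    · rw [h0, zero_add] at h
      obtain ⟨t, ht, htn⟩ := Finset.exists_ne_zero_of_sum_ne_zero h
      by_cases hε : ε = γ t
      · rw [if_pos hε] at htn
        have h1 := ih (right_ne_zero_of_smul htn)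
        have h2 := hα t ht
        have h3 := hβ t ht
        have h4 := hw t ht
        rw [← hε] at h4
        refine ⟨by linarith [h1.1], by linarith [h1.2.1], ?_⟩
        have h5 := h1.2.2
        push_cast at h5 ⊢
        rw [mul_sub, mul_sub] at h5
        simp at h5
        linarith
      · exact absurd (if_neg hε) htn
    · by_cases hε : ε = 1
      · rw [if_pos hε] at h0
        have h1 := ih h0
        refine ⟨h1.1, h1.2.1, ?_⟩
        have h5 := h1.2.2
        subst hε
        push_cast at h5 ⊢
        simp at h5 ⊢
        linarith
      · exact absurd (if_neg hε) h0

end DoubleCover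

/-! ### Witt vectors modulo coboundaries, and the colimit -/

section WittCech

variable (p : ℕ) [Fact p.Prime] (k : Type u) [Field k] [CharP k p]
  {R : Type u} [CommRing R] [Algebra k R] (x y : R)

/-- The Frobenius of `W(R_{xy})`. -/
abbrev frobW : WittVector p (Localization.Away (x * y)) →+* WittVector p (Localization.Away (x * y)) :=
  WittVector.map (frobHom p k (Localization.Away (x * y)))

/-- The Witt vectors whose truncations of length `l` are coboundaries. -/
def Bd (l : ℕ) : AddSubgroup (WittVector p (Localization.Away (x * y))) :=
  ((cls p x y l).comp (WittVector.truncate l).toAddMonoidHom).ker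

variable {p k x y}

theorem mem_Bd {l : ℕ} {w : WittVector p (Localization.Away (x * y))} :
    w ∈ Bd p x y l ↔ cls p x y l (WittVector.truncate l w) = 0 := Iff.rfl

theorem truncate_eq_iff {A : Type u} [CommRing A] {l : ℕ} {w w' : WittVector p A} :
    WittVector.truncate l w = WittVector.truncate l w' ↔
      ∃ u, w = w' + WittVector.verschiebung^[l] u := by
  constructor
  · intro h
    have h0 : w - w' ∈ RingHom.ker (WittVector.truncate (p := p) (R := A) l) := by
      rw [RingHom.mem_ker, map_sub, h, sub_self]
    rw [WittVector.mem_ker_truncate] at h0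
    refine ⟨(w - w').shift l, ?_⟩
    rw [← WittVector.eq_iterate_verschiebung h0]
    ring
  · rintro ⟨u, rfl⟩
    have : WittVector.truncate l (WittVector.verschiebung^[l] u) = 0 := by
      rw [← RingHom.mem_ker, WittVector.mem_ker_truncate]
      intro i hi
      exact WittVector.iterate_verschiebung_coeff_eq_zero _ hi
    rw [map_add, this, add_zero]

/-- The kernel of truncation to length l is the image of V^l. This allows work with untruncated Witt
vectors, so that different lengths live in one group. -/
theorem mem_Bd_iff {l : ℕ} {w : WittVector p (Localization.Away (x * y))} :
    w ∈ Bd p x y l ↔ ∃ a b u, w = WittVector.map (resX x y) a + WittVector.map (resY x y) b +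
      WittVector.verschiebung^[l] u := by
  rw [mem_Bd, cls_eq_zero_iff, coboundaries, AddSubgroup.mem_sup]
  constructor
  · rintro ⟨_, ⟨a, rfl⟩, _, ⟨b, rfl⟩, h⟩
    obtain ⟨a, rfl⟩ := WittVector.truncate_surjective p l _ a
    obtain ⟨b, rfl⟩ := WittVector.truncate_surjective p l _ b
    change tmap l (resX x y) (WittVector.truncate l a) +
      tmap l (resY x y) (WittVector.truncate l b) = _ at h
    rw [tmap_truncate, tmap_truncate, ← map_add] at h
    obtain ⟨u, hu⟩ := truncate_eq_iff.mp h.symm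
    exact ⟨a, b, u, hu⟩
  · rintro ⟨a, b, u, h⟩
    refine ⟨_, ⟨WittVector.truncate l a, rfl⟩, _, ⟨WittVector.truncate l b, rfl⟩, ?_⟩
    change tmap l (resX x y) (WittVector.truncate l a) +
      tmap l (resY x y) (WittVector.truncate l b) = _
    rw [tmap_truncate, tmap_truncate, ← map_add]
    exact (truncate_eq_iff.mpr ⟨u, h⟩).symm

theorem iterate_verschiebung_mem_Bd (l : ℕ) (u : WittVector p (Localization.Away (x * y))) :
    WittVector.verschiebung^[l] u ∈ Bd p x y l :=
  mem_Bd_iff.mpr ⟨0, 0, u, by simp⟩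

theorem map_resX_mem_Bd (l : ℕ) (a : WittVector p (Localization.Away x)) :
    WittVector.map (resX x y) a ∈ Bd p x y l :=
  mem_Bd_iff.mpr ⟨a, 0, 0, by simp⟩

theorem map_resY_mem_Bd (l : ℕ) (a : WittVector p (Localization.Away y)) :
    WittVector.map (resY x y) a ∈ Bd p x y l :=
  mem_Bd_iff.mpr ⟨0, a, 0, by simp⟩

theorem Bd_mono {l l' : ℕ} (h : l' ≤ l) : Bd p x y l ≤ Bd p x y l' := by
  intro w hw
  obtain ⟨a, b, u, rfl⟩ := mem_Bd_iff.mp hw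
  obtain ⟨d, rfl⟩ := Nat.exists_eq_add_of_le h
  exact mem_Bd_iff.mpr ⟨a, b, WittVector.verschiebung^[d] u, by rw [← Function.iterate_add_apply]⟩

theorem Bd_zero : Bd p x y 0 = ⊤ := by
  rw [eq_top_iff]
  intro w _
  exact iterate_verschiebung_mem_Bd 0 w

theorem verschiebung_mem_Bd {l : ℕ} {w : WittVector p (Localization.Away (x * y))}
    (hw : w ∈ Bd p x y l) (d : ℕ) : WittVector.verschiebung^[d] w ∈ Bd p x y (l + d) := by
  obtain ⟨a, b, u, rfl⟩ := mem_Bd_iff.mp hw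
  refine mem_Bd_iff.mpr ⟨WittVector.verschiebung^[d] a, WittVector.verschiebung^[d] b, u, ?_⟩
  rw [iterate_map_add, iterate_map_add, map_iterate_verschiebung, map_iterate_verschiebung,
    add_comm l d, Function.iterate_add_apply]

theorem constMul_mem_Bd {l : ℕ} {w : WittVector p (Localization.Away (x * y))}
    (hw : w ∈ Bd p x y l) (c : WittVector p k) :
    WittVector.map (algebraMap k _) c * w ∈ Bd p x y l := by
  rw [mem_Bd, ← H2.mulConst_cls, mem_Bd.mp hw, map_zero]

theorem frobW_mem_Bd {l : ℕ} {w : WittVector p (Localization.Away (x * y))}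
    (hw : w ∈ Bd p x y l) : frobW p k x y w ∈ Bd p x y l := by
  rw [mem_Bd, ← H2.frob_cls, mem_Bd.mp hw, map_zero]

theorem exists_sub_mem_Bd {l : ℕ} {w : WittVector p (Localization.Away (x * y))}
    (hw : w ∈ Bd p x y l) : ∃ u, w - WittVector.verschiebung^[l] u ∈ Bd p x y (l + 1) := by
  obtain ⟨a, b, u, rfl⟩ := mem_Bd_iff.mp hw
  exact ⟨u, mem_Bd_iff.mpr ⟨a, b, 0, by rw [iterate_map_zero]; ring⟩⟩

theorem verschiebung_injective' {A : Type u} [CommRing A] :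
    Function.Injective (WittVector.verschiebung : WittVector p A →+ WittVector p A) := by
  intro v w h
  ext n
  rw [← WittVector.verschiebung_coeff_succ v, h, WittVector.verschiebung_coeff_succ]

theorem eq_verschiebung_of_coeff_zero {A : Type u} [CommRing A] {w : WittVector p A}
    (h : w.coeff 0 = 0) : w = WittVector.verschiebung (w.shift 1) :=
  WittVector.eq_iterate_verschiebung (n := 1) fun i hi => by
    rw [Nat.lt_one_iff.mp hi, h]

theorem sub_coeff_zero {A : Type u} [CommRing A] (v w : WittVector p A) :
    (v - w).coeff 0 = v.coeff 0 - w.coeff 0 :=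
  map_sub WittVector.constantCoeff v w

/-- V is injective on H²_𝔪, since the connecting obstruction lies in H¹_𝔪(X, 𝒪_X) = 0: the cochains
bounding Vw can be altered by a global Teichmüller lift until both are divisible by V. -/
theorem mem_Bd_of_verschiebung {z : R} (D : DoubleCover k x y z) {l : ℕ}
    {w : WittVector p (Localization.Away (x * y))}
    (hw : WittVector.verschiebung w ∈ Bd p x y (l + 1)) : w ∈ Bd p x y l := by
  obtain ⟨a, b, u, h⟩ := mem_Bd_iff.mp hw
  rw [Function.iterate_succ_apply'] at h
  have h0 := congrArg (fun v => WittVector.coeff v 0) h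
  simp only [WittVector.add_coeff_zero, WittVector.verschiebung_coeff_zero, WittVector.map_coeff,
    add_zero] at h0
  -- The zeroth components of a and b cancel, so they glue to a global function r.
  obtain ⟨r, hr⟩ := D.exists_of_resX_eq_resY (b := a.coeff 0) (b' := -b.coeff 0) (by
    rw [map_neg]; exact eq_neg_of_add_eq_zero_left h0.symm)
  set tr := WittVector.teichmuller p r
  have hX : WittVector.map (resX x y) (WittVector.map (algebraMap R _) tr) =
      WittVector.map (algebraMap R _) tr := by
    ext n
    simp only [WittVector.map_coeff]
    exact IsLocalization.Away.awayToAwayRight_eq x y _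
  have hY : WittVector.map (resY x y) (WittVector.map (algebraMap R _) tr) =
      WittVector.map (algebraMap R _) tr := by
    ext n
    simp only [WittVector.map_coeff]
    exact IsLocalization.Away.awayToAwayLeft_eq y x _
  have htr : (WittVector.map (algebraMap R (Localization.Away (x * y))) tr).coeff 0 =
      algebraMap R _ r := by
    rw [WittVector.map_coeff, WittVector.teichmuller_coeff_zero]
  have ha : (WittVector.map (resX x y) (a - WittVector.map (algebraMap R _) tr)).coeff 0 = 0 := by
    rw [map_sub, hX, sub_coeff_zero, htr, WittVector.map_coeff, hr, sub_self]
  have hb : (WittVector.map (resY x y) (b + WittVector.map (algebraMap R _) tr)).coeff 0 = 0 := by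
    rw [map_add, hY, WittVector.add_coeff_zero, htr, WittVector.map_coeff, ← hr, add_comm]
    exact h0.symm
  have hs : ∀ {A B : Type u} [CommRing A] [CommRing B] (f : A →+* B) (v : WittVector p A),
      (WittVector.map f v).shift 1 = WittVector.map f (v.shift 1) := by
    intro A B _ _ f v
    ext n
    simp only [WittVector.shift_coeff, WittVector.map_coeff]
  -- Moving the lift of r from a to b keeps the sum and kills both zeroth components.
  refine mem_Bd_iff.mpr ⟨(a - WittVector.map (algebraMap R _) tr).shift 1,
    (b + WittVector.map (algebraMap R _) tr).shift 1, u, verschiebung_injective' ?_⟩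
  rw [map_add, map_add, ← hs, ← hs, ← eq_verschiebung_of_coeff_zero ha,
    ← eq_verschiebung_of_coeff_zero hb, h, map_sub, map_add, hX, hY]
  ring

theorem mem_Bd_of_iterate_verschiebung {z : R} (D : DoubleCover k x y z) {l d : ℕ}
    {w : WittVector p (Localization.Away (x * y))}
    (hw : WittVector.verschiebung^[d] w ∈ Bd p x y (l + d)) : w ∈ Bd p x y l := by
  induction d with
  | zero => exact hw
  | succ d ih =>
    rw [Function.iterate_succ_apply'] at hw
    exact ih (mem_Bd_of_verschiebung D hw)

/-- H²_𝔪(X, 𝒪_X) is detected by the coefficients at which both exponents are negative. -/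
theorem mem_Bd_one_iff {z : R} (D : DoubleCover k x y z)
    {w : WittVector p (Localization.Away (x * y))} :
    w ∈ Bd p x y 1 ↔ ∀ ε i j, i < 0 → j < 0 → D.lc (w.coeff 0) ε i j = 0 := by
  rw [mem_Bd_iff]
  constructor
  · rintro ⟨a, b, u, rfl⟩ ε i j hi hj
    simp only [WittVector.add_coeff_zero, WittVector.map_coeff, Function.iterate_one,
      WittVector.verschiebung_coeff_zero, add_zero]
    rw [D.lc_add, D.lc_resX _ _ _ _ hj, D.lc_resY _ _ _ _ hi, add_zero]
  · intro h
    obtain ⟨b, b', hb⟩ := D.exists_eq_add h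
    refine ⟨WittVector.teichmuller p b, WittVector.teichmuller p b', _,
      (add_sub_cancel (WittVector.map (resX x y) (WittVector.teichmuller p b) +
        WittVector.map (resY x y) (WittVector.teichmuller p b')) w).symm.trans
        (congrArg _ (eq_verschiebung_of_coeff_zero ?_))⟩
    rw [sub_coeff_zero, WittVector.add_coeff_zero, WittVector.map_coeff,
      WittVector.map_coeff, WittVector.teichmuller_coeff_zero, WittVector.teichmuller_coeff_zero,
      hb, sub_self]

/-! ### Frobenius-nilpotent Witt vectors -/

theorem iterate_frobW_mem_Bd {l m : ℕ} {w : WittVector p (Localization.Away (x * y))}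
    (hw : w ∈ Bd p x y l) : (frobW p k x y)^[m] w ∈ Bd p x y l := by
  induction m with
  | zero => exact hw
  | succ m ih => rw [Function.iterate_succ_apply']; exact frobW_mem_Bd ih

theorem iterate_frobW_mem_Bd_of_le {l m m' : ℕ} (h : m ≤ m')
    {w : WittVector p (Localization.Away (x * y))}
    (hw : (frobW p k x y)^[m] w ∈ Bd p x y l) : (frobW p k x y)^[m'] w ∈ Bd p x y l := by
  obtain ⟨e, rfl⟩ := Nat.exists_eq_add_of_le' h
  rw [Function.iterate_add_apply]
  exact iterate_frobW_mem_Bd hw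

variable (p k x y) in
/-- The Witt vectors whose truncations of length `l` are coboundaries after a power of
Frobenius. -/
def Nil (l : ℕ) : AddSubgroup (WittVector p (Localization.Away (x * y))) where
  carrier := {w | ∃ m, (frobW p k x y)^[m] w ∈ Bd p x y l}
  zero_mem' := ⟨0, zero_mem _⟩
  add_mem' := by
    rintro v w ⟨m, hm⟩ ⟨m', hm'⟩
    refine ⟨max m m', ?_⟩
    rw [iterate_map_add]
    exact add_mem (iterate_frobW_mem_Bd_of_le (le_max_left _ _) hm)
      (iterate_frobW_mem_Bd_of_le (le_max_right _ _) hm')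
  neg_mem' := by
    rintro v ⟨m, hm⟩
    refine ⟨m, ?_⟩
    rw [iterate_map_neg]
    exact neg_mem hm

theorem Bd_le_Nil (l : ℕ) : Bd p x y l ≤ Nil p k x y l := fun _ hw => ⟨0, hw⟩

theorem Nil_mono {l l' : ℕ} (h : l' ≤ l) : Nil p k x y l ≤ Nil p k x y l' :=
  fun _ ⟨m, hm⟩ => ⟨m, Bd_mono h hm⟩

theorem frobW_mem_Nil_iff {l : ℕ} {w : WittVector p (Localization.Away (x * y))} :
    frobW p k x y w ∈ Nil p k x y l ↔ w ∈ Nil p k x y l := by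
  constructor
  · rintro ⟨m, hm⟩
    exact ⟨m + 1, by rwa [Function.iterate_succ_apply]⟩
  · rintro ⟨m, hm⟩
    refine ⟨m, ?_⟩
    rw [← Function.iterate_succ_apply, Function.iterate_succ_apply']
    exact frobW_mem_Bd hm

theorem iterate_frobW_verschiebung (m d : ℕ) (w : WittVector p (Localization.Away (x * y))) :
    (frobW p k x y)^[m] (WittVector.verschiebung^[d] w) =
      WittVector.verschiebung^[d] ((frobW p k x y)^[m] w) := by
  induction m generalizing w with
  | zero => rfl
  | succ m ih =>
    rw [Function.iterate_succ_apply, map_iterate_verschiebung, ih, Function.iterate_succ_apply]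

theorem iterate_verschiebung_mem_Nil {l : ℕ} {w : WittVector p (Localization.Away (x * y))}
    (hw : w ∈ Nil p k x y l) (d : ℕ) : WittVector.verschiebung^[d] w ∈ Nil p k x y (l + d) := by
  obtain ⟨m, hm⟩ := hw
  exact ⟨m, by rw [iterate_frobW_verschiebung]; exact verschiebung_mem_Bd hm d⟩

theorem iterate_frobW_constMul (m : ℕ) (c : WittVector p k)
    (w : WittVector p (Localization.Away (x * y))) :
    (frobW p k x y)^[m] (WittVector.map (algebraMap k _) c * w) =
      WittVector.map (algebraMap k _) (WittVector.frobenius^[m] c) * (frobW p k x y)^[m] w := by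
  induction m generalizing c w with
  | zero => rfl
  | succ m ih =>
    rw [Function.iterate_succ_apply, map_mul, map_frobHom_map_algebraMap, ih,
      Function.iterate_succ_apply, Function.iterate_succ_apply]

theorem constMul_mem_Nil {l : ℕ} {w : WittVector p (Localization.Away (x * y))}
    (hw : w ∈ Nil p k x y l) (c : WittVector p k) :
    WittVector.map (algebraMap k _) c * w ∈ Nil p k x y l := by
  obtain ⟨m, hm⟩ := hw
  exact ⟨m, by rw [iterate_frobW_constMul]; exact constMul_mem_Bd hm _⟩

/-! ### The elements of the colimit -/

variable [PerfectRing k p]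

theorem iterate_frob_cls (l m : ℕ) (w : WittVector p (Localization.Away (x * y))) :
    (H2.frob p k x y l)^[m] (cls p x y l (WittVector.truncate l w)) =
      cls p x y l (WittVector.truncate l ((frobW p k x y)^[m] w)) := by
  induction m generalizing w with
  | zero => rfl
  | succ m ih => rw [Function.iterate_succ_apply, H2.frob_cls, ih, Function.iterate_succ_apply]

theorem cls_mem_kerF {l m : ℕ} {w : WittVector p (Localization.Away (x * y))}
    (hm : (frobW p k x y)^[m] w ∈ Bd p x y l) :
    cls p x y l (WittVector.truncate l w) ∈ kerF p k x y m l := by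
  rw [mem_kerF, iterate_frob_cls]
  exact hm

theorem coe_trans {m m' l l' : ℕ} (hm : m ≤ m') (hl : l ≤ l') (ξ : kerF p k x y m l) :
    (trans p k x y (m, l) (m', l') ⟨hm, hl⟩ ξ : H2 p x y l') =
      H2.ver p x y (l' - l) l l' (by omega) ξ := rfl

theorem of_trans {m m' l l' : ℕ} (hm : m ≤ m') (hl : l ≤ l') (ξ : kerF p k x y m l) :
    LocalWittCohomology.of p k x y m' l' (trans p k x y (m, l) (m', l') ⟨hm, hl⟩ ξ) =
      LocalWittCohomology.of p k x y m l ξ :=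
  Module.DirectLimit.of_f

/-- Both elements are pushed to the larger of the two powers of Frobenius, where the transition map
is V^d. With d = 0 it says that the power of Frobenius used to represent an element is irrelevant.
-/
theorem of_verschiebung {m m' l l' d : ℕ} (hl : l' = l + d)
    {w : WittVector p (Localization.Away (x * y))}
    (h : (frobW p k x y)^[m] w ∈ Bd p x y l)
    (h' : (frobW p k x y)^[m'] (WittVector.verschiebung^[d] w) ∈ Bd p x y l') :
    LocalWittCohomology.of p k x y m' l' ⟨_, cls_mem_kerF h'⟩ =
      LocalWittCohomology.of p k x y m l ⟨_, cls_mem_kerF h⟩ := by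
  subst hl
  have h1 : ∀ (n : ℕ) (hn : m ≤ n),
      (frobW p k x y)^[n] (WittVector.verschiebung^[d] w) ∈ Bd p x y (l + d) := fun n hn => by
    rw [iterate_frobW_verschiebung]
    exact verschiebung_mem_Bd (iterate_frobW_mem_Bd_of_le hn h) d
  have h2 := h1 (max m m') (le_max_left _ _)
  trans LocalWittCohomology.of p k x y (max m m') (l + d) ⟨_, cls_mem_kerF h2⟩
  · rw [← of_trans (le_max_right m m') (le_refl (l + d))]
    congr 1
    apply Subtype.ext
    rw [coe_trans (le_max_right m m') le_rfl, H2.ver_cls, Nat.sub_self]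
    rfl
  · rw [← of_trans (le_max_left m m') (Nat.le_add_right l d) (⟨_, cls_mem_kerF h⟩ : kerF p k x y m l)]
    congr 1
    apply Subtype.ext
    rw [coe_trans (le_max_left m m') (Nat.le_add_right l d), H2.ver_cls]
    simp only [Nat.add_sub_cancel_left]

variable (p k x y) in
/-- The element of the colimit represented by a Witt vector. -/
def el (l : ℕ) : Nil p k x y l →+ LocalWittCohomology p k x y :=
  AddMonoidHom.mk' (fun w => LocalWittCohomology.of p k x y w.2.choose l
    ⟨_, cls_mem_kerF w.2.choose_spec⟩) (by
    intro v w
    -- The chosen powers of Frobenius for v, w and v + w are unrelated; additivity is read off at a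
    -- common one.
    set m := max (max v.2.choose w.2.choose) (v + w).2.choose
    have hv := iterate_frobW_mem_Bd_of_le
      ((le_max_left _ _).trans (le_max_left _ _) : v.2.choose ≤ m) v.2.choose_spec
    have hw := iterate_frobW_mem_Bd_of_le
      ((le_max_right _ _).trans (le_max_left _ _) : w.2.choose ≤ m) w.2.choose_spec
    have hvw := iterate_frobW_mem_Bd_of_le
      (le_max_right _ _ : (v + w).2.choose ≤ m) (v + w).2.choose_spec
    rw [← of_verschiebung (d := 0) rfl v.2.choose_spec hv,
      ← of_verschiebung (d := 0) rfl w.2.choose_spec hw,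
      ← of_verschiebung (d := 0) rfl (v + w).2.choose_spec hvw, ← map_add]
    congr 1
    apply Subtype.ext
    exact (congrArg (cls p x y l) (map_add (WittVector.truncate l) v.1 w.1)).trans
      (map_add (cls p x y l) _ _))

theorem el_eq_of {l m : ℕ} (w : Nil p k x y l)
    (h : (frobW p k x y)^[m] w.1 ∈ Bd p x y l) :
    el p k x y l w = LocalWittCohomology.of p k x y m l ⟨_, cls_mem_kerF h⟩ :=
  (of_verschiebung (d := 0) rfl w.2.choose_spec h).symm

theorem isRepresentedBy_el {l : ℕ} (w : Nil p k x y l) :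
    IsRepresentedBy (el p k x y l w) (cls p x y l (WittVector.truncate l w.1)) :=
  ⟨_, cls_mem_kerF w.2.choose_spec, rfl⟩

theorem el_iterate_verschiebung {l d : ℕ} (w : Nil p k x y l) :
    el p k x y (l + d) ⟨_, iterate_verschiebung_mem_Nil w.2 d⟩ = el p k x y l w :=
  of_verschiebung rfl w.2.choose_spec (iterate_verschiebung_mem_Nil w.2 d).choose_spec

theorem exists_el (g : LocalWittCohomology p k x y) : ∃ l w, el p k x y l w = g := by
  obtain ⟨⟨m, l⟩, ξ, rfl⟩ := Module.DirectLimit.exists_of g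
  obtain ⟨w, hw⟩ := H2.exists_rep ξ.1
  have h : (frobW p k x y)^[m] w ∈ Bd p x y l := by
    rw [mem_Bd, ← iterate_frob_cls, hw]
    exact ξ.2
  refine ⟨l, ⟨w, m, h⟩, ?_⟩
  rw [el_eq_of _ h]
  change LocalWittCohomology.of p k x y m l _ = LocalWittCohomology.of p k x y m l _
  congr 1
  exact Subtype.ext hw

/-- Vanishing in the colimit means vanishing after some V^d, and V is injective on cohomology; so
nothing is lost in the limit. -/
theorem el_eq_zero_iff {z : R} (D : DoubleCover k x y z) {l : ℕ} (w : Nil p k x y l) :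
    el p k x y l w = 0 ↔ w.1 ∈ Bd p x y l := by
  constructor
  · intro h
    obtain ⟨m, hm⟩ := w.2
    rw [el_eq_of w hm] at h
    obtain ⟨⟨m', l'⟩, hle, h0⟩ := Module.DirectLimit.of.zero_exact h
    have h1 := congrArg Subtype.val h0
    rw [coe_trans hle.1 hle.2, H2.ver_cls] at h1
    obtain ⟨d, rfl⟩ := Nat.exists_eq_add_of_le (show l ≤ l' from hle.2)
    simp only [Nat.add_sub_cancel_left] at h1
    exact mem_Bd_of_iterate_verschiebung D h1
  · intro h
    rw [el_eq_of (m := 0) w h]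
    convert map_zero (LocalWittCohomology.of p k x y 0 l)
    exact h

theorem el_congr {l : ℕ} {v w : WittVector p (Localization.Away (x * y))}
    (hw : w ∈ Nil p k x y l) (h : v - w ∈ Bd p x y l) :
    ∃ hv : v ∈ Nil p k x y l, el p k x y l ⟨v, hv⟩ = el p k x y l ⟨w, hw⟩ := by
  have hv : v ∈ Nil p k x y l := by
    have := add_mem (Bd_le_Nil l h) hw
    rwa [sub_add_cancel] at this
  refine ⟨hv, ?_⟩
  rw [← sub_eq_zero, ← map_sub]
  rw [el_eq_of (m := 0) _ h]
  convert map_zero (LocalWittCohomology.of p k x y 0 l)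
  exact h

theorem F_smul_el {l : ℕ} (w : Nil p k x y l) :
    DieudonneRing.F p k • el p k x y l w =
      el p k x y l ⟨frobW p k x y w.1, frobW_mem_Nil_iff.mpr w.2⟩ := by
  obtain ⟨m, hm⟩ := w.2
  have h : (frobW p k x y)^[m] (frobW p k x y w.1) ∈ Bd p x y l := by
    rw [← Function.iterate_succ_apply, Function.iterate_succ_apply']
    exact frobW_mem_Bd hm
  rw [el_eq_of w hm, el_eq_of _ h, ← map_smul]
  congr 1
  apply Subtype.ext
  change DieudonneRing.F p k • cls p x y l _ = _
  rw [H2.F_smul, H2.frob_cls]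

theorem V_smul_el {l : ℕ} (w : Nil p k x y l) :
    DieudonneRing.V p k • el p k x y l w =
      el p k x y l ⟨WittVector.verschiebung w.1,
        Nil_mono (Nat.le_succ l) (iterate_verschiebung_mem_Nil w.2 1)⟩ := by
  obtain ⟨m, hm⟩ := w.2
  have h : (frobW p k x y)^[m] (WittVector.verschiebung w.1) ∈ Bd p x y l := by
    rw [show WittVector.verschiebung w.1 = WittVector.verschiebung^[1] w.1 from rfl,
      iterate_frobW_verschiebung]
    exact Bd_mono (Nat.le_succ l) (verschiebung_mem_Bd hm 1)
  rw [el_eq_of w hm, el_eq_of _ h, ← map_smul]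
  congr 1
  apply Subtype.ext
  change DieudonneRing.V p k • cls p x y l _ = _
  rw [H2.V_smul, H2.verEnd_cls]

theorem smul_el {l : ℕ} (a : WittVector p k) (w : Nil p k x y l) :
    a • el p k x y l w =
      el p k x y l ⟨WittVector.map (algebraMap k _) (sigmaInv p k l a) * w.1,
        constMul_mem_Nil w.2 _⟩ := by
  obtain ⟨m, hm⟩ := w.2
  have h : (frobW p k x y)^[m] (WittVector.map (algebraMap k _) (sigmaInv p k l a) * w.1) ∈
      Bd p x y l := by
    rw [iterate_frobW_constMul]
    exact constMul_mem_Bd hm _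
  rw [el_eq_of w hm, el_eq_of _ h]
  change DieudonneRing.scal p k a • LocalWittCohomology.of p k x y m l _ = _
  rw [← map_smul]
  congr 1
  apply Subtype.ext
  change DieudonneRing.scal p k a • cls p x y l _ = _
  rw [H2.scal_smul, H2.mulConst_cls]

theorem sigmaInv_iterate_frobenius (d : ℕ) (a : WittVector p k) :
    sigmaInv p k d (WittVector.frobenius^[d] a) = a := by
  have h : ∀ (n l : ℕ) (b : WittVector p k), WittVector.frobenius^[n] (sigmaInv p k l b) =
      sigmaInv p k l (WittVector.frobenius^[n] b) := by
    intro n l b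
    induction n generalizing b with
    | zero => rfl
    | succ n ih => rw [Function.iterate_succ_apply, frobenius_sigmaInv, ih,
        Function.iterate_succ_apply]
  rw [← h]
  have := iterate_frobenius_sigmaInv p k 0 d a
  rwa [zero_add] at this

end WittCech

/-! ### Modules on which `F` and `V` act by strictly triangular matrices -/

section Triangular

variable {p : ℕ} [Fact p.Prime] {k : Type u} [Field k] [CharP k p] [PerfectRing k p]

theorem eq_p_mul_of_not_isUnit {a : WittVector p k} (ha : ¬ IsUnit a) :
    ∃ b, a = p * b := by
  have h0 : a.coeff 0 = 0 := by
    by_contra h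
    exact ha (WittVector.isUnit_of_coeff_zero_ne_zero a h)
  refine ⟨(WittVector.frobeniusEquiv p k).symm (a.shift 1), ?_⟩
  have h1 := eq_verschiebung_of_coeff_zero h0
  have h2 : WittVector.frobenius ((WittVector.frobeniusEquiv p k).symm (a.shift 1)) = a.shift 1 :=
    (WittVector.frobeniusEquiv p k).apply_symm_apply _
  rw [← h2, WittVector.verschiebung_frobenius, mul_comm] at h1
  exact h1

namespace DieudonneRing

theorem F_mul_V : F p k * V p k = (p : DieudonneRing p k) :=
  (map_mul _ _ _).symm.trans ((mk_rel p k DRel.FV).trans (map_natCast _ _))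

theorem V_mul_F : V p k * F p k = (p : DieudonneRing p k) :=
  (map_mul _ _ _).symm.trans ((mk_rel p k DRel.VF).trans (map_natCast _ _))

theorem F_mul_scal (a : WittVector p k) :
    F p k * scal p k a = scal p k (WittVector.frobenius a) * F p k :=
  (map_mul _ _ _).symm.trans ((mk_rel p k (DRel.F_scal a)).trans (map_mul _ _ _))

theorem scal_mul_V (a : WittVector p k) :
    scal p k a * V p k = V p k * scal p k (WittVector.frobenius a) :=
  (map_mul _ _ _).symm.trans ((mk_rel p k (DRel.scal_V a)).trans (map_mul _ _ _))

end DieudonneRing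

open DieudonneRing

variable {P : Type u} [AddCommGroup P] [Module (DieudonneRing p k) P] [Module (WittVector p k) P]
  (hP : ∀ (a : WittVector p k) (u : P), a • u = scal p k a • u)

-- F and V are semilinear over W(k), with respect to σ and σ⁻¹, so stability of a W(k)-span under 𝔻
-- can be tested on the spanning set. Moving a scalar to the left of V uses that k is perfect.
include hP in
theorem smul_mem_span {S : Set P}
    (hF : ∀ u ∈ S, F p k • u ∈ Submodule.span (WittVector p k) S)
    (hV : ∀ u ∈ S, V p k • u ∈ Submodule.span (WittVector p k) S)
    (d : DieudonneRing p k) :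
    ∀ u ∈ Submodule.span (WittVector p k) S, d • u ∈ Submodule.span (WittVector p k) S := by
  induction d using DieudonneRing.induction with
  | hint n =>
    intro u hu
    rw [Int.cast_smul_eq_zsmul]
    exact zsmul_mem hu n
  | hscal a =>
    intro u hu
    rw [← hP]
    exact Submodule.smul_mem _ _ hu
  | hF =>
    intro u hu
    induction hu using Submodule.span_induction with
    | mem u hu => exact hF u hu
    | zero => rw [smul_zero]; exact zero_mem _
    | add u v _ _ hu hv => rw [smul_add]; exact add_mem hu hv
    | smul a u _ hu =>
      rw [hP, ← mul_smul, F_mul_scal, mul_smul, ← hP]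
      exact Submodule.smul_mem _ _ hu
  | hV =>
    intro u hu
    induction hu using Submodule.span_induction with
    | mem u hu => exact hV u hu
    | zero => rw [smul_zero]; exact zero_mem _
    | add u v _ _ hu hv => rw [smul_add]; exact add_mem hu hv
    | smul a u _ hu =>
      have h : V p k * scal p k a =
          scal p k ((WittVector.frobeniusEquiv p k).symm a) * V p k := by
        rw [scal_mul_V]
        congr 2
        exact ((WittVector.frobeniusEquiv p k).apply_symm_apply a).symm
      rw [hP, ← mul_smul, h, mul_smul, ← hP]
      exact Submodule.smul_mem _ _ hu
  | hmul a b ha hb => intro u hu; rw [mul_smul]; exact ha _ (hb _ hu)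
  | hadd a b ha hb => intro u hu; rw [add_smul]; exact add_mem (ha _ hu) (hb _ hu)

variable {n : ℕ} (e : Fin n → P)

/-- The span of the first `i` elements of a sequence. -/
def initialSpan (i : ℕ) : Submodule (WittVector p k) P :=
  Submodule.span (WittVector p k) (e '' {j | (j : ℕ) < i})

theorem initialSpan_zero : initialSpan (p := p) (k := k) e 0 = ⊥ := by
  simp [initialSpan]

theorem initialSpan_succ (i : Fin n) : initialSpan (p := p) (k := k) e (i + 1) =
    Submodule.span _ {e i} ⊔ initialSpan e i := by
  have : {j : Fin n | (j : ℕ) < i + 1} = insert i {j : Fin n | (j : ℕ) < i} := by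
    ext j
    simp only [Set.mem_ofPred_eq, Set.mem_insert_iff, Fin.ext_iff]
    omega
  rw [initialSpan, this, Set.image_insert_eq, Submodule.span_insert]
  rfl

theorem initialSpan_mono {i i' : ℕ} (h : i ≤ i') :
    initialSpan (p := p) (k := k) e i ≤ initialSpan e i' :=
  Submodule.span_mono (Set.image_mono fun _ hj => lt_of_lt_of_le hj h)

variable (hF : ∀ i : Fin n, F p k • e i ∈ initialSpan (p := p) (k := k) e i)
  (hV : ∀ i : Fin n, V p k • e i ∈ initialSpan (p := p) (k := k) e i)

include hP hF hV in
theorem smul_mem_initialSpan (i : ℕ) (d : DieudonneRing p k) {u : P}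
    (hu : u ∈ initialSpan (p := p) (k := k) e i) : d • u ∈ initialSpan (p := p) (k := k) e i := by
  refine smul_mem_span hP ?_ ?_ d u hu
  · rintro _ ⟨j, hj, rfl⟩
    exact initialSpan_mono e (le_of_lt hj) (hF j)
  · rintro _ ⟨j, hj, rfl⟩
    exact initialSpan_mono e (le_of_lt hj) (hV j)

-- Since p = FV, multiplication by p also descends in the filtration.
include hP hF hV in
theorem p_smul_mem_initialSpan (i : Fin n) (b : WittVector p k) :
    (p * b : WittVector p k) • e i ∈ initialSpan (p := p) (k := k) e i := by
  rw [mul_comm, mul_smul]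
  refine Submodule.smul_mem _ _ ?_
  rw [hP, map_natCast, ← F_mul_V, mul_smul]
  exact smul_mem_initialSpan hP e hF hV _ _ (hV i)

-- Each step of the filtration is a quotient of W(k)/p = k: the leading coefficient is a unit or a
-- multiple of p, and in the latter case the leading term drops down.
include hP hF hV in
theorem mem_initialSpan_or (i : Fin n) {u : P}
    (hu : u ∈ initialSpan (p := p) (k := k) e (i + 1)) :
    u ∈ initialSpan (p := p) (k := k) e i ∨
      ∃ a : WittVector p k, IsUnit a ∧ ∃ v ∈ initialSpan (p := p) (k := k) e i, u = a • e i + v := by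
  rw [initialSpan_succ] at hu
  obtain ⟨y, hy, v, hv, rfl⟩ := Submodule.mem_sup.mp hu
  obtain ⟨a, rfl⟩ := Submodule.mem_span_singleton.mp hy
  by_cases ha : IsUnit a
  · exact Or.inr ⟨a, ha, v, hv, rfl⟩
  · obtain ⟨b, rfl⟩ := eq_p_mul_of_not_isUnit ha
    exact Or.inl (add_mem (p_smul_mem_initialSpan hP e hF hV i b) hv)

include hP hF hV in
/-- A covering relation, over any ring whose submodules are stable under `W(k)`. -/
theorem mem_of_initialSpan_lt (i : Fin n) {X : Set P}
    (hadd : ∀ u ∈ X, ∀ v ∈ X, u - v ∈ X) (hsmul : ∀ a : WittVector p k, ∀ u ∈ X, a • u ∈ X)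
    (hle : ∀ u ∈ initialSpan (p := p) (k := k) e i, u ∈ X) {u : P} (hu : u ∈ X)
    (hu' : u ∈ initialSpan (p := p) (k := k) e (i + 1))
    (hn : u ∉ initialSpan (p := p) (k := k) e i) :
    ∀ v ∈ initialSpan (p := p) (k := k) e (i + 1), v ∈ X := by
  rcases mem_initialSpan_or hP e hF hV i hu' with h | ⟨a, ha, v, hv, rfl⟩
  · exact absurd h hn
  · have h1 : e i ∈ X := by
      obtain ⟨b, hb⟩ := ha.exists_left_inv
      have h2 := hsmul b _ (hadd _ hu _ (hle v hv))
      rwa [add_sub_cancel_right, ← mul_smul, hb, one_smul] at h2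
    intro w hw
    rw [initialSpan_succ] at hw
    obtain ⟨y, hy, v', hv', rfl⟩ := Submodule.mem_sup.mp hw
    obtain ⟨c, rfl⟩ := Submodule.mem_span_singleton.mp hy
    have := hadd _ (hsmul c _ h1) _ (hle (-v') (neg_mem hv'))
    rwa [sub_neg_eq_add] at this

variable (hind : ∀ i : Fin n, e i ∉ initialSpan (p := p) (k := k) e i)
  (htop : initialSpan (p := p) (k := k) e n = ⊤)

-- The steps of the filtration are one-dimensional over k, hence simple over W(k) and a fortiori
-- over 𝔻. So one chain is a composition series for both rings.
include hP hF hV hind htop in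
theorem length_eq_of_triangular : Module.length (DieudonneRing p k) P = n ∧
    Module.length (WittVector p k) P = n := by
  have hlt : ∀ i : Fin n, initialSpan (p := p) (k := k) e i < initialSpan e (i + 1) := fun i =>
    lt_of_le_of_ne (initialSpan_mono e (Nat.le_succ _)) fun h => hind i (by
      rw [h, initialSpan_succ]
      exact Submodule.mem_sup_left (Submodule.mem_span_singleton_self _))
  constructor
  · let N : ℕ → Submodule (DieudonneRing p k) P := fun i =>
      { carrier := initialSpan (p := p) (k := k) e i
        add_mem' := fun h h' => add_mem (S := Submodule (WittVector p k) P) h h'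
        zero_mem' := zero_mem (initialSpan (p := p) (k := k) e i)
        smul_mem' := fun d u hu => smul_mem_initialSpan hP e hF hV i d hu }
    have hN : ∀ i u, u ∈ N i ↔ u ∈ initialSpan (p := p) (k := k) e i := fun _ _ => Iff.rfl
    let s : CompositionSeries (Submodule (DieudonneRing p k) P) :=
      { length := n
        toFun := fun i => N i
        step := fun i => by
          change N i ⋖ N (i + 1)
          refine ⟨?_, ?_⟩
          · rw [← SetLike.coe_ssubset_coe]
            exact hlt i
          · intro X h1 h2
            obtain ⟨u, hu, hn⟩ := SetLike.exists_of_lt h1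
            refine h2.not_ge fun v hv => ?_
            refine mem_of_initialSpan_lt hP e hF hV i (X := X) (fun u hu v hv => sub_mem hu hv)
              (fun a u hu => ?_) (fun u hu => h1.le hu) hu (h2.le hu) hn v hv
            rw [hP]
            exact X.smul_mem _ hu }
    refine (Module.length_compositionSeries s ?_ ?_).symm
    · ext u
      change u ∈ N 0 ↔ _
      rw [hN, initialSpan_zero]; rfl
    · ext u
      change u ∈ N n ↔ _
      rw [hN, htop]
      simp
  · let s : CompositionSeries (Submodule (WittVector p k) P) :=
      { length := n
        toFun := fun i => initialSpan e i
        step := fun i => by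
          change initialSpan e i ⋖ initialSpan e (i + 1)
          refine ⟨hlt i, ?_⟩
          intro X h1 h2
          obtain ⟨u, hu, hn⟩ := SetLike.exists_of_lt h1
          refine h2.not_ge fun v hv => ?_
          exact mem_of_initialSpan_lt hP e hF hV i (X := X) (fun u hu v hv => sub_mem hu hv)
            (fun a u hu => X.smul_mem _ hu) (fun u hu => h1.le hu) hu (h2.le hu) hn v hv }
    exact (Module.length_compositionSeries s (initialSpan_zero e) htop).symm

variable {M : Type u} [AddCommGroup M] [Module (DieudonneRing p k) M] [Module (WittVector p k) M]
  (hM : ∀ (a : WittVector p k) (u : M), a • u = scal p k a • u)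

include hP hM in
theorem map_smul_of_compat (π : P →ₗ[DieudonneRing p k] M) (a : WittVector p k) (u : P) :
    π (a • u) = a • π u := by
  rw [hP, hM, map_smul]

include hP hM in
theorem map_mem_initialSpan (π : P →ₗ[DieudonneRing p k] M) {i : ℕ} {u : P}
    (hu : u ∈ initialSpan (p := p) (k := k) e i) :
    π u ∈ initialSpan (p := p) (k := k) (π ∘ e) i := by
  induction hu using Submodule.span_induction with
  | mem u hu =>
    obtain ⟨j, hj, rfl⟩ := hu
    exact Submodule.subset_span ⟨j, hj, rfl⟩
  | zero => rw [map_zero]; exact zero_mem _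
  | add u v _ _ hu hv => rw [map_add]; exact add_mem hu hv
  | smul a u _ hu => rw [map_smul_of_compat hP hM]; exact Submodule.smul_mem _ _ hu

-- If the leading coefficient of an element of the kernel is a unit, the image of that basis element
-- lies in the span of the smaller images, against `hind`. The hypothesis `htop` only asks for
-- generation over 𝔻; triangularity turns it into generation over W(k).
include hP hM hF hV in
theorem injective_of_triangular (π : P →ₗ[DieudonneRing p k] M)
    (htop : Submodule.span (DieudonneRing p k) (Set.range e) = ⊤)
    (hind : ∀ i : Fin n, π (e i) ∉ initialSpan (p := p) (k := k) (π ∘ e) i) :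
    Function.Injective π := by
  have h0 : ∀ i ≤ n, ∀ u ∈ initialSpan (p := p) (k := k) e i, π u = 0 → u = 0 := by
    intro i
    induction i with
    | zero => intro _ u hu _; rwa [initialSpan_zero, Submodule.mem_bot] at hu
    | succ i ih =>
      intro hi u hu hu0
      rcases mem_initialSpan_or hP e hF hV ⟨i, hi⟩ hu with h | ⟨a, ha, v, hv, rfl⟩
      · exact ih (by omega) u h hu0
      · exfalso
        apply hind ⟨i, hi⟩
        obtain ⟨b, hb⟩ := ha.exists_left_inv
        rw [map_add, map_smul_of_compat hP hM] at hu0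
        -- The relation a·π(e_i) + π(v) = 0 is solved for π(e_i) with the inverse b of a.
        have h1 : π (e ⟨i, hi⟩) = b • (-π v) := by
          rw [← eq_neg_of_add_eq_zero_left hu0, ← mul_smul, hb, one_smul]
        rw [h1]
        exact Submodule.smul_mem _ _ (neg_mem (map_mem_initialSpan hP e hM π hv))
  rw [injective_iff_map_eq_zero]
  intro u hu
  refine h0 n le_rfl u ?_ hu
  have hu' : u ∈ Submodule.span (DieudonneRing p k) (Set.range e) := htop ▸ Submodule.mem_top
  clear hu
  induction hu' using Submodule.span_induction with
  | mem u hu =>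
    obtain ⟨j, rfl⟩ := hu
    exact Submodule.subset_span ⟨j, j.2, rfl⟩
  | zero => exact zero_mem _
  | add u v _ _ hu hv => exact add_mem hu hv
  | smul d u _ hu => exact smul_mem_initialSpan hP e hF hV n d hu

end Triangular

/-! ### Triangular families indexed by a finite linear order -/

section Lex

open DieudonneRing

variable {p : ℕ} [Fact p.Prime] {k : Type u} [Field k] [CharP k p] [PerfectRing k p]
variable {P : Type u} [AddCommGroup P] [Module (DieudonneRing p k) P] [Module (WittVector p k) P]
  (hP : ∀ (a : WittVector p k) (u : P), a • u = scal p k a • u)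
  {α : Type*} [LinearOrder α] (T : Finset α) (e : α → P)

/-- The span of the members of a finite family of index less than `t`. -/
def lowerSpan (t : α) : Submodule (WittVector p k) P :=
  Submodule.span (WittVector p k) (e '' {s | s ∈ T ∧ s < t})

theorem initialSpan_orderEmb (i : Fin T.card) :
    initialSpan (p := p) (k := k) (e ∘ T.orderEmbOfFin rfl) i =
      lowerSpan T e (T.orderEmbOfFin rfl i) := by
  rw [initialSpan, lowerSpan, Set.image_comp]
  congr 2
  ext t
  constructor
  · rintro ⟨j, hj, rfl⟩
    exact ⟨T.orderEmbOfFin_mem rfl j, (OrderEmbedding.lt_iff_lt _).mpr hj⟩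
  · rintro ⟨ht, hlt⟩
    have : t ∈ Set.range (T.orderEmbOfFin rfl) := by rwa [Finset.range_orderEmbOfFin]
    obtain ⟨j, rfl⟩ := this
    exact ⟨j, (OrderEmbedding.lt_iff_lt _).mp hlt, rfl⟩

theorem range_orderEmb : Set.range (e ∘ T.orderEmbOfFin rfl) = e '' T := by
  rw [Set.range_comp, Finset.range_orderEmbOfFin]

variable {M : Type u} [AddCommGroup M] [Module (DieudonneRing p k) M] [Module (WittVector p k) M]
  (hM : ∀ (a : WittVector p k) (u : M), a • u = scal p k a • u)

-- For P a module given by generators and relations and M its intended value, triangularity in P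
-- bounds P from above, while independence of the images bounds M from below; together they give an
-- isomorphism and the length.
include hP hM in
theorem bijective_and_length_of_triangular (π : P →ₗ[DieudonneRing p k] M)
    (hF : ∀ t ∈ T, F p k • e t ∈ lowerSpan (p := p) (k := k) T e t)
    (hV : ∀ t ∈ T, V p k • e t ∈ lowerSpan (p := p) (k := k) T e t)
    (htop : Submodule.span (DieudonneRing p k) (e '' T) = ⊤)
    (hind : ∀ t ∈ T, π (e t) ∉ lowerSpan (p := p) (k := k) T (π ∘ e) t)
    (htop' : Submodule.span (WittVector p k) ((π ∘ e) '' T) = ⊤) :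
    Function.Bijective π ∧ Module.length (DieudonneRing p k) M = T.card ∧
      Module.length (WittVector p k) M = T.card := by
  set f := e ∘ T.orderEmbOfFin rfl with hf
  have hF' : ∀ i : Fin T.card, F p k • f i ∈ initialSpan (p := p) (k := k) f i := fun i => by
    rw [hf, initialSpan_orderEmb]; exact hF _ (T.orderEmbOfFin_mem rfl i)
  have hV' : ∀ i : Fin T.card, V p k • f i ∈ initialSpan (p := p) (k := k) f i := fun i => by
    rw [hf, initialSpan_orderEmb]; exact hV _ (T.orderEmbOfFin_mem rfl i)
  have hind' : ∀ i : Fin T.card, π (f i) ∉ initialSpan (p := p) (k := k) (π ∘ f) i := fun i => by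
    rw [hf, ← Function.comp_assoc, initialSpan_orderEmb]
    exact hind _ (T.orderEmbOfFin_mem rfl i)
  have hinj := injective_of_triangular hP f hF' hV' hM π (by rw [hf, range_orderEmb, htop]) hind'
  have hlast : initialSpan (p := p) (k := k) (π ∘ f) T.card = ⊤ := by
    rw [initialSpan, ← htop']
    congr 1
    rw [← range_orderEmb, ← Set.image_univ]
    congr 1
    ext i
    simp
  have hl := length_eq_of_triangular hM (π ∘ f)
    (fun i => by
      rw [Function.comp_apply, ← map_smul]; exact map_mem_initialSpan hP f hM π (hF' i))
    (fun i => by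
      rw [Function.comp_apply, ← map_smul]; exact map_mem_initialSpan hP f hM π (hV' i))
    hind' hlast
  refine ⟨⟨hinj, fun u => ?_⟩, hl⟩
  have hu : u ∈ Submodule.span (WittVector p k) ((π ∘ e) '' T) := htop' ▸ Submodule.mem_top
  induction hu using Submodule.span_induction with
  | mem u hu =>
    obtain ⟨t, _, rfl⟩ := hu
    exact ⟨e t, rfl⟩
  | zero => exact ⟨0, map_zero _⟩
  | add u v _ _ hu hv =>
    obtain ⟨a, rfl⟩ := hu
    obtain ⟨b, rfl⟩ := hv
    exact ⟨a + b, map_add _ _ _⟩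
  | smul a u _ hu =>
    obtain ⟨b, rfl⟩ := hu
    exact ⟨a • b, map_smul_of_compat hP hM π a b⟩

end Lex

/-! ### The criterion for the classes killed by a power of Frobenius -/

section Criterion

variable (p : ℕ) [Fact p.Prime] (k : Type u) [Field k] [CharP k p] [PerfectRing k p]
  {R : Type u} [CommRing R] [Algebra k R] (x y z : R)

/-- The Teichmüller lift of `z / (x y^j)`. -/
def fW (j : ℕ) : WittVector p (Localization.Away (x * y)) :=
  WittVector.teichmuller p (mon x y z (-1) (-j) 1)

/-- Multiplication by the image of a Witt vector over `k`. -/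
abbrev cm (c : WittVector p k) : WittVector p (Localization.Away (x * y)) :=
  WittVector.map (algebraMap k _) c

/-- The multiples of the `V^d f_j`, where `l - d` is at most `μ j`. -/
def spGen (J : Finset ℕ) (μ : ℕ → ℕ) (l : ℕ) : Set (WittVector p (Localization.Away (x * y))) :=
  {w | ∃ j ∈ J, ∃ s d c, s + d = l ∧ s ≤ μ j ∧
    w = WittVector.verschiebung^[d] (cm p k x y c * fW p x y z j)}

/-- The Witt vectors spanned by the `V^d f_j`, modulo coboundaries in length `l`. -/
def Sp (J : Finset ℕ) (μ : ℕ → ℕ) (l : ℕ) : AddSubgroup (WittVector p (Localization.Away (x * y))) :=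
  AddSubgroup.closure (spGen p k x y z J μ l) ⊔ Bd p x y l

variable {p k x y z} {J : Finset ℕ} {μ : ℕ → ℕ}

theorem Bd_le_Sp (l : ℕ) : Bd p x y l ≤ Sp p k x y z J μ l := le_sup_right

theorem gen_mem_Sp {l j s d : ℕ} (hj : j ∈ J) (hl : s + d = l) (hs : s ≤ μ j)
    (c : WittVector p k) :
    WittVector.verschiebung^[d] (cm p k x y c * fW p x y z j) ∈ Sp p k x y z J μ l :=
  (le_sup_left : _ ≤ Sp p k x y z J μ l)
    (AddSubgroup.subset_closure ⟨j, hj, s, d, c, hl, hs, rfl⟩)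

theorem Sp_le_iff {l : ℕ} {H : AddSubgroup (WittVector p (Localization.Away (x * y)))} :
    Sp p k x y z J μ l ≤ H ↔ (∀ j ∈ J, ∀ s d c, s + d = l → s ≤ μ j →
      WittVector.verschiebung^[d] (cm p k x y c * fW p x y z j) ∈ H) ∧ Bd p x y l ≤ H := by
  rw [Sp, sup_le_iff, AddSubgroup.closure_le]
  constructor
  · rintro ⟨h, h'⟩
    exact ⟨fun j hj s d c hl hs => h ⟨j, hj, s, d, c, hl, hs, rfl⟩, h'⟩
  · rintro ⟨h, h'⟩
    refine ⟨?_, h'⟩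
    rintro _ ⟨j, hj, s, d, c, hl, hs, rfl⟩
    exact h j hj s d c hl hs

theorem Sp_mono {μ' : ℕ → ℕ} (h : ∀ j ∈ J, μ j ≤ μ' j) (l : ℕ) :
    Sp p k x y z J μ l ≤ Sp p k x y z J μ' l :=
  Sp_le_iff.mpr ⟨fun j hj _ _ _ hl hs => gen_mem_Sp hj hl (hs.trans (h j hj)) _, Bd_le_Sp l⟩

/-- Dropping the last component turns an f_j of length s + 1 into one of length s; a term with s = 0
is V^{l+1} of something and is a coboundary. -/
theorem Sp_succ_le (l : ℕ) :
    Sp p k x y z J (fun j => μ j + 1) (l + 1) ≤ Sp p k x y z J μ l := by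
  refine Sp_le_iff.mpr ⟨fun j hj s d c hl hs => ?_, (Bd_mono (Nat.le_succ l)).trans (Bd_le_Sp l)⟩
  rcases s with _ | s
  · obtain rfl : d = l + 1 := by omega
    exact Bd_le_Sp l (Bd_mono (Nat.le_succ l) (iterate_verschiebung_mem_Bd _ _))
  · exact gen_mem_Sp hj (by omega : s + d = l) (by simpa using hs) c

theorem Sp_anti {l l' : ℕ} (h : l' ≤ l) : Sp p k x y z J μ l ≤ Sp p k x y z J μ l' := by
  induction l, h using Nat.le_induction with
  | base => exact le_rfl
  | succ l _ ih => exact ((Sp_mono (fun j _ => Nat.le_succ _) _).trans (Sp_succ_le l)).trans ih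

theorem verschiebung_mem_Sp {l : ℕ} {w : WittVector p (Localization.Away (x * y))}
    (hw : w ∈ Sp p k x y z J μ l) (d : ℕ) :
    WittVector.verschiebung^[d] w ∈ Sp p k x y z J μ (l + d) := by
  have h : Sp p k x y z J μ l ≤ (Sp p k x y z J μ (l + d)).comap
      (AddMonoidHom.mk' (WittVector.verschiebung^[d]) (fun a b => iterate_map_add _ d a b)) := by
    refine Sp_le_iff.mpr ⟨fun j hj s d' c hl hs => ?_, fun w hw => ?_⟩
    · change WittVector.verschiebung^[d] (WittVector.verschiebung^[d'] _) ∈ Sp p k x y z J μ (l + d)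
      rw [← Function.iterate_add_apply]
      exact gen_mem_Sp hj (by omega : s + (d + d') = l + d) hs c
    · exact Bd_le_Sp _ (verschiebung_mem_Bd hw d)
  exact h hw

theorem cm_mem_Sp {l : ℕ} {w : WittVector p (Localization.Away (x * y))}
    (hw : w ∈ Sp p k x y z J μ l) (c : WittVector p k) :
    cm p k x y c * w ∈ Sp p k x y z J μ l := by
  have h : Sp p k x y z J μ l ≤ (Sp p k x y z J μ l).comap
      (AddMonoidHom.mulLeft (cm p k x y c)) := by
    refine Sp_le_iff.mpr ⟨fun j hj s d c' hl hs => ?_, fun w hw => ?_⟩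
    · change cm p k x y c * WittVector.verschiebung^[d] _ ∈ Sp p k x y z J μ l
      rw [iterate_mul_verschiebung, ← mul_assoc, ← map_mul]
      exact gen_mem_Sp hj hl hs _
    · exact Bd_le_Sp _ (constMul_mem_Bd hw c)
  exact h hw

theorem fW_mem_Sp {l j : ℕ} (hj : j ∈ J) (hs : l ≤ μ j) :
    fW p x y z j ∈ Sp p k x y z J μ l := by
  have := gen_mem_Sp (x := x) (y := y) (z := z) hj (Nat.add_zero l) hs (1 : WittVector p k)
  rwa [Function.iterate_zero_apply, cm, map_one, one_mul] at this

variable (p k x y z) in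
/-- Expressions of the Frobenius of the `f_j`. -/
structure FrobRelations (J : Finset ℕ) (lam : ℕ → ℕ) (c : ℕ → ℤ) (e j' : ℕ → ℕ)
    (η : ℕ → WittVector p (Localization.Away (x * y))) : Prop where
  pos : ∀ j ∈ J, 1 ≤ j
  one_le : ∀ j ∈ J, 1 ≤ lam j
  -- The term with η j is invisible in length lam j and is the first obstruction to f_j being killed
  -- by a power of F in length lam j + 1.
  rel : ∀ j ∈ J, frobW p k x y (fW p x y z j) -
    (c j • WittVector.verschiebung^[e j] (fW p x y z (j' j)) +
      WittVector.verschiebung^[lam j] (η j)) ∈ Bd p x y (lam j + 1)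
  -- The inequality keeps V^{e j} f_{j' j} inside the expected span in length lam j; the last
  -- alternative makes F decrease the pair (length, j) lexicographically.
  lower : ∀ j ∈ J, c j ≠ 0 → j' j ∈ J ∧ lam j ≤ lam (j' j) + e j ∧ (0 < e j ∨ j' j < j)

namespace FrobRelations

variable {lam : ℕ → ℕ} {c : ℕ → ℤ} {e j' : ℕ → ℕ}
  {η : ℕ → WittVector p (Localization.Away (x * y))}
  (H : FrobRelations p k x y z J lam c e j' η)

include H

/-- The bound is lam + 1 and not lam because the relation is used in length lam j + 1, where f_{j'}
may occur one step beyond its expected range. -/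
theorem frob_sub_mem_Sp {j : ℕ} (hj : j ∈ J) :
    frobW p k x y (fW p x y z j) - WittVector.verschiebung^[lam j] (η j) ∈
      Sp p k x y z J (fun j => lam j + 1) (lam j + 1) := by
  have h := Bd_le_Sp (k := k) (z := z) (J := J) (μ := fun j => lam j + 1) _ (H.rel j hj)
  have h2 : c j • WittVector.verschiebung^[e j] (fW p x y z (j' j)) ∈
      Sp p k x y z J (fun j => lam j + 1) (lam j + 1) := by
    by_cases hc : c j = 0
    · rw [hc, zero_smul]; exact zero_mem _
    · obtain ⟨h1, h2, _⟩ := H.lower j hj hc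
      refine zsmul_mem ?_ _
      have := verschiebung_mem_Sp (fW_mem_Sp (p := p) (k := k) (x := x) (y := y) (z := z)
        (μ := fun j => lam j + 1) h1 (le_refl _)) (e j)
      exact Sp_anti (by omega) this
  convert add_mem h h2 using 1
  ring

theorem frob_mem_Sp {j l : ℕ} (hj : j ∈ J) (hl : l ≤ lam j) :
    frobW p k x y (fW p x y z j) ∈ Sp p k x y z J lam l := by
  have h := Sp_succ_le _ (H.frob_sub_mem_Sp hj)
  have h2 : WittVector.verschiebung^[lam j] (η j) ∈ Sp p k x y z J lam (lam j) :=
    Bd_le_Sp _ (iterate_verschiebung_mem_Bd _ _)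
  have := add_mem h h2
  rw [sub_add_cancel] at this
  exact Sp_anti hl this

theorem frobW_mem_Sp {l : ℕ} {w : WittVector p (Localization.Away (x * y))}
    (hw : w ∈ Sp p k x y z J lam l) : frobW p k x y w ∈ Sp p k x y z J lam l := by
  have h : Sp p k x y z J lam l ≤ (Sp p k x y z J lam l).comap
      (frobW p k x y).toAddMonoidHom := by
    refine Sp_le_iff.mpr ⟨fun j hj s d c' hl hs => ?_, fun w hw => ?_⟩
    · change frobW p k x y (WittVector.verschiebung^[d] _) ∈ Sp p k x y z J lam l
      rw [map_iterate_verschiebung, map_mul, map_frobHom_map_algebraMap, ← hl]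
      exact verschiebung_mem_Sp (cm_mem_Sp (H.frob_mem_Sp hj hs) _) d
    · exact Bd_le_Sp _ (frobW_mem_Bd hw)
  exact h hw

/-- Nested induction on the length and on j: F f_j is, up to a coboundary, a multiple of V^e f_{j'},
which has smaller length if e > 0 and smaller index otherwise. -/
theorem fW_mem_Nil : ∀ s j : ℕ, j ∈ J → s ≤ lam j → fW p x y z j ∈ Nil p k x y s := by
  intro s
  induction s using Nat.strong_induction_on with
  | _ s ihs =>
  intro j
  induction j using Nat.strong_induction_on with
  | _ j ihj =>
  intro hj hs
  rw [← frobW_mem_Nil_iff]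
  have h1 : frobW p k x y (fW p x y z j) - (c j • WittVector.verschiebung^[e j] (fW p x y z (j' j)) +
      WittVector.verschiebung^[lam j] (η j)) ∈ Nil p k x y s :=
    Bd_le_Nil _ (Bd_mono (by omega) (H.rel j hj))
  have h2 : WittVector.verschiebung^[lam j] (η j) ∈ Nil p k x y s :=
    Bd_le_Nil _ (Bd_mono hs (iterate_verschiebung_mem_Bd _ _))
  have h3 : c j • WittVector.verschiebung^[e j] (fW p x y z (j' j)) ∈ Nil p k x y s := by
    by_cases hc : c j = 0
    · rw [hc, zero_smul]; exact zero_mem _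
    · obtain ⟨hj', hle, hlt⟩ := H.lower j hj hc
      refine zsmul_mem ?_ _
      rcases Nat.eq_zero_or_pos (e j) with he | he
      · rw [he, Function.iterate_zero_apply]
        exact ihj _ (by omega) hj' (by omega)
      · by_cases hes : e j ≤ s
        · have := iterate_verschiebung_mem_Nil
            (ihs (s - e j) (by have := H.one_le j hj; omega) (j' j) hj' (by omega)) (e j)
          rwa [Nat.sub_add_cancel hes] at this
        · exact Bd_le_Nil _ (Bd_mono (by omega) (iterate_verschiebung_mem_Bd (e j) _))
  have := add_mem h1 (add_mem h3 h2)
  rwa [sub_add_cancel] at this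

end FrobRelations

/-- From p = VF: a coefficient divisible by p trades f_j for V of F f_j, to which the Frobenius
relations apply. -/
theorem cm_p_mul_eq (b : WittVector p k) (w : WittVector p (Localization.Away (x * y))) :
    cm p k x y (p * b) * w =
      WittVector.verschiebung (cm p k x y (WittVector.frobenius b) * frobW p k x y w) := by
  rw [← mul_verschiebung, verschiebung_map_frobHom, cm, map_mul, map_natCast]
  ring

theorem coeff_zero_sum {A : Type u} [CommRing A] {ι : Type*} (s : Finset ι)
    (w : ι → WittVector p A) : (∑ i ∈ s, w i).coeff 0 = ∑ i ∈ s, (w i).coeff 0 :=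
  map_sum (WittVector.constantCoeff (p := p) (R := A)) w s

theorem coeff_zero_cm_mul (a : WittVector p k) (w : WittVector p (Localization.Away (x * y))) :
    (cm p k x y a * w).coeff 0 = algebraMap k _ (a.coeff 0) * w.coeff 0 := by
  rw [WittVector.mul_coeff_zero, WittVector.map_coeff]

theorem coeff_zero_fW (j : ℕ) :
    (fW p x y z j).coeff 0 = mon x y z (-1) (-j) 1 := WittVector.teichmuller_coeff_zero _ _

theorem lc_coeff_zero_sum_fW (D : DoubleCover k x y z) (J' : Finset ℕ) (a : ℕ → WittVector p k)
    (i : ℕ) : D.lc ((∑ j ∈ J', cm p k x y (a j) * fW p x y z j).coeff 0) 1 (-1) (-i) =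
      if i ∈ J' then (a i).coeff 0 else 0 := by
  rw [coeff_zero_sum, D.lc_sum]
  have h : ∀ j, D.lc ((cm p k x y (a j) * fW p x y z j).coeff 0) 1 (-1) (-i) =
      if i = j then (a j).coeff 0 else 0 := by
    intro j
    have := D.lc_mon (-1) (-j) 1 1 (-1) (-i)
    simp only [Fin.val_one] at this
    rw [coeff_zero_cm_mul, D.lc_algebraMap_mul, coeff_zero_fW, this]
    simp
  simp only [h]
  rw [Finset.sum_ite_eq]

/-- Separates the terms not divisible by V; only these are seen by the zeroth component. -/
theorem exists_top_decomp {l : ℕ} {w : WittVector p (Localization.Away (x * y))}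
    (hw : w ∈ Sp p k x y z J μ (l + 1)) :
    ∃ (a : ℕ → WittVector p k) (s : WittVector p (Localization.Away (x * y))),
      s ∈ Sp p k x y z J μ l ∧
      w - (∑ j ∈ J with l + 1 ≤ μ j, cm p k x y (a j) * fW p x y z j +
        WittVector.verschiebung s) ∈ Bd p x y (l + 1) := by
  let G : AddSubgroup (WittVector p (Localization.Away (x * y))) :=
    { carrier := {w | ∃ (a : ℕ → WittVector p k) (s : WittVector p (Localization.Away (x * y))),
        s ∈ Sp p k x y z J μ l ∧
        w - (∑ j ∈ J with l + 1 ≤ μ j, cm p k x y (a j) * fW p x y z j +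
          WittVector.verschiebung s) ∈ Bd p x y (l + 1)}
      zero_mem' := ⟨0, 0, zero_mem _, by simp [cm]⟩
      add_mem' := by
        rintro u v ⟨a, s, hs, h⟩ ⟨a', s', hs', h'⟩
        refine ⟨a + a', s + s', add_mem hs hs', ?_⟩
        convert add_mem h h' using 1
        simp only [Pi.add_apply, cm, map_add, add_mul, Finset.sum_add_distrib]
        ring
      neg_mem' := by
        rintro u ⟨a, s, hs, h⟩
        refine ⟨-a, -s, neg_mem hs, ?_⟩
        convert neg_mem h using 1
        simp only [Pi.neg_apply, cm, map_neg, neg_mul, Finset.sum_neg_distrib]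
        ring }
  have h : Sp p k x y z J μ (l + 1) ≤ G := by
    refine Sp_le_iff.mpr ⟨fun j hj s d c hl hs => ?_, fun w hw => ?_⟩
    · rcases d with _ | d
      · refine ⟨fun i => if i = j then c else 0, 0, zero_mem _, ?_⟩
        have : ∑ i ∈ J with l + 1 ≤ μ i, cm p k x y (if i = j then c else 0) * fW p x y z i =
            cm p k x y c * fW p x y z j := by
          rw [Finset.sum_eq_single j]
          · rw [if_pos rfl]
          · intro b _ hb; rw [if_neg hb]; simp [cm]
          · intro hn; exact absurd (Finset.mem_filter.mpr ⟨hj, by omega⟩) hn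
        rw [this]
        simp
      · refine ⟨0, WittVector.verschiebung^[d] (cm p k x y c * fW p x y z j),
          gen_mem_Sp hj (by omega) hs c, ?_⟩
        rw [Function.iterate_succ_apply']
        simp [cm]
    · exact ⟨0, 0, zero_mem _, by simpa [cm] using hw⟩
  exact h hw

/-- Measures the failure to lie in the span one length further: a term with s < μ j persists with s
+ 1, so only those with s = μ j and an arbitrary last component V^l u remain. -/
theorem exists_last_decomp {l : ℕ} {w : WittVector p (Localization.Away (x * y))}
    (hw : w ∈ Sp p k x y z J μ l) :
    ∃ (a : ℕ → WittVector p k) (u : WittVector p (Localization.Away (x * y))),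
      w - (∑ j ∈ J with μ j ≤ l,
        WittVector.verschiebung^[l - μ j] (cm p k x y (a j) * fW p x y z j) +
          WittVector.verschiebung^[l] u) ∈ Sp p k x y z J μ (l + 1) := by
  let G : AddSubgroup (WittVector p (Localization.Away (x * y))) :=
    { carrier := {w | ∃ (a : ℕ → WittVector p k) (u : WittVector p (Localization.Away (x * y))),
        w - (∑ j ∈ J with μ j ≤ l,
          WittVector.verschiebung^[l - μ j] (cm p k x y (a j) * fW p x y z j) +
            WittVector.verschiebung^[l] u) ∈ Sp p k x y z J μ (l + 1)}
      zero_mem' := ⟨0, 0, by simp [cm]⟩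
      add_mem' := by
        rintro u v ⟨a, s, h⟩ ⟨a', s', h'⟩
        refine ⟨a + a', s + s', ?_⟩
        convert add_mem h h' using 1
        simp only [Pi.add_apply, cm, map_add, add_mul, iterate_map_add, Finset.sum_add_distrib]
        ring
      neg_mem' := by
        rintro u ⟨a, s, h⟩
        refine ⟨-a, -s, ?_⟩
        convert neg_mem h using 1
        simp only [Pi.neg_apply, cm, map_neg, neg_mul, iterate_map_neg, Finset.sum_neg_distrib]
        ring }
  have h : Sp p k x y z J μ l ≤ G := by
    refine Sp_le_iff.mpr ⟨fun j hj s d c hl hs => ?_, fun w hw => ?_⟩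
    · rcases Nat.lt_or_ge s (μ j) with hlt | hge
      · refine ⟨0, 0, ?_⟩
        have := gen_mem_Sp (x := x) (y := y) (z := z) (μ := μ) hj
          (by omega : s + 1 + d = l + 1) hlt c
        simpa [cm] using this
      · obtain rfl : s = μ j := le_antisymm hs hge
        refine ⟨fun i => if i = j then c else 0, 0, ?_⟩
        have : ∑ i ∈ J with μ i ≤ l, WittVector.verschiebung^[l - μ i]
            (cm p k x y (if i = j then c else 0) * fW p x y z i) =
            WittVector.verschiebung^[d] (cm p k x y c * fW p x y z j) := by
          rw [Finset.sum_eq_single j]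
          · rw [if_pos rfl, show l - μ j = d by omega]
          · intro b _ hb; rw [if_neg hb]; simp [cm]
          · intro hn; exact absurd (Finset.mem_filter.mpr ⟨hj, by omega⟩) hn
        rw [this]
        simp
    · obtain ⟨u, hu⟩ := exists_sub_mem_Bd hw
      exact ⟨0, u, Bd_le_Sp _ (by simpa [cm] using hu)⟩
  exact h hw

/-- The places where the `f_j` have no coefficient. -/
def OffSupport (J : Finset ℕ) (ε : Fin 2) (i j : ℤ) : Prop :=
  i < 0 ∧ j < 0 ∧ ∀ j' ∈ J, ¬(ε = 1 ∧ i = -1 ∧ j = -(j' : ℤ))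

theorem lc_mon_of_offSupport (D : DoubleCover k x y z) {ε : Fin 2} {i j : ℤ}
    (h : OffSupport J ε i j) {j' : ℕ} (hj' : j' ∈ J) :
    D.lc (mon x y z (-1) (-j') 1) ε i j = 0 := by
  have := D.lc_mon (-1) (-j') 1 ε i j
  simp only [Fin.val_one] at this
  rw [this, if_neg]
  rintro ⟨h1, h2, h3⟩
  exact h.2.2 j' hj' ⟨h3, h1, h2⟩

theorem lc_eq_zero_of_mem_Sp_one (D : DoubleCover k x y z)
    {v : WittVector p (Localization.Away (x * y))} (hv : v ∈ Sp p k x y z J μ 1)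
    {ε : Fin 2} {i j : ℤ} (h : OffSupport J ε i j) : D.lc (v.coeff 0) ε i j = 0 := by
  have hle : Sp p k x y z J μ 1 ≤ ((D.lcHom ε i j).comp
      (WittVector.constantCoeff (p := p)).toAddMonoidHom).ker := by
    refine Sp_le_iff.mpr ⟨fun j' hj s d c hl hs => ?_, fun w hw => ?_⟩
    · change D.lc ((WittVector.verschiebung^[d] (cm p k x y c * fW p x y z j')).coeff 0) ε i j = 0
      rcases d with _ | d
      · rw [Function.iterate_zero_apply, coeff_zero_cm_mul, D.lc_algebraMap_mul, coeff_zero_fW,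
          lc_mon_of_offSupport D h hj, mul_zero]
      · rw [WittVector.iterate_verschiebung_coeff_eq_zero _ (Nat.succ_pos d), D.lc_zero]
    · exact (mem_Bd_one_iff D).mp hw ε i j h.1 h.2.1
  exact hle hv

/-- In length one the coefficients themselves give the combination: subtracting their Teichmüller
multiples of the f_j leaves a coboundary. -/
theorem mem_Sp_one (D : DoubleCover k x y z) (hμ : ∀ j ∈ J, 1 ≤ μ j)
    {v : WittVector p (Localization.Away (x * y))}
    (hv : ∀ ε i j, OffSupport J ε i j → D.lc (v.coeff 0) ε i j = 0) :
    v ∈ Sp p k x y z J μ 1 := by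
  set a : ℕ → WittVector p k := fun j =>
    WittVector.teichmuller p (D.lc (v.coeff 0) 1 (-1) (-j)) with ha
  have h : v - ∑ j ∈ J, cm p k x y (a j) * fW p x y z j ∈ Bd p x y 1 := by
    rw [mem_Bd_one_iff D]
    intro ε i j hi hj
    rw [sub_coeff_zero, D.lc_sub]
    by_cases hs : OffSupport J ε i j
    · rw [hv ε i j hs, coeff_zero_sum, D.lc_sum, Finset.sum_eq_zero, sub_zero]
      intro j' hj'
      rw [coeff_zero_cm_mul, D.lc_algebraMap_mul, coeff_zero_fW, lc_mon_of_offSupport D hs hj',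
        mul_zero]
    · have : ∃ j' ∈ J, ε = 1 ∧ i = -1 ∧ j = -(j' : ℤ) := by
        by_contra hc
        push Not at hc
        exact hs ⟨hi, hj, fun j' hj' h => hc j' hj' h.1 h.2.1 h.2.2⟩
      obtain ⟨j', hj', rfl, rfl, rfl⟩ := this
      rw [lc_coeff_zero_sum_fW D, if_pos hj', ha, WittVector.teichmuller_coeff_zero, sub_self]
  have h2 : ∑ j ∈ J, cm p k x y (a j) * fW p x y z j ∈ Sp p k x y z J μ 1 :=
    sum_mem fun j hj => cm_mem_Sp (fW_mem_Sp hj (hμ j hj)) _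
  have := add_mem (Bd_le_Sp 1 h) h2
  rwa [sub_add_cancel] at this

namespace FrobRelations

variable {lam : ℕ → ℕ} {c : ℕ → ℤ} {e j' : ℕ → ℕ}
  {η : ℕ → WittVector p (Localization.Away (x * y))}
  (H : FrobRelations p k x y z J lam c e j' η) (D : DoubleCover k x y z)

include H D

/-- A linear combination of the f_j that is divisible by V has all its coefficients divisible by p.
Since p f_j = V F f_j and F f_j is again in the span, V can be cancelled throughout. -/
theorem mem_Sp_of_verschiebung {l : ℕ} {w : WittVector p (Localization.Away (x * y))}
    (hw : WittVector.verschiebung w ∈ Sp p k x y z J (fun j => lam j + 1) (l + 1)) :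
    w ∈ Sp p k x y z J (fun j => lam j + 1) l := by
  obtain ⟨a, s, hs, h⟩ := exists_top_decomp hw
  set J' := {j ∈ J | l + 1 ≤ lam j + 1} with hJ'
  -- The coefficient of x^{-1} y^{-j} z in the zeroth component picks out the constant term of a_j.
  have h1 : ∀ j ∈ J', (a j).coeff 0 = 0 := by
    intro j hj
    have hm := (mem_Bd_one_iff D).mp (Bd_mono (Nat.le_add_left 1 l) h) 1 (-1) (-j) (by omega)
      (by have := H.pos j (Finset.mem_filter.mp hj).1; omega)
    rw [sub_coeff_zero, WittVector.add_coeff_zero, WittVector.verschiebung_coeff_zero,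
      WittVector.verschiebung_coeff_zero, add_zero, zero_sub, D.lc_neg, lc_coeff_zero_sum_fW D,
      if_pos hj, neg_eq_zero] at hm
    exact hm
  have h2 : ∀ j, ∃ b, j ∈ J' → a j = p * b := by
    intro j
    by_cases hj : j ∈ J'
    · obtain ⟨b, hb⟩ := eq_p_mul_of_not_isUnit (a := a j) (fun hu => by
        have := hu.map (WittVector.constantCoeff (p := p) (R := k))
        exact this.ne_zero (h1 j hj))
      exact ⟨b, fun _ => hb⟩
    · exact ⟨0, fun h => absurd h hj⟩
  choose b hb using h2
  have h3 : ∑ j ∈ J', cm p k x y (a j) * fW p x y z j = WittVector.verschiebung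
      (∑ j ∈ J', cm p k x y (WittVector.frobenius (b j)) * frobW p k x y (fW p x y z j)) := by
    rw [map_sum]
    exact Finset.sum_congr rfl fun j hj => by rw [hb j hj, cm_p_mul_eq]
  rw [h3, ← map_add, ← map_sub] at h
  have h4 := Bd_le_Sp (k := k) (z := z) (J := J) (μ := fun j => lam j + 1) _
    (mem_Bd_of_verschiebung D h)
  have h5 : ∑ j ∈ J', cm p k x y (WittVector.frobenius (b j)) * frobW p k x y (fW p x y z j) ∈
      Sp p k x y z J (fun j => lam j + 1) l :=
    sum_mem fun j hj => cm_mem_Sp (Sp_mono (fun j _ => Nat.le_succ _) _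
      (H.frob_mem_Sp (Finset.mem_filter.mp hj).1
        (Nat.le_of_succ_le_succ (Finset.mem_filter.mp hj).2))) _
  have := add_mem h4 (add_mem h5 hs)
  rwa [sub_add_cancel] at this

theorem mem_Sp_one_of_iterate {l : ℕ} {w : WittVector p (Localization.Away (x * y))}
    (hw : WittVector.verschiebung^[l] w ∈ Sp p k x y z J (fun j => lam j + 1) (l + 1)) :
    w ∈ Sp p k x y z J (fun j => lam j + 1) 1 := by
  induction l with
  | zero => exact hw
  | succ l ih =>
    rw [Function.iterate_succ_apply'] at hw
    exact ih (H.mem_Sp_of_verschiebung D hw)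

variable (K : ∀ (u : Localization.Away (x * y)) (d : ℕ → k),
  (∀ ε i j, OffSupport J ε i j →
    D.lc (u ^ p + ∑ t ∈ J, algebraMap k _ (d t) * (η t).coeff 0) ε i j = 0) →
  (∀ t ∈ J, d t = 0) ∧ ∀ ε i j, OffSupport J ε i j → D.lc u ε i j = 0)

include K

/-- The lifting step. The hypothesis `K` says that the leading coefficients of the η_t are linearly
independent modulo p-th powers and the span of the f_j, and that Frobenius reflects membership in
that span. Applied to the obstruction terms of w, it removes them one and all. -/
theorem mem_Sp_succ {l : ℕ} {w : WittVector p (Localization.Away (x * y))}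
    (hw : w ∈ Sp p k x y z J lam l) (hφ : frobW p k x y w ∈ Sp p k x y z J lam (l + 1)) :
    w ∈ Sp p k x y z J lam (l + 1) := by
  obtain ⟨a, u, h⟩ := exists_last_decomp hw
  set J' := {j ∈ J | lam j ≤ l} with hJ'
  set v : WittVector p (Localization.Away (x * y)) := frobW p k x y u + ∑ j ∈ J', cm p k x y
    (WittVector.frobenius^[lam j] (WittVector.frobenius (a j))) * η j with hv
  -- Apply F to the decomposition of w: each F f_j contributes V^{lam j} η_j up to the span, and
  -- V^{l - lam j} brings all these terms to V^l.
  have h1 : WittVector.verschiebung^[l] v ∈ Sp p k x y z J (fun j => lam j + 1) (l + 1) := by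
    have e1 := Sp_mono (μ' := fun j => lam j + 1) (fun j _ => Nat.le_succ _) _
      (sub_mem hφ (H.frobW_mem_Sp h))
    rw [← map_sub, sub_sub_cancel, map_add, map_sum, map_iterate_verschiebung] at e1
    have e2 : ∑ j ∈ J', WittVector.verschiebung^[l - lam j]
        (cm p k x y (WittVector.frobenius (a j)) * (frobW p k x y (fW p x y z j) -
          WittVector.verschiebung^[lam j] (η j))) ∈
        Sp p k x y z J (fun j => lam j + 1) (l + 1) := by
      refine sum_mem fun j hj => ?_
      obtain ⟨hj, hjl⟩ := Finset.mem_filter.mp hj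
      have := verschiebung_mem_Sp (cm_mem_Sp (H.frob_sub_mem_Sp hj) (WittVector.frobenius (a j)))
        (l - lam j)
      rwa [show lam j + 1 + (l - lam j) = l + 1 by omega] at this
    convert sub_mem e1 e2 using 1
    rw [hv, iterate_map_add, add_comm, add_sub_right_comm]
    congr 1
    rw [← Finset.sum_sub_distrib]
    have e3 : ∀ (s : Finset ℕ) (f : ℕ → WittVector p (Localization.Away (x * y))),
        WittVector.verschiebung^[l] (∑ j ∈ s, f j) =
          ∑ j ∈ s, WittVector.verschiebung^[l] (f j) := fun s f =>
      map_sum (AddMonoidHom.mk' (WittVector.verschiebung^[l]) (fun a b => iterate_map_add _ l a b))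
        f s
    rw [e3]
    refine Finset.sum_congr rfl fun j hj => ?_
    obtain ⟨hj, hjl⟩ := Finset.mem_filter.mp hj
    rw [map_iterate_verschiebung, ← iterate_map_sub, map_mul, map_frobHom_map_algebraMap, mul_sub,
      sub_sub_cancel, iterate_mul_verschiebung, ← Function.iterate_add_apply,
      Nat.sub_add_cancel hjl]
  have h2 := H.mem_Sp_one_of_iterate D h1
  -- Indices with lam t > l do not occur in the decomposition; they get coefficient zero.
  obtain ⟨hd, hu⟩ := K (u.coeff 0) (fun t => if t ∈ J' then
      (WittVector.frobenius^[lam t] (WittVector.frobenius (a t))).coeff 0 else 0) (by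
    intro ε i j hs
    have := lc_eq_zero_of_mem_Sp_one D h2 hs
    rw [hv, WittVector.add_coeff_zero, coeff_zero_sum, WittVector.map_coeff] at this
    refine Eq.trans ?_ this
    congr 2
    rw [hJ', Finset.sum_filter]
    refine Finset.sum_congr rfl fun t ht => ?_
    by_cases hl : lam t ≤ l
    · rw [if_pos hl, if_pos (Finset.mem_filter.mpr ⟨ht, hl⟩), coeff_zero_cm_mul]
    · rw [if_neg hl]; simp [hl])
  have h3 : WittVector.verschiebung^[l] u ∈ Sp p k x y z J lam (l + 1) := by
    have := verschiebung_mem_Sp (mem_Sp_one D H.one_le hu) l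
    rwa [add_comm] at this
  have h4 : ∑ j ∈ J', WittVector.verschiebung^[l - lam j] (cm p k x y (a j) * fW p x y z j) ∈
      Sp p k x y z J lam (l + 1) := by
    refine sum_mem fun j hj => ?_
    obtain ⟨hjJ, hjl⟩ := Finset.mem_filter.mp hj
    -- Frobenius is injective on k, so the vanishing of a p-power of the constant term of a_j
    -- suffices. Then a_j is divisible by p and its term is V^{l - lam j + 1} of a multiple of F
    -- f_j.
    have ha : (a j).coeff 0 = 0 := by
      have h5 := hd j hjJ
      rw [if_pos hj] at h5
      have h6 : ∀ (m : ℕ) (b : WittVector p k),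
          (WittVector.frobenius^[m] b).coeff 0 = 0 → b.coeff 0 = 0 := by
        intro m
        induction m with
        | zero => intro b hb; exact hb
        | succ m ih =>
          intro b hb
          rw [Function.iterate_succ_apply] at hb
          have := ih _ hb
          rw [WittVector.coeff_frobenius_charP] at this
          exact pow_eq_zero_iff (Fact.out : p.Prime).ne_zero |>.mp this
      exact h6 (lam j + 1) _ (by rwa [Function.iterate_succ_apply])
    obtain ⟨b, hb⟩ := eq_p_mul_of_not_isUnit (a := a j) (fun hu => by
      have := hu.map (WittVector.constantCoeff (p := p) (R := k))
      exact this.ne_zero ha)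
    rw [hb, cm_p_mul_eq]
    have := verschiebung_mem_Sp (cm_mem_Sp (H.frob_mem_Sp hjJ le_rfl) (WittVector.frobenius b))
      (l - lam j + 1)
    rw [show lam j + (l - lam j + 1) = l + 1 by omega] at this
    rwa [Function.iterate_succ_apply] at this
  have := add_mem h (add_mem h4 h3)
  rwa [sub_add_cancel] at this

/-- Outer induction on the length puts w into the span in length l; inner induction on the power of
Frobenius puts Fw into the span in length l + 1. -/
theorem Nil_le_Sp (l : ℕ) : Nil p k x y l ≤ Sp p k x y z J lam l := by
  induction l with
  | zero => intro w _; exact Bd_le_Sp 0 (by rw [Bd_zero]; trivial)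
  | succ l ih =>
    rintro w ⟨m, hm⟩
    induction m generalizing w with
    | zero => exact Bd_le_Sp _ hm
    | succ m ihm =>
      rw [Function.iterate_succ_apply] at hm
      refine H.mem_Sp_succ D K (ih ?_) (ihm hm)
      exact frobW_mem_Nil_iff.mp (Nil_mono (Nat.le_succ l) ⟨m, hm⟩)

end FrobRelations

end Criterion

/-! ### The elements `f_j^{(l)}` of the colimit -/

section Generators

variable (p : ℕ) [Fact p.Prime] (k : Type u) [Field k] [CharP k p] [PerfectRing k p]
  {R : Type u} [CommRing R] [Algebra k R] (x y z : R)

open Classical in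
/-- The element of the colimit represented by the Teichmüller lift of `z / (x y^j)` in length `l`. -/
def fel (l j : ℕ) : LocalWittCohomology p k x y :=
  if h : fW p x y z j ∈ Nil p k x y l then el p k x y l ⟨_, h⟩ else 0

variable {p k x y z}

theorem fel_eq {l j : ℕ} (h : fW p x y z j ∈ Nil p k x y l) :
    fel p k x y z l j = el p k x y l ⟨_, h⟩ := dif_pos h

theorem el_eq_zero_of_mem_Bd {l : ℕ} {w : Nil p k x y l} (h : w.1 ∈ Bd p x y l) :
    el p k x y l w = 0 := by
  obtain ⟨hv, he⟩ := el_congr (zero_mem (Nil p k x y l)) (v := w.1) (by rwa [sub_zero])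
  exact he.trans (map_zero _)

theorem fel_zero (j : ℕ) : fel p k x y z 0 j = 0 := by
  have h : fW p x y z j ∈ Nil p k x y 0 := Bd_le_Nil 0 (by rw [Bd_zero]; trivial)
  rw [fel_eq h]
  exact el_eq_zero_of_mem_Bd (by rw [Bd_zero]; trivial)

theorem fel_eq_el {l d j : ℕ} (h : fW p x y z j ∈ Nil p k x y l) :
    fel p k x y z l j = el p k x y (l + d)
      ⟨WittVector.verschiebung^[d] (fW p x y z j), iterate_verschiebung_mem_Nil h d⟩ := by
  rw [fel_eq h, el_iterate_verschiebung ⟨_, h⟩]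

namespace FrobRelations

/-- The index set of the basis, with the lexicographic order. -/
def indexSet (J : Finset ℕ) (lam : ℕ → ℕ) : Finset (ℕ ×ₗ ℕ) :=
  (J.sigma fun j => Finset.Icc 1 (lam j)).image fun s => toLex (s.2, s.1)

theorem mem_indexSet {J : Finset ℕ} {lam : ℕ → ℕ} {l j : ℕ} :
    toLex (l, j) ∈ indexSet J lam ↔ j ∈ J ∧ 1 ≤ l ∧ l ≤ lam j := by
  simp only [indexSet, Finset.mem_image, Finset.mem_sigma, Finset.mem_Icc]
  constructor
  · rintro ⟨⟨j', l'⟩, ⟨h1, h2, h3⟩, h⟩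
    obtain ⟨rfl, rfl⟩ := Prod.mk.inj (toLex.injective h)
    exact ⟨h1, h2, h3⟩
  · rintro ⟨h1, h2, h3⟩
    exact ⟨⟨j, l⟩, ⟨h1, h2, h3⟩, rfl⟩

theorem card_indexSet (J : Finset ℕ) (lam : ℕ → ℕ) :
    (indexSet J lam).card = ∑ j ∈ J, lam j := by
  rw [indexSet, Finset.card_image_of_injective, Finset.card_sigma]
  · simp
  · rintro ⟨j, l⟩ ⟨j', l'⟩ h
    obtain ⟨rfl, rfl⟩ := Prod.mk.inj (toLex.injective h)
    rfl

variable {J : Finset ℕ} {lam : ℕ → ℕ} {c : ℕ → ℤ} {e j' : ℕ → ℕ}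
  {η : ℕ → WittVector p (Localization.Away (x * y))}
  (H : FrobRelations p k x y z J lam c e j' η)

include H

theorem V_smul_fel {l j : ℕ} (hj : j ∈ J) (hl : l + 1 ≤ lam j) :
    DieudonneRing.V p k • fel p k x y z (l + 1) j = fel p k x y z l j := by
  rw [fel_eq (H.fW_mem_Nil (l + 1) j hj hl), V_smul_el,
    fel_eq_el (d := 1) (H.fW_mem_Nil l j hj (by omega))]
  rfl

theorem F_smul_fel {l j : ℕ} (hj : j ∈ J) (hl : l ≤ lam j) :
    DieudonneRing.F p k • fel p k x y z l j = c j • fel p k x y z (l - e j) (j' j) := by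
  have h0 := H.fW_mem_Nil l j hj hl
  have h1 : frobW p k x y (fW p x y z j) -
      c j • WittVector.verschiebung^[e j] (fW p x y z (j' j)) ∈ Bd p x y l := by
    have h1 := Bd_mono (hl.trans (Nat.le_succ _)) (H.rel j hj)
    have h2 := Bd_mono hl (iterate_verschiebung_mem_Bd (lam j) (η j))
    convert add_mem h1 h2 using 1
    ring
  rw [fel_eq h0, F_smul_el]
  by_cases hc : c j = 0
  · rw [hc, zero_smul] at h1 ⊢
    rw [sub_zero] at h1
    exact el_eq_zero_of_mem_Bd h1
  · obtain ⟨hj', hle, _⟩ := H.lower j hj hc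
    by_cases hel : e j ≤ l
    · have h2 := H.fW_mem_Nil (l - e j) (j' j) hj' (by omega)
      have h3 := iterate_verschiebung_mem_Nil h2 (e j)
      rw [fel_eq_el (d := e j) h2]
      rw [← map_zsmul, ← sub_eq_zero]
      have h4 : ∀ (m : ℕ) (hm : m = l) (hw : WittVector.verschiebung^[e j] (fW p x y z (j' j)) ∈
          Nil p k x y m), el p k x y l ⟨_, frobW_mem_Nil_iff.mpr h0⟩ -
          el p k x y m (c j • ⟨_, hw⟩) = 0 := by
        rintro m rfl hw
        rw [← map_sub]
        exact el_eq_zero_of_mem_Bd h1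
      exact h4 _ (Nat.sub_add_cancel hel) h3
    -- If e j > l, the right-hand side vanishes in length l; this agrees with the truncated
    -- subtraction because the element of length 0 is zero.
    · have h2 : WittVector.verschiebung^[e j] (fW p x y z (j' j)) ∈ Bd p x y l :=
        Bd_mono (by omega) (iterate_verschiebung_mem_Bd _ _)
      rw [show l - e j = 0 by omega, fel_zero, smul_zero]
      refine el_eq_zero_of_mem_Bd ?_
      convert add_mem h1 (zsmul_mem h2 (c j)) using 1
      simp

theorem isRepresentedBy_fel {l j : ℕ} (hj : j ∈ J) (hl : l ≤ lam j) :
    IsRepresentedBy (fel p k x y z l j) (cls p x y l (WittVector.truncate l (fW p x y z j))) := by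
  rw [fel_eq (H.fW_mem_Nil l j hj hl)]
  exact isRepresentedBy_el _

variable (D : DoubleCover k x y z)

-- Combines `Nil_le_Sp` with the description of the colimit by Witt vectors: every element is
-- represented by a combination of the V^d(c f_j).
include D in
theorem span_fel_eq_top
    (hN : ∀ l, Nil p k x y l ≤ Sp p k x y z J lam l) :
    Submodule.span (WittVector p k) ((fun t : ℕ ×ₗ ℕ => fel p k x y z (ofLex t).1 (ofLex t).2) ''
      (indexSet J lam)) = ⊤ := by
  rw [eq_top_iff]
  intro g _
  obtain ⟨l, w, rfl⟩ := exists_el g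
  set N := Submodule.span (WittVector p k)
    ((fun t : ℕ ×ₗ ℕ => fel p k x y z (ofLex t).1 (ofLex t).2) '' (indexSet J lam))
  have hle : Sp p k x y z J lam l ≤
      (N.toAddSubgroup.comap (el p k x y l)).map (Nil p k x y l).subtype := by
    refine Sp_le_iff.mpr ⟨fun j hj s d c' hl hs => ?_, fun w hw => ?_⟩
    · subst hl
      have h1 := H.fW_mem_Nil s j hj hs
      have h2 := constMul_mem_Nil h1 c'
      refine ⟨⟨_, iterate_verschiebung_mem_Nil h2 d⟩, ?_, rfl⟩
      change el p k x y (s + d) _ ∈ N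
      rw [el_iterate_verschiebung ⟨_, h2⟩]
      -- In length s a scalar acts through σ^{-s}, so multiplication by c' is the action of σ^s(c').
      have h3 := smul_el (WittVector.frobenius^[s] c') ⟨_, h1⟩
      simp only [sigmaInv_iterate_frobenius] at h3
      rw [← h3, ← fel_eq h1]
      refine Submodule.smul_mem _ _ ?_
      rcases Nat.eq_zero_or_pos s with rfl | hs0
      · rw [fel_zero]; exact zero_mem _
      · exact Submodule.subset_span ⟨toLex (s, j), mem_indexSet.mpr ⟨hj, hs0, hs⟩, rfl⟩
    · refine ⟨⟨w, Bd_le_Nil l hw⟩, ?_, rfl⟩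
      change el p k x y l _ ∈ N
      rw [el_eq_zero_of_mem_Bd hw]
      exact zero_mem _
  obtain ⟨w', hw', he⟩ := hle (hN l w.2)
  obtain rfl : w' = w := Subtype.ext he
  exact hw'

-- In length l all lexicographically smaller elements have no coefficient at x^{-1} y^{-j} z in the
-- zeroth component: those of smaller length are divisible by V, those of equal length are other
-- monomials. The element itself has coefficient 1 there.
include D in
theorem fel_notMem {l j : ℕ} (ht : toLex (l, j) ∈ indexSet J lam) :
    fel p k x y z l j ∉ lowerSpan (p := p) (k := k) (indexSet J lam)
      (fun t : ℕ ×ₗ ℕ => fel p k x y z (ofLex t).1 (ofLex t).2) (toLex (l, j)) := by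
  obtain ⟨hj, hl1, hl⟩ := mem_indexSet.mp ht
  let X : Submodule (WittVector p k) (LocalWittCohomology p k x y) :=
    { carrier := {g | ∃ w : Nil p k x y l, g = el p k x y l w ∧ D.lc (w.1.coeff 0) 1 (-1) (-j) = 0}
      zero_mem' := ⟨0, (map_zero _).symm, by
        rw [ZeroMemClass.coe_zero, WittVector.zero_coeff, D.lc_zero]⟩
      add_mem' := by
        rintro _ _ ⟨v, rfl, hv⟩ ⟨w, rfl, hw⟩
        refine ⟨v + w, (map_add _ _ _).symm, ?_⟩
        rw [AddMemClass.coe_add, WittVector.add_coeff_zero, D.lc_add, hv, hw, add_zero]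
      smul_mem' := by
        rintro a _ ⟨v, rfl, hv⟩
        refine ⟨_, smul_el a v, ?_⟩
        rw [coeff_zero_cm_mul, D.lc_algebraMap_mul, hv, mul_zero] }
  have hle : lowerSpan (p := p) (k := k) (indexSet J lam)
      (fun t : ℕ ×ₗ ℕ => fel p k x y z (ofLex t).1 (ofLex t).2) (toLex (l, j)) ≤ X := by
    rw [lowerSpan, Submodule.span_le]
    rintro _ ⟨⟨l', i⟩, ⟨hs, hlt⟩, rfl⟩
    obtain ⟨hi, hl1', hl'⟩ := mem_indexSet.mp hs
    change fel p k x y z l' i ∈ X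
    have h1 := H.fW_mem_Nil l' i hi hl'
    rcases Prod.Lex.toLex_lt_toLex.mp hlt with h | ⟨h, h2⟩
    · simp only at h
      obtain ⟨d, rfl⟩ := Nat.exists_eq_add_of_lt h
      refine ⟨_, fel_eq_el (d := d + 1) h1, ?_⟩
      simp only
      rw [Function.iterate_succ_apply', WittVector.verschiebung_coeff_zero, D.lc_zero]
    · simp only at h h2
      subst h
      refine ⟨_, fel_eq h1, ?_⟩
      have := D.lc_mon (-1) (-i) 1 1 (-1) (-j)
      simp only [Fin.val_one] at this
      rw [coeff_zero_fW, this, if_neg]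
      rintro ⟨_, h3, _⟩
      omega
  intro hmem
  obtain ⟨w, hw, hw0⟩ := hle hmem
  have h1 := H.fW_mem_Nil l j hj hl
  rw [fel_eq h1, ← sub_eq_zero, ← map_sub, el_eq_zero_iff D] at hw
  have h2 := (mem_Bd_one_iff D).mp (Bd_mono hl1 hw) 1 (-1) (-j) (by omega)
    (by have := H.pos j hj; omega)
  have := D.lc_mon (-1) (-j) 1 1 (-1) (-j)
  simp only [Fin.val_one] at this
  rw [AddSubgroupClass.coe_sub, sub_coeff_zero, D.lc_sub, hw0, coeff_zero_fW, this] at h2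
  simp at h2

end FrobRelations

end Generators

/-! ### From Frobenius relations to a presentation -/

section Presentation

variable {p : ℕ} [Fact p.Prime] {k : Type u} [Field k] [CharP k p] [PerfectRing k p]

theorem frac_eq_mon (h : MvPowerSeries (Fin 3) k) (j : ℕ) :
    frac h j = mon (var h 0) (var h 1) (var h 2) (-1) (-j) 1 := by
  rw [frac, mon, ← coe_xU, ← coe_yU (var h 0)]
  simp only [Ring.inverse_unit, Int.toNat_natCast, Int.toNat_neg_natCast, pow_zero, mul_one,
    zpow_neg, zpow_one, zpow_natCast, pow_one]
  rw [← inv_pow, Units.val_pow_eq_pow_val]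
  ring

theorem fClass_eq (h : MvPowerSeries (Fin 3) k) (l j : ℕ) :
    fClass p h l j = cls p _ _ l (WittVector.truncate l (fW p (var h 0) (var h 1) (var h 2) j)) := by
  rw [fClass, frac_eq_mon, fW]

open DieudonneRing

theorem lowerSpan_congr {P : Type u} [AddCommGroup P] [Module (WittVector p k) P] {α : Type*}
    [LinearOrder α] (T : Finset α) {e e' : α → P} (h : ∀ t ∈ T, e t = e' t) (t : α) :
    lowerSpan (p := p) (k := k) T e t = lowerSpan T e' t := by
  unfold lowerSpan
  congr 1
  exact Set.image_congr fun t (ht : t ∈ T ∧ _) => h t ht.1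

/-- Here `E l j` is a word in the chosen generators lifting f_j^{(l)}. The hypotheses say that the
listed relations already imply the action of F and V on these words and hold in the colimit, so the
quotient by the relations is triangular. The integers κ may differ from c, since only their effect
on the f_j^{(l)} matters. -/
theorem hasPresentation_of_relations {h : MvPowerSeries (Fin 3) k}
    (D : DoubleCover k (var h 0) (var h 1) (var h 2))
    {J : Finset ℕ} {lam : ℕ → ℕ} {c : ℕ → ℤ} {e j' : ℕ → ℕ}
    {η : ℕ → WittVector p (Localization.Away (var h 0 * var h 1))}
    (H : FrobRelations p k (var h 0) (var h 1) (var h 2) J lam c e j' η)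
    (K : ∀ (u : Localization.Away (var h 0 * var h 1)) (d : ℕ → k),
      (∀ ε i j, OffSupport J ε i j →
        D.lc (u ^ p + ∑ t ∈ J, algebraMap k _ (d t) * (η t).coeff 0) ε i j = 0) →
      (∀ t ∈ J, d t = 0) ∧ ∀ ε i j, OffSupport J ε i j → D.lc u ε i j = 0)
    {ι : Type} (gen : ι → ℕ × ℕ) (rels : Set (ι →₀ DieudonneRing p k))
    (E : ℕ → ℕ → (ι →₀ DieudonneRing p k)) (κ : ℕ → ℤ)
    (hgen : ∀ i, (gen i).2 ∈ J ∧ 1 ≤ (gen i).1 ∧ (gen i).1 ≤ lam (gen i).2 ∧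
      E (gen i).1 (gen i).2 = Finsupp.single i 1)
    (hE0 : ∀ j, E 0 j = 0)
    (hEV : ∀ j ∈ J, ∀ l, l + 1 ≤ lam j →
      V p k • E (l + 1) j - E l j ∈ Submodule.span (DieudonneRing p k) rels)
    (hκ : ∀ j ∈ J, κ j ≠ 0 → c j ≠ 0)
    (hEF : ∀ j ∈ J, ∀ l, 1 ≤ l → l ≤ lam j →
      F p k • E l j - κ j • E (l - e j) (j' j) ∈ Submodule.span (DieudonneRing p k) rels)
    (hEg : ∀ j ∈ J, ∀ l, 1 ≤ l → l ≤ lam j → Finsupp.linearCombination (DieudonneRing p k)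
      (fun i => fel p k (var h 0) (var h 1) (var h 2) (gen i).1 (gen i).2) (E l j) =
        fel p k (var h 0) (var h 1) (var h 2) l j)
    (hrel : ∀ ρ ∈ rels, Finsupp.linearCombination (DieudonneRing p k)
      (fun i => fel p k (var h 0) (var h 1) (var h 2) (gen i).1 (gen i).2) ρ = 0) :
    HasPresentation p h gen rels (∑ j ∈ J, lam j) := by
  set g := fun i => fel p k (var h 0) (var h 1) (var h 2) (gen i).1 (gen i).2 with hg
  set Λ := Finsupp.linearCombination (DieudonneRing p k) g with hΛ
  set N := Submodule.span (DieudonneRing p k) rels with hN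
  have hker : N ≤ LinearMap.ker Λ := Submodule.span_le.mpr fun ρ hρ => hrel ρ hρ
  let _ : Module (WittVector p k) ((ι →₀ DieudonneRing p k) ⧸ N) := Module.compHom _ (scal p k)
  have hP : ∀ (a : WittVector p k) (u : (ι →₀ DieudonneRing p k) ⧸ N), a • u = scal p k a • u :=
    fun _ _ => rfl
  let π : ((ι →₀ DieudonneRing p k) ⧸ N) →ₗ[DieudonneRing p k]
    LocalWittCohomology p k (var h 0) (var h 1) := N.liftQ Λ hker
  let T := FrobRelations.indexSet J lam
  let f : ℕ ×ₗ ℕ → (ι →₀ DieudonneRing p k) ⧸ N := fun t => N.mkQ (E (ofLex t).1 (ofLex t).2)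
  have hlow : ∀ l j l' i, toLex (l', i) < toLex (l, j) → i ∈ J → l' ≤ lam i →
      N.mkQ (E l' i) ∈ lowerSpan (p := p) (k := k) T f (toLex (l, j)) := by
    intro l j l' i hlt hi hl'
    rcases Nat.eq_zero_or_pos l' with rfl | h0
    · rw [hE0, map_zero]; exact zero_mem _
    · exact Submodule.subset_span ⟨toLex (l', i),
        ⟨FrobRelations.mem_indexSet.mpr ⟨hi, h0, hl'⟩, hlt⟩, rfl⟩
  have hπf : ∀ t ∈ T, π (f t) = fel p k (var h 0) (var h 1) (var h 2) (ofLex t).1 (ofLex t).2 := by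
    rintro ⟨l, j⟩ ht
    obtain ⟨hj, hl1, hl⟩ := FrobRelations.mem_indexSet.mp ht
    exact hEg j hj l hl1 hl
  have key := bijective_and_length_of_triangular hP T f (fun _ _ => rfl) π ?_ ?_ ?_ ?_ ?_
  · obtain ⟨⟨hinj, hsurj⟩, hl1, hl2⟩ := key
    rw [FrobRelations.card_indexSet] at hl1 hl2
    refine ⟨g, ?_, ?_, ?_, hl1, hl2⟩
    · intro i
      rw [fClass_eq]
      exact H.isRepresentedBy_fel (hgen i).1 (hgen i).2.2.1
    · intro m
      obtain ⟨u, rfl⟩ := hsurj m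
      obtain ⟨v, rfl⟩ := N.mkQ_surjective u
      exact ⟨v, rfl⟩
    · refine le_antisymm (fun v hv => ?_) hker
      have : π (N.mkQ v) = π 0 := by rw [map_zero]; exact hv
      have := hinj this
      rwa [Submodule.mkQ_apply, Submodule.Quotient.mk_eq_zero] at this
  · rintro ⟨l, j⟩ ht
    obtain ⟨hj, hl1, hl⟩ := FrobRelations.mem_indexSet.mp ht
    have h1 := hEF j hj l hl1 hl
    have h2 : F p k • f (toLex (l, j)) = κ j • N.mkQ (E (l - e j) (j' j)) := by
      rw [← map_zsmul, ← sub_eq_zero, ← map_smul, ← map_sub]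
      exact (Submodule.Quotient.mk_eq_zero N).mpr h1
    change F p k • f (toLex (l, j)) ∈ _
    rw [h2]
    by_cases hk : κ j = 0
    · rw [hk, zero_smul]; exact zero_mem _
    · obtain ⟨hj', hle, hlt⟩ := H.lower j hj (hκ j hj hk)
      -- The target of F is lexicographically smaller: its length drops if e j > 0, and otherwise j'
      -- j < j.
      refine zsmul_mem (hlow _ _ _ _ ?_ hj' (by omega)) _
      rw [Prod.Lex.toLex_lt_toLex]
      simp only
      omega
  · rintro ⟨l, j⟩ ht
    obtain ⟨hj, hl1, hl⟩ := FrobRelations.mem_indexSet.mp ht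
    obtain ⟨l, rfl⟩ : ∃ l', l = l' + 1 := ⟨l - 1, by omega⟩
    have h2 : V p k • f (toLex (l + 1, j)) = N.mkQ (E l j) := by
      rw [← sub_eq_zero, ← map_smul, ← map_sub]
      exact (Submodule.Quotient.mk_eq_zero N).mpr (hEV j hj l hl)
    change V p k • f (toLex (l + 1, j)) ∈ _
    rw [h2]
    refine hlow _ _ _ _ ?_ hj (by omega)
    rw [Prod.Lex.toLex_lt_toLex]
    simp
  · rw [eq_top_iff]
    intro u _
    obtain ⟨v, rfl⟩ := N.mkQ_surjective u
    induction v using Finsupp.induction_linear with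
    | zero => rw [map_zero]; exact zero_mem _
    | add v w hv hw => rw [map_add]; exact add_mem (hv trivial) (hw trivial)
    | single i d =>
      obtain ⟨h1, h2, h3, h4⟩ := hgen i
      have : Finsupp.single i d = d • Finsupp.single i (1 : DieudonneRing p k) := by simp
      rw [this, map_smul, ← h4]
      exact Submodule.smul_mem _ _ (Submodule.subset_span
        ⟨toLex ((gen i).1, (gen i).2), FrobRelations.mem_indexSet.mpr ⟨h1, h2, h3⟩, rfl⟩)
  · rintro ⟨l, j⟩ ht
    have h1 := H.fel_notMem D ht
    rw [hπf _ ht]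
    exact fun h2 => h1 ((lowerSpan_congr T (e := π ∘ f) hπf (toLex (l, j))).le h2)
  · rw [← H.span_fel_eq_top D (H.Nil_le_Sp D K)]
    congr 1
    exact Set.image_congr fun t ht => hπf t ht

end Presentation

/-! ### The Teichmüller lift of a sum -/

section TeichmullerExpansion

variable (p : ℕ) [hp : Fact p.Prime] {ι : Type} [Fintype ι] [DecidableEq ι]

/-- The exponents of degree `p ^ i` that are not all divisible by `p`. -/
def primExp (ι : Type) [Fintype ι] [DecidableEq ι] (i : ℕ) : Finset (ι → ℕ) :=
  {e ∈ Finset.piAntidiag Finset.univ (p ^ i) | ¬ ∀ t, p ∣ e t}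

/-- The coefficients of the expansion of the Teichmüller lift of a sum. -/
def teichCoeff (N i : ℕ) (e : ι → ℕ) : ℕ :=
  Nat.multinomial Finset.univ (fun t => p ^ (N - i) * e t) / p ^ i

variable {p}

theorem mem_primExp {i : ℕ} {e : ι → ℕ} :
    e ∈ primExp p ι i ↔ ∑ t, e t = p ^ i ∧ ¬ ∀ t, p ∣ e t := by
  simp [primExp]

/-- Every exponent of degree p^N is uniquely p^{N-i} times an exponent with a component prime to p,
and the latter then has degree p^i. -/
theorem sum_piAntidiag_pow {M : Type*} [AddCommMonoid M] (N : ℕ) (g : (ι → ℕ) → M) :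
    ∑ f ∈ Finset.piAntidiag Finset.univ (p ^ N), g f =
      ∑ i ∈ Finset.range (N + 1), ∑ e ∈ primExp p ι i, g (fun t => p ^ (N - i) * e t) := by
  induction N generalizing g with
  | zero =>
    rw [Finset.sum_range_one]
    have : primExp p ι 0 = Finset.piAntidiag Finset.univ (p ^ 0) := by
      rw [primExp, Finset.filter_true_of_mem]
      intro e he h
      have h1 : p ∣ ∑ t, e t := Finset.dvd_sum fun t _ => h t
      rw [(Finset.mem_piAntidiag.mp he).1, pow_zero] at h1
      exact hp.out.one_lt.ne' (Nat.dvd_one.mp h1)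
    rw [this]
    simp
  | succ N ih =>
    rw [Finset.sum_range_succ, ← Finset.sum_filter_add_sum_filter_not _ (fun e => ∀ t, p ∣ e t)]
    congr 1
    · trans ∑ f ∈ Finset.piAntidiag Finset.univ (p ^ N), g (fun t => p * f t)
      · symm
        refine Finset.sum_nbij (fun f t => p * f t) ?_ ?_ ?_ (fun _ _ => rfl)
        · intro f hf
          rw [Finset.mem_piAntidiag] at hf
          simp only [Finset.mem_filter, Finset.mem_piAntidiag]
          refine ⟨⟨?_, fun _ _ => Finset.mem_univ _⟩, fun t => dvd_mul_right _ _⟩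
          rw [← Finset.mul_sum, pow_succ', ← hf.1]
        · intro f _ f' _ h
          funext t
          exact Nat.eq_of_mul_eq_mul_left hp.out.pos (congrFun h t)
        · intro f hf
          simp only [Finset.coe_filter, Finset.mem_piAntidiag, Set.mem_ofPred_eq] at hf
          obtain ⟨⟨h1, _⟩, h2⟩ := hf
          choose f' hf' using h2
          obtain rfl : f = fun t => p * f' t := funext hf'
          refine ⟨f', ?_, rfl⟩
          simp only [Finset.mem_coe, Finset.mem_piAntidiag]
          refine ⟨?_, fun _ _ => Finset.mem_univ _⟩
          change ∑ t, p * f' t = _ at h1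
          rw [← Finset.mul_sum, pow_succ'] at h1
          exact Nat.eq_of_mul_eq_mul_left hp.out.pos h1
      · rw [ih]
        refine Finset.sum_congr rfl fun i hi => Finset.sum_congr rfl fun e _ => ?_
        rw [show N + 1 - i = N - i + 1 by have := Finset.mem_range.mp hi; omega]
        congr 1
        funext t
        ring
    · refine Finset.sum_congr rfl fun e _ => ?_
      simp

/-- The multinomial coefficient has the factor binom(p^N, p^{N-i} e_t) with p ∤ e_t, whose p-adic
valuation is N - (N - i) = i. -/
theorem pow_dvd_multinomial {N i : ℕ} (hi : i ≤ N) {e : ι → ℕ} (he : e ∈ primExp p ι i) :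
    p ^ i ∣ Nat.multinomial Finset.univ (fun t => p ^ (N - i) * e t) := by
  obtain ⟨h1, h2⟩ := mem_primExp.mp he
  push Not at h2
  obtain ⟨t, ht⟩ := h2
  rw [← Finset.insert_erase (Finset.mem_univ t), Nat.multinomial_insert (Finset.notMem_erase _ _)]
  refine Dvd.dvd.mul_right ?_ _
  rw [Finset.add_sum_erase _ (fun t => p ^ (N - i) * e t) (Finset.mem_univ t), ← Finset.mul_sum, h1,
    ← pow_add, Nat.sub_add_cancel hi]
  have h3 : e t ≠ 0 := fun h => ht (h ▸ dvd_zero p)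
  have h4 : p ^ (N - i) * e t ≤ p ^ N := by
    have : e t ≤ p ^ i := h1 ▸ Finset.single_le_sum (fun _ _ => Nat.zero_le _) (Finset.mem_univ t)
    calc p ^ (N - i) * e t ≤ p ^ (N - i) * p ^ i := Nat.mul_le_mul_left _ this
      _ = p ^ N := by rw [← pow_add, Nat.sub_add_cancel hi]
  have h5 : p ^ (N - i) * e t ≠ 0 := mul_ne_zero (pow_ne_zero _ hp.out.ne_zero) h3
  rw [hp.out.pow_dvd_iff_le_factorization (Nat.choose_pos h4).ne',
    Nat.factorization_choose_prime_pow hp.out h4 h5,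
    Nat.factorization_mul (pow_ne_zero _ hp.out.ne_zero) h3]
  simp only [Finsupp.add_apply, hp.out.factorization_pow, Finsupp.single_eq_same,
    Nat.factorization_eq_zero_of_not_dvd ht]
  omega

theorem pow_mul_teichCoeff {N i : ℕ} (hi : i ≤ N) {e : ι → ℕ} (he : e ∈ primExp p ι i) :
    p ^ i * teichCoeff p N i e = Nat.multinomial Finset.univ (fun t => p ^ (N - i) * e t) :=
  Nat.mul_div_cancel' (pow_dvd_multinomial hi he)

variable {S : Type u} [CommRing S] [CharP S p]

theorem verschiebung_mul (a b : WittVector p S) :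
    WittVector.verschiebung a * b = WittVector.verschiebung (a * WittVector.frobenius b) :=
  (WittVector.verschiebung_mul_frobenius a b).symm

/-- Already (Vc)² = V(c · FVc) = p V(c²), and the image of V is an ideal. -/
theorem verschiebung_pow_p (c : WittVector p S) :
    ∃ d, WittVector.verschiebung c ^ p = (p : WittVector p S) * WittVector.verschiebung d := by
  obtain ⟨q, hq⟩ : ∃ q, p = q + 2 := ⟨p - 2, by have := hp.out.two_le; omega⟩
  refine ⟨c * c * WittVector.frobenius (WittVector.verschiebung c ^ q), ?_⟩
  have h : WittVector.verschiebung c * WittVector.verschiebung c =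
      (p : WittVector p S) * WittVector.verschiebung (c * c) := by
    rw [verschiebung_mul, WittVector.frobenius_verschiebung, ← mul_assoc, ← nsmul_eq_mul,
      ← map_nsmul, nsmul_eq_mul, mul_comm]
  calc WittVector.verschiebung c ^ p
      = WittVector.verschiebung c * WittVector.verschiebung c * WittVector.verschiebung c ^ q :=
        (congrArg (WittVector.verschiebung c ^ ·) hq).trans (by ring)
    _ = _ := by rw [h, mul_assoc, verschiebung_mul]

/-- The usual improvement of a congruence under p-th powers, with the ideal p^n V W in place of
powers of p. -/
theorem exists_pow_eq_add {a b c : WittVector p S} (h : a = b + WittVector.verschiebung c) (n : ℕ) :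
    ∃ d, a ^ p ^ n = b ^ p ^ n + (p : WittVector p S) ^ n * WittVector.verschiebung d := by
  induction n with
  | zero => exact ⟨c, by simpa using h⟩
  | succ n ih =>
    obtain ⟨d, hd⟩ := ih
    obtain ⟨r, hr⟩ := exists_add_pow_prime_eq hp.out (b ^ p ^ n)
      ((p : WittVector p S) ^ n * WittVector.verschiebung d)
    obtain ⟨d', hd'⟩ := verschiebung_pow_p d
    obtain ⟨q, hq⟩ : ∃ q, n * p = n + q := ⟨n * p - n, by
      have := Nat.le_mul_of_pos_right n hp.out.pos
      omega⟩
    have hq' : ((p : WittVector p S) ^ n) ^ p = (p : WittVector p S) ^ n * (p : WittVector p S) ^ q := by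
      rw [← pow_mul, ← pow_add]
      exact congrArg ((p : WittVector p S) ^ ·) hq
    refine ⟨d' * WittVector.frobenius ((p : WittVector p S) ^ q) + d * WittVector.frobenius (b ^ p ^ n * r), ?_⟩
    rw [pow_succ, pow_mul, hd, hr, mul_pow, hd', hq', ← pow_mul, map_add,
      ← verschiebung_mul, ← verschiebung_mul]
    ring

theorem iterate_frobenius_natCast (m n : ℕ) :
    WittVector.frobenius^[m] (n : WittVector p S) = n := by
  rw [← RingHom.coe_pow, map_natCast]

theorem frobenius_iterate_verschiebung (i m : ℕ) (w : WittVector p S) :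
    WittVector.frobenius^[m + i] (WittVector.verschiebung^[i] w) =
      (p : WittVector p S) ^ i * WittVector.frobenius^[m] w := by
  induction i generalizing w with
  | zero => simp
  | succ i ih =>
    rw [Function.iterate_succ_apply, ← add_assoc, Function.iterate_succ_apply',
      ih, map_mul, map_pow, map_natCast, ← Function.iterate_succ_apply' WittVector.frobenius,
      Function.iterate_succ_apply, WittVector.frobenius_verschiebung, iterate_map_mul,
      iterate_frobenius_natCast, pow_succ]
    ring

theorem frobenius_teichmuller (r : S) :
    WittVector.frobenius (WittVector.teichmuller p r) = WittVector.teichmuller p r ^ p := by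
  rw [WittVector.frobenius_eq_map_frobenius, WittVector.map_teichmuller, ← map_pow]
  rfl

theorem iterate_frobenius_teichmuller (m : ℕ) (r : S) :
    WittVector.frobenius^[m] (WittVector.teichmuller p r) = WittVector.teichmuller p r ^ p ^ m := by
  induction m with
  | zero => simp
  | succ m ih =>
    rw [Function.iterate_succ_apply', ih, map_pow, frobenius_teichmuller, ← pow_mul, pow_succ']

theorem exists_sub_eq_verschiebung (X : ι → S) :
    ∃ c, WittVector.teichmuller p (∑ t, X t) =
      ∑ t, WittVector.teichmuller p (X t) + WittVector.verschiebung c := by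
  have h0 : (WittVector.teichmuller p (∑ t, X t) - ∑ t, WittVector.teichmuller p (X t)).coeff 0
      = 0 := by
    simp only [sub_coeff_zero, coeff_zero_sum, WittVector.teichmuller_coeff_zero, sub_self]
  exact ⟨_, sub_eq_iff_eq_add'.mp (eq_verschiebung_of_coeff_zero h0)⟩

theorem frobenius_injective_of_reduced [IsReduced S] :
    Function.Injective (WittVector.frobenius : WittVector p S → WittVector p S) := by
  rw [WittVector.frobenius_eq_map_frobenius]
  exact WittVector.map_injective _ (frobenius_inj S p)

/-- On Witt vectors of a reduced ring F is injective, so the identity may be checked after F^N.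
There the lift of the sum becomes its p^N-th power, which agrees with the p^N-th power of the sum of
the lifts modulo p^N V W = F^N V^{N+1} W. In the multinomial expansion the term of exponent p^{N-i}
e is F^N V^i of `teichCoeff` times the lift of X^e, because F^i V^i = p^i. -/
theorem teichmuller_sum_of_reduced [IsReduced S] (N : ℕ) (X : ι → S) :
    ∃ c, WittVector.teichmuller p (∑ t, X t) =
      ∑ i ∈ Finset.range (N + 1), WittVector.verschiebung^[i]
        (∑ e ∈ primExp p ι i, teichCoeff p N i e • WittVector.teichmuller p (∏ t, X t ^ e t)) +
      WittVector.verschiebung^[N + 1] c := by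
  obtain ⟨d, hd⟩ := exists_sub_eq_verschiebung (p := p) X
  obtain ⟨d, hd⟩ := exists_pow_eq_add hd N
  refine ⟨d, frobenius_injective_of_reduced.iterate N ?_⟩
  rw [iterate_frobenius_teichmuller, hd, iterate_map_add, Finset.sum_pow_eq_sum_piAntidiag,
    sum_piAntidiag_pow]
  congr 1
  · have e3 : ∀ (s : Finset ℕ) (f : ℕ → WittVector p S),
        WittVector.frobenius^[N] (∑ j ∈ s, f j) =
          ∑ j ∈ s, WittVector.frobenius^[N] (f j) := fun s f => by
      rw [← RingHom.coe_pow, map_sum]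
    have e4 : ∀ (s : Finset (ι → ℕ)) (m : ℕ) (f : (ι → ℕ) → WittVector p S),
        WittVector.frobenius^[m] (∑ j ∈ s, f j) =
          ∑ j ∈ s, WittVector.frobenius^[m] (f j) := fun s m f => by
      rw [← RingHom.coe_pow, map_sum]
    rw [e3]
    refine Finset.sum_congr rfl fun i hi => ?_
    obtain ⟨m, hm⟩ := Nat.exists_eq_add_of_le' (Nat.le_of_lt_succ (Finset.mem_range.mp hi))
    subst hm
    rw [frobenius_iterate_verschiebung, e4, Finset.mul_sum]
    refine Finset.sum_congr rfl fun e he => ?_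
    rw [← pow_mul_teichCoeff (by omega) he, nsmul_eq_mul, iterate_map_mul, iterate_frobenius_natCast,
      iterate_frobenius_teichmuller, map_prod]
    simp only [map_pow, ← Finset.prod_pow, ← pow_mul, Nat.add_sub_cancel, mul_comm (e _)]
    push_cast
    ring
  · have := frobenius_iterate_verschiebung N 0 (WittVector.verschiebung d)
    rw [zero_add, Function.iterate_zero_apply] at this
    rw [Function.iterate_succ_apply, this]

/-- The universal case is a polynomial ring over 𝔽_p, which is reduced; the formula specialises to
every ring of characteristic p. -/
theorem teichmuller_sum (N : ℕ) (X : ι → S) :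
    ∃ c, WittVector.teichmuller p (∑ t, X t) =
      ∑ i ∈ Finset.range (N + 1), WittVector.verschiebung^[i]
        (∑ e ∈ primExp p ι i, teichCoeff p N i e • WittVector.teichmuller p (∏ t, X t ^ e t)) +
      WittVector.verschiebung^[N + 1] c := by
  obtain ⟨c, hc⟩ := teichmuller_sum_of_reduced N
    (fun t => (MvPolynomial.X t : MvPolynomial ι (ZMod p)))
  let _ : Algebra (ZMod p) S := ZMod.algebra S p
  let f : MvPolynomial ι (ZMod p) →+* S := (MvPolynomial.aeval X).toRingHom
  have hf : ∀ t, f (MvPolynomial.X t) = X t := fun t => MvPolynomial.aeval_X _ _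
  have hV : ∀ (d : ℕ) (w : WittVector p (MvPolynomial ι (ZMod p))),
      WittVector.map f (WittVector.verschiebung^[d] w) =
        WittVector.verschiebung^[d] (WittVector.map f w) := by
    intro d w
    induction d with
    | zero => rfl
    | succ d ih => rw [Function.iterate_succ_apply', Function.iterate_succ_apply',
        WittVector.map_verschiebung, ih]
  refine ⟨WittVector.map f c, ?_⟩
  have h := congrArg (WittVector.map f) hc
  simp only [map_add, map_sum, hV, WittVector.map_teichmuller, map_nsmul, map_prod, map_pow,
    hf] at h
  simpa only [map_prod, map_pow] using h

end TeichmullerExpansion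

/-! ### Expansion of Teichmüller lifts of monomials by means of the equation -/

section Monomials

variable (p : ℕ) [Fact p.Prime] (k : Type u) [Field k] [CharP k p]
  {R : Type u} [CommRing R] [Algebra k R] (x y z : R)

/-- The Teichmüller lift of `κ x^a y^b z^c`. -/
def tm (κ : ℤ) (a b : ℤ) (c : ℕ) : WittVector p (Localization.Away (x * y)) :=
  WittVector.teichmuller p ((κ : Localization.Away (x * y)) * mon x y z a b c)

variable {p x y z}

theorem exists_resX_eq_mon (a : ℤ) {b : ℤ} (c : ℕ) (hb : 0 ≤ b) :
    ∃ r, resX x y r = mon x y z a b c := by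
  obtain ⟨r, hr⟩ := DoubleCover.mk_resX (x := x) (y := y) (-a).toNat
    (x ^ a.toNat * y ^ b.toNat * z ^ c)
  refine ⟨r, ?_⟩
  apply (((xU x y).isUnit.pow (-a).toNat).mul_right_cancel)
  rw [← coe_xU] at hr
  rw [hr, ← mon_nat]
  have : ∀ n : ℕ, (xU x y : Localization.Away (x * y)) ^ n = mon x y z n 0 0 := fun n => by
    simp [mon]
  rw [this, mon_mul_mon, Int.toNat_of_nonneg hb]
  congr 1 <;> omega

theorem exists_resY_eq_mon {a : ℤ} (b : ℤ) (c : ℕ) (ha : 0 ≤ a) :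
    ∃ r, resY x y r = mon x y z a b c := by
  obtain ⟨r, hr⟩ := DoubleCover.mk_resY (x := x) (y := y) (-b).toNat
    (x ^ a.toNat * y ^ b.toNat * z ^ c)
  refine ⟨r, ?_⟩
  apply (((yU x y).isUnit.pow (-b).toNat).mul_right_cancel)
  rw [← coe_yU] at hr
  rw [hr, ← mon_nat]
  have : ∀ n : ℕ, (yU x y : Localization.Away (x * y)) ^ n = mon x y z 0 n 0 := fun n => by
    simp [mon]
  rw [this, mon_mul_mon, Int.toNat_of_nonneg ha]
  congr 1 <;> omega

/-- A monomial with a nonnegative exponent of x extends to D(y), one with a nonnegative exponent of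
y to D(x), and so do their lifts in every length. -/
theorem tm_mem_Bd (l : ℕ) (κ : ℤ) {a b : ℤ} (c : ℕ) (h : 0 ≤ a ∨ 0 ≤ b) :
    tm p x y z κ a b c ∈ Bd p x y l := by
  rcases h with h | h
  · obtain ⟨r, hr⟩ := exists_resY_eq_mon (x := x) (y := y) (z := z) b c h
    have : tm p x y z κ a b c = WittVector.map (resY x y) (WittVector.teichmuller p (κ * r)) := by
      rw [WittVector.map_teichmuller, map_mul, map_intCast, hr, tm]
    rw [this]
    exact map_resY_mem_Bd _ _
  · obtain ⟨r, hr⟩ := exists_resX_eq_mon (x := x) (y := y) (z := z) a c h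
    have : tm p x y z κ a b c = WittVector.map (resX x y) (WittVector.teichmuller p (κ * r)) := by
      rw [WittVector.map_teichmuller, map_mul, map_intCast, hr, tm]
    rw [this]
    exact map_resX_mem_Bd _ _

theorem coeff_zero_tm (κ : ℤ) (a b : ℤ) (c : ℕ) :
    (tm p x y z κ a b c).coeff 0 = κ * mon x y z a b c := WittVector.teichmuller_coeff_zero _ _

theorem fW_eq_tm (j : ℕ) : fW p x y z j = tm p x y z 1 (-1) (-j) 1 := by
  rw [fW, tm, Int.cast_one, one_mul]

theorem frobW_fW (j : ℕ) :
    frobW p k x y (fW p x y z j) = tm p x y z 1 (-p) (-(p * j)) p := by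
  rw [fW, WittVector.map_teichmuller, tm, Int.cast_one, one_mul]
  change WittVector.teichmuller p (mon x y z (-1) (-j) 1 ^ p) = _
  rw [mon_pow]
  congr 2 <;> ring

variable {ι : Type} [Fintype ι] [DecidableEq ι]

variable (p x y z) in
/-- The part of level `i` in the expansion of the Teichmüller lift of a monomial `x^a y^b z^c`
times `Σ κ x^α y^β z^γ`. -/
def layer (N i : ℕ) (X : Finset (ι → ℕ)) (κ α β : ι → ℤ) (γ : ι → ℕ) (κ₀ a b : ℤ) (c : ℕ) :
    WittVector p (Localization.Away (x * y)) :=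
  ∑ e ∈ X, teichCoeff p N i e • tm p x y z (κ₀ ^ p ^ i * ∏ t, κ t ^ e t)
    ((p : ℤ) ^ i * a + ∑ t, (e t : ℤ) * α t) ((p : ℤ) ^ i * b + ∑ t, (e t : ℤ) * β t)
    (p ^ i * c + ∑ t, e t * γ t)

-- One factor z^q is replaced by the equation and the lift of the resulting sum is expanded. `X i`
-- lists the terms worth keeping at level i; a dropped one need only be a coboundary in length N + 1
-- - i, since V^i is applied to it. The last level N is kept whole: it becomes η.
include k in
theorem tm_expand (κ α β : ι → ℤ) (γ : ι → ℕ) {q : ℕ}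
    (hz : mon x y z 0 0 q = ∑ t, κ t • mon x y z (α t) (β t) (γ t)) (N : ℕ)
    (κ₀ a b : ℤ) (c : ℕ) (X : ℕ → Finset (ι → ℕ)) (hX : ∀ i < N, X i ⊆ primExp p ι i)
    (hX' : ∀ i < N, ∀ e ∈ primExp p ι i, e ∉ X i →
      tm p x y z (κ₀ ^ p ^ i * ∏ t, κ t ^ e t)
        ((p : ℤ) ^ i * a + ∑ t, (e t : ℤ) * α t) ((p : ℤ) ^ i * b + ∑ t, (e t : ℤ) * β t)
        (p ^ i * c + ∑ t, e t * γ t) ∈ Bd p x y (N + 1 - i)) :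
    tm p x y z κ₀ a b (c + q) - (∑ i ∈ Finset.range N, WittVector.verschiebung^[i]
      (layer p x y z N i (X i) κ α β γ κ₀ a b c) +
      WittVector.verschiebung^[N] (layer p x y z N N (primExp p ι N) κ α β γ κ₀ a b c)) ∈
      Bd p x y (N + 1) := by
  -- The zero ring does not have characteristic p and is treated apart.
  rcases subsingleton_or_nontrivial (Localization.Away (x * y)) with hA | hA
  · have : ∀ v w : WittVector p (Localization.Away (x * y)), v = w := fun v w => by
      ext i; exact Subsingleton.elim _ _
    rw [this (_ - _) 0]
    exact zero_mem _
  have : CharP (Localization.Away (x * y)) p :=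
    charP_of_injective_algebraMap (algebraMap k _).injective p
  obtain ⟨w, hw⟩ := teichmuller_sum (p := p) N
    (fun t => ((κ₀ * κ t : ℤ) : Localization.Away (x * y)) * mon x y z (a + α t) (b + β t) (c + γ t))
  have h1 : tm p x y z κ₀ a b (c + q) = ∑ i ∈ Finset.range (N + 1), WittVector.verschiebung^[i]
      (layer p x y z N i (primExp p ι i) κ α β γ κ₀ a b c) +
      WittVector.verschiebung^[N + 1] w := by
    have h2 : (κ₀ : Localization.Away (x * y)) * mon x y z a b (c + q) =
        ∑ t, ((κ₀ * κ t : ℤ) : Localization.Away (x * y)) *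
          mon x y z (a + α t) (b + β t) (c + γ t) := by
      have h3 := mon_mul_mon x y z a b 0 0 c q
      rw [add_zero, add_zero] at h3
      rw [← h3, hz, Finset.mul_sum, Finset.mul_sum]
      refine Finset.sum_congr rfl fun t _ => ?_
      rw [mul_smul_comm, mon_mul_mon, zsmul_eq_mul, Int.cast_mul]
      ring
    rw [tm, h2, hw]
    congr 1
    refine Finset.sum_congr rfl fun i _ => ?_
    congr 1
    refine Finset.sum_congr rfl fun e he => ?_
    congr 1
    rw [tm]
    congr 1
    have h4 := (mem_primExp.mp he).1
    have h4' : (∑ t, (e t : ℤ)) = p ^ i := by exact_mod_cast h4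
    simp only [mul_pow, mon_pow]
    rw [Finset.prod_mul_distrib, mon_prod]
    congr 1
    · rw [Int.cast_mul, Int.cast_prod, Int.cast_pow, ← h4, ← Finset.prod_pow_eq_pow_sum,
        ← Finset.prod_mul_distrib]
      refine Finset.prod_congr rfl fun t _ => ?_
      push_cast
      rw [mul_pow]
    · congr 1
      · simp only [mul_add, Finset.sum_add_distrib]
        rw [← Finset.sum_mul, h4']
      · simp only [mul_add, Finset.sum_add_distrib]
        rw [← Finset.sum_mul, h4']
      · simp only [mul_add, Finset.sum_add_distrib]
        rw [← Finset.sum_mul, h4]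
  have h5 : ∀ i < N, layer p x y z N i (primExp p ι i) κ α β γ κ₀ a b c -
      layer p x y z N i (X i) κ α β γ κ₀ a b c ∈ Bd p x y (N + 1 - i) := by
    intro i hi
    rw [layer, layer, ← Finset.sum_sdiff (hX i hi), add_sub_cancel_right]
    refine sum_mem fun e he => nsmul_mem ?_ _
    obtain ⟨h6, h7⟩ := Finset.mem_sdiff.mp he
    exact hX' i hi e h6 h7
  have h6 : ∑ i ∈ Finset.range N, WittVector.verschiebung^[i]
      (layer p x y z N i (primExp p ι i) κ α β γ κ₀ a b c -
        layer p x y z N i (X i) κ α β γ κ₀ a b c) ∈ Bd p x y (N + 1) := by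
    refine sum_mem fun i hi => ?_
    have hi' := Finset.mem_range.mp hi
    have := verschiebung_mem_Bd (h5 i hi') i
    rwa [Nat.sub_add_cancel (by omega)] at this
  convert add_mem h6 (iterate_verschiebung_mem_Bd (N + 1) w) using 1
  rw [h1, Finset.sum_range_succ]
  simp only [iterate_map_sub, Finset.sum_sub_distrib]
  ring

-- For monomials with both exponents negative whose power of z makes them coboundaries all the same.
include k in
theorem tm_mem_Bd_of_expand (κ α β : ι → ℤ) (γ : ι → ℕ) {q : ℕ}
    (hz : mon x y z 0 0 q = ∑ t, κ t • mon x y z (α t) (β t) (γ t)) (l : ℕ)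
    (κ₀ a b : ℤ) (c : ℕ)
    (hX : ∀ i < l, ∀ e ∈ primExp p ι i,
      0 ≤ (p : ℤ) ^ i * a + ∑ t, (e t : ℤ) * α t ∨ 0 ≤ (p : ℤ) ^ i * b + ∑ t, (e t : ℤ) * β t) :
    tm p x y z κ₀ a b (c + q) ∈ Bd p x y l := by
  have h := Bd_mono (Nat.le_succ l) (tm_expand k κ α β γ hz l κ₀ a b c (fun _ => ∅)
    (fun i _ => Finset.empty_subset _) (fun i hi e he _ => tm_mem_Bd _ _ _ (hX i hi e he)))
  have h2 : ∑ i ∈ Finset.range l, WittVector.verschiebung^[i]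
      (layer p x y z l i ∅ κ α β γ κ₀ a b c) = 0 :=
    Finset.sum_eq_zero fun i _ => by rw [layer, Finset.sum_empty, iterate_map_zero]
  rw [h2, zero_add] at h
  have := add_mem h (iterate_verschiebung_mem_Bd l (layer p x y z
    l l (primExp p ι l) κ α β γ κ₀ a b c))
  rwa [sub_add_cancel] at this

end Monomials

theorem frac_eq_mon_int {k : Type u} [Field k] (h : MvPowerSeries (Fin 3) k) (j : ℤ) :
    frac h j = mon (var h 0) (var h 1) (var h 2) (-1) (-j) 1 := by
  have e : yU (var h 0) (var h 1) ^ (-j) =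
      (yU (var h 0) (var h 1))⁻¹ ^ j.toNat * yU (var h 0) (var h 1) ^ (-j).toNat := by
    rw [← zpow_natCast, ← zpow_natCast, inv_zpow', ← zpow_add]
    congr 1
    omega
  rw [frac, mon, ← coe_xU, ← coe_yU (var h 0), e]
  simp only [Ring.inverse_unit, zpow_neg, zpow_one, pow_one, Units.val_mul, Units.val_pow_eq_pow_val]
  ring

theorem fClass_eq_zero (p : ℕ) [Fact p.Prime] {k : Type u} [Field k] [CharP k p]
    (h : MvPowerSeries (Fin 3) k) (l : ℕ) {j : ℤ} (hj : j ≤ 0) : fClass p h l j = 0 := by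
  have h1 := tm_mem_Bd (p := p) (x := var h 0) (y := var h 1) (z := var h 2) l 1 (a := -1)
    (b := -j) 1 (Or.inr (by omega))
  rw [mem_Bd, tm, Int.cast_one, one_mul] at h1
  rw [fClass, frac_eq_mon_int, h1]

/-! ### Coefficients of `p`-th powers -/

namespace DoubleCover

variable {k : Type u} [Field k] {R : Type u} [CommRing R] [Algebra k R] {x y z : R}
  (D : DoubleCover k x y z) {p : ℕ} [Fact p.Prime] [CharP k p]
  {ι : Type} [Fintype ι] {κ : ι → ℤ} {α β : ι → ℤ} {γ : ι → Fin 2}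
  (hz : mon x y z 0 0 p = ∑ t, κ t • mon x y z (α t) (β t) (γ t))

include hz

/-- With u = u₀ + u₁ z, the exponents in u₀^p are divisible by p and those in u₁^p z^p are congruent
to those of a term of z^p. A point in none of these residue classes sees no p-th power. -/
theorem lc_pow_eq_zero {ε : Fin 2} {i j : ℤ} (h0 : ε = 0 → ¬((p : ℤ) ∣ i ∧ (p : ℤ) ∣ j))
    (h1 : ∀ t, ε = γ t → ¬((p : ℤ) ∣ i - α t ∧ (p : ℤ) ∣ j - β t))
    (u : Localization.Away (x * y)) : D.lc (u ^ p) ε i j = 0 := by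
  rw [D.lc_pow p Finset.univ κ α β γ hz, Finset.sum_eq_zero, add_zero]
  · split_ifs with h
    · exact frobCoeff_of_not _ _ (h0 h)
    · rfl
  · intro t _
    split_ifs with h
    · rw [frobCoeff_of_not _ _ (h1 t h), smul_zero]
    · rfl

theorem lc_pow_base (h1 : ∀ t, γ t = 0 → ¬((p : ℤ) ∣ α t ∧ (p : ℤ) ∣ β t))
    (u : Localization.Away (x * y)) (i j : ℤ) :
    D.lc (u ^ p) 0 (p * i) (p * j) = D.lc u 0 i j ^ p := by
  rw [D.lc_pow p Finset.univ κ α β γ hz, Finset.sum_eq_zero, add_zero, if_pos rfl, frobCoeff_mul]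
  intro t _
  split_ifs with h
  · rw [frobCoeff_of_not _ _, smul_zero]
    rw [dvd_sub_right (dvd_mul_right _ _), dvd_sub_right (dvd_mul_right _ _)]
    exact h1 t h.symm
  · rfl

/-- When the terms of z^p lie in pairwise different residue classes, each of them recovers the
coefficients of u₁ without interference from the others or from u₀. -/
theorem lc_pow_term [DecidableEq ι] (t₀ : ι) (h0 : γ t₀ = 0 → ¬((p : ℤ) ∣ α t₀ ∧ (p : ℤ) ∣ β t₀))
    (h1 : ∀ t, t ≠ t₀ → γ t₀ = γ t → ¬((p : ℤ) ∣ α t₀ - α t ∧ (p : ℤ) ∣ β t₀ - β t))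
    (u : Localization.Away (x * y)) (i j : ℤ) :
    D.lc (u ^ p) (γ t₀) (p * i + α t₀) (p * j + β t₀) = κ t₀ • D.lc u 1 i j ^ p := by
  rw [D.lc_pow p Finset.univ κ α β γ hz, Finset.sum_eq_single t₀, if_pos rfl, add_sub_cancel_right,
    add_sub_cancel_right, frobCoeff_mul]
  · split_ifs with h
    · rw [frobCoeff_of_not, zero_add]
      rw [dvd_add_right (dvd_mul_right _ _), dvd_add_right (dvd_mul_right _ _)]
      exact h0 h
    · rw [zero_add]
  · intro t _ ht
    split_ifs with h
    · rw [frobCoeff_of_not, smul_zero]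
      rw [add_sub_assoc, add_sub_assoc, dvd_add_right (dvd_mul_right _ _),
        dvd_add_right (dvd_mul_right _ _)]
      exact h1 t ht h
    · rfl
  · simp

end DoubleCover

/-! ### The Frobenius of `f_j` -/

section Expansion

variable {p : ℕ} [Fact p.Prime] {k : Type u} [Field k] [CharP k p]
  {R : Type u} [CommRing R] [Algebra k R] {x y z : R}
  {ι : Type} [Fintype ι] [DecidableEq ι]

theorem mon_eq_sum {κ : ι → ℤ} {a b γ : ι → ℕ} {q : ℕ}
    (h : z ^ q = ∑ t, κ t • (x ^ a t * y ^ b t * z ^ γ t)) :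
    mon x y z 0 0 q = ∑ t, κ t • mon x y z (a t) (b t) (γ t) := by
  have := congrArg (algebraMap R (Localization.Away (x * y))) h
  simp only [map_sum, map_zsmul, ← mon_nat] at this
  rw [← this]
  simp [mon]

-- The p-th power of the equation, by additivity of Frobenius. It rewrites higher powers of z in one
-- stroke.
variable (p k) in
include k in
theorem mon_mul_eq_sum {κ α β : ι → ℤ} {γ : ι → ℕ} {q : ℕ}
    (hz : mon x y z 0 0 q = ∑ t, κ t • mon x y z (α t) (β t) (γ t)) :
    mon x y z 0 0 (p * q) = ∑ t, κ t • mon x y z (p * α t) (p * β t) (p * γ t) := by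
  have h := congrArg (frobHom p k (Localization.Away (x * y))) hz
  rw [map_sum] at h
  simp only [map_zsmul] at h
  have e : ∀ α β γ, frobHom p k (Localization.Away (x * y)) (mon x y z α β γ) =
      mon x y z (p * α) (p * β) (p * γ) := fun α β γ => mon_pow x y z α β γ p
  simpa only [e, mul_zero] using h

theorem coeff_zero_nsmul {A : Type u} [CommRing A] (n : ℕ) (w : WittVector p A) :
    (n • w).coeff 0 = n • w.coeff 0 :=
  map_nsmul (WittVector.constantCoeff (p := p)) n w

theorem frobW_fW_sub_mem {κ α β : ι → ℤ} {γ : ι → ℕ}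
    (hz : mon x y z 0 0 p = ∑ t, κ t • mon x y z (α t) (β t) (γ t)) {N j : ℕ}
    (X : ℕ → Finset (ι → ℕ)) (hX : ∀ i < N, X i ⊆ primExp p ι i)
    (hX' : ∀ i < N, ∀ e ∈ primExp p ι i, e ∉ X i →
      tm p x y z (1 ^ p ^ i * ∏ t, κ t ^ e t)
        ((p : ℤ) ^ i * (-p) + ∑ t, (e t : ℤ) * α t)
        ((p : ℤ) ^ i * (-(p * j)) + ∑ t, (e t : ℤ) * β t)
        (p ^ i * 0 + ∑ t, e t * γ t) ∈ Bd p x y (N + 1 - i)) :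
    frobW p k x y (fW p x y z j) - (∑ i ∈ Finset.range N, WittVector.verschiebung^[i]
      (layer p x y z N i (X i) κ α β γ 1 (-p) (-(p * j)) 0) +
      WittVector.verschiebung^[N]
        (layer p x y z N N (primExp p ι N) κ α β γ 1 (-p) (-(p * j)) 0)) ∈ Bd p x y (N + 1) := by
  have := tm_expand k κ α β γ hz N 1 (-p) (-(p * j)) 0 X hX hX'
  rwa [zero_add, ← frobW_fW (k := k)] at this

/-- The case in which every term below level N is a coboundary: F f_j vanishes in length N. The
indices e and j' are placeholders multiplied by 0, to match the shape required in `FrobRelations`.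
-/
theorem frobW_fW_sub_mem_of_forall {κ α β : ι → ℤ} {γ : ι → ℕ}
    (hz : mon x y z 0 0 p = ∑ t, κ t • mon x y z (α t) (β t) (γ t)) {N j : ℕ}
    (hX' : ∀ i < N, ∀ e ∈ primExp p ι i, 0 ≤ (p : ℤ) ^ i * (-p) + ∑ t, (e t : ℤ) * α t ∨
        0 ≤ (p : ℤ) ^ i * (-(p * j)) + ∑ t, (e t : ℤ) * β t) (e j' : ℕ) :
    frobW p k x y (fW p x y z j) - ((0 : ℤ) • WittVector.verschiebung^[e] (fW p x y z j') +
      WittVector.verschiebung^[N]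
        (layer p x y z N N (primExp p ι N) κ α β γ 1 (-p) (-(p * j)) 0)) ∈ Bd p x y (N + 1) := by
  have := frobW_fW_sub_mem (k := k) hz (N := N) (j := j) (fun _ => ∅)
    (fun _ _ => Finset.empty_subset _) (fun i hi e he _ => tm_mem_Bd _ _ _ (hX' i hi e he))
  rwa [Finset.sum_eq_zero fun i _ => by rw [layer, Finset.sum_empty, iterate_map_zero],
    ← zero_smul ℤ (WittVector.verschiebung^[e] (fW p x y z j'))] at this

/-- The case in which a single term below level N survives, and it is the monomial of f_{j'} at
level e. All coefficients of the equation are 1, so the multiplicity is the multinomial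
`teichCoeff`. -/
theorem frobW_fW_sub_mem_of_unique {α β : ι → ℤ} {γ : ι → ℕ}
    (hz : mon x y z 0 0 p = ∑ t, (1 : ℤ) • mon x y z (α t) (β t) (γ t)) {N j j' e : ℕ}
    (he : e < N) {e₀ : ι → ℕ} (he₀ : e₀ ∈ primExp p ι e)
    (hα : (p : ℤ) ^ e * (-p) + ∑ t, (e₀ t : ℤ) * α t = -1)
    (hβ : (p : ℤ) ^ e * (-(p * j)) + ∑ t, (e₀ t : ℤ) * β t = -j')
    (hγ : ∑ t, e₀ t * γ t = 1)
    (hX' : ∀ i < N, ∀ e' ∈ primExp p ι i, ¬(i = e ∧ ∀ t, e' t = e₀ t) →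
      tm p x y z 1 ((p : ℤ) ^ i * (-p) + ∑ t, (e' t : ℤ) * α t)
        ((p : ℤ) ^ i * (-(p * j)) + ∑ t, (e' t : ℤ) * β t)
        (∑ t, e' t * γ t) ∈ Bd p x y (N + 1 - i)) :
    frobW p k x y (fW p x y z j) -
      ((teichCoeff p N e e₀ : ℤ) • WittVector.verschiebung^[e] (fW p x y z j') +
      WittVector.verschiebung^[N]
        (layer p x y z N N (primExp p ι N) (fun _ => 1) α β γ 1 (-p) (-(p * j)) 0)) ∈
          Bd p x y (N + 1) := by
  have := frobW_fW_sub_mem (k := k) hz (N := N) (j := j) (fun i => if i = e then {e₀} else ∅)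
    (fun i _ => by
      split_ifs with h
      · rw [h, Finset.singleton_subset_iff]; exact he₀
      · exact Finset.empty_subset _)
    (fun i hi e' he' hn => by
      have := hX' i hi e' he' (by
        rintro ⟨rfl, h⟩
        exact hn (by simpa using funext h))
      simpa using this)
  rw [Finset.sum_eq_single e] at this
  · rw [if_pos rfl, layer, Finset.sum_singleton, hα, hβ, mul_zero, zero_add, hγ] at this
    simp only [one_pow, Finset.prod_const_one, mul_one] at this
    rw [← fW_eq_tm] at this
    have h2 : WittVector.verschiebung^[e] (teichCoeff p N e e₀ • fW p x y z j') =
        (teichCoeff p N e e₀ : ℤ) • WittVector.verschiebung^[e] (fW p x y z j') := by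
      rw [natCast_zsmul]
      exact map_nsmul (AddMonoidHom.mk' (WittVector.verschiebung^[e])
        (fun a b => iterate_map_add _ e a b)) _ _
    rwa [h2] at this
  · intro i _ hi
    rw [if_neg hi, layer, Finset.sum_empty, iterate_map_zero]
  · intro h
    exact absurd (Finset.mem_range.mpr he) h

end Expansion

namespace DoubleCover

variable {k : Type u} [Field k] {R : Type u} [CommRing R] [Algebra k R] {x y z : R}
  (D : DoubleCover k x y z) {p : ℕ} [Fact p.Prime] [CharP k p]
  {ι : Type} [Fintype ι] [DecidableEq ι]

theorem lc_zsmul (n : ℤ) (a : Localization.Away (x * y)) (ε : Fin 2) (i j : ℤ) :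
    D.lc (n • a) ε i j = n • D.lc a ε i j := map_zsmul (D.lcHom ε i j) n a

/-- Reduces a coefficient of a layer to the few exponents Y that can reach the given point. -/
theorem lc_layer {N i : ℕ} {X : Finset (ι → ℕ)} {κ α β : ι → ℤ} {γ : ι → ℕ} {κ₀ a b : ℤ} {c : ℕ}
    {ε : Fin 2} {I J : ℤ} (Y : Finset (ι → ℕ)) (hY : Y ⊆ X)
    (h : ∀ e ∈ X, e ∉ Y → D.lc (mon x y z ((p : ℤ) ^ i * a + ∑ t, (e t : ℤ) * α t)
      ((p : ℤ) ^ i * b + ∑ t, (e t : ℤ) * β t) (p ^ i * c + ∑ t, e t * γ t)) ε I J = 0) :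
    D.lc ((layer p x y z N i X κ α β γ κ₀ a b c).coeff 0) ε I J =
      ∑ e ∈ Y, (teichCoeff p N i e * (κ₀ ^ p ^ i * ∏ t, κ t ^ e t) : ℤ) •
        D.lc (mon x y z ((p : ℤ) ^ i * a + ∑ t, (e t : ℤ) * α t)
          ((p : ℤ) ^ i * b + ∑ t, (e t : ℤ) * β t) (p ^ i * c + ∑ t, e t * γ t)) ε I J := by
  rw [layer, coeff_zero_sum, lc_sum, ← Finset.sum_sdiff hY, Finset.sum_eq_zero, zero_add]
  · refine Finset.sum_congr rfl fun e _ => ?_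
    rw [coeff_zero_nsmul, lc_nsmul, coeff_zero_tm, ← zsmul_eq_mul, lc_zsmul,
      mul_smul (teichCoeff p N i e : ℤ), natCast_zsmul]
  · intro e he
    obtain ⟨h1, h2⟩ := Finset.mem_sdiff.mp he
    rw [coeff_zero_nsmul, lc_nsmul, coeff_zero_tm, ← zsmul_eq_mul, lc_zsmul, h e h1 h2, smul_zero,
      smul_zero]

theorem lc_mon_add {κ α β : ι → ℤ} {γ : ι → ℕ} {q : ℕ}
    (hz : mon x y z 0 0 q = ∑ t, κ t • mon x y z (α t) (β t) (γ t)) (a b : ℤ) (c : ℕ)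
    (ε : Fin 2) (i j : ℤ) :
    D.lc (mon x y z a b (c + q)) ε i j =
      ∑ t, κ t • D.lc (mon x y z (a + α t) (b + β t) (c + γ t)) ε i j := by
  have h3 := mon_mul_mon x y z a b 0 0 c q
  rw [add_zero, add_zero] at h3
  rw [← h3, hz, Finset.mul_sum, lc_sum]
  refine Finset.sum_congr rfl fun t _ => ?_
  rw [mul_smul_comm, mon_mul_mon, lc_zsmul]

theorem lc_mon_zero (a b : ℤ) (ε : Fin 2) (i j : ℤ) :
    D.lc (mon x y z a b 0) ε i j = if i = a ∧ j = b ∧ ε = 0 then 1 else 0 :=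
  D.lc_mon a b 0 ε i j

theorem lc_mon_one (a b : ℤ) (ε : Fin 2) (i j : ℤ) :
    D.lc (mon x y z a b 1) ε i j = if i = a ∧ j = b ∧ ε = 1 then 1 else 0 :=
  D.lc_mon a b 1 ε i j

/-- If the coefficients of `u ^ p` vanish outside the support, then so do those of `u`. -/
theorem lc_eq_zero_of_pow {κ α β : ι → ℤ} {γ : ι → Fin 2}
    (hz : mon x y z 0 0 p = ∑ t, κ t • mon x y z (α t) (β t) (γ t)) {J : Finset ℕ}
    (hbase : ∀ t, γ t = 0 → ¬((p : ℤ) ∣ α t ∧ (p : ℤ) ∣ β t))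
    (hdist : ∀ t t', t' ≠ t → γ t = γ t' → ¬((p : ℤ) ∣ α t - α t' ∧ (p : ℤ) ∣ β t - β t'))
    (hsupp : ∀ i j : ℤ, i < 0 → j < 0 → ¬(i = -1 ∧ -j ∈ J.map Nat.castEmbedding) →
      ∃ t, ¬(p : ℤ) ∣ κ t ∧ OffSupport J (γ t) (p * i + α t) (p * j + β t))
    {u : Localization.Away (x * y)} (hu : ∀ ε i j, OffSupport J ε i j → D.lc (u ^ p) ε i j = 0)
    (ε : Fin 2) (i j : ℤ) (h : OffSupport J ε i j) : D.lc u ε i j = 0 := by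
  have hp := (Fact.out : p.Prime)
  have hp0 : (0 : ℤ) < p := by exact_mod_cast hp.pos
  have h01 : ε = 0 ∨ ε = 1 := by fin_cases ε <;> simp
  rcases h01 with rfl | rfl
  · have h1 := D.lc_pow_base hz hbase u i j
    rw [hu 0 _ _ ⟨mul_neg_of_pos_of_neg hp0 h.1, mul_neg_of_pos_of_neg hp0 h.2.1, by simp⟩] at h1
    exact pow_eq_zero_iff hp.ne_zero |>.mp h1.symm
  · obtain ⟨t, ht, h2⟩ := hsupp i j h.1 h.2.1 (by
      rintro ⟨hi, hj⟩
      obtain ⟨n, hn, hn'⟩ := Finset.mem_map.mp hj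
      refine h.2.2 n hn ⟨rfl, hi, ?_⟩
      have : (n : ℤ) = -j := hn'
      omega)
    have h1 := D.lc_pow_term hz t (hbase t) (hdist t) u i j
    rw [hu _ _ _ h2, zsmul_eq_mul] at h1
    have h3 : ((κ t : ℤ) : k) ≠ 0 := by
      rwa [Ne, CharP.intCast_eq_zero_iff k p]
    rcases mul_eq_zero.mp h1.symm with h4 | h4
    · exact absurd h4 h3
    · exact pow_eq_zero_iff hp.ne_zero |>.mp h4

end DoubleCover

/-! ### Presentations with one generator -/

section Cyclic

variable {p : ℕ} [Fact p.Prime] {k : Type u} [Field k] [CharP k p] [PerfectRing k p]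

open DieudonneRing in
/-- The case of a single generator `f_1^{(l)}`, where `F` acts as a multiple of a power of `V`. -/
theorem hasPresentation_cyclic {h : MvPowerSeries (Fin 3) k}
    (D : DoubleCover k (var h 0) (var h 1) (var h 2)) {ι : Type} [Fintype ι] [DecidableEq ι]
    {κ α β : ι → ℤ} {γ : ι → Fin 2}
    (hz : mon (var h 0) (var h 1) (var h 2) 0 0 p =
      ∑ t, κ t • mon (var h 0) (var h 1) (var h 2) (α t) (β t) (γ t))
    (hbase : ∀ t, γ t = 0 → ¬((p : ℤ) ∣ α t ∧ (p : ℤ) ∣ β t))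
    (hdist : ∀ t t', t' ≠ t → γ t = γ t' → ¬((p : ℤ) ∣ α t - α t' ∧ (p : ℤ) ∣ β t - β t'))
    (hsupp : ∀ i j : ℤ, i < 0 → j < 0 → ¬(i = -1 ∧ j = -1) →
      ∃ t, ¬(p : ℤ) ∣ κ t ∧ OffSupport {1} (γ t) (p * i + α t) (p * j + β t))
    {l e : ℕ} (hl : 1 ≤ l) (he : 0 < e) (hle : l ≤ 2 * e + 1) {c c' : ℤ}
    (hc : (p : ℤ) ∣ c - c') (hc' : c' ≠ 0 → c ≠ 0)
    {η : WittVector p (Localization.Away (var h 0 * var h 1))}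
    (hrel : frobW p k _ _ (fW p (var h 0) (var h 1) (var h 2) 1) -
      (c • WittVector.verschiebung^[e] (fW p (var h 0) (var h 1) (var h 2) 1) +
        WittVector.verschiebung^[l] η) ∈ Bd p (var h 0) (var h 1) (l + 1))
    {ε : Fin 2} {i j : ℤ} (hoff : OffSupport {1} ε i j)
    (h0 : ε = 0 → ¬((p : ℤ) ∣ i ∧ (p : ℤ) ∣ j))
    (h1 : ∀ t, ε = γ t → ¬((p : ℤ) ∣ i - α t ∧ (p : ℤ) ∣ j - β t))
    (hη : D.lc (η.coeff 0) ε i j ≠ 0) :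
    HasPresentation p h ![(l, 1)]
      {Finsupp.single 0 (F p k - c' • V p k ^ e), Finsupp.single 0 (V p k ^ l)} l := by
  have H : FrobRelations p k (var h 0) (var h 1) (var h 2) {1} (fun _ => l) (fun _ => c)
      (fun _ => e) (fun _ => 1) (fun _ => η) :=
    { pos := by simp
      one_le := fun _ _ => hl
      rel := fun j hj => by rw [Finset.mem_singleton.mp hj]; exact hrel
      lower := fun j hj _ => ⟨by simp, Nat.le_add_right _ _, Or.inl he⟩ }
  have hV : ∀ n m, n + m ≤ l → V p k ^ m • fel p k (var h 0) (var h 1) (var h 2) (n + m) 1 =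
      fel p k (var h 0) (var h 1) (var h 2) n 1 := by
    intro n m
    induction m with
    | zero => intro _; rw [pow_zero, one_smul, add_zero]
    | succ m ih =>
      intro hm
      rw [pow_succ, mul_smul, ← add_assoc, H.V_smul_fel (by simp) (by omega), ih (by omega)]
  have hV' : ∀ m, m ≤ l → V p k ^ m • fel p k (var h 0) (var h 1) (var h 2) l 1 =
      fel p k (var h 0) (var h 1) (var h 2) (l - m) 1 := fun m hm => by
    have := hV (l - m) m (by omega)
    rwa [Nat.sub_add_cancel hm] at this
  -- Here l ≤ 2e + 1 enters: p = FV lowers the length by 1 + e, and n ≤ l - e ≤ e + 1. Thus only the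
  -- residue of c modulo p matters in the relation for F.
  have hp : ∀ n, n ≤ l - e → (p : ℤ) • fel p k (var h 0) (var h 1) (var h 2) n 1 = 0 := by
    intro n hn
    rcases Nat.eq_zero_or_pos n with rfl | hn0
    · rw [fel_zero, smul_zero]
    obtain ⟨n, rfl⟩ := Nat.exists_eq_add_of_le' hn0
    rw [natCast_zsmul, ← Nat.cast_smul_eq_nsmul (DieudonneRing p k), ← F_mul_V, mul_smul,
      H.V_smul_fel (by simp) (by omega), H.F_smul_fel (by simp) (by omega),
      show n - e = 0 by omega, fel_zero, smul_zero]
  have hFl : F p k • fel p k (var h 0) (var h 1) (var h 2) l 1 =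
      c' • fel p k (var h 0) (var h 1) (var h 2) (l - e) 1 := by
    rw [H.F_smul_fel (by simp) le_rfl]
    obtain ⟨d, hd⟩ := hc
    rw [show c = c' + d * p by linarith, add_smul, mul_smul, hp _ le_rfl, smul_zero, add_zero]
  -- For e > l both sides vanish, the right one by truncated subtraction.
  have hVe : V p k ^ e • fel p k (var h 0) (var h 1) (var h 2) l 1 = fel p k (var h 0) (var h 1) (var h 2) (l - e) 1 := by
    rcases le_or_gt e l with h | h
    · exact hV' e h
    · rw [show e = (e - l) + l by omega, pow_add, mul_smul, hV' l le_rfl, Nat.sub_self, fel_zero,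
        smul_zero, Nat.sub_eq_zero_of_le (by omega), fel_zero]
  have := hasPresentation_of_relations D H ?_ ![(l, 1)]
    {Finsupp.single 0 (F p k - c' • V p k ^ e), Finsupp.single 0 (V p k ^ l)}
    (fun n _ => if n = 0 then 0 else Finsupp.single 0 (V p k ^ (l - n))) (fun _ => c') ?_ ?_ ?_ ?_ ?_
    ?_ ?_
  · simpa using this
  · intro u d hu
    -- At the given point u^p has no coefficient and η has a nonzero one.
    have hd : d 1 = 0 := by
      have := hu ε i j hoff
      rw [Finset.sum_singleton, D.lc_add, D.lc_pow_eq_zero hz h0 h1, zero_add,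
        D.lc_algebraMap_mul] at this
      exact (mul_eq_zero.mp this).resolve_right hη
    refine ⟨fun t ht => by rwa [Finset.mem_singleton.mp ht], D.lc_eq_zero_of_pow hz hbase hdist ?_ ?_⟩
    · intro i j hi hj hij
      refine hsupp i j hi hj fun h => hij ⟨h.1, ?_⟩
      simp [h.2]
    · intro ε i j hoff
      have := hu ε i j hoff
      rwa [Finset.sum_singleton, hd, map_zero, zero_mul, add_zero] at this
  · intro i
    obtain rfl := Subsingleton.elim i 0
    refine ⟨Finset.mem_singleton_self 1, hl, le_rfl, ?_⟩
    change (if l = 0 then 0 else Finsupp.single 0 (V p k ^ (l - l))) = Finsupp.single 0 1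
    rw [if_neg (by omega), Nat.sub_self, pow_zero]
  · intro j; rfl
  · intro j _ n hn
    simp only [Nat.succ_ne_zero, if_false]
    rw [Finsupp.smul_single, smul_eq_mul, ← pow_succ', show l - (n + 1) + 1 = l - n by omega]
    split_ifs with h
    · subst h
      rw [sub_zero, Nat.sub_zero]
      exact Submodule.subset_span (by simp)
    · rw [sub_self]; exact zero_mem _
  · intro _ _; exact hc'
  · intro j _ n hn hnl
    rw [if_neg (by omega)]
    have hFV : F p k * V p k ^ (l - n) = V p k ^ (l - n) * F p k :=
      (Commute.pow_right (F_mul_V.trans V_mul_F.symm : Commute (F p k) (V p k)) _)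
    have hc1 : V p k ^ (l - n) * (c' • V p k ^ e) = c' • V p k ^ (l - n + e) := by
      rw [mul_smul_comm, pow_add]
    have e1 : F p k • (Finsupp.single 0 (V p k ^ (l - n)) : Fin 1 →₀ DieudonneRing p k) =
        V p k ^ (l - n) • Finsupp.single 0 (F p k - c' • V p k ^ e) +
          c' • Finsupp.single 0 (V p k ^ (l - n + e)) := by
      rw [Finsupp.smul_single, Finsupp.smul_single, smul_eq_mul, smul_eq_mul, mul_sub, hFV, hc1,
        Finsupp.single_sub, Finsupp.smul_single, sub_add_cancel]
    rw [e1, add_sub_assoc]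
    refine add_mem (Submodule.smul_mem _ _ (Submodule.subset_span (by simp))) ?_
    split_ifs with h
    · rw [smul_zero, sub_zero]
      refine zsmul_mem ?_ _
      rw [show l - n + e = (l - n + e - l) + l by omega, pow_add, ← smul_eq_mul,
        ← Finsupp.smul_single]
      exact Submodule.smul_mem _ _ (Submodule.subset_span (by simp))
    · rw [show l - n + e = l - (n - e) by omega, sub_self]
      exact zero_mem _
  · intro j hj n hn hnl
    obtain rfl := Finset.mem_singleton.mp hj
    rw [if_neg (by omega), Finsupp.linearCombination_single]
    simp only [Matrix.cons_val_zero]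
    rw [hV' _ (by omega), show l - (l - n) = n by omega]
  · rintro ρ (rfl | rfl)
    · rw [Finsupp.linearCombination_single]
      simp only [Matrix.cons_val_zero]
      rw [sub_smul, smul_assoc, hVe, hFl, sub_self]
    · rw [Finsupp.linearCombination_single]
      simp only [Matrix.cons_val_zero]
      rw [hV' _ le_rfl, Nat.sub_self, fel_zero]

end Cyclic

/-! ### The double cover and the relation for `z²` attached to an equation -/

section Equation

variable {k : Type u} [Field k] {h : MvPowerSeries (Fin 3) k} {ι : Type} [Fintype ι] [DecidableEq ι]
  {a b : ι → ℕ} {γ : ι → Fin 2}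

open MvPowerSeries in
theorem exists_doubleCover (hab : ∀ t, 0 < a t + b t)
    (hh : h = X 2 ^ 2 + ∑ t, X 0 ^ a t * X 1 ^ b t * X 2 ^ (γ t : ℕ)) :
    Nonempty (DoubleCover k (var h 0) (var h 1) (var h 2)) := by
  have hmem : ∀ t, (X 0 ^ a t * X 1 ^ b t : MvPowerSeries (Fin 2) k) ∈ varIdeal k := fun t => by
    rcases (show 0 < a t ∨ 0 < b t by have := hab t; omega) with h | h
    · exact Ideal.mul_mem_right _ _ (Ideal.pow_mem_of_mem _ X0_mem_varIdeal _ h)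
    · exact Ideal.mul_mem_left _ _ (Ideal.pow_mem_of_mem _ X1_mem_varIdeal _ h)
  refine ⟨DoubleCover.ofQuadratic h (∑ t with γ t = 0, X 0 ^ a t * X 1 ^ b t)
    (∑ t with ¬γ t = 0, X 0 ^ a t * X 1 ^ b t) (sum_mem fun t _ => hmem t)
    (sum_mem fun t _ => hmem t) ?_⟩
  rw [hh]
  simp only [map_add, map_sum, map_mul, map_pow, lastEquiv_X0, lastEquiv_X1, lastEquiv_X2]
  rw [add_assoc, add_right_inj, ← Finset.sum_filter_add_sum_filter_not _ (fun t => γ t = 0),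
    add_comm, Finset.sum_mul]
  congr 1
  · refine Finset.sum_congr rfl fun t ht => ?_
    have : γ t = 1 := by
      have := (Finset.mem_filter.mp ht).2
      omega
    rw [this]
    simp
  · refine Finset.sum_congr rfl fun t ht => ?_
    rw [(Finset.mem_filter.mp ht).2]
    simp

open MvPowerSeries in
theorem var_sq_eq (hh : h = X 2 ^ 2 + ∑ t, X 0 ^ a t * X 1 ^ b t * X 2 ^ (γ t : ℕ)) :
    var h 2 ^ 2 = ∑ t, (-1 : ℤ) • (var h 0 ^ a t * var h 1 ^ b t * var h 2 ^ (γ t : ℕ)) := by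
  have h0 : Ideal.Quotient.mk (Ideal.span {h}) h = 0 :=
    Ideal.Quotient.eq_zero_iff_mem.mpr (Ideal.mem_span_singleton_self h)
  conv at h0 => enter [1, 2]; rw [hh]
  simp only [map_add, map_sum, map_mul, map_pow] at h0
  rw [← Finset.smul_sum, neg_one_smul]
  exact eq_neg_of_add_eq_zero_left h0

open MvPowerSeries in
theorem mon_two_eq (hh : h = X 2 ^ 2 + ∑ t, X 0 ^ a t * X 1 ^ b t * X 2 ^ (γ t : ℕ)) :
    mon (var h 0) (var h 1) (var h 2) 0 0 2 =
      ∑ t, (-1 : ℤ) • mon (var h 0) (var h 1) (var h 2) (a t) (b t) (γ t) :=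
  mon_eq_sum (γ := fun t => (γ t : ℕ)) (var_sq_eq hh)

-- Signs disappear in characteristic 2. Having all coefficients equal to 1 keeps signs out of the
-- Teichmüller expansions.
open MvPowerSeries in
theorem mon_two_eq_of_charTwo [CharP k 2]
    (hh : h = X 2 ^ 2 + ∑ t, X 0 ^ a t * X 1 ^ b t * X 2 ^ (γ t : ℕ)) :
    mon (var h 0) (var h 1) (var h 2) 0 0 2 =
      ∑ t, (1 : ℤ) • mon (var h 0) (var h 1) (var h 2) (a t) (b t) (γ t) := by
  have h2 : (2 : Localization.Away (var h 0 * var h 1)) = 0 := by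
    have : (2 : k) = 0 := CharP.cast_eq_zero k 2
    simpa only [map_ofNat, map_zero] using congrArg (algebraMap k (Localization.Away (var h 0 * var h 1))) this
  rw [mon_two_eq hh]
  refine Finset.sum_congr rfl fun t _ => ?_
  rw [one_smul, neg_one_smul]
  linear_combination -mon (var h 0) (var h 1) (var h 2) (a t) (b t) (γ t) * h2

end Equation

/-! ### Characteristic 2: types `E_6` and `E_7`, and `E_8` with one generator -/

section CharTwo

variable {k : Type u} [Field k] [CharP k 2] [PerfectRing k 2]

open DieudonneRing MvPowerSeries

/-- At level 1 the only primitive exponent is (1, 1), which gives x^{-1} y^{-2} z; this is the point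
at which η is tested. For the weights 4, 3, 6 of x, y, z the equation is homogeneous. -/
theorem hasPresentation_E60_two :
    HasPresentation 2 (X 2 ^ 2 + X 0 ^ 3 + X 1 ^ 2 * X 2 : MvPowerSeries (Fin 3) k) ![(1, 1)]
      {Finsupp.single 0 (F 2 k), Finsupp.single 0 (V 2 k)} 1 := by
  set h : MvPowerSeries (Fin 3) k := X 2 ^ 2 + X 0 ^ 3 + X 1 ^ 2 * X 2 with hdef
  have hh : h = X 2 ^ 2 + ∑ t : Fin 2, X 0 ^ (![3, 0] t) * X 1 ^ (![0, 2] t) *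
      X 2 ^ ((![0, 1] t : Fin 2) : ℕ) := by
    simp [hdef, Fin.sum_univ_two]; ring
  obtain ⟨D⟩ := exists_doubleCover (by simp [Fin.forall_fin_succ]) hh
  have hz := mon_two_eq_of_charTwo hh
  have hrel := frobW_fW_sub_mem_of_forall (p := 2) (k := k) hz (N := 1) (j := 1) (by
    intro i hi e he
    rw [mem_primExp] at he
    simp only [Fin.sum_univ_two, Fin.forall_fin_succ] at he ⊢
    interval_cases i <;> simp at * <;> omega) 1 1
  have := hasPresentation_cyclic D hz (by simp [Fin.forall_fin_succ]) (by
      simp [Fin.forall_fin_succ]) (by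
      intro i j hi hj hij
      rcases (by omega : i ≤ -2 ∨ i = -1 ∧ j ≤ -2) with h | ⟨h, h'⟩
      · refine ⟨0, by norm_num, ?_, ?_, ?_⟩ <;> simp <;> omega
      · refine ⟨1, by norm_num, ?_, ?_, ?_⟩ <;> simp <;> omega) le_rfl one_pos (by norm_num)
    (c' := 0) (by norm_num) (by norm_num) hrel (ε := 1) (i := -1) (j := -2)
    ⟨by norm_num, by norm_num, by simp⟩
    (by norm_num) (by simp [Fin.forall_fin_succ]) ?_
  · simpa using this
  · rw [D.lc_layer {![1, 1]} (by rw [Finset.singleton_subset_iff, mem_primExp]; decide)]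
    · have h7 : teichCoeff 2 1 1 ![1, 1] = 1 := rfl
      simp [h7, Fin.sum_univ_two, D.lc_mon_one]
    · intro e he hne
      by_contra hc
      have hw := D.weight_le_of_lc_ne_zero Finset.univ _ _ _ _ hz 4 3 6 (by simp) (by simp)
        (by simp [Fin.forall_fin_succ]) hc
      rw [mem_primExp] at he
      refine hne (Finset.mem_singleton.mpr (funext ?_))
      simp [Fin.sum_univ_two, Fin.forall_fin_succ] at he hw ⊢
      omega

/-- The product of x³ and y³z at level 1 reproduces f_1, with multiplicity 35; the relation is
written with -1, as only the parity counts. For the weights 10, 6, 15, f_1 has weight -1, so the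
terms of level 3 in F f_1 have weight at least -16. The point x^{-1} y^{-1} has exactly this weight
and is reached only by the exponent (5, 3, 0), with multiplicity 7. -/
theorem hasPresentation_E83_two :
    HasPresentation 2 (X 2 ^ 2 + X 0 ^ 3 + X 1 ^ 5 + X 1 ^ 3 * X 2 : MvPowerSeries (Fin 3) k)
      ![(3, 1)] {Finsupp.single 0 (F 2 k + V 2 k), Finsupp.single 0 (V 2 k ^ 3)} 3 := by
  set h : MvPowerSeries (Fin 3) k := X 2 ^ 2 + X 0 ^ 3 + X 1 ^ 5 + X 1 ^ 3 * X 2 with hdef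
  have hh : h = X 2 ^ 2 + ∑ t : Fin 3, X 0 ^ (![3, 0, 0] t) * X 1 ^ (![0, 5, 3] t) *
      X 2 ^ ((![0, 0, 1] t : Fin 2) : ℕ) := by
    simp [hdef, Fin.sum_univ_three]; ring
  obtain ⟨D⟩ := exists_doubleCover (by simp [Fin.forall_fin_succ]) hh
  have hz := mon_two_eq_of_charTwo hh
  have hrel := frobW_fW_sub_mem_of_unique (p := 2) (k := k) hz (N := 3) (j := 1) (j' := 1) (e := 1)
    (by norm_num) (e₀ := ![1, 0, 1]) (by rw [mem_primExp]; decide) (by simp [Fin.sum_univ_three])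
    (by simp [Fin.sum_univ_three]) (by simp [Fin.sum_univ_three]) (by
      intro i hi e he hne
      rw [mem_primExp] at he
      simp only [Fin.sum_univ_three, Fin.forall_fin_succ] at he hne
      apply tm_mem_Bd
      simp [Fin.sum_univ_three]
      simp at he hne
      interval_cases i <;> simp at * <;> omega)
  have h35 : teichCoeff 2 3 1 ![1, 0, 1] = 35 := rfl
  have := hasPresentation_cyclic D hz (by simp [Fin.forall_fin_succ]) (by
      simp [Fin.forall_fin_succ]) (by
      intro i j hi hj hij
      rcases (by omega : i ≤ -2 ∨ i = -1 ∧ j ≤ -3 ∨ i = -1 ∧ j = -2) with h | ⟨h, h'⟩ | ⟨h, h'⟩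
      · refine ⟨0, by norm_num, ?_, ?_, ?_⟩ <;> simp <;> omega
      · refine ⟨1, by norm_num, ?_, ?_, ?_⟩ <;> simp <;> omega
      · refine ⟨2, by norm_num, ?_, ?_, ?_⟩ <;> simp <;> omega) (by norm_num) one_pos (by norm_num)
    (c' := -1) (by norm_num [h35]) (by norm_num [h35]) hrel (ε := 0) (i := -1) (j := -1)
    ⟨by norm_num, by norm_num, by simp⟩
    (by norm_num) (by simp [Fin.forall_fin_succ]) ?_
  · simpa using this
  · rw [D.lc_layer {![5, 3, 0]} (by rw [Finset.singleton_subset_iff, mem_primExp]; decide)]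
    · have h7 : teichCoeff 2 3 3 ![5, 3, 0] = 7 := rfl
      have h7' : (7 : k) ≠ 0 := by
        rw [← Nat.cast_ofNat, Ne, CharP.cast_eq_zero_iff k 2]; norm_num
      simpa [h7, Fin.sum_univ_three, D.lc_mon_zero] using h7'
    · intro e he hne
      by_contra hc
      have hw := D.weight_le_of_lc_ne_zero Finset.univ _ _ _ _ hz 10 6 15 (by simp) (by simp)
        (by simp [Fin.forall_fin_succ]) hc
      rw [mem_primExp] at he
      refine hne (Finset.mem_singleton.mpr (funext ?_))
      simp [Fin.sum_univ_three, Fin.forall_fin_succ] at he hw ⊢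
      omega

theorem hasPresentation_E82_two :
    HasPresentation 2 (X 2 ^ 2 + X 0 ^ 3 + X 1 ^ 5 + X 0 * X 1 ^ 2 * X 2 : MvPowerSeries (Fin 3) k)
      ![(3, 1)] {Finsupp.single 0 (F 2 k + V 2 k ^ 2), Finsupp.single 0 (V 2 k ^ 3)} 3 := by
  set h : MvPowerSeries (Fin 3) k := X 2 ^ 2 + X 0 ^ 3 + X 1 ^ 5 + X 0 * X 1 ^ 2 * X 2 with hdef
  have hh : h = X 2 ^ 2 + ∑ t : Fin 3, X 0 ^ (![3, 0, 1] t) * X 1 ^ (![0, 5, 2] t) *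
      X 2 ^ ((![0, 0, 1] t : Fin 2) : ℕ) := by
    simp [hdef, Fin.sum_univ_three]; ring
  obtain ⟨D⟩ := exists_doubleCover (by simp [Fin.forall_fin_succ]) hh
  have hz := mon_two_eq_of_charTwo hh
  have hrel := frobW_fW_sub_mem_of_unique (p := 2) (k := k) hz (N := 3) (j := 1) (j' := 1)
    (e := 2) (by norm_num) (e₀ := ![2, 1, 1]) (by rw [mem_primExp]; decide)
    (by simp [Fin.sum_univ_three]) (by simp [Fin.sum_univ_three]) (by simp [Fin.sum_univ_three]) (by
      intro i hi e he hne
      rw [mem_primExp] at he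
      simp only [Fin.sum_univ_three, Fin.forall_fin_succ] at he hne
      -- This exponent gives x^{-2} y^{-2} z³, with both exponents negative; one more expansion of
      -- z² shows that it is a coboundary in length 2, which is enough at level 2 for N = 3.
      by_cases hs : i = 2 ∧ e 0 = 1 ∧ e 1 = 0 ∧ e 2 = 3
      · obtain ⟨rfl, h0, h1, h2⟩ := hs
        have := tm_mem_Bd_of_expand (p := 2) k _ _ _ _ hz 2 1 (-2) (-2) 1 (by
          intro i hi e he
          rw [mem_primExp] at he
          simp only [Fin.sum_univ_three, Fin.forall_fin_succ] at he ⊢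
          interval_cases i <;> simp at * <;> omega)
        simpa [Fin.sum_univ_three, h0, h1, h2] using this
      apply tm_mem_Bd
      simp [Fin.sum_univ_three]
      simp at he hne
      interval_cases i <;> simp at * <;> omega)
  have hc : teichCoeff 2 3 2 ![2, 1, 1] = 105 := rfl
  have := hasPresentation_cyclic D hz (by simp [Fin.forall_fin_succ]) (by
      simp [Fin.forall_fin_succ]) (by
      intro i j hi hj hij
      rcases (by omega : i ≤ -2 ∨ i = -1 ∧ j ≤ -3 ∨ i = -1 ∧ j = -2) with h | ⟨h, h'⟩ | ⟨h, h'⟩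
      · refine ⟨0, by norm_num, ?_, ?_, ?_⟩ <;> simp <;> omega
      · refine ⟨1, by norm_num, ?_, ?_, ?_⟩ <;> simp <;> omega
      · refine ⟨2, by norm_num, ?_, ?_, ?_⟩ <;> simp <;> omega) (by norm_num) (e := 2) two_pos (by norm_num)
    (c' := -1) (by norm_num [hc]) (by norm_num [hc])
    hrel (ε := 0) (i := -1) (j := -1)
    ⟨by norm_num, by norm_num, by simp⟩
    (by norm_num) (by simp [Fin.forall_fin_succ]) ?_
  · simpa using this
  · rw [D.lc_layer {![5, 3, 0]} (by rw [Finset.singleton_subset_iff, mem_primExp]; decide)]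
    · have ht : teichCoeff 2 3 3 ![5, 3, 0] = 7 := rfl
      have h' : (7 : k) ≠ 0 := by
        rw [← Nat.cast_ofNat, Ne, CharP.cast_eq_zero_iff k 2]; norm_num
      simpa [ht, Fin.sum_univ_three, D.lc_mon_zero] using h'
    · intro e he hne
      by_contra hc
      have hw := D.weight_le_of_lc_ne_zero Finset.univ _ _ _ _ hz 10 6 15 (by simp) (by simp)
        (by simp [Fin.forall_fin_succ]) hc
      rw [mem_primExp] at he
      refine hne (Finset.mem_singleton.mpr (funext ?_))
      simp [Fin.sum_univ_three, Fin.forall_fin_succ] at he hw ⊢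
      omega

/-- The product of x³ and y³z at level 1 reproduces f_1 with odd multiplicity 3. At level 2 the
point x^{-1} y^{-2} z is reached only by (2, 1, 1), again with multiplicity 3. The weights are 6, 4,
9. -/
theorem hasPresentation_E72_two :
    HasPresentation 2 (X 2 ^ 2 + X 0 ^ 3 + X 0 * X 1 ^ 3 + X 1 ^ 3 * X 2 : MvPowerSeries (Fin 3) k)
      ![(2, 1)] {Finsupp.single 0 (F 2 k + V 2 k), Finsupp.single 0 (V 2 k ^ 2)} 2 := by
  set h : MvPowerSeries (Fin 3) k := X 2 ^ 2 + X 0 ^ 3 + X 0 * X 1 ^ 3 + X 1 ^ 3 * X 2 with hdef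
  have hh : h = X 2 ^ 2 + ∑ t : Fin 3, X 0 ^ (![3, 1, 0] t) * X 1 ^ (![0, 3, 3] t) *
      X 2 ^ ((![0, 0, 1] t : Fin 2) : ℕ) := by
    simp [hdef, Fin.sum_univ_three]; ring
  obtain ⟨D⟩ := exists_doubleCover (by simp [Fin.forall_fin_succ]) hh
  have hz := mon_two_eq_of_charTwo hh
  have hrel := frobW_fW_sub_mem_of_unique (p := 2) (k := k) hz (N := 2) (j := 1) (j' := 1)
    (e := 1) (by norm_num) (e₀ := ![1, 0, 1]) (by rw [mem_primExp]; decide)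
    (by simp [Fin.sum_univ_three]) (by simp [Fin.sum_univ_three]) (by simp [Fin.sum_univ_three]) (by
      intro i hi e he hne
      rw [mem_primExp] at he
      simp only [Fin.sum_univ_three, Fin.forall_fin_succ] at he hne
      apply tm_mem_Bd
      simp [Fin.sum_univ_three]
      simp at he hne
      interval_cases i <;> simp at * <;> omega)
  have hc : teichCoeff 2 2 1 ![1, 0, 1] = 3 := rfl
  have := hasPresentation_cyclic D hz (by simp [Fin.forall_fin_succ]) (by
      simp [Fin.forall_fin_succ]) (by
      intro i j hi hj hij
      rcases (by omega : i ≤ -2 ∨ i = -1 ∧ j ≤ -2) with h | ⟨h, h'⟩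
      · refine ⟨0, by norm_num, ?_, ?_, ?_⟩ <;> simp <;> omega
      · refine ⟨1, by norm_num, ?_, ?_, ?_⟩ <;> simp <;> omega) (by norm_num) (e := 1) one_pos (by norm_num)
    (c' := -1) (by norm_num [hc]) (by norm_num [hc])
    hrel (ε := 1) (i := -1) (j := -2)
    ⟨by norm_num, by norm_num, by simp⟩
    (by norm_num) (by simp [Fin.forall_fin_succ]) ?_
  · simpa using this
  · rw [D.lc_layer {![2, 1, 1]} (by rw [Finset.singleton_subset_iff, mem_primExp]; decide)]
    · have ht : teichCoeff 2 2 2 ![2, 1, 1] = 3 := rfl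
      have h' : (3 : k) ≠ 0 := by
        rw [← Nat.cast_ofNat, Ne, CharP.cast_eq_zero_iff k 2]; norm_num
      simpa [ht, Fin.sum_univ_three, D.lc_mon_one] using h'
    · intro e he hne
      by_contra hc
      have hw := D.weight_le_of_lc_ne_zero Finset.univ _ _ _ _ hz 6 4 9 (by simp) (by simp)
        (by simp [Fin.forall_fin_succ]) hc
      rw [mem_primExp] at he
      refine hne (Finset.mem_singleton.mpr (funext ?_))
      simp [Fin.sum_univ_three, Fin.forall_fin_succ] at he hw ⊢
      omega

theorem hasPresentation_E71_two :
    HasPresentation 2 (X 2 ^ 2 + X 0 ^ 3 + X 0 * X 1 ^ 3 + X 0 ^ 2 * X 1 * X 2 : MvPowerSeries (Fin 3) k)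
      ![(3, 1)] {Finsupp.single 0 (F 2 k + V 2 k ^ 2), Finsupp.single 0 (V 2 k ^ 3)} 3 := by
  set h : MvPowerSeries (Fin 3) k := X 2 ^ 2 + X 0 ^ 3 + X 0 * X 1 ^ 3 + X 0 ^ 2 * X 1 * X 2 with hdef
  have hh : h = X 2 ^ 2 + ∑ t : Fin 3, X 0 ^ (![3, 1, 2] t) * X 1 ^ (![0, 3, 1] t) *
      X 2 ^ ((![0, 0, 1] t : Fin 2) : ℕ) := by
    simp [hdef, Fin.sum_univ_three]; ring
  obtain ⟨D⟩ := exists_doubleCover (by simp [Fin.forall_fin_succ]) hh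
  have hz := mon_two_eq_of_charTwo hh
  have hrel := frobW_fW_sub_mem_of_unique (p := 2) (k := k) hz (N := 3) (j := 1) (j' := 1)
    (e := 2) (by norm_num) (e₀ := ![1, 2, 1]) (by rw [mem_primExp]; decide)
    (by simp [Fin.sum_univ_three]) (by simp [Fin.sum_univ_three]) (by simp [Fin.sum_univ_three]) (by
      intro i hi e he hne
      rw [mem_primExp] at he
      simp only [Fin.sum_univ_three, Fin.forall_fin_succ] at he hne
      -- The term x^{-1} y^{-2} z³ becomes a coboundary in length 2 only after a further expansion
      -- of z².
      by_cases hs : i = 2 ∧ e 0 = 0 ∧ e 1 = 1 ∧ e 2 = 3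
      · obtain ⟨rfl, h0, h1, h2⟩ := hs
        have := tm_mem_Bd_of_expand (p := 2) k _ _ _ _ hz 2 1 (-1) (-2) 1 (by
          intro i hi e he
          rw [mem_primExp] at he
          simp only [Fin.sum_univ_three, Fin.forall_fin_succ] at he ⊢
          interval_cases i <;> simp at * <;> omega)
        simpa [Fin.sum_univ_three, h0, h1, h2] using this
      apply tm_mem_Bd
      simp [Fin.sum_univ_three]
      simp at he hne
      interval_cases i <;> simp at * <;> omega)
  have hc : teichCoeff 2 3 2 ![1, 2, 1] = 105 := rfl
  have := hasPresentation_cyclic D hz (by simp [Fin.forall_fin_succ]) (by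
      simp [Fin.forall_fin_succ]) (by
      intro i j hi hj hij
      rcases (by omega : i ≤ -2 ∨ i = -1 ∧ j ≤ -2) with h | ⟨h, h'⟩
      · refine ⟨0, by norm_num, ?_, ?_, ?_⟩ <;> simp <;> omega
      · refine ⟨1, by norm_num, ?_, ?_, ?_⟩ <;> simp <;> omega) (by norm_num) (e := 2) two_pos (by norm_num)
    (c' := -1) (by norm_num [hc]) (by norm_num [hc])
    hrel (ε := 0) (i := -2) (j := -1)
    ⟨by norm_num, by norm_num, by simp⟩
    (by norm_num) (by simp [Fin.forall_fin_succ]) ?_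
  · simpa using this
  · rw [D.lc_layer {![3, 5, 0]} (by rw [Finset.singleton_subset_iff, mem_primExp]; decide)]
    · have ht : teichCoeff 2 3 3 ![3, 5, 0] = 7 := rfl
      have h' : (7 : k) ≠ 0 := by
        rw [← Nat.cast_ofNat, Ne, CharP.cast_eq_zero_iff k 2]; norm_num
      simpa [ht, Fin.sum_univ_three, D.lc_mon_zero] using h'
    · intro e he hne
      by_contra hc
      have hw := D.weight_le_of_lc_ne_zero Finset.univ _ _ _ _ hz 6 4 9 (by simp) (by simp)
        (by simp [Fin.forall_fin_succ]) hc
      rw [mem_primExp] at he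
      refine hne (Finset.mem_singleton.mpr (funext ?_))
      simp [Fin.sum_univ_three, Fin.forall_fin_succ] at he hw ⊢
      omega

/-- The equation is homogeneous for the weights 6, 4, 9, and F f_1 vanishes below level 3. There the
point x^{-2} y^{-1}, of weight -16, is reached only by (3, 5). -/
theorem hasPresentation_E70_two :
    HasPresentation 2 (X 2 ^ 2 + X 0 ^ 3 + X 0 * X 1 ^ 3 : MvPowerSeries (Fin 3) k)
      ![(3, 1)] {Finsupp.single 0 (F 2 k), Finsupp.single 0 (V 2 k ^ 3)} 3 := by
  set h : MvPowerSeries (Fin 3) k := X 2 ^ 2 + X 0 ^ 3 + X 0 * X 1 ^ 3 with hdef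
  have hh : h = X 2 ^ 2 + ∑ t : Fin 2, X 0 ^ (![3, 1] t) * X 1 ^ (![0, 3] t) *
      X 2 ^ ((![0, 0] t : Fin 2) : ℕ) := by
    simp [hdef, Fin.sum_univ_two]; ring
  obtain ⟨D⟩ := exists_doubleCover (by simp [Fin.forall_fin_succ]) hh
  have hz := mon_two_eq_of_charTwo hh
  have hrel := frobW_fW_sub_mem_of_forall (p := 2) (k := k) hz (N := 3) (j := 1) (by
    intro i hi e he
    rw [mem_primExp] at he
    simp only [Fin.sum_univ_two, Fin.forall_fin_succ] at he ⊢
    interval_cases i <;> simp at * <;> omega) 3 1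
  have := hasPresentation_cyclic D hz (by simp [Fin.forall_fin_succ]) (by
      simp [Fin.forall_fin_succ]) (by
      intro i j hi hj hij
      rcases (by omega : i ≤ -2 ∨ i = -1 ∧ j ≤ -2) with h | ⟨h, h'⟩
      · refine ⟨0, by norm_num, ?_, ?_, ?_⟩ <;> simp <;> omega
      · refine ⟨1, by norm_num, ?_, ?_, ?_⟩ <;> simp <;> omega) (by norm_num) (by norm_num) (by norm_num)
    (c' := 0) (by norm_num) (by norm_num)
    hrel (ε := 0) (i := -2) (j := -1)
    ⟨by norm_num, by norm_num, by simp⟩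
    (by norm_num) (by simp [Fin.forall_fin_succ]) ?_
  · simpa using this
  · rw [D.lc_layer {![3, 5]} (by rw [Finset.singleton_subset_iff, mem_primExp]; decide)]
    · have ht : teichCoeff 2 3 3 ![3, 5] = 7 := rfl
      have h' : (7 : k) ≠ 0 := by
        rw [← Nat.cast_ofNat, Ne, CharP.cast_eq_zero_iff k 2]; norm_num
      simpa [ht, Fin.sum_univ_two, D.lc_mon_zero] using h'
    · intro e he hne
      by_contra hc
      have hw := D.weight_le_of_lc_ne_zero Finset.univ _ _ _ _ hz 6 4 9 (by simp) (by simp)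
        (by simp [Fin.forall_fin_succ]) hc
      rw [mem_primExp] at he
      refine hne (Finset.mem_singleton.mpr (funext ?_))
      simp [Fin.sum_univ_two, Fin.forall_fin_succ] at he hw ⊢
      omega

end CharTwo

/-! ### Presentations with two generators -/

section TwoGenerators

variable {p : ℕ} [Fact p.Prime] {k : Type u} [Field k] [CharP k p] [PerfectRing k p]

open DieudonneRing in
/-- The case of two generators `f_1^{(3)}` and `f_2^{(1)}`, where `F` kills the first one and maps
the second one to a multiple of `f_1^{(1)}`. -/
theorem hasPresentation_two_generators {h : MvPowerSeries (Fin 3) k}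
    (D : DoubleCover k (var h 0) (var h 1) (var h 2)) {ι : Type} [Fintype ι] [DecidableEq ι]
    {κ α β : ι → ℤ} {γ : ι → Fin 2}
    (hz : mon (var h 0) (var h 1) (var h 2) 0 0 p =
      ∑ t, κ t • mon (var h 0) (var h 1) (var h 2) (α t) (β t) (γ t))
    (hbase : ∀ t, γ t = 0 → ¬((p : ℤ) ∣ α t ∧ (p : ℤ) ∣ β t))
    (hdist : ∀ t t', t' ≠ t → γ t = γ t' → ¬((p : ℤ) ∣ α t - α t' ∧ (p : ℤ) ∣ β t - β t'))
    (hsupp : ∀ i j : ℤ, i < 0 → j < 0 → ¬(i = -1 ∧ (j = -1 ∨ j = -2)) →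
      ∃ t, ¬(p : ℤ) ∣ κ t ∧ OffSupport {1, 2} (γ t) (p * i + α t) (p * j + β t))
    {c : ℤ} {η₁ η₂ : WittVector p (Localization.Away (var h 0 * var h 1))}
    (hrel₁ : frobW p k _ _ (fW p (var h 0) (var h 1) (var h 2) 1) -
      ((0 : ℤ) • WittVector.verschiebung^[3] (fW p (var h 0) (var h 1) (var h 2) 1) +
        WittVector.verschiebung^[3] η₁) ∈ Bd p (var h 0) (var h 1) 4)
    (hrel₂ : frobW p k _ _ (fW p (var h 0) (var h 1) (var h 2) 2) -
      (c • WittVector.verschiebung^[0] (fW p (var h 0) (var h 1) (var h 2) 1) +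
        WittVector.verschiebung^[1] η₂) ∈ Bd p (var h 0) (var h 1) 2)
    {ε₁ ε₂ : Fin 2} {i₁ j₁ i₂ j₂ : ℤ} (hoff₁ : OffSupport {1, 2} ε₁ i₁ j₁)
    (h01 : ε₁ = 0 → ¬((p : ℤ) ∣ i₁ ∧ (p : ℤ) ∣ j₁))
    (h11 : ∀ t, ε₁ = γ t → ¬((p : ℤ) ∣ i₁ - α t ∧ (p : ℤ) ∣ j₁ - β t))
    (hoff₂ : OffSupport {1, 2} ε₂ i₂ j₂) (h02 : ε₂ = 0 → ¬((p : ℤ) ∣ i₂ ∧ (p : ℤ) ∣ j₂))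
    (h12 : ∀ t, ε₂ = γ t → ¬((p : ℤ) ∣ i₂ - α t ∧ (p : ℤ) ∣ j₂ - β t))
    (hη₁ : D.lc (η₁.coeff 0) ε₁ i₁ j₁ ≠ 0) (hη₂ : D.lc (η₂.coeff 0) ε₂ i₂ j₂ ≠ 0)
    (hη : D.lc (η₁.coeff 0) ε₂ i₂ j₂ = 0) :
    HasPresentation p h ![(3, 1), (1, 2)]
      {Finsupp.single 0 (F p k), Finsupp.single 0 (V p k ^ 3),
        Finsupp.single 1 (F p k) - c • Finsupp.single 0 (V p k ^ 2),
        Finsupp.single 1 (V p k)} 4 := by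
  have H : FrobRelations p k (var h 0) (var h 1) (var h 2) {1, 2} (fun j => if j = 1 then 3 else 1)
      (fun j => if j = 1 then 0 else c) (fun j => if j = 1 then 3 else 0) (fun _ => 1)
      (fun j => if j = 1 then η₁ else η₂) :=
    { pos := by simp
      one_le := by simp
      rel := by
        intro j hj
        rcases Finset.mem_insert.mp hj with rfl | hj
        · simpa using hrel₁
        · rw [Finset.mem_singleton.mp hj]
          simpa using hrel₂
      lower := by simp }
  have hV1 := H.V_smul_fel (l := 0) (j := 1) (by simp) (by simp)
  have hV2 := H.V_smul_fel (l := 1) (j := 1) (by simp) (by simp)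
  have hV3 := H.V_smul_fel (l := 2) (j := 1) (by simp) (by simp)
  have hV4 := H.V_smul_fel (l := 0) (j := 2) (by simp) (by simp)
  have hF1 := H.F_smul_fel (l := 3) (j := 1) (by simp) (by simp)
  have hF2 := H.F_smul_fel (l := 1) (j := 2) (by simp) (by simp)
  simp only [zero_add, Nat.reduceAdd, if_true, zero_smul, fel_zero] at hV1 hV2 hV3 hV4 hF1
  simp only [OfNat.ofNat_ne_one, if_false, Nat.sub_zero] at hF2
  have hFV : ∀ n, F p k * V p k ^ n = V p k ^ n * F p k := fun n =>
    Commute.pow_right (F_mul_V.trans V_mul_F.symm : Commute (F p k) (V p k)) _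
  set rels : Set (Fin 2 →₀ DieudonneRing p k) :=
    {Finsupp.single 0 (F p k), Finsupp.single 0 (V p k ^ 3),
      Finsupp.single 1 (F p k) - c • Finsupp.single 0 (V p k ^ 2), Finsupp.single 1 (V p k)} with hrels
  have hr1 : Finsupp.single 0 (F p k) ∈ Submodule.span (DieudonneRing p k) rels :=
    Submodule.subset_span (by simp [hrels])
  have hr2 : Finsupp.single 0 (V p k ^ 3) ∈ Submodule.span (DieudonneRing p k) rels :=
    Submodule.subset_span (by simp [hrels])
  have hr3 : Finsupp.single 1 (F p k) - c • Finsupp.single 0 (V p k ^ 2) ∈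
      Submodule.span (DieudonneRing p k) rels := Submodule.subset_span (by simp [hrels])
  have hr4 : Finsupp.single 1 (V p k) ∈ Submodule.span (DieudonneRing p k) rels :=
    Submodule.subset_span (by simp [hrels])
  have := hasPresentation_of_relations D H ?_ ![(3, 1), (1, 2)] rels
    (fun n j => if n = 0 then 0 else if j = 1 then Finsupp.single 0 (V p k ^ (3 - n)) else
      Finsupp.single 1 1) (fun j => if j = 1 then 0 else c) ?_ ?_ ?_ ?_ ?_ ?_ ?_
  · simpa using this
  · intro u d hu
    have hd : ∀ ε i j, OffSupport {1, 2} ε i j → D.lc (u ^ p) ε i j +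
        (d 1 * D.lc (η₁.coeff 0) ε i j + d 2 * D.lc (η₂.coeff 0) ε i j) = 0 := by
      intro ε i j hoff
      have := hu ε i j hoff
      rw [Finset.sum_insert (by simp), Finset.sum_singleton, D.lc_add, D.lc_add,
        D.lc_algebraMap_mul, D.lc_algebraMap_mul] at this
      simpa using this
    -- The second point is used first, because η₁ has no coefficient there.
    have hd2 : d 2 = 0 := by
      have := hd _ _ _ hoff₂
      rw [D.lc_pow_eq_zero hz h02 h12, hη, zero_add, mul_zero, zero_add] at this
      exact (mul_eq_zero.mp this).resolve_right hη₂
    have hd1 : d 1 = 0 := by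
      have := hd _ _ _ hoff₁
      rw [D.lc_pow_eq_zero hz h01 h11, hd2, zero_add, zero_mul, add_zero] at this
      exact (mul_eq_zero.mp this).resolve_right hη₁
    refine ⟨by simp [hd1, hd2], D.lc_eq_zero_of_pow hz hbase hdist ?_ ?_⟩
    · intro i j hi hj hij
      refine hsupp i j hi hj fun h => hij ⟨h.1, ?_⟩
      rcases h.2 with h | h <;> simp [h]
    · intro ε i j hoff
      have := hd ε i j hoff
      rwa [hd1, hd2, zero_mul, zero_mul, add_zero, add_zero] at this
  · intro i
    fin_cases i
    · exact ⟨by simp, by simp, by simp, by simp⟩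
    · exact ⟨by simp, by simp, by simp, by simp⟩
  · intro j; rfl
  · intro j hj n hn
    rcases Finset.mem_insert.mp hj with rfl | hj
    · simp only [if_true] at hn
      simp only [Nat.succ_ne_zero, if_false, if_true]
      rw [Finsupp.smul_single, smul_eq_mul, ← pow_succ', show 3 - (n + 1) + 1 = 3 - n by omega]
      split_ifs with h
      · subst h
        rw [sub_zero]
        exact hr2
      · rw [sub_self]; exact zero_mem _
    · obtain rfl := Finset.mem_singleton.mp hj
      obtain rfl : n = 0 := by simp at hn; exact hn
      simpa using hr4
  · intro j _ h; exact h
  · intro j hj n hn hnl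
    rcases Finset.mem_insert.mp hj with rfl | hj
    · simp only [if_true, zero_smul, sub_zero]
      rw [if_neg (by omega), Finsupp.smul_single, smul_eq_mul, hFV, ← smul_eq_mul,
        ← Finsupp.smul_single]
      exact Submodule.smul_mem _ _ hr1
    · obtain rfl := Finset.mem_singleton.mp hj
      obtain rfl : n = 1 := by simp at hnl; omega
      simpa using hr3
  · intro j hj n hn hnl
    rcases Finset.mem_insert.mp hj with rfl | hj
    · simp only [if_true] at hnl
      rw [if_neg (by omega), if_pos rfl, Finsupp.linearCombination_single]
      simp only [Matrix.cons_val_zero]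
      interval_cases n
      · rw [show 3 - 1 = 1 + 1 by rfl, pow_succ, mul_smul, hV3, pow_one, hV2]
      · rw [show 3 - 2 = 1 by rfl, pow_one, hV3]
      · rw [Nat.sub_self, pow_zero, one_smul]
    · obtain rfl := Finset.mem_singleton.mp hj
      obtain rfl : n = 1 := by simp at hnl; omega
      simp
  · rw [hrels]
    have hV22 : V p k ^ 2 • fel p k (var h 0) (var h 1) (var h 2) 3 1 =
        fel p k (var h 0) (var h 1) (var h 2) 1 1 := by
      rw [pow_two, mul_smul, hV3, hV2]
    rintro ρ (rfl | rfl | rfl | rfl)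
    · simpa [Finsupp.linearCombination_single] using hF1
    · rw [Finsupp.linearCombination_single]
      simp only [Matrix.cons_val_zero]
      rw [pow_succ', mul_smul, hV22, hV1]
    · rw [map_sub, map_zsmul, Finsupp.linearCombination_single, Finsupp.linearCombination_single]
      simp only [Matrix.cons_val_zero, Matrix.cons_val_one]
      rw [hV22, hF2, sub_self]
    · simpa [Finsupp.linearCombination_single] using hV4

end TwoGenerators

/-! ### Characteristic 2: `E_8^1` and `E_8^0` -/

section CharTwo

variable {k : Type u} [Field k] [CharP k 2] [PerfectRing k 2]

open DieudonneRing MvPowerSeries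

/-- The term x y³ z at level 0 sends f_2 to f_1 in length 1. With the weights 10, 6, 15 the layer η₁
has weight at least -16 and is tested at x^{-1} y^{-1}. The layer η₂ is tested at x^{-1} y^{-3},
whose weight -28 is out of reach for η₁. -/
theorem hasPresentation_E81_two :
    HasPresentation 2 (X 2 ^ 2 + X 0 ^ 3 + X 1 ^ 5 + X 0 * X 1 ^ 3 * X 2 : MvPowerSeries (Fin 3) k)
      ![(3, 1), (1, 2)] {Finsupp.single 0 (F 2 k), Finsupp.single 0 (V 2 k ^ 3),
        Finsupp.single 1 (F 2 k) - Finsupp.single 0 (V 2 k ^ 2), Finsupp.single 1 (V 2 k)} 4 := by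
  set h : MvPowerSeries (Fin 3) k := X 2 ^ 2 + X 0 ^ 3 + X 1 ^ 5 + X 0 * X 1 ^ 3 * X 2 with hdef
  have hh : h = X 2 ^ 2 + ∑ t : Fin 3, X 0 ^ (![3, 0, 1] t) * X 1 ^ (![0, 5, 3] t) *
      X 2 ^ ((![0, 0, 1] t : Fin 2) : ℕ) := by
    simp [hdef, Fin.sum_univ_three]; ring
  obtain ⟨D⟩ := exists_doubleCover (by simp [Fin.forall_fin_succ]) hh
  have hz := mon_two_eq_of_charTwo hh
  have hrel₁ := frobW_fW_sub_mem_of_forall (p := 2) (k := k) hz (N := 3) (j := 1) (by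
    intro i hi e he
    rw [mem_primExp] at he
    simp only [Fin.sum_univ_three, Fin.forall_fin_succ] at he ⊢
    interval_cases i <;> simp at * <;> omega) 3 1
  have hrel₂ := frobW_fW_sub_mem_of_unique (p := 2) (k := k) hz (N := 1) (j := 2) (j' := 1)
    (e := 0) (by norm_num) (e₀ := ![0, 0, 1]) (by rw [mem_primExp]; decide)
    (by simp [Fin.sum_univ_three]) (by simp [Fin.sum_univ_three]) (by simp [Fin.sum_univ_three]) (by
      intro i hi e he hne
      rw [mem_primExp] at he
      simp only [Fin.sum_univ_three, Fin.forall_fin_succ] at he hne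
      apply tm_mem_Bd
      simp [Fin.sum_univ_three]
      simp at he hne
      interval_cases i <;> simp at * <;> omega)
  have hc : teichCoeff 2 1 0 ![0, 0, 1] = 1 := rfl
  have := hasPresentation_two_generators D hz (by simp [Fin.forall_fin_succ]) (by
      simp [Fin.forall_fin_succ]) (by
      intro i j hi hj hij
      rcases (by omega : i ≤ -2 ∨ i = -1 ∧ j ≤ -3) with h | ⟨h, h'⟩
      · refine ⟨0, by norm_num, ?_, ?_, ?_⟩ <;> simp <;> omega
      · refine ⟨1, by norm_num, ?_, ?_, ?_⟩ <;> simp <;> omega) hrel₁ hrel₂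
    (ε₁ := 0) (i₁ := -1) (j₁ := -1) (ε₂ := 0) (i₂ := -1) (j₂ := -3)
    ⟨by norm_num, by norm_num, by simp⟩ (by norm_num) (by simp [Fin.forall_fin_succ])
    ⟨by norm_num, by norm_num, by simp⟩ (by norm_num) (by simp [Fin.forall_fin_succ]) ?_ ?_ ?_
  · simpa [hc] using this
  · rw [D.lc_layer {![5, 3, 0]} (by rw [Finset.singleton_subset_iff, mem_primExp]; decide)]
    · have ht : teichCoeff 2 3 3 ![5, 3, 0] = 7 := rfl
      have h' : (7 : k) ≠ 0 := by
        rw [← Nat.cast_ofNat, Ne, CharP.cast_eq_zero_iff k 2]; norm_num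
      simpa [ht, Fin.sum_univ_three, D.lc_mon_zero] using h'
    · intro e he hne
      by_contra hc
      have hw := D.weight_le_of_lc_ne_zero Finset.univ _ _ _ _ hz 10 6 15 (by simp) (by simp)
        (by simp [Fin.forall_fin_succ]) hc
      rw [mem_primExp] at he
      refine hne (Finset.mem_singleton.mpr (funext ?_))
      simp [Fin.sum_univ_three, Fin.forall_fin_succ] at he hw ⊢
      omega
  · rw [D.lc_layer {![1, 1, 0]} (by rw [Finset.singleton_subset_iff, mem_primExp]; decide)]
    · have ht : teichCoeff 2 1 1 ![1, 1, 0] = 1 := rfl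
      simp [ht, Fin.sum_univ_three, D.lc_mon_zero]
    · intro e he hne
      by_contra hc
      have hw := D.weight_le_of_lc_ne_zero Finset.univ _ _ _ _ hz 10 6 15 (by simp) (by simp)
        (by simp [Fin.forall_fin_succ]) hc
      rw [mem_primExp] at he
      refine hne (Finset.mem_singleton.mpr (funext ?_))
      simp [Fin.sum_univ_three, Fin.forall_fin_succ] at he hw ⊢
      omega
  · rw [D.lc_layer ∅ (Finset.empty_subset _), Finset.sum_empty]
    intro e he _
    by_contra hc
    have hw := D.weight_le_of_lc_ne_zero Finset.univ _ _ _ _ hz 10 6 15 (by simp) (by simp)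
      (by simp [Fin.forall_fin_succ]) hc
    rw [mem_primExp] at he
    simp [Fin.sum_univ_three, Fin.forall_fin_succ] at he hw
    omega

theorem hasPresentation_E80_two :
    HasPresentation 2 (X 2 ^ 2 + X 0 ^ 3 + X 1 ^ 5 : MvPowerSeries (Fin 3) k)
      ![(3, 1), (1, 2)] {Finsupp.single 0 (F 2 k), Finsupp.single 0 (V 2 k ^ 3),
        Finsupp.single 1 (F 2 k), Finsupp.single 1 (V 2 k)} 4 := by
  set h : MvPowerSeries (Fin 3) k := X 2 ^ 2 + X 0 ^ 3 + X 1 ^ 5 with hdef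
  have hh : h = X 2 ^ 2 + ∑ t : Fin 2, X 0 ^ (![3, 0] t) * X 1 ^ (![0, 5] t) *
      X 2 ^ ((![0, 0] t : Fin 2) : ℕ) := by
    simp [hdef, Fin.sum_univ_two]; ring
  obtain ⟨D⟩ := exists_doubleCover (by simp [Fin.forall_fin_succ]) hh
  have hz := mon_two_eq_of_charTwo hh
  have hrel₁ := frobW_fW_sub_mem_of_forall (p := 2) (k := k) hz (N := 3) (j := 1) (by
    intro i hi e he
    rw [mem_primExp] at he
    simp only [Fin.sum_univ_two, Fin.forall_fin_succ] at he ⊢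
    interval_cases i <;> simp at * <;> omega) 3 1
  have hrel₂ := frobW_fW_sub_mem_of_forall (p := 2) (k := k) hz (N := 1) (j := 2) (by
    intro i hi e he
    rw [mem_primExp] at he
    simp only [Fin.sum_univ_two, Fin.forall_fin_succ] at he ⊢
    interval_cases i <;> simp at * <;> omega) 0 1
  have := hasPresentation_two_generators D hz (by simp [Fin.forall_fin_succ]) (by
      simp [Fin.forall_fin_succ]) (by
      intro i j hi hj hij
      rcases (by omega : i ≤ -2 ∨ i = -1 ∧ j ≤ -3) with h | ⟨h, h'⟩
      · refine ⟨0, by norm_num, ?_, ?_, ?_⟩ <;> simp <;> omega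
      · refine ⟨1, by norm_num, ?_, ?_, ?_⟩ <;> simp <;> omega) hrel₁ hrel₂
    (ε₁ := 0) (i₁ := -1) (j₁ := -1) (ε₂ := 0) (i₂ := -1) (j₂ := -3)
    ⟨by norm_num, by norm_num, by simp⟩ (by norm_num) (by simp [Fin.forall_fin_succ])
    ⟨by norm_num, by norm_num, by simp⟩ (by norm_num) (by simp [Fin.forall_fin_succ]) ?_ ?_ ?_
  · simpa using this
  · rw [D.lc_layer {![5, 3]} (by rw [Finset.singleton_subset_iff, mem_primExp]; decide)]
    · have ht : teichCoeff 2 3 3 ![5, 3] = 7 := rfl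
      have h' : (7 : k) ≠ 0 := by
        rw [← Nat.cast_ofNat, Ne, CharP.cast_eq_zero_iff k 2]; norm_num
      simpa [ht, Fin.sum_univ_two, D.lc_mon_zero] using h'
    · intro e he hne
      by_contra hc
      have hw := D.weight_le_of_lc_ne_zero Finset.univ _ _ _ _ hz 10 6 15 (by simp) (by simp)
        (by simp [Fin.forall_fin_succ]) hc
      rw [mem_primExp] at he
      refine hne (Finset.mem_singleton.mpr (funext ?_))
      simp [Fin.sum_univ_two, Fin.forall_fin_succ] at he hw ⊢
      omega
  · rw [D.lc_layer {![1, 1]} (by rw [Finset.singleton_subset_iff, mem_primExp]; decide)]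
    · have ht : teichCoeff 2 1 1 ![1, 1] = 1 := rfl
      simp [ht, Fin.sum_univ_two, D.lc_mon_zero]
    · intro e he hne
      by_contra hc
      have hw := D.weight_le_of_lc_ne_zero Finset.univ _ _ _ _ hz 10 6 15 (by simp) (by simp)
        (by simp [Fin.forall_fin_succ]) hc
      rw [mem_primExp] at he
      refine hne (Finset.mem_singleton.mpr (funext ?_))
      simp [Fin.sum_univ_two, Fin.forall_fin_succ] at he hw ⊢
      omega
  · rw [D.lc_layer ∅ (Finset.empty_subset _), Finset.sum_empty]
    intro e he _
    by_contra hc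
    have hw := D.weight_le_of_lc_ne_zero Finset.univ _ _ _ _ hz 10 6 15 (by simp) (by simp)
      (by simp [Fin.forall_fin_succ]) hc
    rw [mem_primExp] at he
    simp [Fin.sum_univ_two, Fin.forall_fin_succ] at he hw
    omega

end CharTwo

open DieudonneRing MvPowerSeries

/-- The exponents in the expansion of z⁵ whose monomial can reach x^{-1} y^{-5} z, for `E_8^0` in
characteristic 5. -/
theorem mem_exponents_of_bounds (a b c : ℕ) (h1 : a + b + c = 5) (h2 : 6 * a + 3 * b ≤ 24)
    (h3 : b + 2 * c ≤ 4) : ![a, b, c] ∈ ({![1, 4, 0], ![2, 2, 1], ![2, 3, 0], ![3, 0, 2],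
      ![3, 1, 1], ![3, 2, 0], ![4, 0, 1]} : Finset (Fin 3 → ℕ)) := by
  have ha : a ≤ 4 := by omega
  have hb : b ≤ 4 := by omega
  have hc : c ≤ 2 := by omega
  interval_cases a <;> interval_cases b <;> interval_cases c <;> first | omega | decide

/-! ### Characteristic 5 -/

section CharFive

variable [Fact (Nat.Prime 5)] {k : Type u} [Field k] [CharP k 5] [PerfectRing k 5]

theorem hasPresentation_E80_five :
    HasPresentation 5 (X 2 ^ 2 + X 0 ^ 3 + X 1 ^ 5 : MvPowerSeries (Fin 3) k) ![(1, 1)]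
      {Finsupp.single 0 (F 5 k), Finsupp.single 0 (V 5 k)} 1 := by
  set h : MvPowerSeries (Fin 3) k := X 2 ^ 2 + X 0 ^ 3 + X 1 ^ 5 with hdef
  have hh : h = X 2 ^ 2 + ∑ t : Fin 2, X 0 ^ (![3, 0] t) * X 1 ^ (![0, 5] t) *
      X 2 ^ ((![0, 0] t : Fin 2) : ℕ) := by
    simp [hdef, Fin.sum_univ_two]; ring
  obtain ⟨D⟩ := exists_doubleCover (by simp [Fin.forall_fin_succ]) hh
  have hz2 := mon_two_eq hh
  have hR : var h 2 ^ 5 = ∑ t : Fin 3, (![1, 2, 1] t : ℤ) •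
      (var h 0 ^ (![6, 3, 0] t) * var h 1 ^ (![0, 5, 10] t) *
        var h 2 ^ ((![1, 1, 1] t : Fin 2) : ℕ)) := by
    have h2 := var_sq_eq hh
    simp [Fin.sum_univ_two] at h2
    simp [Fin.sum_univ_three]
    linear_combination var h 2 * (var h 2 ^ 2 - (var h 0 ^ 3 + var h 1 ^ 5)) * h2
  have hz := mon_eq_sum (x := var h 0) (y := var h 1) (γ := fun t => ((![1, 1, 1] t : Fin 2) : ℕ)) hR
  have hrel := frobW_fW_sub_mem_of_forall (p := 5) (k := k) hz (N := 1) (j := 1) (by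
    intro i hi e he
    rw [mem_primExp] at he
    simp only [Fin.sum_univ_three, Fin.forall_fin_succ] at he ⊢
    interval_cases i <;> simp at * <;> omega) 1 1
  have := hasPresentation_cyclic D hz (by simp [Fin.forall_fin_succ]) (by
      simp [Fin.forall_fin_succ]) (by
      intro i j hi hj hij
      rcases (by omega : i ≤ -2 ∨ i = -1 ∧ j = -2 ∨ i = -1 ∧ j ≤ -3) with h | ⟨h, h'⟩ | ⟨h, h'⟩
      · refine ⟨0, by norm_num, ?_, ?_, ?_⟩ <;> simp <;> omega
      · refine ⟨1, by norm_num, ?_, ?_, ?_⟩ <;> simp <;> omega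
      · refine ⟨2, by simp, ?_, ?_, ?_⟩ <;> simp <;> omega) le_rfl one_pos (by norm_num)
    (c' := 0) (by norm_num) (by norm_num) hrel (ε := 1) (i := -1) (j := -5)
    ⟨by norm_num, by norm_num, by simp⟩
    (by norm_num) (by simp [Fin.forall_fin_succ]) ?_
  · simpa using this
  · have h3 : ∀ a b, D.lc (mon (var h 0) (var h 1) (var h 2) a b 3) 1 (-1) (-5) = _ :=
      fun a b => D.lc_mon_add (γ := fun t => ((![0, 0] t : Fin 2) : ℕ)) hz2 a b 1 1 (-1) (-5)
    have h5 : ∀ a b, D.lc (mon (var h 0) (var h 1) (var h 2) a b 5) 1 (-1) (-5) = _ :=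
      fun a b => D.lc_mon_add (γ := fun t => ((![0, 0] t : Fin 2) : ℕ)) hz2 a b 3 1 (-1) (-5)
    rw [D.lc_layer {![1, 4, 0], ![2, 2, 1], ![2, 3, 0], ![3, 0, 2], ![3, 1, 1], ![3, 2, 0],
      ![4, 0, 1]} (by simp [Finset.insert_subset_iff, mem_primExp]; decide)]
    · have t1 : teichCoeff 5 1 1 ![1, 4, 0] = 1 := rfl
      have t2 : teichCoeff 5 1 1 ![2, 2, 1] = 6 := rfl
      have t3 : teichCoeff 5 1 1 ![2, 3, 0] = 2 := rfl
      have t4 : teichCoeff 5 1 1 ![3, 0, 2] = 2 := rfl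
      have t5 : teichCoeff 5 1 1 ![3, 1, 1] = 4 := rfl
      have t6 : teichCoeff 5 1 1 ![3, 2, 0] = 2 := rfl
      have t7 : teichCoeff 5 1 1 ![4, 0, 1] = 1 := rfl
      -- The seven exponents contribute 16 + 24 + 32 + 2 + 16 + 8 + 1 = 99, in the order of the
      -- list: each is the multinomial over 5, times the power of 2 from the middle term of z⁵,
      -- times the coefficient left by reducing z⁵ once more.
      have h' : (99 : k) ≠ 0 := by
        rw [← Nat.cast_ofNat, Ne, CharP.cast_eq_zero_iff k 5]; norm_num
      rw [Finset.sum_insert (by decide), Finset.sum_insert (by decide),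
        Finset.sum_insert (by decide), Finset.sum_insert (by decide),
        Finset.sum_insert (by decide), Finset.sum_insert (by decide), Finset.sum_singleton]
      simp [t1, t2, t3, t4, t5, t6, t7, Fin.sum_univ_three, Fin.prod_univ_three, h5, h3,
        Fin.sum_univ_two, D.lc_mon_one]
      norm_num
      exact h'
    · intro e he hne
      by_contra hc
      have hw := D.weight_le_of_lc_ne_zero Finset.univ _ _ _ _ hz2 10 6 15 (by simp) (by simp)
        (by simp [Fin.forall_fin_succ]) hc
      rw [mem_primExp] at he
      simp [Fin.sum_univ_three, Fin.forall_fin_succ] at he hw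
      rw [show e = ![e 0, e 1, e 2] by ext t; fin_cases t <;> rfl] at hne
      exact hne (mem_exponents_of_bounds _ _ _ (by omega) (by omega) (by omega))

end CharFive

/-! ### Characteristic 3: `E_6^0` and `E_7^0` -/

section CharThree

variable {k : Type u} [Field k] [CharP k 3] [PerfectRing k 3]

theorem hasPresentation_E60_three :
    HasPresentation 3 (X 2 ^ 2 + X 0 ^ 3 + X 1 ^ 4 : MvPowerSeries (Fin 3) k) ![(1, 1)]
      {Finsupp.single 0 (F 3 k), Finsupp.single 0 (V 3 k)} 1 := by
  set h : MvPowerSeries (Fin 3) k := X 2 ^ 2 + X 0 ^ 3 + X 1 ^ 4 with hdef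
  have hh : h = X 2 ^ 2 + ∑ t : Fin 2, X 0 ^ (![3, 0] t) * X 1 ^ (![0, 4] t) *
      X 2 ^ ((![0, 0] t : Fin 2) : ℕ) := by
    simp [hdef, Fin.sum_univ_two]; ring
  obtain ⟨D⟩ := exists_doubleCover (by simp [Fin.forall_fin_succ]) hh
  have hz2 := mon_two_eq hh
  have hR : var h 2 ^ 3 = ∑ t : Fin 2, (-1 : ℤ) • (var h 0 ^ (![3, 0] t) *
      var h 1 ^ (![0, 4] t) * var h 2 ^ ((![1, 1] t : Fin 2) : ℕ)) := by
    have h2 := var_sq_eq hh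
    simp [Fin.sum_univ_two] at h2 ⊢
    linear_combination var h 2 * h2
  have hz := mon_eq_sum (x := var h 0) (y := var h 1) (γ := fun t => ((![1, 1] t : Fin 2) : ℕ)) hR
  have hrel := frobW_fW_sub_mem_of_forall (p := 3) (k := k) hz (N := 1) (j := 1) (by
    intro i hi e he
    rw [mem_primExp] at he
    simp only [Fin.sum_univ_two, Fin.forall_fin_succ] at he ⊢
    interval_cases i <;> simp at * <;> omega) 1 1
  have := hasPresentation_cyclic D hz (by simp [Fin.forall_fin_succ]) (by
      simp [Fin.forall_fin_succ]) (by
      intro i j hi hj hij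
      rcases (by omega : i ≤ -2 ∨ i = -1 ∧ j ≤ -2) with h | ⟨h, h'⟩
      · refine ⟨0, by norm_num, ?_, ?_, ?_⟩ <;> simp <;> omega
      · refine ⟨1, by norm_num, ?_, ?_, ?_⟩ <;> simp <;> omega) le_rfl one_pos (by norm_num)
    (c' := 0) (by norm_num) (by norm_num) hrel (ε := 1) (i := -3) (j := -1)
    ⟨by norm_num, by norm_num, by simp⟩
    (by norm_num) (by simp [Fin.forall_fin_succ]) ?_
  · simpa using this
  · have h3 : ∀ a b, D.lc (mon (var h 0) (var h 1) (var h 2) a b 3) 1 (-3) (-1) = _ :=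
      fun a b => D.lc_mon_add (γ := fun t => ((![1, 1] t : Fin 2) : ℕ)) hz a b 0 1 (-3) (-1)
    rw [D.lc_layer {![1, 2], ![2, 1]} (by simp [Finset.insert_subset_iff, mem_primExp])]
    · have t1 : teichCoeff 3 1 1 ![1, 2] = 1 := rfl
      have t2 : teichCoeff 3 1 1 ![2, 1] = 1 := rfl
      have h' : (2 : k) ≠ 0 := by
        rw [← Nat.cast_ofNat, Ne, CharP.cast_eq_zero_iff k 3]; norm_num
      rw [Finset.sum_insert (by decide), Finset.sum_singleton]
      simp [t1, t2, Fin.sum_univ_two, Fin.prod_univ_two, h3, D.lc_mon_one]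
      norm_num
      exact h'
    · intro e he hne
      by_contra hc
      have hw := D.weight_le_of_lc_ne_zero Finset.univ _ _ _ _ hz2 4 3 6 (by simp) (by simp)
        (by simp [Fin.forall_fin_succ]) hc
      rw [mem_primExp] at he
      refine hne ?_
      simp [Fin.sum_univ_two, Fin.forall_fin_succ, funext_iff] at he hw ⊢
      omega

theorem hasPresentation_E70_three :
    HasPresentation 3 (X 2 ^ 2 + X 0 ^ 3 + X 0 * X 1 ^ 3 : MvPowerSeries (Fin 3) k) ![(1, 1)]
      {Finsupp.single 0 (F 3 k), Finsupp.single 0 (V 3 k)} 1 := by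
  set h : MvPowerSeries (Fin 3) k := X 2 ^ 2 + X 0 ^ 3 + X 0 * X 1 ^ 3 with hdef
  have hh : h = X 2 ^ 2 + ∑ t : Fin 2, X 0 ^ (![3, 1] t) * X 1 ^ (![0, 3] t) *
      X 2 ^ ((![0, 0] t : Fin 2) : ℕ) := by
    simp [hdef, Fin.sum_univ_two]; ring
  obtain ⟨D⟩ := exists_doubleCover (by simp [Fin.forall_fin_succ]) hh
  have hz2 := mon_two_eq hh
  have hR : var h 2 ^ 3 = ∑ t : Fin 2, (-1 : ℤ) • (var h 0 ^ (![3, 1] t) *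
      var h 1 ^ (![0, 3] t) * var h 2 ^ ((![1, 1] t : Fin 2) : ℕ)) := by
    have h2 := var_sq_eq hh
    simp [Fin.sum_univ_two] at h2 ⊢
    linear_combination var h 2 * h2
  have hz := mon_eq_sum (x := var h 0) (y := var h 1) (γ := fun t => ((![1, 1] t : Fin 2) : ℕ)) hR
  have hrel := frobW_fW_sub_mem_of_forall (p := 3) (k := k) hz (N := 1) (j := 1) (by
    intro i hi e he
    rw [mem_primExp] at he
    simp only [Fin.sum_univ_two, Fin.forall_fin_succ] at he ⊢
    interval_cases i <;> simp at * <;> omega) 1 1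
  have := hasPresentation_cyclic D hz (by simp [Fin.forall_fin_succ]) (by
      simp [Fin.forall_fin_succ]) (by
      intro i j hi hj hij
      rcases (by omega : i ≤ -2 ∨ i = -1 ∧ j ≤ -2) with h | ⟨h, h'⟩
      · refine ⟨0, by norm_num, ?_, ?_, ?_⟩ <;> simp <;> omega
      · refine ⟨1, by norm_num, ?_, ?_, ?_⟩ <;> simp <;> omega) le_rfl one_pos (by norm_num)
    (c' := 0) (by norm_num) (by norm_num) hrel (ε := 1) (i := -1) (j := -3)
    ⟨by norm_num, by norm_num, by simp⟩
    (by norm_num) (by simp [Fin.forall_fin_succ]) ?_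
  · simpa using this
  · have h3 : ∀ a b, D.lc (mon (var h 0) (var h 1) (var h 2) a b 3) 1 (-1) (-3) = _ :=
      fun a b => D.lc_mon_add (γ := fun t => ((![1, 1] t : Fin 2) : ℕ)) hz a b 0 1 (-1) (-3)
    rw [D.lc_layer {![1, 2], ![2, 1]} (by simp [Finset.insert_subset_iff, mem_primExp])]
    · have t1 : teichCoeff 3 1 1 ![1, 2] = 1 := rfl
      have t2 : teichCoeff 3 1 1 ![2, 1] = 1 := rfl
      have h' : (2 : k) ≠ 0 := by
        rw [← Nat.cast_ofNat, Ne, CharP.cast_eq_zero_iff k 3]; norm_num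
      rw [Finset.sum_insert (by decide), Finset.sum_singleton]
      simp [t1, t2, Fin.sum_univ_two, Fin.prod_univ_two, h3, D.lc_mon_one]
      norm_num
      exact h'
    · intro e he hne
      by_contra hc
      have hw := D.weight_le_of_lc_ne_zero Finset.univ _ _ _ _ hz2 6 4 9 (by simp) (by simp)
        (by simp [Fin.forall_fin_succ]) hc
      rw [mem_primExp] at he
      refine hne ?_
      simp [Fin.sum_univ_two, Fin.forall_fin_succ, funext_iff] at he hw ⊢
      omega

end CharThree

theorem verschiebung_nsmul {p : ℕ} [Fact p.Prime] {A : Type u} [CommRing A] (n : ℕ)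
    (w : WittVector p A) :
    WittVector.verschiebung (n • w) = n • WittVector.verschiebung w := map_nsmul _ _ _

theorem verschiebung_zsmul {p : ℕ} [Fact p.Prime] {A : Type u} [CommRing A] (n : ℤ)
    (w : WittVector p A) :
    WittVector.verschiebung (n • w) = n • WittVector.verschiebung w := map_zsmul _ _ _

/-! ### Expansion in two steps -/

section TwoSteps

variable {p : ℕ} [Fact p.Prime] {k : Type u} [Field k] [CharP k p]
  {R : Type u} [CommRing R] [Algebra k R] {x y z : R}
  {ι : Type} [Fintype ι] [DecidableEq ι]

/-- The primitive exponents of degree 1 are the unit vectors, with multiplicity 1: modulo V the lift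
of a sum is the sum of the lifts. -/
theorem layer_level_zero (N : ℕ) (κ α β : ι → ℤ) (γ : ι → ℕ) (κ₀ a b : ℤ) (c : ℕ) :
    layer p x y z N 0 (primExp p ι 0) κ α β γ κ₀ a b c =
      ∑ t, tm p x y z (κ₀ * κ t) (a + α t) (b + β t) (c + γ t) := by
  symm
  refine Finset.sum_bij (fun t _ => Pi.single t 1) ?_ ?_ ?_ ?_
  · intro t _
    rw [mem_primExp]
    refine ⟨by simp, fun h => ?_⟩
    have := h t
    rw [Pi.single_eq_same] at this
    exact (Fact.out : p.Prime).one_lt.ne' (Nat.dvd_one.mp this)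
  · intro t _ t' _ h
    by_contra hne
    have := congrFun h t
    rw [Pi.single_eq_same, Pi.single_eq_of_ne hne] at this
    exact one_ne_zero this
  · intro e he
    rw [mem_primExp, pow_zero] at he
    obtain ⟨t, ht⟩ : ∃ t, e t ≠ 0 := by
      by_contra hc
      push Not at hc
      simp [hc] at he
    refine ⟨t, Finset.mem_univ _, ?_⟩
    have h1 := Finset.add_sum_erase Finset.univ e (Finset.mem_univ t)
    have h2 : ∑ i ∈ Finset.univ.erase t, e i = 0 := by omega
    ext t'
    by_cases htt : t' = t
    · subst htt
      rw [Pi.single_eq_same]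
      omega
    · rw [Pi.single_eq_of_ne htt]
      exact ((Finset.sum_eq_zero_iff.mp h2) t' (by simp [htt])).symm
  · intro t _
    have h1 : teichCoeff p N 0 (Pi.single t 1) = 1 := by
      rw [teichCoeff, pow_zero, Nat.div_one, Nat.multinomial,
        Finset.sum_eq_single t (fun b _ hb => by rw [Pi.single_eq_of_ne hb, mul_zero]) (by simp),
        Finset.prod_eq_single t (fun b _ hb => by
          rw [Pi.single_eq_of_ne hb, mul_zero, Nat.factorial_zero]) (by simp)]
      exact Nat.div_self (Nat.factorial_pos _)
    rw [h1, one_smul]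
    simp [Pi.single_apply]

/-- Substitutes expansions of the level-one terms into an expansion modulo V³; their own V-parts
join the last layer. -/
theorem sub_mem_Bd_of_level_one {τ : Type*} {X : Finset τ} {n : τ → ℕ} {c : τ → ℤ}
    {T L : τ → WittVector p (Localization.Away (x * y))}
    {f w v : WittVector p (Localization.Away (x * y))}
    (h : ∀ (e) (_ : e ∈ X), e ∈ X → T e - (c e • f + WittVector.verschiebung (L e)) ∈ Bd p x y 2)
    (hw : w - (WittVector.verschiebung (∑ e ∈ X, n e • T e) + WittVector.verschiebung^[2] v) ∈
      Bd p x y 3) :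
    w - ((∑ e ∈ X, n e * c e) • WittVector.verschiebung^[1] f +
      WittVector.verschiebung^[2] (v + ∑ e ∈ X, n e • L e)) ∈ Bd p x y 3 := by
  have h4 : WittVector.verschiebung (∑ e ∈ X, n e •
      (T e - (c e • f + WittVector.verschiebung (L e)))) ∈ Bd p x y 3 :=
    verschiebung_mem_Bd (sum_mem fun e he => nsmul_mem (h e he he) _) 1
  convert add_mem hw h4 using 1
  have h5 : WittVector.verschiebung (∑ e ∈ X, n e • c e • f) =
      (∑ e ∈ X, n e * c e) • WittVector.verschiebung f := by
    rw [← verschiebung_zsmul, Finset.sum_smul]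
    refine congrArg _ (Finset.sum_congr rfl fun e _ => ?_)
    rw [mul_smul, natCast_zsmul]
  have h6 : ∑ e ∈ X, n e • WittVector.verschiebung (L e) =
      WittVector.verschiebung (∑ e ∈ X, n e • L e) := by
    rw [map_sum]
    exact Finset.sum_congr rfl fun e _ => (verschiebung_nsmul _ _).symm
  simp only [smul_sub, smul_add, Finset.sum_sub_distrib, Finset.sum_add_distrib, map_sub, map_add,
    Function.iterate_succ, Function.iterate_zero, Function.comp_apply, id, h6, h5]
  abel

/-- The Frobenius of `f_1` modulo `V^3`, when the exceptional terms have level `1` and have to be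
expanded once more. -/
theorem frobW_fW_sub_mem_of_level_one {κ α β : ι → ℤ} {γ : ι → ℕ}
    (hz : mon x y z 0 0 p = ∑ t, κ t • mon x y z (α t) (β t) (γ t)) {j j' : ℕ}
    (X : Finset (ι → ℕ)) (hX : X ⊆ primExp p ι 1)
    (hX' : ∀ i < 2, ∀ e ∈ primExp p ι i, ¬(i = 1 ∧ e ∈ X) →
      0 ≤ (p : ℤ) ^ i * (-p) + ∑ t, (e t : ℤ) * α t ∨
        0 ≤ (p : ℤ) ^ i * (-(p * j)) + ∑ t, (e t : ℤ) * β t)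
    (hγ : ∀ e ∈ X, ∑ t, e t * γ t = p) (c : (ι → ℕ) → ℤ)
    (hc : ∀ e ∈ X, ∑ t, tm p x y z ((∏ t, κ t ^ e t) * κ t)
      ((p : ℤ) ^ 1 * (-p) + ∑ t, (e t : ℤ) * α t + α t)
      ((p : ℤ) ^ 1 * (-(p * j)) + ∑ t, (e t : ℤ) * β t + β t) (0 + γ t) - c e • fW p x y z j' ∈
        Bd p x y 2) :
    frobW p k x y (fW p x y z j) -
      ((∑ e ∈ X, teichCoeff p 2 1 e * c e) • WittVector.verschiebung^[1] (fW p x y z j') +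
      WittVector.verschiebung^[2]
        (layer p x y z 2 2 (primExp p ι 2) κ α β γ 1 (-p) (-(p * j)) 0 +
          ∑ e ∈ X, teichCoeff p 2 1 e • layer p x y z 1 1 (primExp p ι 1) κ α β γ
            (∏ t, κ t ^ e t) ((p : ℤ) ^ 1 * (-p) + ∑ t, (e t : ℤ) * α t)
            ((p : ℤ) ^ 1 * (-(p * j)) + ∑ t, (e t : ℤ) * β t) 0)) ∈ Bd p x y 3 := by
  have h1 := frobW_fW_sub_mem (k := k) hz (N := 2) (j := j) (fun i => if i = 1 then X else ∅)
    (fun i _ => by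
      split_ifs with h
      · rw [h]; exact hX
      · exact Finset.empty_subset _)
    (fun i hi e he hn => tm_mem_Bd _ _ _ (hX' i hi e he (by
      rintro ⟨rfl, h⟩
      exact hn (by simpa using h))))
  have h2 : ∀ e ∈ X, tm p x y z (∏ t, κ t ^ e t) ((p : ℤ) ^ 1 * (-p) + ∑ t, (e t : ℤ) * α t)
      ((p : ℤ) ^ 1 * (-(p * j)) + ∑ t, (e t : ℤ) * β t) (∑ t, e t * γ t) -
      (c e • fW p x y z j' + WittVector.verschiebung (layer p x y z 1 1 (primExp p ι 1) κ α β γ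
            (∏ t, κ t ^ e t) ((p : ℤ) ^ 1 * (-p) + ∑ t, (e t : ℤ) * α t)
            ((p : ℤ) ^ 1 * (-(p * j)) + ∑ t, (e t : ℤ) * β t) 0)) ∈ Bd p x y 2 := by
    intro e he
    have h3 := tm_expand k κ α β γ hz 1 (∏ t, κ t ^ e t)
      ((p : ℤ) ^ 1 * (-p) + ∑ t, (e t : ℤ) * α t)
      ((p : ℤ) ^ 1 * (-(p * j)) + ∑ t, (e t : ℤ) * β t) 0 (primExp p ι) (fun _ _ => subset_rfl)
      (fun _ _ e he hn => absurd he hn)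
    rw [Finset.sum_range_one, Function.iterate_zero, id, layer_level_zero, Function.iterate_one,
      zero_add] at h3
    rw [hγ e he]
    convert add_mem h3 (hc e he) using 1
    simp only [zero_add]
    abel
  refine sub_mem_Bd_of_level_one (fun e _ => h2 e) ?_
  rw [Finset.sum_range_succ, Finset.sum_range_one] at h1
  simpa only [zero_ne_one, if_false, if_true, layer, Finset.sum_empty, Function.iterate_one, id,
    Function.iterate_zero, one_pow, one_mul, mul_zero, zero_add] using h1

end TwoSteps

open DieudonneRing MvPowerSeries

/-! ### Characteristic 3: `E_8^0` and `E_8^1` -/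

section CharThree

variable {k : Type u} [Field k] [CharP k 3] [PerfectRing k 3]

/-- The exceptional exponent (2, 1) gives x^{-3} y^{-4} z³ at level 1. Expanding z³ again yields
coboundaries, but also a contribution to η. The test point x^{-3} y^{-2} z has weight -27, which is
27 times the weight of f_1. -/
theorem hasPresentation_E80_three :
    HasPresentation 3 (X 2 ^ 2 + X 0 ^ 3 + X 1 ^ 5 : MvPowerSeries (Fin 3) k) ![(2, 1)]
      {Finsupp.single 0 (F 3 k), Finsupp.single 0 (V 3 k ^ 2)} 2 := by
  set h : MvPowerSeries (Fin 3) k := X 2 ^ 2 + X 0 ^ 3 + X 1 ^ 5 with hdef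
  have hh : h = X 2 ^ 2 + ∑ t : Fin 2, X 0 ^ (![3, 0] t) * X 1 ^ (![0, 5] t) *
      X 2 ^ ((![0, 0] t : Fin 2) : ℕ) := by
    simp [hdef, Fin.sum_univ_two]; ring
  obtain ⟨D⟩ := exists_doubleCover (by simp [Fin.forall_fin_succ]) hh
  have hz2 := mon_two_eq hh
  have hR : var h 2 ^ 3 = ∑ t : Fin 2, (-1 : ℤ) • (var h 0 ^ (![3, 0] t) *
      var h 1 ^ (![0, 5] t) * var h 2 ^ ((![1, 1] t : Fin 2) : ℕ)) := by
    have h2 := var_sq_eq hh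
    simp [Fin.sum_univ_two] at h2 ⊢
    linear_combination var h 2 * h2
  have hz := mon_eq_sum (x := var h 0) (y := var h 1)
    (γ := fun t => ((![1, 1] t : Fin 2) : ℕ)) hR
  have hz9 := mon_mul_eq_sum 3 k hz
  have hrel := frobW_fW_sub_mem_of_level_one (p := 3) (k := k) hz (j := 1) (j' := 1)
    {![2, 1]} (by simp [Finset.insert_subset_iff, mem_primExp]) (by
      intro i hi e he hne
      rw [mem_primExp] at he
      rw [show e = ![e 0, e 1] by ext t; fin_cases t <;> rfl] at hne
      simp only [Fin.sum_univ_two, Fin.forall_fin_succ] at he ⊢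
      simp at he hne ⊢
      interval_cases i <;> simp at * <;> omega)
    (by simp [Fin.sum_univ_two]) (fun _ => 0) (by
      intro e he
      obtain rfl := Finset.mem_singleton.mp he
      simp only [zero_smul, sub_zero]
      refine sum_mem fun t _ => tm_mem_Bd _ _ _ ?_
      fin_cases t <;> simp [Fin.sum_univ_two])
  have r0 : teichCoeff 3 2 1 ![2, 1] = 28 := rfl
  have := hasPresentation_cyclic D hz (by simp [Fin.forall_fin_succ]) (by
      simp [Fin.forall_fin_succ]) (by
      intro i j hi hj hij
      rcases (by omega : i ≤ -2 ∨ i = -1 ∧ j ≤ -2) with h | ⟨h, h'⟩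
      · refine ⟨0, by norm_num, ?_, ?_, ?_⟩ <;> simp <;> omega
      · refine ⟨1, by norm_num, ?_, ?_, ?_⟩ <;> simp <;> omega) one_le_two one_pos (by norm_num)
    (c' := 0) (by simp) (by simp) hrel (ε := 1) (i := -3) (j := -2)
    ⟨by norm_num, by norm_num, by simp⟩
    (by norm_num) (by simp [Fin.forall_fin_succ]) ?_
  · simpa using this
  · have h3 : ∀ a b, D.lc (mon (var h 0) (var h 1) (var h 2) a b 3) 1 (-3) (-2) = _ :=
      fun a b => D.lc_mon_add (γ := fun t => ((![1, 1] t : Fin 2) : ℕ)) hz a b 0 1 (-3) (-2)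
    have h9 : ∀ a b, D.lc (mon (var h 0) (var h 1) (var h 2) a b 9) 1 (-3) (-2) = _ :=
      fun a b => D.lc_mon_add (q := 9) hz9 a b 0 1 (-3) (-2)
    simp [Fin.sum_univ_two, D.lc_mon_one] at h3 h9
    have t0 : teichCoeff 3 2 2 ![4, 5] = 14 := rfl
    have t1 : teichCoeff 3 2 2 ![5, 4] = 14 := rfl
    have t2 : teichCoeff 3 2 2 ![7, 2] = 4 := rfl
    have t3 : teichCoeff 3 2 2 ![8, 1] = 1 := rfl
    have s0 : teichCoeff 3 1 1 ![1, 2] = 1 := rfl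
    have s1 : teichCoeff 3 1 1 ![2, 1] = 1 := rfl
    rw [WittVector.add_coeff_zero, D.lc_add, coeff_zero_sum, D.lc_sum,
      Finset.sum_singleton, coeff_zero_nsmul, D.lc_nsmul]
    rw [D.lc_layer {![4, 5], ![5, 4], ![7, 2], ![8, 1]} (by simp [Finset.insert_subset_iff, mem_primExp])]
    · rw [D.lc_layer {![1, 2], ![2, 1]} (by simp [Finset.insert_subset_iff, mem_primExp])]
      · have h' : (89 : k) ≠ 0 := by
          rw [← Nat.cast_ofNat, Ne, CharP.cast_eq_zero_iff k 3]; norm_num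
        rw [Finset.sum_insert (by decide), Finset.sum_insert (by decide),
          Finset.sum_insert (by decide), Finset.sum_singleton, Finset.sum_insert (by decide),
          Finset.sum_singleton]
        simp [Fin.sum_univ_two, Fin.prod_univ_two, h9, h3, t0, t1, t2, t3, s0, s1, r0]
        norm_num
        exact h'
      all_goals
        intro e he hne
        by_contra hc
        have hw := D.weight_le_of_lc_ne_zero Finset.univ _ _ _ _ hz2 10 6 15 (by simp) (by simp)
          (by simp [Fin.forall_fin_succ]) hc
        rw [mem_primExp] at he
        rw [show e = ![e 0, e 1] by ext t; fin_cases t <;> rfl] at hne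
        simp [Fin.sum_univ_two, Fin.forall_fin_succ] at he hw hne
        omega
    · intro e he hne
      by_contra hc
      have hw := D.weight_le_of_lc_ne_zero Finset.univ _ _ _ _ hz2 10 6 15 (by simp) (by simp)
        (by simp [Fin.forall_fin_succ]) hc
      rw [mem_primExp] at he
      rw [show e = ![e 0, e 1] by ext t; fin_cases t <;> rfl] at hne
      simp [Fin.sum_univ_two, Fin.forall_fin_succ] at he hw hne
      omega

/-- Of the four exceptional monomials of level 1, all but the one with exponent (1, 0, 2) produce
f_1 once when z³ is expanded again. The total multiplicity 28 + 560 + 28 = 616 is 1 modulo 3, whence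
F = V. The extra term x² y³ has larger weight than z², so it does not affect the coefficient of η at
the test point of `E_8^0`. -/
theorem hasPresentation_E81_three :
    HasPresentation 3 (X 2 ^ 2 + X 0 ^ 3 + X 1 ^ 5 + X 0 ^ 2 * X 1 ^ 3 : MvPowerSeries (Fin 3) k) ![(2, 1)]
      {Finsupp.single 0 (F 3 k - V 3 k), Finsupp.single 0 (V 3 k ^ 2)} 2 := by
  set h : MvPowerSeries (Fin 3) k := X 2 ^ 2 + X 0 ^ 3 + X 1 ^ 5 + X 0 ^ 2 * X 1 ^ 3 with hdef
  have hh : h = X 2 ^ 2 + ∑ t : Fin 3, X 0 ^ (![3, 0, 2] t) * X 1 ^ (![0, 5, 3] t) *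
      X 2 ^ ((![0, 0, 0] t : Fin 2) : ℕ) := by
    simp [hdef, Fin.sum_univ_three]; ring
  obtain ⟨D⟩ := exists_doubleCover (by simp [Fin.forall_fin_succ]) hh
  have hz2 := mon_two_eq hh
  have hR : var h 2 ^ 3 = ∑ t : Fin 3, (-1 : ℤ) • (var h 0 ^ (![3, 0, 2] t) *
      var h 1 ^ (![0, 5, 3] t) * var h 2 ^ ((![1, 1, 1] t : Fin 2) : ℕ)) := by
    have h2 := var_sq_eq hh
    simp [Fin.sum_univ_three] at h2 ⊢
    linear_combination var h 2 * h2
  have hz := mon_eq_sum (x := var h 0) (y := var h 1)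
    (γ := fun t => ((![1, 1, 1] t : Fin 2) : ℕ)) hR
  have hz9 := mon_mul_eq_sum 3 k hz
  have hrel := frobW_fW_sub_mem_of_level_one (p := 3) (k := k) hz (j := 1) (j' := 1)
    {![2, 1, 0], ![1, 1, 1], ![2, 0, 1], ![1, 0, 2]} (by simp [Finset.insert_subset_iff, mem_primExp, Fin.sum_univ_three, Fin.forall_fin_succ]) (by
      intro i hi e he hne
      rw [mem_primExp] at he
      rw [show e = ![e 0, e 1, e 2] by ext t; fin_cases t <;> rfl] at hne
      simp only [Fin.sum_univ_three, Fin.forall_fin_succ] at he ⊢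
      simp at he hne ⊢
      interval_cases i <;> simp at * <;> omega)
    (by simp [Fin.sum_univ_three]) (fun e => if e 2 = 2 then 0 else 1) (by
      intro e he
      have hb : ∀ (κ a b : ℤ) (c : ℕ), 0 ≤ a ∨ 0 ≤ b →
        tm 3 (var h 0) (var h 1) (var h 2) κ a b c ∈ Bd 3 (var h 0) (var h 1) 2 :=
        fun κ a b c => tm_mem_Bd 2 κ c
      simp only [Finset.mem_insert, Finset.mem_singleton] at he
      rw [fW_eq_tm]
      rcases he with rfl | rfl | rfl | rfl
      · simp [Fin.sum_univ_three, Fin.prod_univ_three]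
        exact add_mem (hb _ _ _ _ (by norm_num)) (hb _ _ _ _ (by norm_num))
      · simp [Fin.sum_univ_three, Fin.prod_univ_three]
        convert add_mem (hb 1 (-4) 4 1 (by norm_num)) (hb 1 (-2) 2 1 (by norm_num)) using 1
        abel
      · simp [Fin.sum_univ_three, Fin.prod_univ_three]
        convert add_mem (hb 1 2 (-6) 1 (by norm_num)) (hb 1 1 (-3) 1 (by norm_num)) using 1
        abel
      · simp [Fin.sum_univ_three, Fin.prod_univ_three]
        exact add_mem (add_mem (hb _ _ _ _ (by norm_num)) (hb _ _ _ _ (by norm_num)))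
          (hb _ _ _ _ (by norm_num)))
  have r0 : teichCoeff 3 2 1 ![2, 1, 0] = 28 := rfl
  have r1 : teichCoeff 3 2 1 ![1, 1, 1] = 560 := rfl
  have r2 : teichCoeff 3 2 1 ![2, 0, 1] = 28 := rfl
  have r3 : teichCoeff 3 2 1 ![1, 0, 2] = 28 := rfl
  have := hasPresentation_cyclic D hz (by simp [Fin.forall_fin_succ]) (by
      simp [Fin.forall_fin_succ]) (by
      intro i j hi hj hij
      rcases (by omega : i ≤ -2 ∨ i = -1 ∧ j ≤ -2) with h | ⟨h, h'⟩
      · refine ⟨0, by norm_num, ?_, ?_, ?_⟩ <;> simp <;> omega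
      · refine ⟨1, by norm_num, ?_, ?_, ?_⟩ <;> simp <;> omega) one_le_two one_pos (by norm_num)
    (c' := 1) (by rw [Finset.sum_insert (by decide), Finset.sum_insert (by decide), Finset.sum_insert (by decide), Finset.sum_singleton]; simp [r0, r1, r2, r3]) (by rw [Finset.sum_insert (by decide), Finset.sum_insert (by decide), Finset.sum_insert (by decide), Finset.sum_singleton]; simp [r0, r1, r2, r3]) hrel (ε := 1) (i := -3) (j := -2)
    ⟨by norm_num, by norm_num, by simp⟩
    (by norm_num) (by simp [Fin.forall_fin_succ]) ?_
  · simpa using this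
  · have h3 : ∀ a b, D.lc (mon (var h 0) (var h 1) (var h 2) a b 3) 1 (-3) (-2) = _ :=
      fun a b => D.lc_mon_add (γ := fun t => ((![1, 1, 1] t : Fin 2) : ℕ)) hz a b 0 1 (-3) (-2)
    have h9 : ∀ a b, D.lc (mon (var h 0) (var h 1) (var h 2) a b 9) 1 (-3) (-2) = _ :=
      fun a b => D.lc_mon_add (q := 9) hz9 a b 0 1 (-3) (-2)
    simp [Fin.sum_univ_three, D.lc_mon_one] at h3 h9
    have t0 : teichCoeff 3 2 2 ![4, 5, 0] = 14 := rfl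
    have t1 : teichCoeff 3 2 2 ![5, 4, 0] = 14 := rfl
    have t2 : teichCoeff 3 2 2 ![7, 2, 0] = 4 := rfl
    have t3 : teichCoeff 3 2 2 ![8, 1, 0] = 1 := rfl
    have s0 : teichCoeff 3 1 1 ![1, 2, 0] = 1 := rfl
    have s1 : teichCoeff 3 1 1 ![2, 1, 0] = 1 := rfl
    rw [WittVector.add_coeff_zero, D.lc_add, coeff_zero_sum, D.lc_sum,
      Finset.sum_insert (by decide), Finset.sum_insert (by decide), Finset.sum_insert (by decide), Finset.sum_singleton, coeff_zero_nsmul, D.lc_nsmul, coeff_zero_nsmul, D.lc_nsmul, coeff_zero_nsmul, D.lc_nsmul, coeff_zero_nsmul, D.lc_nsmul]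
    rw [D.lc_layer {![4, 5, 0], ![5, 4, 0], ![7, 2, 0], ![8, 1, 0]} (by simp [Finset.insert_subset_iff, mem_primExp, Fin.sum_univ_three, Fin.forall_fin_succ])]
    · rw [D.lc_layer {![1, 2, 0], ![2, 1, 0]} (by simp [Finset.insert_subset_iff, mem_primExp, Fin.sum_univ_three, Fin.forall_fin_succ]), D.lc_layer ∅ (Finset.empty_subset _), D.lc_layer ∅ (Finset.empty_subset _), D.lc_layer ∅ (Finset.empty_subset _)]
      · have h' : (89 : k) ≠ 0 := by
          rw [← Nat.cast_ofNat, Ne, CharP.cast_eq_zero_iff k 3]; norm_num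
        rw [Finset.sum_insert (by decide), Finset.sum_insert (by decide),
          Finset.sum_insert (by decide), Finset.sum_singleton, Finset.sum_insert (by decide),
          Finset.sum_singleton]
        simp [Fin.sum_univ_three, Fin.prod_univ_three, h9, h3, t0, t1, t2, t3, s0, s1, r0, r1, r2, r3]
        norm_num
        exact h'
      all_goals
        intro e he hne
        by_contra hc
        have hw := D.weight_le_of_lc_ne_zero Finset.univ _ _ _ _ hz2 10 6 15 (by simp) (by simp)
          (by simp [Fin.forall_fin_succ]) hc
        rw [mem_primExp] at he
        rw [show e = ![e 0, e 1, e 2] by ext t; fin_cases t <;> rfl] at hne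
        simp [Fin.sum_univ_three, Fin.forall_fin_succ] at he hw hne
        omega
    · intro e he hne
      by_contra hc
      have hw := D.weight_le_of_lc_ne_zero Finset.univ _ _ _ _ hz2 10 6 15 (by simp) (by simp)
        (by simp [Fin.forall_fin_succ]) hc
      rw [mem_primExp] at he
      rw [show e = ![e 0, e 1, e 2] by ext t; fin_cases t <;> rfl] at hne
      simp [Fin.sum_univ_three, Fin.forall_fin_succ] at he hw hne
      omega

end CharThree

/-! ### Type `D`: the index pairs -/

section TypeDCombinatorics

/-- The largest `l` with `2 ^ (l - 1) * (2 * j - 1) ≤ L`. -/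
def lamD (L j : ℕ) : ℕ := Nat.log 2 (L / (2 * j - 1)) + 1

theorem le_lamD_iff {L l j : ℕ} (hj : 1 ≤ j) (hjL : 2 * j - 1 ≤ L) :
    l ≤ lamD L j ↔ 2 ^ (l - 1) * (2 * j - 1) ≤ L := by
  have h0 : L / (2 * j - 1) ≠ 0 := (Nat.div_pos hjL (by omega)).ne'
  rw [← Nat.le_div_iff_mul_le (by omega), ← Nat.le_log_iff_pow_le one_lt_two h0, lamD]
  omega

theorem lt_two_pow_lamD {L j : ℕ} (hj : 1 ≤ j) (hjL : 2 * j - 1 ≤ L) :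
    L < 2 ^ lamD L j * (2 * j - 1) := by
  have := (le_lamD_iff (l := lamD L j + 1) hj hjL).not.mp (by omega)
  simpa using this

/-- The `j ≥ 1` with `2 * j - 1 ≤ L`. -/
def indD (L : ℕ) : Finset ℕ := Finset.Icc 1 ((L + 1) / 2)

theorem mem_indD {L j : ℕ} : j ∈ indD L ↔ 1 ≤ j ∧ 2 * j - 1 ≤ L := by
  rw [indD, Finset.mem_Icc]
  omega

theorem two_pow_mul_odd_injective {a b i j : ℕ} (hi : 1 ≤ i) (hj : 1 ≤ j)
    (h : 2 ^ a * (2 * i - 1) = 2 ^ b * (2 * j - 1)) : a = b ∧ i = j := by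
  have key : ∀ {a b i j : ℕ}, 1 ≤ i → 1 ≤ j → a < b →
      2 ^ a * (2 * i - 1) ≠ 2 ^ b * (2 * j - 1) := by
    intro a b i j hi hj hab h
    obtain ⟨c, rfl⟩ := Nat.exists_eq_add_of_lt hab
    rw [show a + c + 1 = a + (c + 1) by ring, pow_add, mul_assoc] at h
    have h2 := Nat.eq_of_mul_eq_mul_left (by positivity) h
    rw [pow_succ, mul_assoc] at h2
    have : 2 * i - 1 = 2 * (2 ^ c * (2 * j - 1)) := by rw [h2]; ring
    omega
  rcases lt_trichotomy a b with hab | rfl | hab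
  · exact absurd h (key hi hj hab)
  · have := Nat.eq_of_mul_eq_mul_left (by positivity) h
    exact ⟨rfl, by omega⟩
  · exact absurd h.symm (key hj hi hab)

/-- Every n between 1 and L is 2^{l-1}(2j-1) for exactly one pair (l, j). -/
theorem sum_lamD (L : ℕ) : ∑ j ∈ indD L, lamD L j = L := by
  have h1 : ∑ j ∈ indD L, lamD L j = ((indD L).sigma fun j => Finset.Icc 1 (lamD L j)).card := by
    rw [Finset.card_sigma]
    simp
  rw [h1]
  have h2 : L = (Finset.Icc 1 L).card := by simp
  conv_rhs => rw [h2]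
  refine Finset.card_bij (fun s _ => 2 ^ (s.2 - 1) * (2 * s.1 - 1)) ?_ ?_ ?_
  · rintro ⟨j, l⟩ h
    simp only [Finset.mem_sigma, Finset.mem_Icc, mem_indD] at h ⊢
    refine ⟨?_, (le_lamD_iff h.1.1 h.1.2).mp h.2.2⟩
    exact Nat.mul_pos (by positivity) (by omega)
  · rintro ⟨j, l⟩ h ⟨j', l'⟩ h' heq
    simp only [Finset.mem_sigma, Finset.mem_Icc, mem_indD] at h h'
    obtain ⟨h3, rfl⟩ := two_pow_mul_odd_injective h.1.1 h'.1.1 heq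
    have h3' : l - 1 = l' - 1 := h3
    obtain rfl : l = l' := by omega
    rfl
  · intro n hn
    rw [Finset.mem_Icc] at hn
    obtain ⟨a, b, ⟨c, rfl⟩, rfl⟩ := Nat.exists_eq_two_pow_mul_odd (by omega : n ≠ 0)
    have hc : 2 * (c + 1) - 1 = 2 * c + 1 := by omega
    have hle : 2 * c + 1 ≤ L := le_trans (Nat.le_mul_of_pos_left _ (by positivity)) hn.2
    refine ⟨⟨c + 1, a + 1⟩, ?_, ?_⟩
    · simp only [Finset.mem_sigma, Finset.mem_Icc, mem_indD]
      refine ⟨⟨by omega, by omega⟩, by omega, ?_⟩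
      rw [le_lamD_iff (by omega) (by omega), hc]
      exact hn.2
    · simp [hc]

/-- The exponent of y is -Q(2j-1) + (m-1)e₁ + q e₂. It is nonnegative once e₁ ≥ 1 or e₂ ≥ 2, since
Q(2j-1) ≤ L ≤ min(m-1, 2q); for e₁ = e₂ = 0 the exponent of x is zero. There remains one factor of x
y^{q+1} z. -/
theorem typeD_sign {Q j m q L e0 e1 e2 bx : ℤ} (h1 : 0 ≤ e1) (h2 : 0 ≤ e2)
    (he : e0 + e1 + e2 = Q) (hQ : Q * (2 * j - 1) ≤ L) (hm : L ≤ m - 1) (hq : L ≤ 2 * q)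
    (hL : 0 ≤ L) :
    (0 ≤ Q * (-2) + (e0 * 2 + e1 * bx + e2 * 1) ∨ 0 ≤ Q * (-(2 * j)) + (e0 * 1 + e1 * m + e2 * (q + 1)))
      ∨ (e1 = 0 ∧ e2 = 1 ∧ q < Q * (2 * j - 1)) := by
  have hy : Q * (-(2 * j)) + (e0 * 1 + e1 * m + e2 * (q + 1)) =
      -(Q * (2 * j - 1)) + e1 * (m - 1) + e2 * q := by
    rw [← he]; ring
  rw [hy]
  rcases h1.eq_or_lt with rfl | h1
  · rcases h2.eq_or_lt with rfl | h2
    · left; left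
      linarith
    · rcases (show e2 = 1 ∨ 2 ≤ e2 by omega) with rfl | h2
      · by_cases hc : q < Q * (2 * j - 1)
        · exact Or.inr ⟨rfl, rfl, hc⟩
        · left; right
          linarith
      · left; right
        nlinarith
  · left; right
    have : 0 ≤ e2 * q := mul_nonneg h2 (by linarith)
    nlinarith

end TypeDCombinatorics

/-! ### Type `D`: the Frobenius of `f_j` -/

section TypeD

variable {k : Type u} [Field k] [CharP k 2]
  {R : Type u} [CommRing R] [Algebra k R] {x y z : R}

/-- With Q = 2^i this is binom(2Q, 2)/Q. What matters later is that it is odd. -/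
theorem teichCoeff_typeD (i : ℕ) : teichCoeff 2 (i + 1) i ![2 ^ i - 1, 0, 1] = 2 * 2 ^ i - 1 := by
  have hp : 0 < 2 ^ i := by positivity
  generalize hQ : 2 ^ i = Q at hp ⊢
  rw [teichCoeff, show i + 1 - i = 1 by omega, pow_one, hQ, Nat.multinomial, Fin.sum_univ_three,
    Fin.prod_univ_three]
  simp only [Matrix.cons_val_zero, Matrix.cons_val_one, Matrix.cons_val, mul_zero, mul_one,
    Nat.factorial_zero, add_zero, Nat.factorial_two]
  obtain ⟨P, rfl⟩ := Nat.exists_eq_add_of_le' hp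
  have h1 : (2 * (P + 1 - 1) + 2).factorial = (2 * P).factorial * 2 * ((P + 1) * (2 * P + 1)) := by
    rw [Nat.add_sub_cancel, Nat.factorial_succ, Nat.factorial_succ]
    ring
  rw [h1, Nat.add_sub_cancel, Nat.mul_div_cancel_left _ (by positivity),
    Nat.mul_div_cancel_left _ (by positivity)]
  omega

/-- By `typeD_sign` the only possible survivor below the last layer is x^{-1} y^{q-C} z with C = 2^i
(2j-1) > q, which is the monomial of f_{C-q}. -/
theorem frobW_fW_sub_mem_typeD {m q L bx : ℕ} {bz : Fin 2}
    (hz : mon x y z 0 0 2 = ∑ t : Fin 3, (1 : ℤ) • mon x y z ((![2, bx, 1] t : ℕ) : ℤ)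
      ((![1, m, q + 1] t : ℕ) : ℤ) ((![0, bz, 1] t : Fin 2) : ℕ))
    (hm : L + 1 ≤ m) (hq : L ≤ 2 * q) {j N : ℕ} (hj : 1 ≤ j)
    (hN : 2 ^ N * (2 * j - 1) ≤ L) :
    frobW 2 k x y (fW 2 x y z j) -
      ((if q < 2 ^ N * (2 * j - 1) then ((2 * 2 ^ N - 1 : ℕ) : ℤ) else 0) •
        WittVector.verschiebung^[N] (fW 2 x y z (2 ^ N * (2 * j - 1) - q)) +
      WittVector.verschiebung^[N + 1]
        (layer 2 x y z (N + 1) (N + 1) (primExp 2 (Fin 3) (N + 1)) (fun _ => 1)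
          (fun t => ((![2, bx, 1] t : ℕ) : ℤ)) (fun t => ((![1, m, q + 1] t : ℕ) : ℤ))
          (fun t => ((![0, bz, 1] t : Fin 2) : ℕ)) 1 (-(2 : ℕ)) (-((2 : ℕ) * j)) 0)) ∈
        Bd 2 x y (N + 1 + 1) := by
  have hj' : ((2 * j - 1 : ℕ) : ℤ) = 2 * j - 1 := by omega
  have hQ : ∀ i, i < N + 1 → (2 : ℤ) ^ i * (2 * j - 1) ≤ L := by
    intro i hi
    rw [← hj']
    have : 2 ^ i * (2 * j - 1) ≤ L :=
      le_trans (Nat.mul_le_mul_right _ (Nat.pow_le_pow_right two_pos (by omega))) hN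
    exact_mod_cast this
  have hsign : ∀ i < N + 1, ∀ e ∈ primExp 2 (Fin 3) i,
      (0 ≤ ((2 : ℕ) : ℤ) ^ i * (-(2 : ℕ)) + ∑ t, (e t : ℤ) * ((![2, bx, 1] t : ℕ) : ℤ) ∨
        0 ≤ ((2 : ℕ) : ℤ) ^ i * (-((2 : ℕ) * j)) + ∑ t, (e t : ℤ) * ((![1, m, q + 1] t : ℕ) : ℤ)) ∨
      (e 1 = 0 ∧ e 2 = 1 ∧ q < 2 ^ i * (2 * j - 1)) := by
    intro i hi e he
    obtain ⟨he, -⟩ := mem_primExp.mp he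
    rw [Fin.sum_univ_three] at he
    have he' : (e 0 : ℤ) + e 1 + e 2 = 2 ^ i := by exact_mod_cast he
    have h := typeD_sign (bx := bx) (m := m) (q := q)
      (Int.natCast_nonneg (e 1)) (Int.natCast_nonneg (e 2)) he' (hQ i hi) (by omega) (by omega)
      (by omega)
    rw [Fin.sum_univ_three, Fin.sum_univ_three]
    simp only [Matrix.cons_val_zero, Matrix.cons_val_one, Matrix.cons_val, Nat.cast_ofNat,
      Nat.cast_one, Nat.cast_add]
    rcases h with h | ⟨h1, h2, h3⟩
    · exact Or.inl h
    · refine Or.inr ⟨by exact_mod_cast h1, by exact_mod_cast h2, ?_⟩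
      rw [← hj'] at h3
      exact_mod_cast h3
  -- Doubling keeps C at most L ≤ 2q below the top level, so the survivor can only occur at level N.
  have htwo : ∀ i < N, 2 ^ i * (2 * j - 1) ≤ q := by
    intro i hi
    have h1 : 2 ^ (i + 1) * (2 * j - 1) ≤ L :=
      le_trans (Nat.mul_le_mul_right _ (Nat.pow_le_pow_right two_pos hi)) hN
    rw [pow_succ', mul_assoc] at h1
    omega
  split_ifs with hlt
  · rw [← teichCoeff_typeD N]
    have h1 : 1 ≤ 2 ^ N := Nat.one_le_two_pow
    refine frobW_fW_sub_mem_of_unique (p := 2) (k := k) hz (N := N + 1) (Nat.lt_succ_self N) ?_ ?_ ?_ ?_ ?_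
    · rw [mem_primExp, Fin.sum_univ_three]
      simp [Fin.forall_fin_succ]
      omega
    · rw [Fin.sum_univ_three]
      simp [Nat.cast_sub h1]
      ring
    · rw [Fin.sum_univ_three]
      simp [Nat.cast_sub h1]
      rw [Nat.cast_sub hlt.le]
      push_cast
      rw [hj']
      ring
    · rw [Fin.sum_univ_three]
      simp
    · intro i hi e he hne
      refine tm_mem_Bd _ _ _ ((hsign i hi e he).resolve_right ?_)
      rintro ⟨h2, h3, h4⟩
      obtain rfl : i = N := by
        by_contra hiN
        have := htwo i (by omega)
        omega
      refine hne ⟨rfl, ?_⟩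
      have := (mem_primExp.mp he).1
      rw [Fin.sum_univ_three] at this
      simp [Fin.forall_fin_succ]
      omega
  · refine frobW_fW_sub_mem_of_forall (p := 2) (k := k) hz (N := N + 1) ?_ _ _
    intro i hi e he
    refine (hsign i hi e he).resolve_right ?_
    rintro ⟨-, -, h4⟩
    have : 2 ^ i * (2 * j - 1) ≤ 2 ^ N * (2 * j - 1) :=
      Nat.mul_le_mul_right _ (Nat.pow_le_pow_right two_pos (by omega))
    omega

end TypeD

/-! ### Type `D`: the last layer -/

section TypeD

variable {k : Type u} [Field k] [CharP k 2]
  {R : Type u} [CommRing R] [Algebra k R] {x y z : R}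

theorem teichCoeff_typeD_mid (i : ℕ) : teichCoeff 2 i i ![2 ^ i - 1, 1, 0] = 1 := by
  have hp : 1 ≤ 2 ^ i := Nat.one_le_two_pow
  rw [teichCoeff, Nat.sub_self, pow_zero, Nat.multinomial, Fin.sum_univ_three, Fin.prod_univ_three]
  simp only [Matrix.cons_val_zero, Matrix.cons_val_one, Matrix.cons_val, one_mul,
    Nat.factorial_zero, Nat.factorial_one, add_zero, mul_one]
  rw [Nat.sub_add_cancel hp, ← Nat.mul_factorial_pred (Nat.pos_iff_ne_zero.mp hp), Nat.mul_div_cancel _ (by positivity),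
    Nat.div_self hp]

theorem teichCoeff_typeD_last (i : ℕ) : teichCoeff 2 i i ![2 ^ i - 1, 0, 1] = 1 := by
  have hp : 1 ≤ 2 ^ i := Nat.one_le_two_pow
  rw [teichCoeff, Nat.sub_self, pow_zero, Nat.multinomial, Fin.sum_univ_three, Fin.prod_univ_three]
  simp only [Matrix.cons_val_zero, Matrix.cons_val_one, Matrix.cons_val, one_mul,
    Nat.factorial_zero, Nat.factorial_one, add_zero, mul_one]
  rw [Nat.sub_add_cancel hp, ← Nat.mul_factorial_pred (Nat.pos_iff_ne_zero.mp hp), Nat.mul_div_cancel _ (by positivity),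
    Nat.div_self hp]

variable (x y z) in
/-- The last term in the expansion of the Frobenius of `f_j`, in type `D`. -/
def etaD (m q bx : ℕ) (bz : Fin 2) (L j : ℕ) : WittVector 2 (Localization.Away (x * y)) :=
  layer 2 x y z (lamD L j) (lamD L j) (primExp 2 (Fin 3) (lamD L j)) (fun _ => 1)
    (fun t => ((![2, bx, 1] t : ℕ) : ℤ)) (fun t => ((![1, m, q + 1] t : ℕ) : ℤ))
    (fun t => ((![0, bz, 1] t : Fin 2) : ℕ)) 1 (-(2 : ℕ)) (-((2 : ℕ) * j)) 0

/-- The monomials in the last term of the expansion of the Frobenius of `f_j`, in type `D`. -/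
abbrev monD (m q bx : ℕ) (bz : Fin 2) (N j : ℕ) (e : Fin 3 → ℕ) (x y z : R) :
    Localization.Away (x * y) :=
  mon x y z (((2 : ℕ) : ℤ) ^ N * (-(2 : ℕ)) + ∑ t, (e t : ℤ) * ((![2, bx, 1] t : ℕ) : ℤ))
    (((2 : ℕ) : ℤ) ^ N * (-((2 : ℕ) * j)) + ∑ t, (e t : ℤ) * ((![1, m, q + 1] t : ℕ) : ℤ))
    (2 ^ N * 0 + ∑ t, e t * ((![0, bz, 1] t : Fin 2) : ℕ))

/-- Indices t with larger 2^{lam t}(2t-1) than t₀ have d t = 0, the others do not reach the point,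
and of η_{t₀} only the monomial e₀ does, with multiplicity 1. -/
theorem sum_lc_etaD (D : DoubleCover k x y z) {m q bx : ℕ} {bz : Fin 2} {L : ℕ} (d : ℕ → k)
    {ε : Fin 2} {I J : ℤ} {t₀ : ℕ} (ht₀ : t₀ ∈ indD L)
    (hmax : ∀ t ∈ indD L, d t ≠ 0 → 2 ^ lamD L t * (2 * t - 1) ≤ 2 ^ lamD L t₀ * (2 * t₀ - 1))
    {e₀ : Fin 3 → ℕ} (he₀ : e₀ ∈ primExp 2 (Fin 3) (lamD L t₀))
    (hc : teichCoeff 2 (lamD L t₀) (lamD L t₀) e₀ = 1)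
    (h1 : D.lc (monD m q bx bz (lamD L t₀) t₀ e₀ x y z) ε I J = 1)
    (h0 : ∀ t ∈ indD L, 2 ^ lamD L t * (2 * t - 1) ≤ 2 ^ lamD L t₀ * (2 * t₀ - 1) →
      ∀ e ∈ primExp 2 (Fin 3) (lamD L t), ¬(t = t₀ ∧ e = e₀) →
        D.lc (monD m q bx bz (lamD L t) t e x y z) ε I J = 0) :
    ∑ t ∈ indD L, d t * D.lc ((etaD x y z m q bx bz L t).coeff 0) ε I J = d t₀ := by
  rw [Finset.sum_eq_single_of_mem t₀ ht₀]
  · rw [etaD, D.lc_layer {e₀} (Finset.singleton_subset_iff.mpr he₀), Finset.sum_singleton, h1, hc]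
    · simp
    · intro e he hne
      exact h0 t₀ ht₀ le_rfl e he fun h => hne (Finset.mem_singleton.mpr h.2)
  · intro t ht htt
    by_cases hd : d t = 0
    · rw [hd, zero_mul]
    · rw [etaD, D.lc_layer ∅ (Finset.empty_subset _), Finset.sum_empty, mul_zero]
      intro e he _
      exact h0 t ht (hmax t ht hd) e he fun h => htt h.1

/-- The exponents of a monomial with nonzero coefficient, in type `D`. -/
theorem exponents_of_lc_monD_ne_zero (D : DoubleCover k x y z) {m q bx : ℕ} {bz : Fin 2}
    (hz : mon x y z 0 0 2 = ∑ t : Fin 3, (1 : ℤ) • mon x y z ((![2, bx, 1] t : ℕ) : ℤ)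
      ((![1, m, q + 1] t : ℕ) : ℤ) ((![0, bz, 1] t : Fin 2) : ℕ)) (hm : 1 ≤ m)
    {N t : ℕ} {e : Fin 3 → ℕ} (he : e ∈ primExp 2 (Fin 3) N) {ε : Fin 2} {I J : ℤ}
    (h : D.lc (monD m q bx bz N t e x y z) ε I J ≠ 0) :
    e 0 + e 1 + e 2 = 2 ^ N ∧ -((2 : ℤ) - bx) * e 1 - e 2 ≤ I ∧
      2 * (-((2 : ℤ) ^ N * (2 * t - 1)) + (m - 1) * e 1 + q * e 2) + (bz : ℕ) * e 1 + e 2 ≤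
        2 * J + (ε : ℕ) := by
  have hw := D.weight_le_of_lc_ne_zero Finset.univ _ _ _ _ hz 0 2 1 (by
      simp [Fin.forall_fin_succ]) (by simp [Fin.forall_fin_succ])
    (by simp [Fin.forall_fin_succ]; omega) h
  obtain ⟨h1, -⟩ := mem_primExp.mp he
  rw [Fin.sum_univ_three] at h1
  have h1' : (2 : ℤ) ^ N = e 0 + e 1 + e 2 := by exact_mod_cast h1.symm
  simp only [Fin.sum_univ_three, Matrix.cons_val_zero, Matrix.cons_val_one, Matrix.cons_val,
    Nat.cast_ofNat, Nat.cast_add, Nat.cast_one, Nat.cast_mul, Nat.cast_zero, h1', Fin.val_zero,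
    Fin.val_one, Nat.mul_zero, mul_one, mul_zero, zero_add, zero_mul, one_mul] at hw
  refine ⟨h1, ?_, ?_⟩
  · linarith [hw.1]
  · rw [h1']
    linarith [hw.2.2]

theorem monD_eq {m q bx : ℕ} {bz : Fin 2} {N t : ℕ} {e : Fin 3 → ℕ}
    (he : e 0 + e 1 + e 2 = 2 ^ N) :
    monD m q bx bz N t e x y z = mon x y z (-((2 : ℤ) - bx) * e 1 - e 2)
      (-((2 : ℤ) ^ N * (2 * t - 1)) + (m - 1) * e 1 + q * e 2) (bz * e 1 + e 2) := by
  have h1' : (2 : ℤ) ^ N = e 0 + e 1 + e 2 := by exact_mod_cast he.symm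
  unfold monD
  simp only [Fin.sum_univ_three, Matrix.cons_val_zero, Matrix.cons_val_one, Matrix.cons_val,
    Nat.cast_ofNat, Nat.cast_add, Nat.cast_one, Nat.cast_zero, h1', Fin.val_zero,
    Fin.val_one]
  congr 1 <;> ring

/-- The weight bound leaves room for a single factor besides x² y; if it is x y^m, then C must be
maximal. -/
theorem exponents_typeD_even {C P m q e1 e2 : ℤ} (h1 : 0 ≤ e1) (h2 : 0 ≤ e2) (hC : C ≤ 2 * P)
    (hm : 2 ≤ m) (hq : m - 1 ≤ 2 * q) (hI : 1 ≤ e1 + e2)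
    (hJ : 2 * (-C + (m - 1) * e1 + q * e2) + e2 ≤ 2 * -(2 * P - (m - 1))) :
    (e1 = 0 ∧ e2 = 1) ∨ (e1 = 1 ∧ e2 = 0 ∧ C = 2 * P) := by
  have h5 : e1 ≤ 1 := by
    by_contra h5
    have h7 : 0 ≤ q * e2 := mul_nonneg (by omega) h2
    nlinarith
  obtain rfl | rfl : e1 = 0 ∨ e1 = 1 := by omega
  · refine Or.inl ⟨rfl, ?_⟩
    by_contra h6
    have : 2 ≤ e2 := by omega
    nlinarith
  · obtain rfl : e2 = 0 := by
      by_contra h6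
      have : 1 ≤ e2 := by omega
      nlinarith
    exact Or.inr ⟨rfl, rfl, by linarith⟩

theorem exponents_typeD_odd {C P m q e1 e2 : ℤ} (h1 : 0 ≤ e1) (h2 : 0 ≤ e2) (hC : C ≤ 2 * P)
    (hm : 2 ≤ m) (hq : m - 1 ≤ 2 * q) (hI : 2 ≤ 2 * e1 + e2)
    (hJ : 2 * (-C + (m - 1) * e1 + q * e2) + e1 + e2 ≤ 2 * -(2 * P - (m - 1)) + 1) :
    e1 = 1 ∧ e2 = 0 ∧ C = 2 * P := by
  have h5 : e1 ≤ 1 := by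
    by_contra h5
    have h7 : 0 ≤ q * e2 := mul_nonneg (by omega) h2
    nlinarith
  obtain rfl | rfl : e1 = 0 ∨ e1 = 1 := by omega
  · have : 2 ≤ e2 := by omega
    nlinarith
  · obtain rfl : e2 = 0 := by
      by_contra h6
      have : 1 ≤ e2 := by omega
      nlinarith
    exact ⟨rfl, rfl, by linarith⟩

set_option maxHeartbeats 400000 in
/-- A point where the coefficient of the last terms in the expansion of the Frobenius of the `f_j`
is determined by the one with the largest index. -/
theorem exists_point_typeD (D : DoubleCover k x y z) {m q bx : ℕ} {bz : Fin 2}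
    (hz : mon x y z 0 0 2 = ∑ t : Fin 3, (1 : ℤ) • mon x y z ((![2, bx, 1] t : ℕ) : ℤ)
      ((![1, m, q + 1] t : ℕ) : ℤ) ((![0, bz, 1] t : Fin 2) : ℕ))
    (hb : bx + (bz : ℕ) = 1) (hm : 2 ≤ m) (hq : 1 ≤ q) {L : ℕ} (hL : L = min (m - 1) (2 * q))
    (d : ℕ → k) {t₀ : ℕ} (ht₀ : t₀ ∈ indD L)
    (hmax : ∀ t ∈ indD L, d t ≠ 0 → 2 ^ lamD L t * (2 * t - 1) ≤ 2 ^ lamD L t₀ * (2 * t₀ - 1)) :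
    ∃ (ε : Fin 2) (I J : ℤ), OffSupport (indD L) ε I J ∧ (ε = 0 → ¬((2 : ℤ) ∣ I ∧ (2 : ℤ) ∣ J)) ∧
      (∀ t : Fin 3, ε = ![0, bz, 1] t → ¬((2 : ℤ) ∣ I - ((![2, bx, 1] t : ℕ) : ℤ) ∧
        (2 : ℤ) ∣ J - ((![1, m, q + 1] t : ℕ) : ℤ))) ∧
      ∑ t ∈ indD L, d t * D.lc ((etaD x y z m q bx bz L t).coeff 0) ε I J = d t₀ := by
  obtain ⟨ht1, ht2⟩ := mem_indD.mp ht₀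
  have hlt := lt_two_pow_lamD ht1 ht2
  have hcast : ∀ t : ℕ, 1 ≤ t → ((2 ^ lamD L t * (2 * t - 1) : ℕ) : ℤ) =
      (2 : ℤ) ^ lamD L t * (2 * t - 1) := fun t ht => by
    rw [Nat.cast_mul, Nat.cast_sub (by omega)]; push_cast; ring
  -- The evenness of this number decides the parity of the chosen exponent of y, which keeps the
  -- point away from all squares.
  obtain ⟨P, hP⟩ : ∃ P, 2 ^ lamD L t₀ * (2 * t₀ - 1) = 2 * P :=
    ⟨2 ^ (lamD L t₀ - 1) * (2 * t₀ - 1), by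
      rw [← mul_assoc, ← pow_succ']
      rfl⟩
  have hP' : (2 : ℤ) ^ lamD L t₀ * (2 * t₀ - 1) = 2 * P := by rw [← hcast t₀ ht1, hP]; simp
  have hQ : 1 ≤ 2 ^ lamD L t₀ := Nat.one_le_two_pow
  have hmem1 : ![2 ^ lamD L t₀ - 1, 1, 0] ∈ primExp 2 (Fin 3) (lamD L t₀) := by
    rw [mem_primExp, Fin.sum_univ_three]
    simp [Fin.forall_fin_succ]
    omega
  have hmem2 : ![2 ^ lamD L t₀ - 1, 0, 1] ∈ primExp 2 (Fin 3) (lamD L t₀) := by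
    rw [mem_primExp, Fin.sum_univ_three]
    simp [Fin.forall_fin_succ]
    omega
  -- The numbers 2^{lam t}(2t-1) are pairwise different, so the maximal one belongs to t₀ alone.
  have huniq : ∀ t ∈ indD L, (2 : ℤ) ^ lamD L t * (2 * t - 1) = 2 * P → t = t₀ := by
    intro t ht h
    rw [← hP', ← hcast t₀ ht1, ← hcast t (mem_indD.mp ht).1] at h
    exact (two_pow_mul_odd_injective (mem_indD.mp ht).1 ht1 (by exact_mod_cast h)).2
  have hle : ∀ t ∈ indD L, 2 ^ lamD L t * (2 * t - 1) ≤ 2 ^ lamD L t₀ * (2 * t₀ - 1) →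
      (2 : ℤ) ^ lamD L t * (2 * t - 1) ≤ 2 * P := by
    intro t ht h
    rw [← hP', ← hcast t₀ ht1, ← hcast t (mem_indD.mp ht).1]
    exact_mod_cast h
  have hext : ∀ {t : ℕ} {e : Fin 3 → ℕ} {a b : ℕ}, t = t₀ → e 0 + e 1 + e 2 = 2 ^ lamD L t →
      e 1 = a → e 2 = b → e = ![2 ^ lamD L t₀ - (a + b), a, b] := by
    rintro t e a b rfl h0 rfl rfl
    ext i
    fin_cases i
    · simp; omega
    · rfl
    · rfl
  -- The dominant obstruction uses one factor x y^{q+1} z if L = 2q < m - 1, and one factor x^{bx}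
  -- y^m z^{bz} if L = m - 1. The point is the resulting monomial of η_{t₀}.
  rcases Nat.lt_or_ge (2 * q) (m - 1) with hc | hc
  · refine ⟨1, -1, -(2 * P - q), ⟨by norm_num, by omega, ?_⟩, by simp, ?_,
      sum_lc_etaD D d ht₀ hmax hmem2 (teichCoeff_typeD_last _) ?_ ?_⟩
    · rintro j hj ⟨-, -, h⟩
      have := mem_indD.mp hj
      omega
    · intro t ht
      fin_cases t
      · simp at ht
      · simp at ht
        obtain rfl : bx = 0 := by rw [← ht] at hb; simpa using hb
        simp
      · simp
        omega
    · rw [monD_eq (by simp; omega), hP']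
      simp
      rw [D.lc_mon_one, if_pos]
      refine ⟨rfl, by ring_nf, rfl⟩
    · intro t ht htC e he hne
      by_contra h
      obtain ⟨h1, h2, h3⟩ := exponents_of_lc_monD_ne_zero D hz (by omega) he h
      have h4 := hle t ht htC
      have hm' : 2 * (q : ℤ) + 1 ≤ m - 1 := by omega
      have h5 : e 1 = 0 := by
        by_contra h5
        have : (1 : ℤ) ≤ e 1 := by omega
        have h6 : (0 : ℤ) ≤ (bz : ℕ) * e 1 := by positivity
        have h7 : (0 : ℤ) ≤ q * e 2 := by positivity
        simp only [Fin.val_one, Nat.cast_one] at h3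
        nlinarith
      rw [h5] at h2 h3
      simp at h2 h3
      have h6 : e 2 = 1 := by
        by_contra h6
        have : (2 : ℤ) ≤ e 2 := by omega
        nlinarith
      rw [h6] at h3
      have h7 : t = t₀ := huniq t ht (by push_cast at h3; linarith)
      exact hne ⟨h7, hext h7 h1 h5 h6⟩
  · obtain rfl : L = m - 1 := by omega
    have hm' : (m : ℤ) - 1 ≤ 2 * q := by omega
    obtain ⟨rfl, rfl⟩ | ⟨rfl, rfl⟩ : (bz = 0 ∧ bx = 1) ∨ (bz = 1 ∧ bx = 0) := by
      fin_cases bz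
      · left; simpa using hb
      · right; simpa using hb
    · refine ⟨0, -1, -(2 * P - (m - 1)), ⟨by norm_num, by omega, ?_⟩, by omega, ?_,
        sum_lc_etaD D d ht₀ hmax hmem1 (teichCoeff_typeD_mid _) ?_ ?_⟩
      · rintro j hj ⟨h, -, -⟩
        exact absurd h (by decide)
      · intro t ht
        fin_cases t
        · simp
        · simp
          omega
        · simp at ht
      · rw [monD_eq (by simp; omega), hP']
        simp
        rw [D.lc_mon_zero, if_pos]
        refine ⟨rfl, by ring_nf, by ring_nf⟩
      · intro t ht htC e he hne
        by_contra h
        obtain ⟨h1, h2, h3⟩ := exponents_of_lc_monD_ne_zero D hz (by omega) he h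
        have h4 := hle t ht htC
        have hm2 : (2 : ℤ) ≤ m := by omega
        simp only [Fin.val_zero, Nat.cast_zero, zero_mul, add_zero, Nat.cast_one] at h2 h3
        obtain ⟨h5, h6⟩ | ⟨h5, h6, h7⟩ := exponents_typeD_even (Int.natCast_nonneg (e 1))
          (Int.natCast_nonneg (e 2)) h4 hm2 hm' (by linarith) h3
        -- One factor x y^{q+1} z gives a monomial linear in z, without coefficient at ε = 0.
        · rw [monD_eq h1, Nat.cast_eq_zero.mp h5, Nat.cast_eq_one.mp h6] at h
          simp [D.lc_mon_one] at h
        · have h8 : t = t₀ := huniq t ht h7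
          exact hne ⟨h8, hext h8 h1 (Nat.cast_eq_one.mp h5) (Nat.cast_eq_zero.mp h6)⟩
    · refine ⟨1, -2, -(2 * P - (m - 1)), ⟨by norm_num, by omega, ?_⟩, by simp, ?_,
        sum_lc_etaD D d ht₀ hmax hmem1 (teichCoeff_typeD_mid _) ?_ ?_⟩
      · rintro j hj ⟨-, h, -⟩
        omega
      · intro t ht
        fin_cases t
        · simp at ht
        · simp
          omega
        · simp
      · rw [monD_eq (by simp; omega), hP']
        simp
        rw [D.lc_mon_one, if_pos]
        refine ⟨rfl, by ring_nf, by ring_nf⟩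
      · intro t ht htC e he hne
        by_contra h
        obtain ⟨h1, h2, h3⟩ := exponents_of_lc_monD_ne_zero D hz (by omega) he h
        have h4 := hle t ht htC
        have hm2 : (2 : ℤ) ≤ m := by omega
        simp only [Fin.val_one, Nat.cast_one, Nat.cast_zero, one_mul, sub_zero] at h2 h3
        obtain ⟨h5, h6, h7⟩ := exponents_typeD_odd (Int.natCast_nonneg (e 1))
          (Int.natCast_nonneg (e 2)) h4 hm2 hm' (by linarith) h3
        have h8 : t = t₀ := huniq t ht h7
        exact hne ⟨h8, hext h8 h1 (Nat.cast_eq_one.mp h5) (Nat.cast_eq_zero.mp h6)⟩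

end TypeD

/-! ### Type `D`: bounds on `C(l, j)` -/

section TypeDIndex

theorem mem_dIndex_iff {n : ℕ} {r : ℚ} {L l j : ℕ} (hL : lBound n r = L) :
    (1 ≤ l ∧ 1 ≤ j ∧ (cIndex l j : ℤ) ≤ lBound n r) ↔ j ∈ indD L ∧ 1 ≤ l ∧ l ≤ lamD L j := by
  rw [hL, Nat.cast_le, mem_indD]
  constructor
  · rintro ⟨h1, h2, h3⟩
    have h4 : 2 * j - 1 ≤ L := le_trans (Nat.le_mul_of_pos_left _ (by positivity)) h3
    exact ⟨⟨h2, h4⟩, h1, (le_lamD_iff h2 h4).mpr h3⟩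
  · rintro ⟨⟨h2, h4⟩, h1, h3⟩
    exact ⟨h1, h2, (le_lamD_iff h2 h4).mp h3⟩

/-- Since 2 C(l, j) = C(l+1, j) ≤ L ≤ 2q. Hence F is nonzero on f_j^{(l)} at most for the largest l.
-/
theorem cIndex_le_of_lt_lamD {q L l j : ℕ} (hq : L ≤ 2 * q) (hj : j ∈ indD L) (h1 : 1 ≤ l)
    (hl : l < lamD L j) : cIndex l j ≤ q := by
  obtain ⟨h2, h3⟩ := mem_indD.mp hj
  have h4 := (le_lamD_iff (l := l + 1) h2 h3).mp hl
  obtain ⟨l, rfl⟩ := Nat.exists_eq_add_of_le' h1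
  rw [Nat.add_sub_cancel, pow_succ', mul_assoc] at h4
  rw [cIndex, Nat.add_sub_cancel]
  omega

theorem cIndex_lamD_le {L j : ℕ} (hj : j ∈ indD L) : cIndex (lamD L j) j ≤ L :=
  (le_lamD_iff (mem_indD.mp hj).1 (mem_indD.mp hj).2).mp le_rfl

theorem one_le_lamD (L j : ℕ) : 1 ≤ lamD L j := Nat.succ_pos _

theorem cIndex_sub_mem_indD {q L j : ℕ} (hq : L ≤ 2 * q) (hj : j ∈ indD L)
    (h : q < cIndex (lamD L j) j) : cIndex (lamD L j) j - q ∈ indD L := by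
  have := cIndex_lamD_le hj
  rw [mem_indD]
  omega

end TypeDIndex

/-! ### Type `D`: the presentation -/

section TypeD

variable {k : Type u} [Field k] [CharP k 2]

section

variable {R : Type u} [CommRing R] [Algebra k R] {x y z : R} {m q bx : ℕ} {bz : Fin 2} {L : ℕ}

/-- The coefficient of `f_{C - q}` in the expansion of the Frobenius of `f_j`, in type `D`. -/
def coeffD (q L j : ℕ) : ℤ :=
  if q < cIndex (lamD L j) j then ((2 * 2 ^ (lamD L j - 1) - 1 : ℕ) : ℤ) else 0

/-- With e = lam j - 1, the Frobenius of the longest f_j^{(l)} lands in length 1, as the relations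
for F require. -/
theorem frobRelations_typeD [PerfectRing k 2]
    (hz : mon x y z 0 0 2 = ∑ t : Fin 3, (1 : ℤ) • mon x y z ((![2, bx, 1] t : ℕ) : ℤ)
      ((![1, m, q + 1] t : ℕ) : ℤ) ((![0, bz, 1] t : Fin 2) : ℕ))
    (hm : L + 1 ≤ m) (hL : L ≤ 2 * q) :
    FrobRelations 2 k x y z (indD L) (lamD L) (coeffD q L) (fun j => lamD L j - 1)
      (fun j => cIndex (lamD L j) j - q) (etaD x y z m q bx bz L) where
  pos j hj := (mem_indD.mp hj).1
  one_le j _ := one_le_lamD L j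
  rel j hj := by
    have h1 := cIndex_lamD_le hj
    obtain ⟨N, hN⟩ := Nat.exists_eq_add_of_le' (one_le_lamD L j)
    simp only [coeffD, etaD, cIndex, hN, Nat.add_sub_cancel] at h1 ⊢
    exact frobW_fW_sub_mem_typeD hz hm hL (mem_indD.mp hj).1 h1
  lower j hj hc := by
    have h : q < cIndex (lamD L j) j := by
      by_contra h
      exact hc (if_neg h)
    have h1 := one_le_lamD L (cIndex (lamD L j) j - q)
    have h2 := one_le_lamD L j
    refine ⟨cIndex_sub_mem_indD hL hj h, by omega, ?_⟩
    -- In length 1 the target index is 2j - 1 - q, which is below j because 2j - 1 ≤ L ≤ 2q.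
    by_cases h3 : lamD L j = 1
    · right
      obtain ⟨h4, h5⟩ := mem_indD.mp hj
      have h6 : cIndex (lamD L j) j = 2 * j - 1 := by rw [h3, cIndex]; simp
      change cIndex (lamD L j) j - q < j
      omega
    · left; omega

theorem eq_zero_of_lc_typeD (D : DoubleCover k x y z)
    (hz : mon x y z 0 0 2 = ∑ t : Fin 3, (1 : ℤ) • mon x y z ((![2, bx, 1] t : ℕ) : ℤ)
      ((![1, m, q + 1] t : ℕ) : ℤ) ((![0, bz, 1] t : Fin 2) : ℕ))
    (hb : bx + (bz : ℕ) = 1) (hm : 2 ≤ m) (hq : 1 ≤ q) (hL : L = min (m - 1) (2 * q))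
    (u : Localization.Away (x * y)) (d : ℕ → k)
    (hu : ∀ ε i j, OffSupport (indD L) ε i j → D.lc (u ^ 2 +
      ∑ t ∈ indD L, algebraMap k _ (d t) * (etaD x y z m q bx bz L t).coeff 0) ε i j = 0) :
    (∀ t ∈ indD L, d t = 0) ∧ ∀ ε i j, OffSupport (indD L) ε i j → D.lc u ε i j = 0 := by
  classical
  have hd : ∀ ε i j, OffSupport (indD L) ε i j → D.lc (u ^ 2) ε i j +
      ∑ t ∈ indD L, d t * D.lc ((etaD x y z m q bx bz L t).coeff 0) ε i j = 0 := by
    intro ε i j hoff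
    have := hu ε i j hoff
    rw [D.lc_add, D.lc_sum] at this
    simpa only [D.lc_algebraMap_mul] using this
  have hd0 : ∀ t ∈ indD L, d t = 0 := by
    by_contra! hne
    obtain ⟨t, ht, hdt⟩ := hne
    obtain ⟨t₀, ht₀, hmax⟩ := Finset.exists_max_image ((indD L).filter fun t => d t ≠ 0)
      (fun t => 2 ^ lamD L t * (2 * t - 1)) ⟨t, Finset.mem_filter.mpr ⟨ht, hdt⟩⟩
    obtain ⟨h1, h2⟩ := Finset.mem_filter.mp ht₀
    obtain ⟨ε, i, j, hoff, h3, h4, h5⟩ := exists_point_typeD D hz hb hm hq hL d h1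
      fun t ht hdt => hmax t (Finset.mem_filter.mpr ⟨ht, hdt⟩)
    have := hd ε i j hoff
    rw [D.lc_pow_eq_zero hz h3 h4, h5, zero_add] at this
    exact h2 this
  refine ⟨hd0, D.lc_eq_zero_of_pow hz ?_ ?_ ?_ ?_⟩
  · intro t ht
    fin_cases t
    · simp
    · simp at ht ⊢
      rw [ht] at hb
      simp at hb
      simp [hb]
    · simp at ht
  · have hbz : bz = 0 ∧ bx = 1 ∨ bz = 1 ∧ bx = 0 := by
      fin_cases bz
      · left; simpa using hb
      · right; simpa using hb
    intro t t' hne ht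
    obtain ⟨rfl, rfl⟩ | ⟨rfl, rfl⟩ := hbz <;> fin_cases t <;> fin_cases t' <;>
      simp at hne ht ⊢
  · intro i j hi hj hij
    -- For i ≤ -2 the term x² y detects the coefficient. For i = -1 it is the term that determines
    -- L: x y^{q+1} z if L = 2q < m - 1, and x^{bx} y^m z^{bz} otherwise.
    rcases (by omega : i ≤ -2 ∨ i = -1) with h | rfl
    · refine ⟨0, by norm_num, ?_, ?_, ?_⟩ <;> simp <;> omega
    · have hj' : (L : ℤ) < -2 * j - 1 := by
        by_contra hc
        refine hij ⟨rfl, Finset.mem_map.mpr ⟨(-j).toNat, mem_indD.mpr ⟨by omega, by omega⟩, ?_⟩⟩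
        simp
        omega
      rcases Nat.lt_or_ge (2 * q) (m - 1) with hc | hc
      · refine ⟨2, by norm_num, ?_, ?_, ?_⟩
        · simp
        · simp
          omega
        · intro j' hj'' h
          have := mem_indD.mp hj''
          simp at h
          omega
      · refine ⟨1, by norm_num, ?_, ?_, ?_⟩
        · simp
          omega
        · simp
          omega
        · intro j' hj'' h
          have := mem_indD.mp hj''
          simp at h
          omega
  · intro ε i j hoff
    have := hd ε i j hoff
    rwa [Finset.sum_eq_zero fun t ht => by rw [hd0 t ht, zero_mul], add_zero] at this

end

variable [PerfectRing k 2]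

open DieudonneRing

/-- Both parities of n at once: (bx, bz) is (1, 0) for even n and (0, 1) for odd n, and q = n/2 - r
- 1. -/
theorem hasPresentation_typeD {h : MvPowerSeries (Fin 3) k}
    (D : DoubleCover k (var h 0) (var h 1) (var h 2)) {m q bx : ℕ} {bz : Fin 2}
    (hz : mon (var h 0) (var h 1) (var h 2) 0 0 2 =
      ∑ t : Fin 3, (1 : ℤ) • mon (var h 0) (var h 1) (var h 2) ((![2, bx, 1] t : ℕ) : ℤ)
      ((![1, m, q + 1] t : ℕ) : ℤ) ((![0, bz, 1] t : Fin 2) : ℕ))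
    (hb : bx + (bz : ℕ) = 1) (hm : 2 ≤ m) (hq : 1 ≤ q) {L : ℕ} (hL : L = min (m - 1) (2 * q))
    {n : ℕ} {r : ℚ} (hnL : lBound n r = L) (hnq : (n : ℚ) / 2 - r - 1 = q) :
    HasPresentation 2 h (fun i : DIndex n r => i.1) {ρ | DRelation 2 k n r ρ}
      (lBound n r).toNat := by
  rw [show (lBound n r).toNat = L by rw [hnL, Int.toNat_natCast]]
  classical
  have hLq : L ≤ 2 * q := by omega
  have H := frobRelations_typeD (k := k) (L := L) hz (by omega) hLq
  set E : ℕ → ℕ → (DIndex n r →₀ DieudonneRing 2 k) := fun l j =>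
    if hlj : 1 ≤ l ∧ 1 ≤ j ∧ (cIndex l j : ℤ) ≤ lBound n r then
      Finsupp.single ⟨(l, j), hlj⟩ 1 else 0 with hE
  have hmem : ∀ {l j}, j ∈ indD L → 1 ≤ l → l ≤ lamD L j →
      1 ≤ l ∧ 1 ≤ j ∧ (cIndex l j : ℤ) ≤ lBound n r := fun h1 h2 h3 =>
    (mem_dIndex_iff hnL).mpr ⟨h1, h2, h3⟩
  have hE0 : ∀ j, E 0 j = 0 := fun j => dif_neg (by simp)
  have hE1 : ∀ {l j} (hlj : 1 ≤ l ∧ 1 ≤ j ∧ (cIndex l j : ℤ) ≤ lBound n r),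
      E l j = Finsupp.single ⟨(l, j), hlj⟩ 1 := fun hlj => dif_pos hlj
  have hVs : ∀ i : DIndex n r, V 2 k • Finsupp.single i (1 : DieudonneRing 2 k) =
      Finsupp.single i (V 2 k) := fun i => by rw [Finsupp.smul_single, smul_eq_mul, mul_one]
  have hFs : ∀ i : DIndex n r, F 2 k • Finsupp.single i (1 : DieudonneRing 2 k) =
      Finsupp.single i (F 2 k) := fun i => by rw [Finsupp.smul_single, smul_eq_mul, mul_one]
  have hlast : ∀ {l j}, j ∈ indD L → 1 ≤ l → l ≤ lamD L j → q < cIndex l j → l = lamD L j := by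
    intro l j hj h1 hl hlt
    by_contra hne
    exact absurd (cIndex_le_of_lt_lamD hLq hj h1 (by omega)) (by omega)
  -- In length 1, 2 = FV is zero because V is; so the odd multiplicity in F f_j acts as 1.
  have htwo : ∀ j ∈ indD L, (2 : ℤ) • fel 2 k (var h 0) (var h 1) (var h 2) 1 j = 0 := by
    intro j hj
    have h1 := H.V_smul_fel (l := 0) hj (one_le_lamD L j)
    rw [fel_zero] at h1
    have h2 : F 2 k • V 2 k • fel 2 k (var h 0) (var h 1) (var h 2) 1 j = 0 := by
      rw [h1, smul_zero]
    rw [← mul_smul, F_mul_V, Nat.cast_smul_eq_nsmul] at h2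
    rw [← h2, ← natCast_zsmul]
    rfl
  have hcoeff : ∀ j, q < cIndex (lamD L j) j → ∀ j' ∈ indD L,
      coeffD q L j • fel 2 k (var h 0) (var h 1) (var h 2) 1 j' =
        fel 2 k (var h 0) (var h 1) (var h 2) 1 j' := by
    intro j hlt j' hj'
    have h1 : 1 ≤ 2 ^ (lamD L j - 1) := Nat.one_le_two_pow
    rw [coeffD, if_pos hlt, show ((2 * 2 ^ (lamD L j - 1) - 1 : ℕ) : ℤ) =
      ((2 ^ (lamD L j - 1) - 1 : ℕ) : ℤ) * 2 + 1 by omega, add_smul, mul_smul, htwo j' hj',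
      smul_zero, zero_add, one_smul]
  have key := hasPresentation_of_relations D H
    (fun u d hu => eq_zero_of_lc_typeD D hz hb hm hq hL u d hu) (fun i : DIndex n r => i.1)
    {ρ | DRelation 2 k n r ρ} E (fun j => if q < cIndex (lamD L j) j then 1 else 0)
    ?_ hE0 ?_ ?_ ?_ ?_ ?_
  · rwa [sum_lamD] at key
  · rintro ⟨⟨l, j⟩, hi⟩
    obtain ⟨h1, h2, h3⟩ := (mem_dIndex_iff hnL).mp hi
    exact ⟨h1, h2, h3, hE1 hi⟩
  · intro j hj l hl
    rw [hE1 (hmem hj (by omega) hl), hVs]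
    rcases Nat.eq_zero_or_pos l with rfl | h0
    · rw [hE0, sub_zero]
      exact Submodule.subset_span (.V_zero _ rfl)
    · rw [hE1 (hmem hj h0 (by omega))]
      exact Submodule.subset_span (.V_eq _ _ rfl rfl)
  · intro j _ hκ
    have hlt : q < cIndex (lamD L j) j := by
      by_contra hc
      exact hκ (if_neg hc)
    have h1 : 1 ≤ 2 ^ (lamD L j - 1) := Nat.one_le_two_pow
    rw [coeffD, if_pos hlt]
    omega
  · intro j hj l h1 hl
    rw [hE1 (hmem hj h1 hl), hFs]
    by_cases hlt : q < cIndex l j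
    · obtain rfl := hlast hj h1 hl hlt
      rw [if_pos hlt, one_smul, show lamD L j - (lamD L j - 1) = 1 by omega,
        hE1 (hmem (cIndex_sub_mem_indD hLq hj hlt) le_rfl (one_le_lamD _ _))]
      refine Submodule.subset_span (.F_eq _ _ rfl ?_)
      rw [hnq]
      exact Nat.cast_sub hlt.le
    · have h0 : (if q < cIndex (lamD L j) j then (1 : ℤ) else 0) •
          E (l - (lamD L j - 1)) (cIndex (lamD L j) j - q) = 0 := by
        by_cases hll : l = lamD L j
        · rw [← hll, if_neg hlt, zero_smul]
        · rw [show l - (lamD L j - 1) = 0 by omega, hE0, smul_zero]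
      rw [h0, sub_zero]
      refine Submodule.subset_span (.F_zero _ ?_)
      rw [hnq, sub_nonpos, Nat.cast_le]
      exact not_lt.mp hlt
  · intro j hj l h1 hl
    rw [hE1 (hmem hj h1 hl), Finsupp.linearCombination_single, one_smul]
  · rintro ρ hρ
    rcases hρ with ⟨⟨⟨l, j⟩, hi⟩, ⟨⟨l', j'⟩, hi'⟩, hl, hj⟩ | ⟨⟨⟨l, j⟩, hi⟩, hl⟩ |
      ⟨⟨⟨l, j⟩, hi⟩, ⟨⟨l', j'⟩, hi'⟩, hl, hj⟩ | ⟨⟨⟨l, j⟩, hi⟩, hj⟩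
    · obtain ⟨h1, h2, h3⟩ : j ∈ indD L ∧ 1 ≤ l ∧ l ≤ lamD L j := (mem_dIndex_iff hnL).mp hi
      simp only at hl hj
      subst hl hj
      rw [map_sub, Finsupp.linearCombination_single, Finsupp.linearCombination_single, one_smul,
        H.V_smul_fel h1 h3, sub_self]
    · obtain ⟨h1, h2, h3⟩ : j ∈ indD L ∧ 1 ≤ l ∧ l ≤ lamD L j := (mem_dIndex_iff hnL).mp hi
      simp only at hl
      subst hl
      rw [Finsupp.linearCombination_single, H.V_smul_fel h1 h3, fel_zero]
    · obtain ⟨h1, h2, h3⟩ : j ∈ indD L ∧ 1 ≤ l ∧ l ≤ lamD L j := (mem_dIndex_iff hnL).mp hi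
      simp only [hnq] at hl hj
      subst hl
      obtain ⟨h1', -, -⟩ : j' ∈ indD L ∧ _ := (mem_dIndex_iff hnL).mp hi'
      have hsum : cIndex l j = j' + q := by
        rw [eq_sub_iff_add_eq] at hj
        exact_mod_cast hj.symm
      have hpos := (mem_indD.mp h1').1
      obtain rfl := hlast h1 h2 h3 (by omega)
      rw [map_sub, Finsupp.linearCombination_single, Finsupp.linearCombination_single, one_smul,
        H.F_smul_fel h1 h3, show lamD L j - (lamD L j - 1) = 1 by omega,
        show cIndex (lamD L j) j - q = j' by omega, hcoeff j (by omega) j' h1', sub_self]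
    · obtain ⟨h1, h2, h3⟩ : j ∈ indD L ∧ 1 ≤ l ∧ l ≤ lamD L j := (mem_dIndex_iff hnL).mp hi
      simp only [hnq, sub_nonpos, Nat.cast_le] at hj
      rw [Finsupp.linearCombination_single, H.F_smul_fel h1 h3]
      by_cases hll : l = lamD L j
      · subst hll
        rw [coeffD, if_neg (by omega), zero_smul]
      · rw [show l - (lamD L j - 1) = 0 by omega, fel_zero, smul_zero]

/-- For both parities ⌊n/2 - 1⌋ = m - 1, and n - 2r - 2 = 2q is an integer. -/
theorem lBound_eq {n L : ℕ} {r : ℚ} {m q : ℕ} (hL : L = min (m - 1) (2 * q)) (hm : 1 ≤ m)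
    (hr : (n : ℚ) / 2 - r - 1 = q) (hn : (n : ℚ) = 2 * m ∨ (n : ℚ) = 2 * m + 1) :
    lBound n r = L := by
  have h1 : (n : ℚ) - 2 * r - 2 = ((2 * q : ℕ) : ℤ) := by push_cast; linarith
  have h2 : ⌊(n : ℚ) / 2 - 1⌋ = ((m - 1 : ℕ) : ℤ) := by
    rw [Int.floor_eq_iff]
    push_cast [Nat.cast_sub hm]
    rcases hn with h | h <;> constructor <;> linarith
  have h3 : ∀ a b : ℚ, ⌊min a b⌋ = min ⌊a⌋ ⌊b⌋ := fun a b =>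
    (Int.floor_mono (R := ℚ)).map_min
  rw [lBound, h3, h1, h2, Int.floor_intCast, hL]
  push_cast
  rfl

open MvPowerSeries

theorem hasPresentation_D_even {m r : ℕ} (hr : r + 2 ≤ m) :
    HasPresentation 2
      (X 2 ^ 2 + X 0 ^ 2 * X 1 + X 0 * X 1 ^ m + X 2 * X 0 * X 1 ^ (m - r) :
        MvPowerSeries (Fin 3) k)
      (fun i : DIndex (2 * m) r => i.1) {ρ | DRelation 2 k (2 * m) r ρ}
      (lBound (2 * m) r).toNat := by
  obtain ⟨q, hq⟩ : ∃ q, m - r = q + 1 := ⟨m - r - 1, by omega⟩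
  set h : MvPowerSeries (Fin 3) k :=
    X 2 ^ 2 + X 0 ^ 2 * X 1 + X 0 * X 1 ^ m + X 2 * X 0 * X 1 ^ (m - r) with hdef
  have hh : h = X 2 ^ 2 + ∑ t : Fin 3, X 0 ^ (![2, 1, 1] t) * X 1 ^ (![1, m, q + 1] t) *
      X 2 ^ ((![0, 0, 1] t : Fin 2) : ℕ) := by
    simp [hdef, Fin.sum_univ_three, hq]; ring
  obtain ⟨D⟩ := exists_doubleCover (by simp [Fin.forall_fin_succ]) hh
  have hm : m = q + 1 + r := by omega
  have hnq : ((2 * m : ℕ) : ℚ) / 2 - r - 1 = q := by rw [hm]; push_cast; ring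
  have hz := mon_two_eq_of_charTwo hh
  have hnL := lBound_eq (L := min (m - 1) (2 * q)) rfl (by omega) hnq (Or.inl (by push_cast; rfl) : _ ∨ _ = 2 * (m : ℚ) + 1)
  exact hasPresentation_typeD D hz (by simp) (by omega) (by omega) rfl hnL hnq

theorem hasPresentation_D_odd {m s : ℕ} (hs : s + 2 ≤ m) :
    HasPresentation 2
      (X 2 ^ 2 + X 0 ^ 2 * X 1 + X 2 * X 1 ^ m + X 2 * X 0 * X 1 ^ (m - s) :
        MvPowerSeries (Fin 3) k)
      (fun i : DIndex (2 * m + 1) (s + 1 / 2) => i.1)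
      {ρ | DRelation 2 k (2 * m + 1) (s + 1 / 2) ρ}
      (lBound (2 * m + 1) (s + 1 / 2)).toNat := by
  obtain ⟨q, hq⟩ : ∃ q, m - s = q + 1 := ⟨m - s - 1, by omega⟩
  set h : MvPowerSeries (Fin 3) k :=
    X 2 ^ 2 + X 0 ^ 2 * X 1 + X 2 * X 1 ^ m + X 2 * X 0 * X 1 ^ (m - s) with hdef
  have hh : h = X 2 ^ 2 + ∑ t : Fin 3, X 0 ^ (![2, 0, 1] t) * X 1 ^ (![1, m, q + 1] t) *
      X 2 ^ ((![0, 1, 1] t : Fin 2) : ℕ) := by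
    simp [hdef, Fin.sum_univ_three, hq]; ring
  obtain ⟨D⟩ := exists_doubleCover (by simp [Fin.forall_fin_succ]; omega) hh
  have hm : m = q + 1 + s := by omega
  have hnq : ((2 * m + 1 : ℕ) : ℚ) / 2 - (s + 1 / 2) - 1 = q := by rw [hm]; push_cast; ring
  have hz := mon_two_eq_of_charTwo hh
  have hnL := lBound_eq (L := min (m - 1) (2 * q)) rfl (by omega) hnq (Or.inr (by push_cast; rfl) : _ = 2 * (m : ℚ) ∨ _)
  exact hasPresentation_typeD D hz (by simp) (by omega) (by omega) rfl hnL hnq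

end TypeD

end LocalWitt

end

/-! ### All cases together -/

open LocalWitt MvPowerSeries Finsupp in
theorem mainTheorem3 (p : ℕ) [Fact p.Prime] (k : Type*) [Field k] [CharP k p] [IsAlgClosed k]
    (x y z : MvPowerSeries (Fin 3) k) (hx : x = X 0) (hy : y = X 1) (hz : z = X 2)
    (F V : DieudonneRing p k) (hF : F = DieudonneRing.F p k) (hV : V = DieudonneRing.V p k) :
    -- the classes `f_j^{(l)}` vanish for `j ≤ 0`
    (∀ (h : MvPowerSeries (Fin 3) k) (l : ℕ) (j : ℤ), j ≤ 0 → fClass p h l j = 0) ∧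
    (p = 5 →
      -- `E_8^0`
      HasPresentation p (z ^ 2 + x ^ 3 + y ^ 5) ![(1, 1)] {single 0 F, single 0 V} 1) ∧
    (p = 3 →
      -- `E_6^0`
      HasPresentation p (z ^ 2 + x ^ 3 + y ^ 4) ![(1, 1)] {single 0 F, single 0 V} 1 ∧
      -- `E_7^0`
      HasPresentation p (z ^ 2 + x ^ 3 + x * y ^ 3) ![(1, 1)] {single 0 F, single 0 V} 1 ∧
      -- `E_8^1`
      HasPresentation p (z ^ 2 + x ^ 3 + y ^ 5 + x ^ 2 * y ^ 3) ![(2, 1)]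
        {single 0 (F - V), single 0 (V ^ 2)} 2 ∧
      -- `E_8^0`
      HasPresentation p (z ^ 2 + x ^ 3 + y ^ 5) ![(2, 1)] {single 0 F, single 0 (V ^ 2)} 2) ∧
    (p = 2 →
      -- `D_{2m}^r`, `0 ≤ r ≤ m - 2`
      (∀ m r : ℕ, r + 2 ≤ m →
        HasPresentation p (z ^ 2 + x ^ 2 * y + x * y ^ m + z * x * y ^ (m - r))
          (fun i : DIndex (2 * m) r => i.1) {ρ | DRelation p k (2 * m) r ρ}
          (lBound (2 * m) r).toNat) ∧
      -- `D_{2m+1}^r`, `r = s + 1/2`, `0 ≤ s ≤ m - 2`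
      (∀ m s : ℕ, s + 2 ≤ m →
        HasPresentation p (z ^ 2 + x ^ 2 * y + z * y ^ m + z * x * y ^ (m - s))
          (fun i : DIndex (2 * m + 1) (s + 1 / 2) => i.1)
          {ρ | DRelation p k (2 * m + 1) (s + 1 / 2) ρ}
          (lBound (2 * m + 1) (s + 1 / 2)).toNat) ∧
      -- `E_6^0`
      HasPresentation p (z ^ 2 + x ^ 3 + y ^ 2 * z) ![(1, 1)] {single 0 F, single 0 V} 1 ∧
      -- `E_7^2`
      HasPresentation p (z ^ 2 + x ^ 3 + x * y ^ 3 + y ^ 3 * z) ![(2, 1)]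
        {single 0 (F + V), single 0 (V ^ 2)} 2 ∧
      -- `E_7^1`
      HasPresentation p (z ^ 2 + x ^ 3 + x * y ^ 3 + x ^ 2 * y * z) ![(3, 1)]
        {single 0 (F + V ^ 2), single 0 (V ^ 3)} 3 ∧
      -- `E_7^0`
      HasPresentation p (z ^ 2 + x ^ 3 + x * y ^ 3) ![(3, 1)] {single 0 F, single 0 (V ^ 3)} 3 ∧
      -- `E_8^3`
      HasPresentation p (z ^ 2 + x ^ 3 + y ^ 5 + y ^ 3 * z) ![(3, 1)]
        {single 0 (F + V), single 0 (V ^ 3)} 3 ∧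
      -- `E_8^2`
      HasPresentation p (z ^ 2 + x ^ 3 + y ^ 5 + x * y ^ 2 * z) ![(3, 1)]
        {single 0 (F + V ^ 2), single 0 (V ^ 3)} 3 ∧
      -- `E_8^1`
      HasPresentation p (z ^ 2 + x ^ 3 + y ^ 5 + x * y ^ 3 * z) ![(3, 1), (1, 2)]
        {single 0 F, single 0 (V ^ 3), single 1 F - single 0 (V ^ 2), single 1 V} 4 ∧
      -- `E_8^0`
      HasPresentation p (z ^ 2 + x ^ 3 + y ^ 5) ![(3, 1), (1, 2)]
        {single 0 F, single 0 (V ^ 3), single 1 F, single 1 V} 4) := by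
  subst hx hy hz hF hV
  refine ⟨fun h l _ hj => fClass_eq_zero p h l hj, ?_, ?_, ?_⟩
  · rintro rfl
    exact hasPresentation_E80_five
  · rintro rfl
    exact ⟨hasPresentation_E60_three, hasPresentation_E70_three, hasPresentation_E81_three,
      hasPresentation_E80_three⟩
  · rintro rfl
    exact ⟨fun _ _ h => hasPresentation_D_even h, fun _ _ h => hasPresentation_D_odd h,
      hasPresentation_E60_two, hasPresentation_E72_two, hasPresentation_E71_two,
      hasPresentation_E70_two, hasPresentation_E83_two, hasPresentation_E82_two,
      hasPresentation_E81_two, hasPresentation_E80_two⟩
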